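/- Let $X$ be a closed, oriented, Riemannian four-manifold with scalar curvature $R$, let $(\rho,W^+,W^-)$ be a spin$^c$ structure on $X$ with a smooth spin$^c$ connection, inducing a connection $A_L$ on $L=\det W^+$, and let $E$ be a Hermitian two-plane bundle over $X$ whose determinant line bundle $\det E$ carries a fixed smooth unitary connection $A_e$. Let $A$ be a unitary connection on $E$ inducing $A_e$ on $\det E$ (equivalently, an $\mathrm{SO}(3)$ connection on $\mathfrak{su}(E)$), and let $F_A^+\in\Lambda^+\otimes\mathfrak{su}(E)$ denote the self-dual part of the curvature of the induced connection on $\mathfrak{su}(E)$. Let $\tau_0$ be a section of $\mathfrak{gl}(\Lambda^+)$, $\tau_A$ a section of $\mathfrak{gl}(\Lambda^+\otimes\mathfrak{su}(E))$ (for instance of $\mathfrak{gl}(\Lambda^+)\otimes\mathfrak{so}(\mathfrak{su}(E))$), $\vartheta_0$ a complex $C^1$ one-form and $\vartheta_A$ a $C^1$ section of $\mathrm{Hom}(W^+\otimes E,W^-\otimes E)$ (for instance of $\mathrm{Hom}(W^+,W^-)\otimes\mathfrak{sl}(E)$), such that $$\|\tau_0\|_{L^\infty}+\|\tau_A\|_{L^\infty}\le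 \tfrac1{64},\qquad \|\vartheta_0\|_{L^\infty_1}+\|\vartheta_A\|_{L^\infty_{1,A}}\le 1,$$ where pointwise norms are operator norms and the $L^\infty_1$ norm is the larger of the suprema of the section and of its covariant derivative. A pair $(A,\Phi)$, with $\Phi$ a section of $W^+\otimes E$, is a $\mathrm{PU}(2)$ monopole if $$F_A^+=(\mathrm{id}+\tau_0\otimes\mathrm{id}_{\mathfrak{su}(E)}+\tau_A)\,\rho^{-1}(\Phi\otimes\Phi^*)_{00},\qquad D_A\Phi+\rho(\vartheta_0)\Phi+\vartheta_A\Phi=0,$$ where $D_A$ is the Dirac operator and $(\Phi\otimes\Phi^*)_{00}$ is the component of $\Phi\otimes\Phi^*$ in $\mathfrak{su}(W^+)\otimes\mathfrak{su}(E)$. There is a non-negative constant $K_3$, depending only on the $C^0$ norms of $R$, $F(A_e)$ and $F(A_L)$ (and on nothing else, not even on $X$), such that every $C^1$ $\mathrm{PU}(2)$ monopole $(A,\Phi)$ satisfies $$\|\Phi\|_{C^0(X)}^2\le K_3\quad\text{and}\quad \|F_A^+\|_{C^0(X)}\le K_3.$$ In particular, if $K_3\le 0$ then $\Phi\equiv0$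 and $F_A^+\equiv0$. Moreover, there is a universal constant $c\ge 0$ such that $\Phi\equiv 0$ and $F_A^+\equiv 0$ for every $C^1$ $\mathrm{PU}(2)$ monopole whenever $$R\ \ge\ c\left(\|\vartheta_0\|_{L^\infty_1}+\|\vartheta_A\|_{L^\infty_{1,A}}+|F^+(A_e)|+|F^+(A_L)|\right)\quad\text{on all of }X.$$ -/

import Mathlib

open scoped Manifold ContDiff Bundle TensorProduct ENNReal NNReal

universe u v w

noncomputable section

namespace PU2Monopole

/-! ### The base manifold -/

/-- The model space `ℝ⁴` of the base manifold. -/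
abbrev R4 := EuclideanSpace ℝ (Fin 4)

/-- The model fibre `ℂ²` of a Hermitian two-plane bundle. -/
abbrev C2 := EuclideanSpace ℂ (Fin 2)

/-- The tangent space at `x`. -/
abbrev T {X : Type*} [TopologicalSpace X] [ChartedSpace R4 X] (x : X) : Type :=
  TangentSpace (𝓡 4) x

/-- A vector field `Y` is of class `C^n`. -/
def IsVectorField {X : Type*} [TopologicalSpace X] [ChartedSpace R4 X] [IsManifold (𝓡 4) ∞ X]
    (n : WithTop ℕ∞) (Y : ∀ x : X, T x) : Prop :=
  ContMDiff (𝓡 4) ((𝓡 4).prod 𝓘(ℝ, R4)) n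
    (fun x => (⟨x, Y x⟩ : Bundle.TotalSpace R4 (TangentSpace (𝓡 4) : X → Type _)))

/-- A vector field `Y` is differentiable at `x`. -/
def VectorFieldDiffAt {X : Type*} [TopologicalSpace X] [ChartedSpace R4 X]
    [IsManifold (𝓡 4) ∞ X] (Y : ∀ x : X, T x) (x : X) : Prop :=
  MDifferentiableAt (𝓡 4) ((𝓡 4).prod 𝓘(ℝ, R4))
    (fun x => (⟨x, Y x⟩ : Bundle.TotalSpace R4 (TangentSpace (𝓡 4) : X → Type _))) x

/-- Connections on the tangent bundle. -/
abbrev TangentConnection (X : Type*) [TopologicalSpace X] [ChartedSpace R4 X]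
    [IsManifold (𝓡 4) ∞ X] :=
  CovariantDerivative (𝓡 4) R4 (TangentSpace (𝓡 4) : X → Type _)

instance instFiniteDimensionalTangent {X : Type*} [TopologicalSpace X] [ChartedSpace R4 X]
    (x : X) : FiniteDimensional ℝ (T x) :=
  inferInstanceAs (FiniteDimensional ℝ R4)

instance instFactFinrankTangent {X : Type*} [TopologicalSpace X] [ChartedSpace R4 X]
    (x : X) : Fact (Module.finrank ℝ (T x) = 4) :=
  ⟨(finrank_euclideanSpace_fin : Module.finrank ℝ R4 = 4)⟩

/-! ### Hermitian two-plane bundles, sections and connections -/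

/-- A smooth complex vector bundle of rank two over `X` with a smooth Hermitian metric.
The complex bundle is a smooth real bundle whose trivializations are complex linear; the Hermitian
metric is smooth when its real part is. -/
structure HermitianPlaneBundle (X : Type*) [TopologicalSpace X] [ChartedSpace R4 X] where
  fiber : X → Type*
  [normed : ∀ x, NormedAddCommGroup (fiber x)]
  [innerProduct : ∀ x, InnerProductSpace ℂ (fiber x)]
  [totalTopology : TopologicalSpace (Bundle.TotalSpace C2 fiber)]
  [fiberBundle : FiberBundle C2 fiber]
  [complexVectorBundle : VectorBundle ℂ C2 fiber]
  [realVectorBundle : VectorBundle ℝ C2 fiber]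
  [smoothBundle : ContMDiffVectorBundle ∞ C2 fiber (𝓡 4)]
  smoothMetric :
    letI : ∀ x, InnerProductSpace ℝ (fiber x) := fun _ => InnerProductSpace.complexToReal
    IsContMDiffRiemannianBundle (𝓡 4) ∞ C2 fiber

attribute [instance] HermitianPlaneBundle.normed HermitianPlaneBundle.innerProduct
  HermitianPlaneBundle.totalTopology HermitianPlaneBundle.fiberBundle
  HermitianPlaneBundle.complexVectorBundle HermitianPlaneBundle.realVectorBundle
  HermitianPlaneBundle.smoothBundle

section Bundles

variable {X : Type*} [TopologicalSpace X] [ChartedSpace R4 X]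

instance instFiniteDimensionalFiber (V : HermitianPlaneBundle X) (x : X) :
    FiniteDimensional ℂ (V.fiber x) :=
  ((trivializationAt C2 V.fiber x).continuousLinearEquivAt ℂ x
    (FiberBundle.mem_baseSet_trivializationAt' x)).symm.toLinearEquiv.finiteDimensional

/-- The section `s` of `V` is of class `C^n`. -/
def IsSection (V : HermitianPlaneBundle X) (n : WithTop ℕ∞) (s : ∀ x, V.fiber x) : Prop :=
  ContMDiff (𝓡 4) ((𝓡 4).prod 𝓘(ℝ, C2)) n
    (fun x => (⟨x, s x⟩ : Bundle.TotalSpace C2 V.fiber))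

/-- The section `s` of `V` is differentiable at `x`. -/
def SectionDiffAt (V : HermitianPlaneBundle X) (s : ∀ x, V.fiber x) (x : X) : Prop :=
  MDifferentiableAt (𝓡 4) ((𝓡 4).prod 𝓘(ℝ, C2))
    (fun x => (⟨x, s x⟩ : Bundle.TotalSpace C2 V.fiber)) x

/-- Connections on `V`; `A s x v` is the covariant derivative of the section `s` at `x` in the
direction `v`. -/
abbrev Connection (V : HermitianPlaneBundle X) := CovariantDerivative (𝓡 4) C2 V.fiber

/-- A unitary connection: it is complex linear and `d⟨s, t⟩ = ⟨∇s, t⟩ + ⟨s, ∇t⟩`. -/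
structure IsUnitary {V : HermitianPlaneBundle X} (A : Connection V) : Prop where
  smul : ∀ (s : ∀ x, V.fiber x) (x : X) (v : T x), SectionDiffAt V s x →
    A (fun y => Complex.I • s y) x v = Complex.I • A s x v
  metric : ∀ (s t : ∀ x, V.fiber x) (x : X) (v : T x),
    SectionDiffAt V s x → SectionDiffAt V t x →
    mvfderiv (𝓡 4) (fun y => inner ℂ (s y) (t y)) x v =
      inner ℂ (A s x v) (t x) + inner ℂ (s x) (A t x v)

variable [IsManifold (𝓡 4) ∞ X]

/-- The connection `A` is of class `C^n`. -/
def IsConnectionOfClass {V : HermitianPlaneBundle X} (n : WithTop ℕ∞) (A : Connection V) : Prop :=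
  CovariantDerivative.ContMDiffCovariantDerivative A n

/-- The curvature `R(u, v) s = ∇_u ∇_v s - ∇_v ∇_u s - ∇_[u, v] s` of a connection, evaluated at a
point after extending `u`, `v`, `s` smoothly near the point. -/
def curvature {F : Type*} [NormedAddCommGroup F] [NormedSpace ℝ F] {V : X → Type*}
    [TopologicalSpace (Bundle.TotalSpace F V)] [∀ x, AddCommGroup (V x)]
    [∀ x, Module ℝ (V x)] [∀ x, TopologicalSpace (V x)] [∀ x, IsTopologicalAddGroup (V x)]
    [∀ x, ContinuousSMul ℝ (V x)] [FiberBundle F V]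
    (D : CovariantDerivative (𝓡 4) F V) (x : X) (u v : T x) (s : V x) : V x :=
  let u' : ∀ y : X, T y := FiberBundle.extend R4 u
  let v' : ∀ y : X, T y := FiberBundle.extend R4 v
  let s' : ∀ y : X, V y := FiberBundle.extend F s
  D (fun y => D s' y (v' y)) x u - D (fun y => D s' y (u' y)) x v
    - D s' x (VectorField.mlieBracket (𝓡 4) u' v' x)

/-- An orthonormal basis of the fibre `V_x`. -/
def fiberBasis (V : HermitianPlaneBundle X) (x : X) :
    OrthonormalBasis (Fin (Module.finrank ℂ (V.fiber x))) ℂ (V.fiber x) :=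
  stdOrthonormalBasis ℂ (V.fiber x)

/-- The curvature `F_A(u, v)` as a complex linear endomorphism of `V_x`. -/
def curvatureEnd {V : HermitianPlaneBundle X} (A : Connection V) (x : X) (u v : T x) :
    Module.End ℂ (V.fiber x) :=
  (fiberBasis V x).toBasis.constr ℂ fun b => curvature A x u v (fiberBasis V x b)

/-- `A` and `A₀` induce the same connection on the determinant line bundle `det V`, that is, the
trace of the `End V`-valued one-form `A - A₀` vanishes. -/
def SameDeterminant {V : HermitianPlaneBundle X} (A A₀ : Connection V) : Prop :=
  ∀ (x : X) (v : T x), ∑ b, inner ℂ (fiberBasis V x b)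
    (A (FiberBundle.extend C2 (fiberBasis V x b)) x v
      - A₀ (FiberBundle.extend C2 (fiberBasis V x b)) x v) = 0

end Bundles

/-! ### Fibrewise linear algebra of endomorphisms -/

section LinearAlgebra

variable {H : Type*} [NormedAddCommGroup H] [InnerProductSpace ℂ H] [FiniteDimensional ℂ H]

/-- The fibre norm `|M|² = ½ tr (M† M)` on the endomorphisms of a Hermitian plane. -/
def endNorm (M : Module.End ℂ H) : ℝ :=
  √((LinearMap.trace ℂ H (LinearMap.adjoint M * M)).re / 2)

/-- The projection `M ↦ M - ½ (tr M) id` onto the traceless endomorphisms of a plane. -/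
def traceless : Module.End ℂ H →ₗ[ℂ] Module.End ℂ H :=
  LinearMap.id - (LinearMap.trace ℂ H).smulRight ((1 / 2 : ℂ) • (1 : Module.End ℂ H))

/-- The skew-Hermitian traceless endomorphisms. -/
def su (H : Type*) [NormedAddCommGroup H] [InnerProductSpace ℂ H] :
    Submodule ℝ (Module.End ℂ H) where
  carrier := {M | (∀ s t : H, inner ℂ (M s) t = -inner ℂ s (M t)) ∧ LinearMap.trace ℂ H M = 0}
  add_mem' := by
    rintro M N ⟨hM, hM'⟩ ⟨hN, hN'⟩
    refine ⟨fun s t => ?_, by rw [map_add, hM', hN', add_zero]⟩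
    simp only [LinearMap.add_apply, inner_add_left, inner_add_right, hM, hN, neg_add]
  zero_mem' := by simp
  smul_mem' := by
    rintro r M ⟨hM, hM'⟩
    have h : r • M = (r : ℂ) • M := by ext; simp
    refine ⟨fun s t => ?_, by rw [h, map_smul, hM', smul_zero]⟩
    rw [h, LinearMap.smul_apply, LinearMap.smul_apply, inner_smul_left, inner_smul_right, hM,
      Complex.conj_ofReal, mul_neg]

end LinearAlgebra

section Riemannian

variable {X : Type*} [TopologicalSpace X] [ChartedSpace R4 X] [IsManifold (𝓡 4) ∞ X]
  [Bundle.RiemannianBundle (fun x : X => TangentSpace (𝓡 4) x)]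

/-- An orthonormal basis of the tangent space at `x`. -/
def frame (x : X) : OrthonormalBasis (Fin 4) ℝ (T x) :=
  (stdOrthonormalBasis ℝ (T x)).reindex (finCongr Fact.out)

/-- A continuous family of orientations of the tangent spaces: the associated Riemannian volume
form is continuous. -/
structure ManifoldOrientation (X : Type*) [TopologicalSpace X] [ChartedSpace R4 X]
    [IsManifold (𝓡 4) ∞ X] [Bundle.RiemannianBundle (fun x : X => TangentSpace (𝓡 4) x)] where
  at_ : ∀ x : X, Orientation ℝ (T x) (Fin 4)
  continuous_volumeForm : ∀ Y : Fin 4 → ∀ x : X, T x, (∀ i, IsVectorField ∞ (Y i)) →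
    Continuous fun x => (at_ x).volumeForm fun i => Y i x

/-- `D` is the Levi-Civita connection of the metric. -/
structure IsLeviCivita (D : TangentConnection X) : Prop where
  metric : ∀ (Y Z : ∀ x : X, T x) (x : X) (v : T x),
    VectorFieldDiffAt Y x → VectorFieldDiffAt Z x →
    mvfderiv (𝓡 4) (fun y => inner ℝ (Y y) (Z y)) x v =
      inner ℝ (D Y x v) (Z x) + inner ℝ (Y x) (D Z x v)
  torsion_free : ∀ (Y Z : ∀ x : X, T x) (x : X),
    VectorFieldDiffAt Y x → VectorFieldDiffAt Z x →
    D Z x (Y x) - D Y x (Z x) = VectorField.mlieBracket (𝓡 4) Y Z x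
  smooth : CovariantDerivative.ContMDiffCovariantDerivative D ∞

/-- The scalar curvature `∑ ⟨R(e_i, e_j) e_j, e_i⟩` (equal to `n (n - 1)` on the unit `n`-sphere). -/
def scalarCurvature (D : TangentConnection X) (x : X) : ℝ :=
  ∑ i, ∑ j, inner ℝ (curvature D x (frame x i) (frame x j) (frame x j)) (frame x i)

/-! ### Two-forms at a point -/

/-- Bilinear forms on `T_x X` with values in a real vector space; two-forms are the alternating
ones. -/
abbrev Bilin (x : X) (G : Type*) [AddCommGroup G] [Module ℝ G] := T x →ₗ[ℝ] T x →ₗ[ℝ] G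

section Forms

variable {G : Type*} [AddCommGroup G] [Module ℝ G]

/-- The bilinear form that takes the values `f (e_i, e_j)` on the orthonormal basis. -/
def ofFrame (x : X) (f : T x → T x → G) : Bilin x G :=
  (frame x).toBasis.constr ℝ fun i => (frame x).toBasis.constr ℝ fun j =>
    f (frame x i) (frame x j)

/-- The Hodge hodgeStar `(*η)(u, v) = ½ ∑ vol(u, v, e_k, e_l) η(e_k, e_l)` on two-forms. -/
def hodgeStar (o : ManifoldOrientation X) {x : X} (η : Bilin x G) (u v : T x) : G :=
  (1 / 2 : ℝ) • ∑ k, ∑ l,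
    (o.at_ x).volumeForm ![u, v, frame x k, frame x l] • η (frame x k) (frame x l)

/-- The self-dual part `η⁺ = ½ (η + *η)` of a two-form. -/
def selfDualPart (o : ManifoldOrientation X) {x : X} (η : Bilin x G) : Bilin x G :=
  ofFrame x fun u v => (1 / 2 : ℝ) • (η u v + hodgeStar o η u v)

/-- The norm `|η|² = ∑_{i < j} |η(e_i, e_j)|²` of a two-form, for a norm `ν` on the values. -/
def formNorm (ν : G → ℝ) {x : X} (η : Bilin x G) : ℝ :=
  √((1 / 2) * ∑ i, ∑ j, ν (η (frame x i) (frame x j)) ^ 2)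

end Forms

/-- The space `Λ⁺_x` of real self-dual two-forms. -/
def LambdaPlus (o : ManifoldOrientation X) (x : X) : Submodule ℝ (Bilin x ℝ) where
  carrier := {η | (∀ u, η u u = 0) ∧ ∀ u v, hodgeStar o η u v = η u v}
  add_mem' := by
    rintro η ζ ⟨h1, h2⟩ ⟨h3, h4⟩
    refine ⟨fun u => by simp [h1, h3], fun u v => ?_⟩
    rw [LinearMap.add_apply, LinearMap.add_apply, ← h2, ← h4]
    simp only [hodgeStar, LinearMap.add_apply, smul_add, Finset.sum_add_distrib]
  zero_mem' := by simp [hodgeStar]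
  smul_mem' := by
    rintro r η ⟨h1, h2⟩
    refine ⟨fun u => by simp [h1], fun u v => ?_⟩
    rw [LinearMap.smul_apply, LinearMap.smul_apply, ← h2]
    simp only [hodgeStar, LinearMap.smul_apply, Finset.smul_sum]
    refine Finset.sum_congr rfl fun k _ => Finset.sum_congr rfl fun l _ => ?_
    simp only [smul_eq_mul]
    ring

/-- The fibre `Λ⁺ ⊗ su(E)` at `x`. -/
abbrev LambdaPlusSu (o : ManifoldOrientation X) (E : HermitianPlaneBundle X) (x : X) :=
  LambdaPlus o x ⊗[ℝ] su (E.fiber x)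

/-- The inclusion of `Λ⁺ ⊗ su(E)` into the `End E`-valued forms, `η ⊗ N ↦ η(u, v) N`. -/
def toForm (o : ManifoldOrientation X) (E : HermitianPlaneBundle X) (x : X) :
    LambdaPlusSu o E x →ₗ[ℝ] Bilin x (Module.End ℂ (E.fiber x)) :=
  TensorProduct.lift (LinearMap.mk₂ ℝ
    (fun η N => η.1.compr₂ (LinearMap.toSpanSingleton ℝ _ N.1))
    (fun _ _ _ => by ext; simp [add_smul])
    (fun _ _ _ => by ext; simp [mul_smul])
    (fun _ _ _ => by ext; simp)
    (fun c η N => by ext; simp [smul_comm c]))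

/-- The norm on `Λ⁺ ⊗ su(E)`. -/
def lambdaPlusSuNorm {o : ManifoldOrientation X} {E : HermitianPlaneBundle X} {x : X}
    (q : LambdaPlusSu o E x) : ℝ :=
  formNorm endNorm (toForm o E x q)

/-! ### Curvatures -/

section Curvatures

variable {V : HermitianPlaneBundle X}

/-- The curvature of the connection that `A` induces on `det V`: the trace of the curvature. -/
def detCurvature (A : Connection V) (x : X) : Bilin x ℂ :=
  ofFrame x fun u v => LinearMap.trace ℂ (V.fiber x) (curvatureEnd A x u v)

/-- The curvature of the connection that `A` induces on `su(V)`, as an `su(V)`-valued two-form: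
the traceless part of the curvature. -/
def adCurvature (A : Connection V) (x : X) : Bilin x (Module.End ℂ (V.fiber x)) :=
  ofFrame x fun u v => traceless (curvatureEnd A x u v)

/-- `F_A⁺`, the self-dual part of the curvature on `su(V)`. -/
def adCurvaturePlus (o : ManifoldOrientation X) (A : Connection V) (x : X) :
    Bilin x (Module.End ℂ (V.fiber x)) :=
  selfDualPart o (adCurvature A x)

end Curvatures

/-! ### Spin^c structures -/

/-- A spin^c structure with a spin^c connection on an oriented Riemannian four-manifold with
Levi-Civita connection `D`. Clifford multiplication by a one-form is written as Clifford
multiplication by the metrically dual tangent vector. -/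
structure SpincStructure (o : ManifoldOrientation X) (D : TangentConnection X) where
  Wplus : HermitianPlaneBundle.{_, v} X
  Wminus : HermitianPlaneBundle.{_, v} X
  /-- Clifford multiplication `ρ₊ : T*X → Hom(W⁺, W⁻)`. -/
  rho : ∀ x : X, T x →ₗ[ℝ] (Wplus.fiber x →ₗ[ℂ] Wminus.fiber x)
  rho_smooth : ∀ (Y : ∀ x, T x) (φ : ∀ x, Wplus.fiber x), IsVectorField ∞ Y →
    IsSection Wplus ∞ φ → IsSection Wminus ∞ fun x => rho x (Y x) (φ x)
  /-- `ρ₊(v)† ρ₊(v) = |v|² id`. -/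
  clifford : ∀ (x : X) (v : T x),
    LinearMap.adjoint (rho x v) ∘ₗ rho x v = ((‖v‖ ^ 2 : ℝ) : ℂ) • LinearMap.id
  /-- `W⁺` is the positive spinor bundle for the given orientation: since `ρ₋ = -ρ₊†`, this says
  that `ρ(e₀) ρ(e₁) ρ(e₂) ρ(e₃) = -id` on `W⁺` for oriented orthonormal bases, so that `ρ` maps
  `Λ⁻` to zero and `Λ⁺` onto `su(W⁺)`. -/
  chirality : ∀ (x : X) (e : OrthonormalBasis (Fin 4) ℝ (T x)), e.toBasis.orientation = o.at_ x →
    (-LinearMap.adjoint (rho x (e 0)) ∘ₗ rho x (e 1)) ∘ₗ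
      (-LinearMap.adjoint (rho x (e 2)) ∘ₗ rho x (e 3)) = -LinearMap.id
  nablaPlus : Connection Wplus
  nablaMinus : Connection Wminus
  nablaPlus_smooth : IsConnectionOfClass ∞ nablaPlus
  nablaMinus_smooth : IsConnectionOfClass ∞ nablaMinus
  nablaPlus_unitary : IsUnitary nablaPlus
  nablaMinus_unitary : IsUnitary nablaMinus
  /-- `∇(ρ(Y) φ) = ρ(∇Y) φ + ρ(Y) ∇φ`. -/
  compatible : ∀ (Y : ∀ x, T x) (φ : ∀ x, Wplus.fiber x) (x : X) (v : T x),
    VectorFieldDiffAt Y x → SectionDiffAt Wplus φ x →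
    nablaMinus (fun y => rho y (Y y) (φ y)) x v =
      rho x (D Y x v) (φ x) + rho x (Y x) (nablaPlus φ x v)

/-! ### Tensor products -/

/-- The fibre of `V ⊗ E` at `x`, with the induced Hermitian inner product. -/
abbrev Tensor (V E : HermitianPlaneBundle X) (x : X) := V.fiber x ⊗[ℂ] E.fiber x

/-- The contraction `w ⊗ ξ ↦ ⟨s, ξ⟩ w` of `V_x ⊗ E_x` with `s ∈ E_x`. -/
def contract {V E : HermitianPlaneBundle X} {x : X} (s : E.fiber x) :
    Tensor V E x →ₗ[ℂ] V.fiber x :=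
  (TensorProduct.rid ℂ (V.fiber x)).toLinearMap ∘ₗ
    LinearMap.lTensor (V.fiber x) (innerₛₗ ℂ s)

/-- The section `Φ` of `V ⊗ E` is of class `C^n`: so are all its contractions with smooth sections
of `E`. -/
def IsTensorSection (V E : HermitianPlaneBundle X) (n : WithTop ℕ∞) (Φ : ∀ x, Tensor V E x) : Prop :=
  ∀ s : ∀ x, E.fiber x, IsSection E ∞ s → IsSection V n fun x => contract (s x) (Φ x)

/-- The tensor product connection on `V ⊗ E` of connections `B` on `V` and `A` on `E`, for `A`
unitary. The contraction of `∇_v Φ` with a section `s` of `E` is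
`∇_v ⟨s, Φ⟩ - ⟨∇_v s, Φ⟩`. -/
def tensorDeriv {V E : HermitianPlaneBundle X} (B : Connection V) (A : Connection E)
    (Φ : ∀ x, Tensor V E x) (x : X) (v : T x) : Tensor V E x :=
  ∑ b, (B (fun y => contract (FiberBundle.extend C2 (fiberBasis E x b) y) (Φ y)) x v
      - contract (A (FiberBundle.extend C2 (fiberBasis E x b)) x v) (Φ x)) ⊗ₜ[ℂ] fiberBasis E x b

/-- The projection `π_V ⊗ π_E` of `gl(V) ⊗ gl(E) = gl(V ⊗ E)` onto `sl(V) ⊗ sl(E)`. -/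
def tracelessTraceless {V E : HermitianPlaneBundle X} {x : X}
    (M : Module.End ℂ (Tensor V E x)) : Module.End ℂ (Tensor V E x) :=
  homTensorHomEquiv ℂ (V.fiber x) (E.fiber x) (V.fiber x) (E.fiber x)
    (TensorProduct.map traceless traceless
      ((homTensorHomEquiv ℂ (V.fiber x) (E.fiber x) (V.fiber x) (E.fiber x)).symm M))

/-- `(Φ ⊗ Φ*)₀₀`, where `(Φ ⊗ Φ*) Ψ = ⟨Ψ, Φ⟩ Φ` (Hermitian product linear in `Ψ`). -/
def quadratic {V E : HermitianPlaneBundle X} {x : X} (Φ : Tensor V E x) :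
    Module.End ℂ (Tensor V E x) :=
  tracelessTraceless (InnerProductSpace.rankOne ℂ Φ Φ).toLinearMap

/-! ### The `PU(2)` monopole equations -/

section Monopoles

variable {o : ManifoldOrientation X} {D : TangentConnection X}

/-- Clifford multiplication `ρ ⊗ id` of two-forms with values in `End E`, acting on `W⁺ ⊗ E`:
`ρ(e_i ∧ e_j) = ρ₋(e_i) ρ₊(e_j)` for `i ≠ j`, with `ρ₋ = -ρ₊†`, so that
`ρ(η) = ½ ∑ ρ₋(e_i) ρ₊(e_j) ⊗ η(e_i, e_j)`. -/
def rhoForm (S : SpincStructure o D) {E : HermitianPlaneBundle X} {x : X}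
    (η : Bilin x (Module.End ℂ (E.fiber x))) : Module.End ℂ (Tensor S.Wplus E x) :=
  (1 / 2 : ℂ) • ∑ i, ∑ j, TensorProduct.map
    (-LinearMap.adjoint (S.rho x (frame x i)) ∘ₗ S.rho x (frame x j))
    (η (frame x i) (frame x j))

/-- The Dirac operator `D_A Φ = ∑ (ρ(e_i) ⊗ id) ∇_{A, e_i} Φ`. -/
def dirac (S : SpincStructure o D) {E : HermitianPlaneBundle X} (A : Connection E)
    (Φ : ∀ x, Tensor S.Wplus E x) (x : X) : Tensor S.Wminus E x :=
  ∑ i, LinearMap.rTensor (E.fiber x) (S.rho x (frame x i))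
    (tensorDeriv S.nablaPlus A Φ x (frame x i))

/-- Clifford multiplication by a complex one-form. -/
def rhoOneForm (S : SpincStructure o D) (x : X) (θ : T x →ₗ[ℝ] ℂ) :
    S.Wplus.fiber x →ₗ[ℂ] S.Wminus.fiber x :=
  ∑ i, θ (frame x i) • S.rho x (frame x i)

/-- Perturbations of the `PU(2)` monopole equations at a given connection on `E`. The section
`tau` of `gl(Λ⁺ ⊗ su(E))` stands for `τ · m(A)`, a section of the subbundle
`gl(Λ⁺) ⊗ so(su(E))`, and the section `theta` of `Hom(W⁺ ⊗ E, W⁻ ⊗ E)` for `ϑ · m(A)`, a section of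
the subbundle `Hom(W⁺, W⁻) ⊗ sl(E)`. -/
structure Perturbation (S : SpincStructure o D) (E : HermitianPlaneBundle X) where
  tau0 : ∀ x : X, LambdaPlus o x →ₗ[ℝ] LambdaPlus o x
  tau : ∀ x : X, LambdaPlusSu o E x →ₗ[ℝ] LambdaPlusSu o E x
  theta0 : ∀ x : X, T x →ₗ[ℝ] ℂ
  theta : ∀ x : X, Tensor S.Wplus E x →ₗ[ℂ] Tensor S.Wminus E x
  theta0_C1 : ∀ Y : ∀ x : X, T x, IsVectorField ∞ Y →
    ContMDiff (𝓡 4) 𝓘(ℝ, ℂ) 1 fun x => theta0 x (Y x)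
  theta_C1 : ∀ Ψ : ∀ x, Tensor S.Wplus E x, IsTensorSection S.Wplus E ∞ Ψ →
    IsTensorSection S.Wminus E 1 fun x => theta x (Ψ x)

/-- The `C⁰` norm of a section with pointwise norm `f`. -/
def C0norm (f : X → ℝ) : ℝ≥0∞ := ⨆ x, ENNReal.ofReal (f x)

namespace Perturbation

variable {S : SpincStructure o D} {E : HermitianPlaneBundle X} (P : Perturbation S E)

/-- The supremum over `X` of the pointwise operator norm of `τ₀`. -/
def tau0Norm : ℝ≥0∞ :=
  ⨆ (x : X) (η : LambdaPlus o x) (_ : formNorm abs η.1 ≤ 1),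
    ENNReal.ofReal (formNorm abs (P.tau0 x η).1)

/-- The supremum over `X` of the pointwise operator norm of `τ`. -/
def tauNorm : ℝ≥0∞ :=
  ⨆ (x : X) (q : LambdaPlusSu o E x) (_ : lambdaPlusSuNorm q ≤ 1),
    ENNReal.ofReal (lambdaPlusSuNorm (P.tau x q))

/-- The `L^∞_1` norm of the complex one-form `ϑ₀`, the larger of the suprema of `|ϑ₀|` and
`|∇ϑ₀|`. -/
def theta0Norm : ℝ≥0∞ :=
  max (⨆ (x : X) (w : T x) (_ : ‖w‖ ≤ 1), ‖P.theta0 x w‖ₑ)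
    (⨆ (x : X) (v : T x) (w : T x) (_ : ‖v‖ ≤ 1) (_ : ‖w‖ ≤ 1),
      ‖mvfderiv (𝓡 4) (fun y => P.theta0 y (FiberBundle.extend R4 w y)) x v
        - P.theta0 x (D (FiberBundle.extend R4 w) x v)‖ₑ)

/-- The `L^∞_{1,A}` norm of `ϑ`, the larger of the suprema of `|ϑ|` and `|∇_A ϑ|`, where
`(∇_A ϑ) Ψ = ∇_A (ϑ Ψ) - ϑ (∇_A Ψ)`. -/
def thetaNorm (A : Connection E) : ℝ≥0∞ :=
  max (⨆ (x : X) (ψ : Tensor S.Wplus E x) (_ : ‖ψ‖ ≤ 1), ‖P.theta x ψ‖ₑ)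
    (⨆ (x : X) (v : T x) (Ψ : ∀ y, Tensor S.Wplus E y) (_ : ‖v‖ ≤ 1) (_ : ‖Ψ x‖ ≤ 1)
      (_ : IsTensorSection S.Wplus E ∞ Ψ),
      ‖tensorDeriv S.nablaMinus A (fun y => P.theta y (Ψ y)) x v
        - P.theta x (tensorDeriv S.nablaPlus A Ψ x v)‖ₑ)

/-- The standing smallness conditions on the perturbations. -/
structure IsAdmissible (A : Connection E) : Prop where
  tau_le : P.tau0Norm + P.tauNorm ≤ 1 / 64
  theta_le : P.theta0Norm + P.thetaNorm A ≤ 1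

end Perturbation

/-- The `PU(2)` monopole equations
`F_A⁺ = (id + τ₀ ⊗ id + τ) ρ⁻¹ (Φ ⊗ Φ*)₀₀` and `D_A Φ + ρ(ϑ₀) Φ + ϑ Φ = 0`. -/
structure IsMonopole (S : SpincStructure o D) {E : HermitianPlaneBundle X}
    (P : Perturbation S E) (A : Connection E) (Φ : ∀ x, Tensor S.Wplus E x) : Prop where
  curvature_eq : ∀ x, ∃ q : LambdaPlusSu o E x, rhoForm S (toForm o E x q) = quadratic (Φ x) ∧
    adCurvaturePlus o A x =
      toForm o E x (q + LinearMap.rTensor (su (E.fiber x)) (P.tau0 x) q + P.tau x q)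
  dirac_eq : ∀ x, dirac S A Φ x
    + LinearMap.rTensor (E.fiber x) (rhoOneForm S x (P.theta0 x)) (Φ x) + P.theta x (Φ x) = 0

end Monopoles

end Riemannian

end PU2Monopole

end

noncomputable section

namespace PU2Monopole

open MeasureTheory Topology
-- Weak symmetry of second derivatives for `C¹` functions
section Analysis
set_option linter.unusedSectionVars false
variable {E₀ : Type*} [NormedAddCommGroup E₀] [InnerProductSpace ℝ E₀] [FiniteDimensional ℝ E₀]
  [MeasurableSpace E₀] [BorelSpace E₀]
variable {V : Type*} [NormedAddCommGroup V] [InnerProductSpace ℝ V] [FiniteDimensional ℝ V]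

/-! The estimate is the maximum principle for |Φ|² combined with the Bochner–Weitzenböck formula. At
a maximum of |Φ|² that formula gives |∇Φ|² + Re ∑ ⟨∇_i(D_A Φ), ρ(e_i)Φ⟩ + (R/4)|Φ|² + Re⟨ρ(F_A)Φ, Φ⟩
- (terms in F⁺(A_L) and F⁺(A_e)) ≤ 0, where F_A is the curvature on su(E). The two monopole
equations control the second and the fourth term.

Dirac equation. Let θ ≤ 1 be the sum of the two `L^∞_1` norms. Since D_A Φ = -(ρ(ϑ₀) + ϑ)Φ, each of
its derivatives along a unit vector is at most 4θ(|Φ| + |∇Φ|). Young's inequality absorbs the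
gradient into |∇Φ|² and leaves an error of at most 32θ|Φ|² (`le_of_gradient_absorption`,
`weitzenbock_le_at_local_max`).

Curvature equation. Clifford multiplication sees only F_A⁺, which is (id + τ) applied to ρ⁻¹(Φ ⊗
Φ*)₀₀, with τ short for the two τ-terms. The quartic form ⟨(Φ ⊗ Φ*)₀₀ Φ, Φ⟩ is at least |Φ|⁴/4, and
the bound 1/64 on τ costs less than half of it (`re_inner_rhoForm_adCurvature_ge`). The outcome is
`curvature_inequality_at_local_max`, (R/4)|Φ|² + |Φ|⁴/8 ≤ (32θ + determinant curvatures)|Φ|².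
Division by |Φ|² bounds |Φ|² where it is largest, and forces Φ = 0 when R dominates the right-hand
side. The curvature equation then bounds F_A⁺ by 8|Φ|² (`formNorm_adCurvaturePlus_le`).

Regularity. A and Φ are only of class `C¹`, so second derivatives of Φ need not exist and Bochner's
formula is proved weakly. The Dirac equation makes D_A Φ of class `C¹`. In a chart, integration
against test functions shows that the second order operator div(a∇|Φ|²) is, as a distribution, a
continuous function; the commutator of covariant derivatives enters through
`integral_covDeriv_comm`, and `weak_maximum_principle` gives the sign at a local maximum. The local
result is `LocalDirac.bochner_at_local_max`. Orthonormal frames of W⁺, W⁻ and E, together with a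
coordinate frame and its dual, carry it to the manifold (`localDirac_localize`,
`bochner_at_local_max`).

Algebra. The endomorphisms ρ(e₀)†ρ(e_a), a = 1, 2, 3, generate a quaternion algebra and identify Λ⁺
with su(W⁺). Compatibility of the spin connection with Clifford multiplication determines the
traceless part of its curvature from the Riemann tensor (`curvatureEnd_nablaPlus`), and the Bianchi
identity reduces the contraction to R/4 (`weitzenbock_term_eq`).

Uniformity. The trace of the curvature is the exterior derivative of the trace of the connection
form, so F(A_e) is the same for A and for the reference connection
(`SameDeterminant.detCurvature_eq`). Compactness makes the three `C⁰` norms finite, and only these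
norms enter `monopoleBound`. -/

lemma continuous_fderiv_apply_const {F : Type*} [NormedAddCommGroup F] [NormedSpace ℝ F] {h : E₀ → F}
    (hh : ContDiff ℝ 1 h) (w : E₀) : Continuous fun p => fderiv ℝ h p w :=
  (hh.continuous_fderiv one_ne_zero).clm_apply continuous_const

/-- The integral of a directional derivative of a compactly supported `C¹` function vanishes. -/
lemma integral_fderiv_apply_eq_zero {h : E₀ → ℝ} (hh : ContDiff ℝ 1 h) (hc : HasCompactSupport h)
    (w : E₀) : ∫ p, fderiv ℝ h p w = 0 := by
  have h1 : Integrable fun p => fderiv ℝ h p w :=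
    (continuous_fderiv_apply_const hh w).integrable_of_hasCompactSupport
      (hc.fderiv_apply (𝕜 := ℝ) w)
  have h2 := integral_mul_fderiv_eq_neg_fderiv_mul_of_integrable (μ := (volume : Measure E₀))
    (f := fun _ : E₀ => (1 : ℝ)) (g := h) (v := w) (by simp) (by simpa using h1)
    (by simpa using hh.continuous.integrable_of_hasCompactSupport hc)
    (by fun_prop) (fun x _ => (hh.differentiable one_ne_zero) x)
  simpa using h2

/-- Consider z ↦ ∫ ⟨∂_v u(t), ξ(t - z)⟩ dt. Integration by parts in t also writes it as -∫ ⟨u(t),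
∂_v ξ(t - z)⟩ dt. Both expressions are convolutions; the derivative in z along w at 0 falls on ξ in
the first and on u in the second, so no second derivative ever appears. -/
lemma integral_inner_fderiv_comm_of_hasCompactSupport {u ξ : E₀ → V} (hu : ContDiff ℝ 1 u)
    (hξ : ContDiff ℝ 1 ξ) (hcu : HasCompactSupport u) (hc : HasCompactSupport ξ) (v w : E₀) :
    ∫ p, inner ℝ (fderiv ℝ u p v) (fderiv ℝ ξ p w) =
      ∫ p, inner ℝ (fderiv ℝ u p w) (fderiv ℝ ξ p v) := by
  have hneg : ∀ (g : E₀ → V), HasCompactSupport g → HasCompactSupport fun y => g (-y) :=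
    fun g hg => hg.comp_homeomorph (Homeomorph.neg E₀)
  set L : V →L[ℝ] V →L[ℝ] ℝ := innerSL ℝ
  set f : E₀ → V := fun t => fderiv ℝ u t v
  set g : E₀ → V := fun y => ξ (-y)
  set k : E₀ → V := fun t => fderiv ℝ ξ (-t) v
  have hf : Continuous f := continuous_fderiv_apply_const hu v
  have hk : Continuous k := (continuous_fderiv_apply_const hξ v).comp continuous_neg
  have hg : ContDiff ℝ 1 g := hξ.comp contDiff_neg
  have hgc : HasCompactSupport g := hneg ξ hc
  have h1 := hgc.hasFDerivAt_convolution_right L (μ := volume) hf.locallyIntegrable hg 0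
  have h2 := hcu.hasFDerivAt_convolution_right L (μ := volume) hk.locallyIntegrable hu 0
  have hgd : ∀ t, fderiv ℝ g t = -fderiv ℝ ξ (-t) := fun t => by
    have h := ((hξ.differentiable one_ne_zero) (-t)).hasFDerivAt.comp t (hasFDerivAt_id t).neg
    refine h.fderiv.trans ?_
    ext; simp
  -- The two expressions for the correlation of `∂_v u` with the translates of `ξ`.
  have heq : ∀ z, (convolution f g L volume) z = -(convolution k u L volume) z := by
    intro z
    have hξz : ContDiff ℝ 1 fun t => ξ (t - z) := hξ.comp (contDiff_id.sub contDiff_const)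
    have hξzc : HasCompactSupport fun t => ξ (t - z) := by
      simpa [sub_eq_add_neg] using! hc.comp_homeomorph (Homeomorph.addRight (-z))
    have hd : ∀ t, fderiv ℝ (fun t => ξ (t - z)) t = fderiv ℝ ξ (t - z) :=
      fun t => fderiv_comp_sub z
    have hparts := integral_bilinear_fderiv_right_eq_neg_left_of_integrable
      (μ := (volume : Measure E₀)) (f := u) (g := fun t => ξ (t - z)) (v := v) (B := L)
      ?_ ?_ ?_ (fun x _ => hu.differentiable one_ne_zero x)
      (fun x _ => hξz.differentiable one_ne_zero x)
    · simp only [convolution_def]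
      have e1 : ∫ t, L (f t) (g (z - t)) = ∫ t, L (fderiv ℝ u t v) (ξ (t - z)) := by
        simp [f, g]
      have e2 : ∫ t, L (k t) (u (z - t)) = ∫ t, L (u t) (fderiv ℝ ξ (t - z) v) := by
        rw [← integral_sub_left_eq_self (fun t => L (u t) (fderiv ℝ ξ (t - z) v)) volume z]
        refine integral_congr_ae (.of_forall fun t => ?_)
        simp only [k, sub_sub_cancel_left]
        exact real_inner_comm _ _
      rw [e1, e2]
      simp only [hd] at hparts
      rw [hparts]; simp
    · exact (L.continuous₂.comp₂ hf hξz.continuous).integrable_of_hasCompactSupport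
        (hξzc.mono' fun x hx => subset_tsupport _ fun h => hx (by simp [h]))
    · exact (L.continuous₂.comp₂ hu.continuous
        (continuous_fderiv_apply_const hξz v)).integrable_of_hasCompactSupport
        (hcu.mono' fun x hx => subset_tsupport _ fun h => hx (by simp [h]))
    · exact (L.continuous₂.comp₂ hu.continuous hξz.continuous).integrable_of_hasCompactSupport
        (hcu.mono' fun x hx => subset_tsupport _ fun h => hx (by simp [h]))
  have h3 : HasFDerivAt (convolution f g L volume)
      (-(convolution k (fderiv ℝ u) (L.precompR E₀) volume 0)) 0 := by
    have : convolution f g L volume = fun z => -(convolution k u L volume z) := funext heq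
    rw [this]; exact h2.neg
  have h4 := congrArg (fun A => A w) (h1.unique h3)
  have i1 := ContinuousLinearMap.integral_apply (𝕜 := ℝ) (μ := (volume : Measure E₀))
    (φ := fun t => (L.precompR E₀) (f t) (fderiv ℝ g (0 - t))) ?_ w
  have i2 := ContinuousLinearMap.integral_apply (𝕜 := ℝ) (μ := (volume : Measure E₀))
    (φ := fun t => (L.precompR E₀) (k t) (fderiv ℝ u (0 - t))) ?_ w
  · simp only [convolution_def, neg_apply] at h4
    rw [i1, i2] at h4
    simp only [ContinuousLinearMap.precompR_apply, ContinuousLinearMap.compL_apply,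
      ContinuousLinearMap.comp_apply, hgd, zero_sub, neg_neg,
      neg_apply, map_neg, integral_neg, neg_inj] at h4
    rw [← integral_neg_eq_self (μ := (volume : Measure E₀))
      (fun t => L (k t) (fderiv ℝ u (-t) w))] at h4
    simp only [k, neg_neg] at h4
    refine h4.trans ?_
    exact integral_congr_ae (.of_forall fun t => real_inner_comm _ _)
  · refine ((L.precompR E₀).continuous₂.comp₂ hk ((hu.continuous_fderiv one_ne_zero).comp
      (continuous_const.sub continuous_id))).integrable_of_hasCompactSupport
      ((hneg _ (hc.fderiv_apply (𝕜 := ℝ) v)).mono' fun x hx => subset_tsupport _ fun h => hx ?_)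
    have : k x = 0 := h
    simp [this]
  · refine ((L.precompR E₀).continuous₂.comp₂ hf ((hg.continuous_fderiv one_ne_zero).comp
      (continuous_const.sub continuous_id))).integrable_of_hasCompactSupport
      ((hcu.fderiv_apply (𝕜 := ℝ) v).mono' fun x hx => subset_tsupport _ fun h => hx ?_)
    have : f x = 0 := h
    simp [this]

/-- Weak symmetry of second derivatives. -/
lemma integral_inner_fderiv_comm {u ξ : E₀ → V} (hu : ContDiff ℝ 1 u) (hξ : ContDiff ℝ 1 ξ)
    (hc : HasCompactSupport ξ) (v w : E₀) :
    ∫ p, inner ℝ (fderiv ℝ u p v) (fderiv ℝ ξ p w) =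
      ∫ p, inner ℝ (fderiv ℝ u p w) (fderiv ℝ ξ p v) := by
  obtain ⟨R, hR, hKR⟩ := hc.isCompact.isBounded.subset_ball_lt 0 (0 : E₀)
  -- `χ` is 1 on a ball that contains the support of `ξ`, so replacing `u` by `χ u` changes neither
  -- integral and supplies the missing compact support.
  let χ : ContDiffBump (0 : E₀) := ⟨R, R + 1, hR, by linarith⟩
  have hχu : ContDiff ℝ 1 fun p => χ p • u p := χ.contDiff.smul hu
  have hfd : ∀ p ∈ tsupport ξ, fderiv ℝ (fun p => χ p • u p) p = fderiv ℝ u p := fun p hp => by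
    refine Filter.EventuallyEq.fderiv_eq ?_
    filter_upwards [Metric.isOpen_ball.mem_nhds (hKR hp)] with q hq
    rw [χ.one_of_mem_closedBall (Metric.ball_subset_closedBall hq), one_smul]
  have hz : ∀ p ∉ tsupport ξ, fderiv ℝ ξ p = 0 := fun p hp =>
    image_eq_zero_of_notMem_tsupport fun h => hp (tsupport_fderiv_subset ℝ h)
  have key := integral_inner_fderiv_comm_of_hasCompactSupport hχu hξ
    (χ.hasCompactSupport.smul_right) hc v w
  have conv : ∀ v w : E₀, ∫ p, inner ℝ (fderiv ℝ (fun p => χ p • u p) p v) (fderiv ℝ ξ p w) =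
      ∫ p, inner ℝ (fderiv ℝ u p v) (fderiv ℝ ξ p w) := fun v w => by
    refine integral_congr_ae (.of_forall fun p => ?_)
    by_cases hp : p ∈ tsupport ξ
    · simp only [hfd p hp]
    · simp [hz p hp]
  rwa [conv, conv] at key

end Analysis

/-! ### The maximum principle in weak form -/

section Analysis
set_option linter.unusedSectionVars false
variable {E₀ : Type*} [NormedAddCommGroup E₀] [InnerProductSpace ℝ E₀] [FiniteDimensional ℝ E₀]
  [MeasurableSpace E₀] [BorelSpace E₀]
variable {V : Type*} [NormedAddCommGroup V] [InnerProductSpace ℝ V] [FiniteDimensional ℝ V]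

/-- Integration by parts against a compactly supported function. -/
lemma integral_mul_fderiv_apply {b φ : E₀ → ℝ} (hb : ContDiff ℝ 1 b) (hφ : ContDiff ℝ 1 φ)
    (hc : HasCompactSupport φ) (w : E₀) :
    ∫ p, b p * fderiv ℝ φ p w = -∫ p, φ p * fderiv ℝ b p w := by
  have h := integral_fderiv_apply_eq_zero (hb.mul hφ) hc.mul_left w
  have h1 : ∀ p, fderiv ℝ (fun q => b q * φ q) p w = b p * fderiv ℝ φ p w + φ p * fderiv ℝ b p w := fun p => by
    rw [fderiv_fun_mul (hb.differentiable one_ne_zero p) (hφ.differentiable one_ne_zero p)]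
    simp
  have i1 : Integrable fun p => b p * fderiv ℝ φ p w :=
    (hb.continuous.mul (continuous_fderiv_apply_const hφ w)).integrable_of_hasCompactSupport
      (hc.fderiv_apply (𝕜 := ℝ) w).mul_left
  have i2 : Integrable fun p => φ p * fderiv ℝ b p w :=
    (hφ.continuous.mul (continuous_fderiv_apply_const hb w)).integrable_of_hasCompactSupport
      hc.mul_right
  simp only [h1] at h
  rw [integral_add i1 i2] at h
  linarith

/-- A weak maximum principle at a local maximum of a `C¹` function. -/
theorem weak_maximum_principle {ι : Type*} [Fintype ι] (w : ι → E₀) {U : Set E₀} (hU : IsOpen U)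
    {p₀ : E₀} (hp₀ : p₀ ∈ U) {f Q : E₀ → ℝ} {a : ι → ι → E₀ → ℝ} (hf : ContDiff ℝ 1 f)
    (hQ : Continuous Q) (ha : ∀ i j, ContDiff ℝ 1 (a i j))
    (hpos : ∀ p ∈ U, ∀ x : ι → ℝ, 0 ≤ ∑ i, ∑ j, a i j p * x i * x j) (hmax : IsLocalMax f p₀)
    (hweak : ∀ φ : E₀ → ℝ, ContDiff ℝ 1 φ → HasCompactSupport φ → tsupport φ ⊆ U →
      -∫ p, ∑ i, ∑ j, a i j p * fderiv ℝ f p (w i) * fderiv ℝ φ p (w j) = ∫ p, φ p * Q p) :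
    Q p₀ ≤ 0 := by
  by_contra! hQ0
  have hlin : ∀ i, ContDiff ℝ 1 fun p : E₀ => 2 * inner ℝ (p - p₀) (w i) := fun i =>
    contDiff_const.mul ((contDiff_id.sub contDiff_const).inner ℝ contDiff_const)
  -- `B` is div(a∇|p - p₀|²). Hence `H = Q - δB` is the weak value of the operator on the perturbed
  -- function `g = f - δ|p - p₀|²`, whose local maximum at `p₀` is strict.
  set b : ι → ι → E₀ → ℝ := fun i j p => a i j p * (2 * inner ℝ (p - p₀) (w i))
  have hb : ∀ i j, ContDiff ℝ 1 (b i j) := fun i j => (ha i j).mul (hlin i)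
  set B : E₀ → ℝ := fun p => ∑ i, ∑ j, fderiv ℝ (b i j) p (w j)
  have hB : Continuous B := continuous_finsetSum _ fun i _ => continuous_finsetSum _ fun j _ =>
    continuous_fderiv_apply_const (hb i j) _
  -- Small enough that `δ |B p₀|` is less than half of `Q p₀`, which keeps `H` positive at `p₀`.
  set δ : ℝ := Q p₀ / (2 * (|B p₀| + 1))
  have hδ : 0 < δ := by positivity
  set H : E₀ → ℝ := fun p => Q p - δ * B p
  have hH : Continuous H := hQ.sub (continuous_const.mul hB)
  have hH0 : 0 < H p₀ := by
    have h1 : δ * B p₀ ≤ δ * |B p₀| := mul_le_mul_of_nonneg_left (le_abs_self _) hδ.le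
    have h2 : δ * (2 * (|B p₀| + 1)) = Q p₀ := by
      simp only [δ]; field_simp
    simp only [H]; nlinarith [abs_nonneg (B p₀)]
  obtain ⟨r, hr, hball⟩ : ∃ r > 0, Metric.closedBall p₀ r ⊆ {p | p ∈ U ∧ 0 < H p ∧ f p ≤ f p₀} := by
    refine Metric.nhds_basis_closedBall.mem_iff.1 ?_
    filter_upwards [hU.mem_nhds hp₀, hH.continuousAt.eventually (lt_mem_nhds hH0), hmax]
      with p h1 h2 h3 using ⟨h1, h2, h3⟩
  set g : E₀ → ℝ := fun p => f p - δ * ‖p - p₀‖ ^ 2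
  have hg : ContDiff ℝ 1 g :=
    hf.sub (contDiff_const.mul ((contDiff_id.sub contDiff_const).norm_sq ℝ))
  have hgd : ∀ p i, fderiv ℝ g p (w i) =
      fderiv ℝ f p (w i) - δ * (2 * inner ℝ (p - p₀) (w i)) := fun p i => by
    have h1 : HasFDerivAt (fun p : E₀ => p - p₀) (ContinuousLinearMap.id ℝ E₀) p :=
      (hasFDerivAt_id p).sub_const p₀
    have h2 := (hf.differentiable one_ne_zero p).hasFDerivAt.sub (h1.norm_sq.const_mul δ)
    have h3 : fderiv ℝ g p = _ := h2.fderiv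
    rw [h3]
    simp [inner_sub_left]
  -- At this level `g ≤ t` on the shell r/2 ≤ |p - p₀| ≤ r. So `G (g - t)`, a smooth substitute for
  -- the positive part of `g - t`, vanishes on the shell, although it need not vanish outside the
  -- larger ball.
  set t : ℝ := f p₀ - δ * (r / 2) ^ 2
  set G : ℝ → ℝ := expNegInvGlue
  have hG : ContDiff ℝ 1 G := expNegInvGlue.contDiff
  let χ : ContDiffBump p₀ := ⟨r / 2, r, by positivity, by linarith⟩
  have hχ : ContDiff ℝ 1 (χ : E₀ → ℝ) := χ.contDiff
  set η : E₀ → ℝ := fun p => G (g p - t)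
  have hη : ContDiff ℝ 1 η := hG.comp (hg.sub contDiff_const)
  have hηd : ∀ p v, fderiv ℝ η p v = deriv G (g p - t) * fderiv ℝ g p v := fun p v => by
    have h := ((hG.differentiable one_ne_zero) (g p - t)).hasDerivAt.comp_hasFDerivAt p
      ((hg.differentiable one_ne_zero p).hasFDerivAt.sub_const t)
    have h' : fderiv ℝ η p = _ := h.fderiv
    rw [h']; simp
  have hη0 : ∀ p ∈ Metric.closedBall p₀ r, r / 2 ≤ ‖p - p₀‖ → η p = 0 := fun p hp h => by
    refine expNegInvGlue.zero_of_nonpos ?_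
    have := (hball hp).2.2
    have : δ * (r / 2) ^ 2 ≤ δ * ‖p - p₀‖ ^ 2 := by gcongr
    simp only [g, t]; linarith
  set φ : E₀ → ℝ := fun p => χ p * η p
  have hφ : ContDiff ℝ 1 φ := hχ.mul hη
  have hφc : HasCompactSupport φ := χ.hasCompactSupport.mul_right
  have hφU : tsupport φ ⊆ U := fun p hp => by
    have : p ∈ tsupport χ := tsupport_mul_subset_left hp
    rw [χ.tsupport_eq] at this
    exact (hball this).1
  have hφd : ∀ p v, fderiv ℝ φ p v = χ p * (deriv G (g p - t) * fderiv ℝ g p v) := fun p v => by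
    have h1 : fderiv ℝ φ p v = χ p * fderiv ℝ η p v + η p * fderiv ℝ χ p v := by
      have := fderiv_mul (hχ.differentiable one_ne_zero p) (hη.differentiable one_ne_zero p)
      change fderiv ℝ (⇑χ * η) p v = _
      rw [this]; simp
    -- Inside radius r/2 the cutoff is constant, on the shell `η` vanishes, and outside the closed
    -- ball of radius r the cutoff has zero derivative.
    have h2 : η p * fderiv ℝ χ p v = 0 := by
      by_cases hp : p ∈ Metric.closedBall p₀ r
      · by_cases h : r / 2 ≤ ‖p - p₀‖
        · rw [hη0 p hp h, zero_mul]
        · have : (χ : E₀ → ℝ) =ᶠ[𝓝 p] fun _ => 1 := by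
            filter_upwards [Metric.isOpen_ball.mem_nhds
              (show p ∈ Metric.ball p₀ (r / 2) by rw [mem_ball_iff_norm]; linarith)] with q hq
            exact χ.one_of_mem_closedBall (Metric.ball_subset_closedBall hq)
          rw [this.fderiv_eq]; simp
      · rw [← χ.tsupport_eq] at hp
        have : fderiv ℝ χ p = 0 :=
          image_eq_zero_of_notMem_tsupport fun h => hp (tsupport_fderiv_subset ℝ h)
        rw [this]; simp
    rw [h1, h2, hηd, add_zero]
  have hGd : ∀ x, 0 ≤ deriv G x := fun x => expNegInvGlue.monotone.deriv_nonneg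
  -- Testing with `φ = χ G(g - t)` gives ∫ φH = -∫ χ G'(g - t) a(∇g, ∇g), which is nonpositive
  -- because `G` is monotone and `a` is nonnegative. Positivity of `φ H` near `p₀` contradicts this.
  have hmain : ∫ p, φ p * H p ≤ 0 := by
    have e1 := hweak φ hφ hφc hφU
    have e2 : ∀ i j, ∫ p, b i j p * fderiv ℝ φ p (w j) = -∫ p, φ p * fderiv ℝ (b i j) p (w j) :=
      fun i j => integral_mul_fderiv_apply (hb i j) hφ hφc (w j)
    have i1 : ∀ i j, Integrable fun p => a i j p * fderiv ℝ f p (w i) * fderiv ℝ φ p (w j) :=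
      fun i j => (((ha i j).continuous.mul (continuous_fderiv_apply_const hf _)).mul
        (continuous_fderiv_apply_const hφ _)).integrable_of_hasCompactSupport
        (hφc.fderiv_apply (𝕜 := ℝ) (w j)).mul_left
    have i2 : ∀ i j, Integrable fun p => b i j p * fderiv ℝ φ p (w j) :=
      fun i j => ((hb i j).continuous.mul
        (continuous_fderiv_apply_const hφ _)).integrable_of_hasCompactSupport
        (hφc.fderiv_apply (𝕜 := ℝ) (w j)).mul_left
    have i3 : ∀ i j, Integrable fun p => φ p * fderiv ℝ (b i j) p (w j) :=
      fun i j => (hφ.continuous.mul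
        (continuous_fderiv_apply_const (hb i j) _)).integrable_of_hasCompactSupport hφc.mul_right
    have i4 : Integrable fun p => φ p * Q p :=
      (hφ.continuous.mul hQ).integrable_of_hasCompactSupport hφc.mul_right
    have i5 : Integrable fun p => φ p * B p :=
      (hφ.continuous.mul hB).integrable_of_hasCompactSupport hφc.mul_right
    have e3 : ∫ p, φ p * H p = (∫ p, φ p * Q p) - δ * ∫ p, φ p * B p := by
      rw [← integral_const_mul, ← integral_sub i4 (i5.const_mul δ)]
      congr 1; ext p; simp only [H]; ring
    have e4 : ∫ p, φ p * B p = ∑ i, ∑ j, ∫ p, φ p * fderiv ℝ (b i j) p (w j) := by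
      simp only [B, Finset.mul_sum]
      rw [integral_finsetSum _ fun i _ => integrable_finsetSum _ fun j _ => i3 i j]
      exact Finset.sum_congr rfl fun i _ => integral_finsetSum _ fun j _ => i3 i j
    have e5 : ∫ p, φ p * B p = -∫ p, ∑ i, ∑ j, b i j p * fderiv ℝ φ p (w j) := by
      rw [e4, integral_finsetSum _ fun i _ => integrable_finsetSum _ fun j _ => i2 i j,
        ← Finset.sum_neg_distrib]
      refine Finset.sum_congr rfl fun i _ => ?_
      rw [integral_finsetSum _ fun j _ => i2 i j, ← Finset.sum_neg_distrib]
      exact Finset.sum_congr rfl fun j _ => by rw [e2, neg_neg]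
    rw [e3, ← e1, e5, mul_neg, sub_neg_eq_add, ← integral_const_mul, neg_add_eq_sub,
      ← integral_sub ((integrable_finsetSum _ fun i _ => integrable_finsetSum _ fun j _ =>
        i2 i j).const_mul δ) (integrable_finsetSum _ fun i _ =>
        integrable_finsetSum _ fun j _ => i1 i j)]
    refine integral_nonpos fun p => ?_
    have e6 : (δ * ∑ i, ∑ j, b i j p * fderiv ℝ φ p (w j)) -
        ∑ i, ∑ j, a i j p * fderiv ℝ f p (w i) * fderiv ℝ φ p (w j) =
        -(χ p * deriv G (g p - t) *
          ∑ i, ∑ j, a i j p * fderiv ℝ g p (w i) * fderiv ℝ g p (w j)) := by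
      simp only [Finset.mul_sum, ← Finset.sum_sub_distrib, ← Finset.sum_neg_distrib]
      refine Finset.sum_congr rfl fun i _ => Finset.sum_congr rfl fun j _ => ?_
      rw [hφd]
      have := hgd p i
      simp only [b]
      linear_combination (-(a i j p) * χ p * deriv G (g p - t) * fderiv ℝ g p (w j)) * (-this)
    simp only [Pi.zero_apply, e6]
    by_cases hp : p ∈ U
    · have := hpos p hp fun i => fderiv ℝ g p (w i)
      have := mul_nonneg (mul_nonneg (χ.nonneg (x := p)) (hGd (g p - t))) this
      linarith
    · have : χ p = 0 := by
        refine image_eq_zero_of_notMem_tsupport fun h => hp ?_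
        rw [χ.tsupport_eq] at h
        exact (hball h).1
      simp [this]
  have hpos' : 0 < ∫ p, φ p * H p := by
    refine Continuous.integral_pos_of_hasCompactSupport_nonneg_nonzero (x := p₀)
      (hφ.continuous.mul hH) hφc.mul_right (fun p => ?_) ?_
    · by_cases hp : p ∈ Metric.closedBall p₀ r
      · exact mul_nonneg (mul_nonneg χ.nonneg (expNegInvGlue.nonneg _)) (hball hp).2.1.le
      · rw [← χ.tsupport_eq] at hp
        simp [φ, image_eq_zero_of_notMem_tsupport hp]
    · have h1 : χ p₀ = 1 := χ.one_of_mem_closedBall (Metric.mem_closedBall_self (by positivity))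
      have h2 : 0 < η p₀ := expNegInvGlue.pos_of_pos (by simp [g, t]; positivity)
      simp only [φ, h1, one_mul]
      exact (mul_pos h2 hH0).ne'
  linarith

end Analysis

/-! ### Covariant derivatives and curvature of `C¹` functions in coordinates -/

section Analysis
set_option linter.unusedSectionVars false
variable {E₀ : Type*} [NormedAddCommGroup E₀] [InnerProductSpace ℝ E₀] [FiniteDimensional ℝ E₀]
  [MeasurableSpace E₀] [BorelSpace E₀]
variable {V : Type*} [NormedAddCommGroup V] [InnerProductSpace ℝ V] [FiniteDimensional ℝ V]
variable {V' : Type*} [NormedAddCommGroup V'] [InnerProductSpace ℝ V'] [FiniteDimensional ℝ V']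

/-- The derivative `∂_w u + Γ u` of a vector valued function for the connection form `Γ` in the
direction `w`. -/
def covDeriv (Γ : E₀ → V →L[ℝ] V) (w : E₀) (u : E₀ → V) (p : E₀) : V :=
  fderiv ℝ u p w + Γ p (u p)

/-- The induced derivative of a function with values in `Hom(V, V')`. -/
def covDerivHom (Γ : E₀ → V →L[ℝ] V) (Γ' : E₀ → V' →L[ℝ] V') (w : E₀) (A : E₀ → V →L[ℝ] V')
    (p : E₀) : V →L[ℝ] V' :=
  fderiv ℝ A p w + Γ' p ∘L A p - A p ∘L Γ p

/-- The curvature `∂_v H - ∂_w G + [G, H]` of the connection forms `G`, `H` in the directions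
`v`, `w`. -/
def curvForm (G H : E₀ → V →L[ℝ] V) (v w : E₀) (p : E₀) : V →L[ℝ] V :=
  fderiv ℝ H p v - fderiv ℝ G p w + G p ∘L H p - H p ∘L G p

/-- The endomorphism `T` is skew-adjoint. -/
def IsSkew (T : V →L[ℝ] V) : Prop := ∀ x y, inner ℝ (T x) y = -inner ℝ x (T y)

lemma fderiv_inner_eq {Γ : E₀ → V →L[ℝ] V} {x y : E₀ → V} (hx : ContDiff ℝ 1 x)
    (hy : ContDiff ℝ 1 y) (w : E₀) {p : E₀} (hΓ : IsSkew (Γ p)) :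
    fderiv ℝ (fun q => (inner ℝ (x q) (y q) : ℝ)) p w =
      inner ℝ (covDeriv Γ w x p) (y p) + inner ℝ (x p) (covDeriv Γ w y p) := by
  rw [fderiv_inner_apply ℝ (hx.differentiable one_ne_zero p) (hy.differentiable one_ne_zero p)]
  simp only [covDeriv, inner_add_left, inner_add_right, hΓ (x p) (y p)]
  ring

lemma covDeriv_clm_apply {Γ : E₀ → V →L[ℝ] V} {Γ' : E₀ → V' →L[ℝ] V'} {A : E₀ → V →L[ℝ] V'}
    {x : E₀ → V} (hA : ContDiff ℝ 1 A) (hx : ContDiff ℝ 1 x) (w p : E₀) :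
    covDeriv Γ' w (fun q => A q (x q)) p =
      covDerivHom Γ Γ' w A p (x p) + A p (covDeriv Γ w x p) := by
  simp only [covDeriv, covDerivHom]
  rw [fderiv_clm_apply (hA.differentiable one_ne_zero p) (hx.differentiable one_ne_zero p)]
  simp
  abel

lemma covDeriv_smul {Γ : E₀ → V →L[ℝ] V} {φ : E₀ → ℝ} {x : E₀ → V} (hφ : ContDiff ℝ 1 φ)
    (hx : ContDiff ℝ 1 x) (w p : E₀) :
    covDeriv Γ w (fun q => φ q • x q) p =
      φ p • covDeriv Γ w x p + fderiv ℝ φ p w • x p := by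
  simp only [covDeriv]
  rw [fderiv_fun_smul (hφ.differentiable one_ne_zero p) (hx.differentiable one_ne_zero p)]
  simp
  abel

lemma continuous_covDeriv {Γ : E₀ → V →L[ℝ] V} {x : E₀ → V} (hΓ : Continuous Γ)
    (hx : ContDiff ℝ 1 x) (w : E₀) : Continuous (covDeriv Γ w x) :=
  (continuous_fderiv_apply_const hx w).add (hΓ.clm_apply hx.continuous)

lemma continuous_curvForm {G H : E₀ → V →L[ℝ] V} (hG : ContDiff ℝ 1 G) (hH : ContDiff ℝ 1 H)
    (v w : E₀) : Continuous (curvForm G H v w) :=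
  (((continuous_fderiv_apply_const hH v).sub (continuous_fderiv_apply_const hG w)).add
    (hG.continuous.clm_comp hH.continuous)).sub (hH.continuous.clm_comp hG.continuous)

lemma covDeriv_eq_zero_of_notMem {Γ : E₀ → V →L[ℝ] V} {x : E₀ → V} (w : E₀) {p : E₀}
    (hp : p ∉ tsupport x) : covDeriv Γ w x p = 0 := by
  have h1 : x p = 0 := image_eq_zero_of_notMem_tsupport hp
  have h2 : fderiv ℝ x p = 0 :=
    image_eq_zero_of_notMem_tsupport fun h => hp (tsupport_fderiv_subset ℝ h)
  simp [covDeriv, h1, h2]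

lemma hasCompactSupport_covDeriv {Γ : E₀ → V →L[ℝ] V} {x : E₀ → V} (hx : HasCompactSupport x)
    (w : E₀) : HasCompactSupport (covDeriv Γ w x) :=
  hx.mono' fun p hp => by
    by_contra h
    exact hp (covDeriv_eq_zero_of_notMem w h)

/-- The curvature is the weak commutator of covariant derivatives. -/
lemma integral_covDeriv_comm {G H : E₀ → V →L[ℝ] V} (hG : ContDiff ℝ 1 G) (hH : ContDiff ℝ 1 H)
    {x ξ : E₀ → V} (hx : ContDiff ℝ 1 x) (hξ : ContDiff ℝ 1 ξ) (hc : HasCompactSupport ξ)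
    (hGs : ∀ p ∈ tsupport ξ, IsSkew (G p)) (hHs : ∀ p ∈ tsupport ξ, IsSkew (H p)) (v w : E₀) :
    ∫ p, ((inner ℝ (covDeriv H w x p) (covDeriv G v ξ p) : ℝ) -
        inner ℝ (covDeriv G v x p) (covDeriv H w ξ p)) =
      -∫ p, inner ℝ (curvForm G H v w p (x p)) (ξ p) := by
  have ddc : ∀ {K : E₀ → V →L[ℝ] V} (_ : ContDiff ℝ 1 K) (z p : E₀),
      fderiv ℝ (fun q => (inner ℝ (K q (x q)) (ξ q) : ℝ)) p z =
        inner ℝ (fderiv ℝ K p z (x p)) (ξ p) + inner ℝ (K p (fderiv ℝ x p z)) (ξ p)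
          + inner ℝ (K p (x p)) (fderiv ℝ ξ p z) := fun {K} hK z p => by
    rw [fderiv_inner_apply ℝ ((hK.clm_apply hx).differentiable one_ne_zero p)
      (hξ.differentiable one_ne_zero p),
      fderiv_clm_apply (hK.differentiable one_ne_zero p) (hx.differentiable one_ne_zero p)]
    simp [inner_add_left]
    ring
  have hdiv : ∀ {K : E₀ → V →L[ℝ] V} (_ : ContDiff ℝ 1 K) (z : E₀),
      (∫ p, fderiv ℝ (fun q => (inner ℝ (K q (x q)) (ξ q) : ℝ)) p z) = 0 ∧
      Integrable (fun p => fderiv ℝ (fun q => (inner ℝ (K q (x q)) (ξ q) : ℝ)) p z) :=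
    fun {K} hK z => by
      have h1 : ContDiff ℝ 1 fun q => (inner ℝ (K q (x q)) (ξ q) : ℝ) := (hK.clm_apply hx).inner ℝ hξ
      have h2 : HasCompactSupport fun q => (inner ℝ (K q (x q)) (ξ q) : ℝ) :=
        hc.mono fun p hp h => hp (by simp [h])
      exact ⟨integral_fderiv_apply_eq_zero h1 h2 z, (continuous_fderiv_apply_const h1
        z).integrable_of_hasCompactSupport (h2.fderiv_apply (𝕜 := ℝ) z)⟩
  have isymm : ∀ v w, Integrable fun p => (inner ℝ (fderiv ℝ x p v) (fderiv ℝ ξ p w) : ℝ) :=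
    fun v w => ((continuous_fderiv_apply_const hx v).inner
      (continuous_fderiv_apply_const hξ w)).integrable_of_hasCompactSupport
      ((hc.fderiv_apply (𝕜 := ℝ) w).mono fun p hp h => hp (by simp [h]))
  have hFint : Integrable fun p => (inner ℝ (curvForm G H v w p (x p)) (ξ p) : ℝ) :=
    (((continuous_curvForm hG hH v w).clm_apply hx.continuous).inner
      hξ.continuous).integrable_of_hasCompactSupport (hc.mono fun p hp h => hp (by simp [h]))
  -- Skewness of `G` and `H` splits the integrand into the antisymmetrised first derivatives, whose
  -- integral is zero by weak symmetry, two total derivatives of compactly supported functions, and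
  -- the curvature.
  have key : ∀ p, (inner ℝ (covDeriv H w x p) (covDeriv G v ξ p) : ℝ) -
      inner ℝ (covDeriv G v x p) (covDeriv H w ξ p) =
      ((inner ℝ (fderiv ℝ x p w) (fderiv ℝ ξ p v) - inner ℝ (fderiv ℝ x p v) (fderiv ℝ ξ p w)) +
      (fderiv ℝ (fun q => (inner ℝ (H q (x q)) (ξ q) : ℝ)) p v -
        fderiv ℝ (fun q => (inner ℝ (G q (x q)) (ξ q) : ℝ)) p w)) -
      inner ℝ (curvForm G H v w p (x p)) (ξ p) := fun p => by
    rw [ddc hH, ddc hG]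
    by_cases hp : p ∈ tsupport ξ
    · have h1 := hGs p hp (fderiv ℝ x p w) (ξ p)
      have h2 := hGs p hp (H p (x p)) (ξ p)
      have h3 := hHs p hp (fderiv ℝ x p v) (ξ p)
      have h4 := hHs p hp (G p (x p)) (ξ p)
      simp only [covDeriv, curvForm, inner_add_left, inner_add_right, inner_sub_left,
        add_apply, sub_apply, ContinuousLinearMap.comp_apply, h1, h2, h3, h4]
      ring
    · have h1 : ξ p = 0 := image_eq_zero_of_notMem_tsupport hp
      have h2 : fderiv ℝ ξ p = 0 :=
        image_eq_zero_of_notMem_tsupport fun h => hp (tsupport_fderiv_subset ℝ h)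
      simp [covDeriv, h1, h2]
  simp only [key]
  have i1 : Integrable fun p => (inner ℝ (fderiv ℝ x p w) (fderiv ℝ ξ p v) : ℝ) -
      inner ℝ (fderiv ℝ x p v) (fderiv ℝ ξ p w) := (isymm w v).sub (isymm v w)
  have i2 : Integrable fun p => fderiv ℝ (fun q => (inner ℝ (H q (x q)) (ξ q) : ℝ)) p v -
      fderiv ℝ (fun q => (inner ℝ (G q (x q)) (ξ q) : ℝ)) p w := (hdiv hH v).2.sub (hdiv hG w).2
  rw [integral_sub (by exact i1.add i2) hFint, integral_add i1 i2,
    integral_sub (isymm w v) (isymm v w), integral_sub (hdiv hH v).2 (hdiv hG w).2,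
    (hdiv hH v).1, (hdiv hG w).1, integral_inner_fderiv_comm hx hξ hc w v]
  ring

lemma contDiff_adjoint {A : E₀ → V →L[ℝ] V'} (hA : ContDiff ℝ 1 A) :
    ContDiff ℝ 1 fun p => ContinuousLinearMap.adjoint (A p) := by
  let L : (V →L[ℝ] V') →ₗ[ℝ] (V' →L[ℝ] V) :=
    { toFun := fun B => ContinuousLinearMap.adjoint B
      map_add' := fun B C => map_add _ B C
      map_smul' := fun c B => by simp }
  exact (LinearMap.toContinuousLinearMap L).contDiff.comp hA

lemma inner_adjoint_comp_sub {A B : V →L[ℝ] V'} (c : ℝ) (x y : V) :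
    (inner ℝ x ((ContinuousLinearMap.adjoint A ∘L B - c • ContinuousLinearMap.id ℝ V) y) : ℝ) =
      inner ℝ (A x) (B y) - c * inner ℝ x y := by
  simp [inner_sub_right, inner_smul_right, ContinuousLinearMap.adjoint_inner_right]

/-- The covariant derivative of `A† B - c`. -/
lemma inner_covDerivHom_adjoint_comp {Γ : E₀ → V →L[ℝ] V} {Γ' : E₀ → V' →L[ℝ] V'}
    {A B : E₀ → V →L[ℝ] V'} {c : E₀ → ℝ} (hA : ContDiff ℝ 1 A) (hB : ContDiff ℝ 1 B)
    (hc : ContDiff ℝ 1 c) (w p : E₀) (hΓ : IsSkew (Γ p)) (hΓ' : IsSkew (Γ' p)) (x y : V) :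
    (inner ℝ x (covDerivHom Γ Γ w (fun q => ContinuousLinearMap.adjoint (A q) ∘L B q -
        c q • ContinuousLinearMap.id ℝ V) p y) : ℝ) =
      inner ℝ (covDerivHom Γ Γ' w A p x) (B p y) + inner ℝ (A p x) (covDerivHom Γ Γ' w B p y)
        - fderiv ℝ c p w * inner ℝ x y := by
  set σ : E₀ → V →L[ℝ] V := fun q => ContinuousLinearMap.adjoint (A q) ∘L B q -
    c q • ContinuousLinearMap.id ℝ V
  have hσ : ContDiff ℝ 1 σ :=
    ((contDiff_adjoint hA).clm_comp hB).sub (hc.smul contDiff_const)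
  -- The flat derivative is found by pairing with constant vectors. The terms with `Γ` and `Γ'` are
  -- added afterwards and recombine by skewness.
  have hd : (inner ℝ x (fderiv ℝ σ p w y) : ℝ) = inner ℝ (fderiv ℝ A p w x) (B p y) +
      inner ℝ (A p x) (fderiv ℝ B p w y) - fderiv ℝ c p w * inner ℝ x y := by
    have e1 : fderiv ℝ (fun q => (inner ℝ x (σ q y) : ℝ)) p w = inner ℝ x (fderiv ℝ σ p w y) := by
      rw [fderiv_inner_apply ℝ (differentiableAt_const x)
        ((hσ.clm_apply contDiff_const).differentiable one_ne_zero p),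
        fderiv_clm_apply (hσ.differentiable one_ne_zero p) (differentiableAt_const y)]
      simp
    rw [← e1]
    have e2 : (fun q => (inner ℝ x (σ q y) : ℝ)) =
        fun q => inner ℝ (A q x) (B q y) - c q * inner ℝ x y :=
      funext fun q => inner_adjoint_comp_sub (c q) x y
    have dA : ContDiff ℝ 1 fun q => A q x := hA.clm_apply contDiff_const
    have dB : ContDiff ℝ 1 fun q => B q y := hB.clm_apply contDiff_const
    rw [e2, fderiv_fun_sub ((dA.inner ℝ dB).differentiable one_ne_zero p)
      ((hc.mul contDiff_const).differentiable one_ne_zero p), sub_apply,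
      fderiv_inner_apply ℝ (dA.differentiable one_ne_zero p) (dB.differentiable one_ne_zero p),
      fderiv_clm_apply (hA.differentiable one_ne_zero p) (differentiableAt_const x),
      fderiv_clm_apply (hB.differentiable one_ne_zero p) (differentiableAt_const y),
      fderiv_mul_const (hc.differentiable one_ne_zero p)]
    simp
    ring
  have h1 := inner_adjoint_comp_sub (A := A p) (B := B p) (c p) (Γ p x) y
  have h2 := inner_adjoint_comp_sub (A := A p) (B := B p) (c p) x (Γ p y)
  have h3 := hΓ x (σ p y)
  have h4 := hΓ' (A p x) (B p y)
  have h5 := hΓ x y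
  have h6 : (inner ℝ x (Γ p (σ p y)) : ℝ) = -inner ℝ (Γ p x) (σ p y) := by linarith
  simp only [covDerivHom, add_apply, sub_apply, ContinuousLinearMap.comp_apply, inner_add_left,
    inner_add_right, inner_sub_left, inner_sub_right, hd, h6]
  simp only [σ, h1, h2, h4, h5]
  ring

end Analysis

/-! ### The weak Bochner formula for a local Dirac operator -/

section Analysis
set_option linter.unusedSectionVars false
variable {E₀ : Type*} [NormedAddCommGroup E₀] [InnerProductSpace ℝ E₀] [FiniteDimensional ℝ E₀]
  [MeasurableSpace E₀] [BorelSpace E₀]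
variable {V : Type*} [NormedAddCommGroup V] [InnerProductSpace ℝ V] [FiniteDimensional ℝ V]
variable {V' : Type*} [NormedAddCommGroup V'] [InnerProductSpace ℝ V'] [FiniteDimensional ℝ V']

/-- A Dirac operator `∑ γ_j ∇_j` in local coordinates: `a` is the metric on one-forms, `γ_j` is
Clifford multiplication by the `j`-th coordinate form, and `C` are the Christoffel symbols. -/
structure LocalDirac {ι : Type*} [Fintype ι] (w : ι → E₀) (U : Set E₀) (a : ι → ι → E₀ → ℝ)
    (C : ι → ι → ι → E₀ → ℝ) (Γ : ι → E₀ → V →L[ℝ] V) (Γ' : ι → E₀ → V' →L[ℝ] V')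
    (γ : ι → E₀ → V →L[ℝ] V') : Prop where
  a_C1 : ∀ i j, ContDiff ℝ 1 (a i j)
  C_cont : ∀ i l j, Continuous (C i l j)
  Γ_C1 : ∀ i, ContDiff ℝ 1 (Γ i)
  Γ'_cont : ∀ i, Continuous (Γ' i)
  γ_C1 : ∀ i, ContDiff ℝ 1 (γ i)
  a_symm : ∀ p ∈ U, ∀ i j, a i j p = a j i p
  a_nonneg : ∀ p ∈ U, ∀ x : ι → ℝ, 0 ≤ ∑ i, ∑ j, a i j p * x i * x j
  C_symm : ∀ p ∈ U, ∀ i l j, C i l j p = C l i j p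
  Γ_skew : ∀ p ∈ U, ∀ i, IsSkew (Γ i p)
  Γ'_skew : ∀ p ∈ U, ∀ i, IsSkew (Γ' i p)
  clifford : ∀ p ∈ U, ∀ i j x y,
    (inner ℝ (γ i p x) (γ j p y) : ℝ) + inner ℝ (γ j p x) (γ i p y) = 2 * a i j p * inner ℝ x y
  parallel : ∀ p ∈ U, ∀ i j x,
    covDerivHom (Γ i) (Γ' i) (w i) (γ j) p x = -∑ l, C i l j p • γ l p x

/-- The Bochner formula at a local maximum of the norm of a `C¹` section `u` with `C¹` Dirac
derivative `v`. -/
theorem LocalDirac.bochner_at_local_max {ι : Type*} [Fintype ι] {w : ι → E₀} {U : Set E₀}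
    {a : ι → ι → E₀ → ℝ} {C : ι → ι → ι → E₀ → ℝ} {Γ : ι → E₀ → V →L[ℝ] V}
    {Γ' : ι → E₀ → V' →L[ℝ] V'} {γ : ι → E₀ → V →L[ℝ] V'} (h : LocalDirac w U a C Γ Γ' γ)
    (hU : IsOpen U) {p₀ : E₀} (hp₀ : p₀ ∈ U) {u : E₀ → V} {v : E₀ → V'} (hu : ContDiff ℝ 1 u)
    (hv : ContDiff ℝ 1 v) (hD : ∀ p ∈ U, ∑ j, γ j p (covDeriv (Γ j) (w j) u p) = v p)
    (hmax : IsLocalMax (fun p => ‖u p‖ ^ 2) p₀) :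
    (∑ i, ∑ j, a i j p₀ * (inner ℝ (covDeriv (Γ i) (w i) u p₀) (covDeriv (Γ j) (w j) u p₀) : ℝ))
      + ∑ i, (inner ℝ (covDeriv (Γ' i) (w i) v p₀) (γ i p₀ (u p₀)) : ℝ)
      - 1 / 2 * ∑ i, ∑ j, (inner ℝ (γ j p₀ (curvForm (Γ i) (Γ j) (w i) (w j) p₀ (u p₀)))
          (γ i p₀ (u p₀)) : ℝ) ≤ 0 := by
  set f : E₀ → ℝ := fun p => ‖u p‖ ^ 2
  have hf : ContDiff ℝ 1 f := hu.norm_sq ℝ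
  have hfd : ∀ p ∈ U, ∀ i, fderiv ℝ f p (w i) = 2 * inner ℝ (covDeriv (Γ i) (w i) u p) (u p) := by
    intro p hp i
    have e : f = fun q => (inner ℝ (u q) (u q) : ℝ) :=
      funext fun q => (real_inner_self_eq_norm_sq _).symm
    rw [e, fderiv_inner_eq hu hu (w i) (h.Γ_skew p hp i), real_inner_comm (u p)]
    ring
  set N : ι → E₀ → V := fun i => covDeriv (Γ i) (w i) u
  have hN : ∀ i, Continuous (N i) := fun i => continuous_covDeriv (h.Γ_C1 i).continuous hu _
  set F : ι → ι → E₀ → V →L[ℝ] V := fun i j => curvForm (Γ i) (Γ j) (w i) (w j)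
  have hF : ∀ i j, Continuous (F i j) := fun i j => continuous_curvForm (h.Γ_C1 i) (h.Γ_C1 j) _ _
  -- The product γ_j†γ_i splits into its scalar part a_ij, which produces the Laplacian, and the
  -- remainder σ_ij. By the Clifford relation σ_ij is antisymmetric in i and j, so it meets only
  -- commutators of derivatives.
  set σ : ι → ι → E₀ → V →L[ℝ] V := fun i j p =>
    ContinuousLinearMap.adjoint (γ j p) ∘L γ i p - a i j p • ContinuousLinearMap.id ℝ V
  have hσ : ∀ i j, ContDiff ℝ 1 (σ i j) := fun i j =>
    ((contDiff_adjoint (h.γ_C1 j)).clm_comp (h.γ_C1 i)).sub ((h.a_C1 i j).smul contDiff_const)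
  have hσi : ∀ i j p x y, (inner ℝ x (σ i j p y) : ℝ) =
      inner ℝ (γ j p x) (γ i p y) - a i j p * inner ℝ x y := fun i j p x y =>
    inner_adjoint_comp_sub _ _ _
  have hσs : ∀ p ∈ U, ∀ i j y, σ j i p y = -σ i j p y := fun p hp i j y => by
    refine ext_inner_left ℝ fun x => ?_
    rw [inner_neg_right, hσi, hσi, h.a_symm p hp j i]
    linarith [h.clifford p hp i j x y]
  -- the coefficients of the first order term
  set c : ι → E₀ → ℝ := fun j p =>
    (∑ i, ∑ l, C i l j p * a i l p) + ∑ i, fderiv ℝ (a i j) p (w i)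
  have hc : ∀ j, Continuous (c j) := fun j =>
    (continuous_finsetSum _ fun i _ => continuous_finsetSum _ fun l _ =>
      (h.C_cont i l j).mul (h.a_C1 i l).continuous).add
    (continuous_finsetSum _ fun i _ => continuous_fderiv_apply_const (h.a_C1 i j) _)
  have hCs : ∀ p ∈ U, ∀ j x y, ∑ i, ∑ l, C i l j p * (inner ℝ (γ l p x) (γ i p y) : ℝ) =
      (∑ i, ∑ l, C i l j p * a i l p) * inner ℝ x y := fun p hp j x y => by
    have e1 : ∑ i, ∑ l, C i l j p * (inner ℝ (γ l p x) (γ i p y) : ℝ) =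
        ∑ i, ∑ l, C i l j p * (inner ℝ (γ i p x) (γ l p y) : ℝ) := by
      rw [Finset.sum_comm]
      exact Finset.sum_congr rfl fun i _ => Finset.sum_congr rfl fun l _ => by
        rw [h.C_symm p hp l i j]
    have e2 : (∑ i, ∑ l, C i l j p * (inner ℝ (γ i p x) (γ l p y) : ℝ)) +
        ∑ i, ∑ l, C i l j p * (inner ℝ (γ l p x) (γ i p y) : ℝ) =
        2 * ((∑ i, ∑ l, C i l j p * a i l p) * inner ℝ x y) := by
      simp only [← Finset.sum_add_distrib, Finset.sum_mul, Finset.mul_sum]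
      refine Finset.sum_congr rfl fun i _ => Finset.sum_congr rfl fun l _ => ?_
      linear_combination (C i l j p) * h.clifford p hp i l x y
    linarith
  -- The weak value of div(a∇|u|²): twice the gradient term, twice the pairing with `∇v`, the
  -- curvature, and a first order term that collects the Christoffel symbols and the divergence of
  -- `a`.
  set Q : E₀ → ℝ := fun p =>
    2 * (∑ i, ∑ j, a i j p * (inner ℝ (N i p) (N j p) : ℝ))
      + 2 * (∑ i, (inner ℝ (covDeriv (Γ' i) (w i) v p) (γ i p (u p)) : ℝ))
      - (∑ i, ∑ j, (inner ℝ (F i j p (u p)) (σ i j p (u p)) : ℝ))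
      + ∑ j, c j p * fderiv ℝ f p (w j)
  have hQ : Continuous Q := by
    refine (((continuous_const.mul ?_).add (continuous_const.mul ?_)).sub ?_).add ?_
    · exact continuous_finsetSum _ fun i _ => continuous_finsetSum _ fun j _ =>
        (h.a_C1 i j).continuous.mul ((hN i).inner (hN j))
    · exact continuous_finsetSum _ fun i _ => (continuous_covDeriv (h.Γ'_cont i) hv _).inner
        ((h.γ_C1 i).continuous.clm_apply hu.continuous)
    · exact continuous_finsetSum _ fun i _ => continuous_finsetSum _ fun j _ =>
        ((hF i j).clm_apply hu.continuous).inner ((hσ i j).continuous.clm_apply hu.continuous)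
    · exact continuous_finsetSum _ fun j _ => (hc j).mul (continuous_fderiv_apply_const hf _)
  have hQ0 : Q p₀ ≤ 0 := by
    refine weak_maximum_principle w hU hp₀ hf hQ h.a_C1 h.a_nonneg hmax fun φ hφ hφc hφU => ?_
    -- The scalar test function is turned into the vector valued test section `φ u`, since `f` is
    -- the square of the norm of `u`.
    set η : E₀ → V := fun p => φ p • u p
    have hη : ContDiff ℝ 1 η := hφ.smul hu
    have hηc : HasCompactSupport η := hφc.smul_right
    have hηU : tsupport η ⊆ U := (tsupport_smul_subset_left φ u).trans hφU
    have hξ : ∀ i j, ContDiff ℝ 1 fun p => σ i j p (η p) := fun i j => (hσ i j).clm_apply hη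
    have hξs : ∀ i j, tsupport (fun p => σ i j p (η p)) ⊆ tsupport η := fun i j =>
      closure_mono fun p hp hz => hp (by simp [hz])
    have hξc : ∀ i j, HasCompactSupport fun p => σ i j p (η p) := fun i j =>
      hηc.mono' (subset_closure.trans (hξs i j))
    have hcomm : ∀ i j, ∫ p, ((inner ℝ (N j p) (covDeriv (Γ i) (w i) (fun q => σ i j q (η q)) p) : ℝ)
        - inner ℝ (N i p) (covDeriv (Γ j) (w j) (fun q => σ i j q (η q)) p)) =
        -∫ p, inner ℝ (F i j p (u p)) (σ i j p (η p)) := fun i j =>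
      integral_covDeriv_comm (h.Γ_C1 i) (h.Γ_C1 j) hu (hξ i j) (hξc i j)
        (fun p hp => h.Γ_skew p (hηU (hξs i j hp)) i)
        (fun p hp => h.Γ_skew p (hηU (hξs i j hp)) j) _ _
    have hγη : ∀ i, ContDiff ℝ 1 fun p => γ i p (η p) := fun i => (h.γ_C1 i).clm_apply hη
    have hdc : ∀ i, HasCompactSupport fun p => (inner ℝ (v p) (γ i p (η p)) : ℝ) := fun i =>
      hηc.mono fun p hp hz => hp (by simp [hz])
    have hdiv : ∀ i, ∫ p, fderiv ℝ (fun q => (inner ℝ (v q) (γ i q (η q)) : ℝ)) p (w i) = 0 :=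
      fun i => integral_fderiv_apply_eq_zero (hv.inner ℝ (hγη i)) (hdc i) _
    -- the pointwise identity behind the weak formula
    have hpt : ∀ p, (∑ i, ∑ j, a i j p * fderiv ℝ f p (w i) * fderiv ℝ φ p (w j)) + φ p * Q p =
        2 * (∑ i, fderiv ℝ (fun q => (inner ℝ (v q) (γ i q (η q)) : ℝ)) p (w i))
        - ∑ i, ∑ j, (((inner ℝ (N j p) (covDeriv (Γ i) (w i) (fun q => σ i j q (η q)) p) : ℝ)
        - inner ℝ (N i p) (covDeriv (Γ j) (w j) (fun q => σ i j q (η q)) p))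
          + inner ℝ (F i j p (u p)) (σ i j p (η p))) := by
      intro p
      by_cases hp : p ∈ U
      swap
      · have hpφ : p ∉ tsupport φ := fun hz => hp (hφU hz)
        have hpη : p ∉ tsupport η := fun hz => hp (hηU hz)
        have e1 : φ p = 0 := image_eq_zero_of_notMem_tsupport hpφ
        have e2 : fderiv ℝ φ p = 0 :=
          image_eq_zero_of_notMem_tsupport fun hz => hpφ (tsupport_fderiv_subset ℝ hz)
        have e3 : η p = 0 := image_eq_zero_of_notMem_tsupport hpη
        have e4 : ∀ i j k, covDeriv (Γ k) (w k) (fun q => σ i j q (η q)) p = 0 := fun i j k =>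
          covDeriv_eq_zero_of_notMem _ fun hz => hpη (hξs i j hz)
        have e5 : ∀ i, fderiv ℝ (fun q => (inner ℝ (v q) (γ i q (η q)) : ℝ)) p = 0 := fun i =>
          image_eq_zero_of_notMem_tsupport fun hz => hpη <| by
            have hs : tsupport (fun q => (inner ℝ (v q) (γ i q (η q)) : ℝ)) ⊆ tsupport η :=
              closure_mono fun q hq hz' => hq (by simp [hz'])
            exact hs (tsupport_fderiv_subset ℝ hz)
        simp [e1, e2, e3, e4, e5]
      have sk := h.Γ_skew p hp
      have sk' := h.Γ'_skew p hp
      have hηd : ∀ i, covDeriv (Γ i) (w i) η p = φ p • N i p + fderiv ℝ φ p (w i) • u p :=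
        fun i => covDeriv_smul hφ hu _ p
      have t1 : ∀ i, fderiv ℝ (fun q => (inner ℝ (v q) (γ i q (η q)) : ℝ)) p (w i) =
          inner ℝ (covDeriv (Γ' i) (w i) v p) (γ i p (η p)) +
          (inner ℝ (v p) (covDerivHom (Γ i) (Γ' i) (w i) (γ i) p (η p)) +
            inner ℝ (v p) (γ i p (covDeriv (Γ i) (w i) η p))) := fun i => by
        rw [fderiv_inner_eq hv (hγη i) (w i) (sk' i), covDeriv_clm_apply (h.γ_C1 i) hη,
          inner_add_right]
      have t2 : ∀ i j, (inner ℝ (N j p) (covDeriv (Γ i) (w i) (fun q => σ i j q (η q)) p) : ℝ) =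
          inner ℝ (covDerivHom (Γ i) (Γ' i) (w i) (γ j) p (N j p)) (γ i p (η p)) +
          inner ℝ (γ j p (N j p)) (covDerivHom (Γ i) (Γ' i) (w i) (γ i) p (η p)) -
          fderiv ℝ (a i j) p (w i) * inner ℝ (N j p) (η p) +
          (inner ℝ (γ j p (N j p)) (γ i p (covDeriv (Γ i) (w i) η p)) -
            a i j p * inner ℝ (N j p) (covDeriv (Γ i) (w i) η p)) := fun i j => by
        rw [covDeriv_clm_apply (hσ i j) hη, inner_add_right, hσi,
          inner_covDerivHom_adjoint_comp (h.γ_C1 j) (h.γ_C1 i) (h.a_C1 i j) (w i) p (sk i) (sk' i)]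
      have t3 : ∀ i j, covDeriv (Γ j) (w j) (fun q => σ i j q (η q)) p =
          -covDeriv (Γ j) (w j) (fun q => σ j i q (η q)) p := fun i j => by
        have e : (fun q => σ i j q (η q)) =ᶠ[𝓝 p] fun q => -σ j i q (η q) := by
          filter_upwards [hU.mem_nhds hp] with q hq using hσs q hq j i (η q)
        simp only [covDeriv, e.fderiv_eq, e.self_of_nhds, fderiv_fun_neg, neg_apply, map_neg,
          neg_add]
      -- Summation over j turns `γ_j ∇_j u` into `v`; here and in `s2` the equation for the Dirac
      -- derivative is used.
      have s1 : ∑ i, ∑ j, (inner ℝ (γ j p (N j p))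
            (covDerivHom (Γ i) (Γ' i) (w i) (γ i) p (η p)) : ℝ) =
          ∑ i, (inner ℝ (v p) (covDerivHom (Γ i) (Γ' i) (w i) (γ i) p (η p)) : ℝ) := by
        simp only [← sum_inner, hD p hp, N]
      have s2 : ∑ i, ∑ j, (inner ℝ (γ j p (N j p)) (γ i p (covDeriv (Γ i) (w i) η p)) : ℝ) =
          ∑ i, (inner ℝ (v p) (γ i p (covDeriv (Γ i) (w i) η p)) : ℝ) := by
        simp only [← sum_inner, hD p hp, N]
      have s3 : ∑ i, ∑ j, (inner ℝ (covDerivHom (Γ i) (Γ' i) (w i) (γ j) p (N j p))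
            (γ i p (η p)) : ℝ) =
          -∑ j, (∑ i, ∑ l, C i l j p * a i l p) * (inner ℝ (N j p) (η p) : ℝ) := by
        rw [Finset.sum_comm, ← Finset.sum_neg_distrib]
        refine Finset.sum_congr rfl fun j _ => ?_
        rw [← hCs p hp, ← Finset.sum_neg_distrib]
        refine Finset.sum_congr rfl fun i _ => ?_
        rw [h.parallel p hp, inner_neg_left, sum_inner]
        simp only [inner_smul_left, RCLike.conj_to_real]
      have s4 : ∑ i, ∑ j, fderiv ℝ (a i j) p (w i) * (inner ℝ (N j p) (η p) : ℝ) =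
          ∑ j, (∑ i, fderiv ℝ (a i j) p (w i)) * (inner ℝ (N j p) (η p) : ℝ) := by
        rw [Finset.sum_comm]
        simp only [Finset.sum_mul]
      have s5 : 2 * ∑ j, c j p * (inner ℝ (N j p) (η p) : ℝ) =
          φ p * ∑ j, c j p * fderiv ℝ f p (w j) := by
        simp only [Finset.mul_sum]
        refine Finset.sum_congr rfl fun j _ => ?_
        rw [hfd p hp, inner_smul_right]
        ring
      have s6 : 2 * ∑ i, ∑ j, a i j p * (inner ℝ (N j p) (covDeriv (Γ i) (w i) η p) : ℝ) =
          φ p * (2 * ∑ i, ∑ j, a i j p * (inner ℝ (N i p) (N j p) : ℝ)) +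
          ∑ i, ∑ j, a i j p * fderiv ℝ f p (w i) * fderiv ℝ φ p (w j) := by
        have e : ∑ i, ∑ j, a i j p * fderiv ℝ f p (w i) * fderiv ℝ φ p (w j) =
            ∑ i, ∑ j, a i j p * fderiv ℝ f p (w j) * fderiv ℝ φ p (w i) := by
          rw [Finset.sum_comm]
          exact Finset.sum_congr rfl fun i _ => Finset.sum_congr rfl fun j _ => by
            rw [h.a_symm p hp j i]
        rw [e]
        simp only [Finset.mul_sum, ← Finset.sum_add_distrib]
        refine Finset.sum_congr rfl fun i _ => Finset.sum_congr rfl fun j _ => ?_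
        rw [hηd, inner_add_right, inner_smul_right, inner_smul_right, hfd p hp,
          real_inner_comm (N i p)]
        ring
      have s7 : ∑ i, ∑ j, (inner ℝ (F i j p (u p)) (σ i j p (η p)) : ℝ) =
          φ p * ∑ i, ∑ j, (inner ℝ (F i j p (u p)) (σ i j p (u p)) : ℝ) := by
        simp only [Finset.mul_sum, η, map_smul, inner_smul_right]
      have s8 : ∑ i, (inner ℝ (covDeriv (Γ' i) (w i) v p) (γ i p (η p)) : ℝ) =
          φ p * ∑ i, (inner ℝ (covDeriv (Γ' i) (w i) v p) (γ i p (u p)) : ℝ) := by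
        simp only [Finset.mul_sum, η, map_smul, inner_smul_right]
      -- Antisymmetry of `σ` makes the two halves of the commutator contribute equally; the
      -- resulting factor 2 matches the one in front of the divergence.
      have s9 : ∑ i, ∑ j, (inner ℝ (N i p) (covDeriv (Γ j) (w j) (fun q => σ i j q (η q)) p) : ℝ) =
          -∑ i, ∑ j, (inner ℝ (N j p) (covDeriv (Γ i) (w i) (fun q => σ i j q (η q)) p) : ℝ) := by
        rw [Finset.sum_comm]
        simp only [t3, inner_neg_right, Finset.sum_neg_distrib]
      have s10 : ∑ j, c j p * (inner ℝ (N j p) (η p) : ℝ) =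
          (∑ j, (∑ i, ∑ l, C i l j p * a i l p) * (inner ℝ (N j p) (η p) : ℝ)) +
          ∑ j, (∑ i, fderiv ℝ (a i j) p (w i)) * (inner ℝ (N j p) (η p) : ℝ) := by
        simp only [c, add_mul, Finset.sum_add_distrib]
      have s11 : ∑ i, ∑ j, (inner ℝ (N j p) (covDeriv (Γ i) (w i) (fun q => σ i j q (η q)) p) : ℝ) =
          -(∑ j, c j p * (inner ℝ (N j p) (η p) : ℝ)) +
          (∑ i, (inner ℝ (v p) (covDerivHom (Γ i) (Γ' i) (w i) (γ i) p (η p)) : ℝ)) +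
          (∑ i, (inner ℝ (v p) (γ i p (covDeriv (Γ i) (w i) η p)) : ℝ)) -
          ∑ i, ∑ j, a i j p * (inner ℝ (N j p) (covDeriv (Γ i) (w i) η p) : ℝ) := by
        rw [s10, ← s1, ← s2, ← s4]
        simp only [t2, Finset.sum_add_distrib, Finset.sum_sub_distrib, s3]
        ring
      simp only [Finset.sum_add_distrib, Finset.sum_sub_distrib, t1, s9, s7, s11]
      simp only [Q]
      linear_combination -s5 - s6 - 2 * s8
    have j1 : Integrable fun p => ∑ i, ∑ j, a i j p * fderiv ℝ f p (w i) * fderiv ℝ φ p (w j) :=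
      integrable_finsetSum _ fun i _ => integrable_finsetSum _ fun j _ =>
        (((h.a_C1 i j).continuous.mul (continuous_fderiv_apply_const hf _)).mul
        (continuous_fderiv_apply_const hφ _)).integrable_of_hasCompactSupport
        (hφc.fderiv_apply (𝕜 := ℝ) (w j)).mul_left
    have j2 : Integrable fun p => φ p * Q p :=
      (hφ.continuous.mul hQ).integrable_of_hasCompactSupport hφc.mul_right
    have j3 : ∀ i, Integrable fun p => fderiv ℝ (fun q => (inner ℝ (v q) (γ i q (η q)) : ℝ)) p (w i) :=
      fun i => (continuous_fderiv_apply_const (hv.inner ℝ (hγη i)) _).integrable_of_hasCompactSupport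
        ((hdc i).fderiv_apply (𝕜 := ℝ) _)
    have j4 : ∀ i j k l, Integrable fun p =>
        (inner ℝ (N l p) (covDeriv (Γ k) (w k) (fun q => σ i j q (η q)) p) : ℝ) := fun i j k l =>
      ((hN l).inner (continuous_covDeriv (h.Γ_C1 k).continuous (hξ i j) _)
        ).integrable_of_hasCompactSupport
        ((hasCompactSupport_covDeriv (Γ := Γ k) (hξc i j) (w k)).mono fun p hp hz => hp
          (by simp only [hz, inner_zero_right]))
    have j5 : ∀ i j, Integrable fun p => (inner ℝ (F i j p (u p)) (σ i j p (η p)) : ℝ) := fun i j =>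
      (((hF i j).clm_apply hu.continuous).inner (hξ i j).continuous).integrable_of_hasCompactSupport
        ((hξc i j).mono fun p hp hz => hp (by simp [hz]))
    have j6 : ∀ i j, Integrable fun p =>
        ((inner ℝ (N j p) (covDeriv (Γ i) (w i) (fun q => σ i j q (η q)) p) : ℝ)
        - inner ℝ (N i p) (covDeriv (Γ j) (w j) (fun q => σ i j q (η q)) p)) := fun i j =>
      (j4 i j i j).sub (j4 i j j i)
    have j7 : ∀ i j, ∫ p, (((inner ℝ (N j p) (covDeriv (Γ i) (w i) (fun q => σ i j q (η q)) p) : ℝ)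
        - inner ℝ (N i p) (covDeriv (Γ j) (w j) (fun q => σ i j q (η q)) p))
          + inner ℝ (F i j p (u p)) (σ i j p (η p))) = 0 := fun i j => by
      rw [integral_add (j6 i j) (j5 i j), hcomm i j, neg_add_cancel]
    have j10 : ∀ i j, Integrable fun p => (((inner ℝ (N j p)
        (covDeriv (Γ i) (w i) (fun q => σ i j q (η q)) p) : ℝ)
        - inner ℝ (N i p) (covDeriv (Γ j) (w j) (fun q => σ i j q (η q)) p))
          + inner ℝ (F i j p (u p)) (σ i j p (η p))) := fun i j => (j6 i j).add (j5 i j)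
    have j8 := integral_congr_ae (μ := (volume : Measure E₀)) (.of_forall hpt)
    rw [integral_add j1 j2, integral_sub ((integrable_finsetSum _ fun i _ => j3 i).const_mul 2)
      (integrable_finsetSum _ fun i _ => integrable_finsetSum _ fun j _ => j10 i j),
      integral_const_mul, integral_finsetSum _ fun i _ => j3 i,
      integral_finsetSum _ fun i _ => integrable_finsetSum _ fun j _ => j10 i j] at j8
    have j9 : ∀ i, ∫ p, ∑ j, (((inner ℝ (N j p)
        (covDeriv (Γ i) (w i) (fun q => σ i j q (η q)) p) : ℝ)
        - inner ℝ (N i p) (covDeriv (Γ j) (w j) (fun q => σ i j q (η q)) p))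
          + inner ℝ (F i j p (u p)) (σ i j p (η p))) = 0 := fun i => by
      rw [integral_finsetSum _ fun j _ => j10 i j]
      exact Finset.sum_eq_zero fun j _ => j7 i j
    simp only [hdiv, j9, Finset.sum_const_zero, mul_zero, sub_zero] at j8
    linarith
  -- At the maximum the first order term of `Q` disappears, and with it the contribution of the
  -- Christoffel symbols to the first order coefficients.
  have hfd0 : fderiv ℝ f p₀ = 0 := hmax.fderiv_eq_zero
  -- The scalar part of `σ` drops out because a_ij is symmetric and F_ij antisymmetric.
  have hσF : ∑ i, ∑ j, (inner ℝ (F i j p₀ (u p₀)) (σ i j p₀ (u p₀)) : ℝ) =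
      ∑ i, ∑ j, (inner ℝ (γ j p₀ (F i j p₀ (u p₀))) (γ i p₀ (u p₀)) : ℝ) := by
    have hFs : ∀ i j, F j i p₀ = -F i j p₀ := fun i j => by
      simp only [F, curvForm]; abel
    have e : ∑ i, ∑ j, a i j p₀ * (inner ℝ (F i j p₀ (u p₀)) (u p₀) : ℝ) = 0 := by
      have e1 : ∑ i, ∑ j, a i j p₀ * (inner ℝ (F i j p₀ (u p₀)) (u p₀) : ℝ) =
          -∑ i, ∑ j, a i j p₀ * (inner ℝ (F i j p₀ (u p₀)) (u p₀) : ℝ) := by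
        conv_lhs => rw [Finset.sum_comm]
        simp only [← Finset.sum_neg_distrib]
        refine Finset.sum_congr rfl fun i _ => Finset.sum_congr rfl fun j _ => ?_
        rw [hFs i j, h.a_symm p₀ hp₀ j i]
        simp
      linarith
    simp only [hσi, Finset.sum_sub_distrib, e, sub_zero]
  have hQe : Q p₀ = 2 * (∑ i, ∑ j, a i j p₀ * (inner ℝ (N i p₀) (N j p₀) : ℝ))
      + 2 * (∑ i, (inner ℝ (covDeriv (Γ' i) (w i) v p₀) (γ i p₀ (u p₀)) : ℝ))
      - ∑ i, ∑ j, (inner ℝ (γ j p₀ (F i j p₀ (u p₀))) (γ i p₀ (u p₀)) : ℝ) := by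
    simp only [Q, hfd0, hσF]
    simp
  linarith

end Analysis

/-! ### Derivatives and brackets along coordinate fields -/

section ChartCalculus

variable {X : Type*} [TopologicalSpace X] [ChartedSpace R4 X]
variable {G : Type*} [NormedAddCommGroup G] [NormedSpace ℝ G]

lemma mvfderiv_congr {f g : X → G} {x : X} (h : f =ᶠ[𝓝 x] g) (v : T x) :
    mvfderiv (𝓡 4) f x v = mvfderiv (𝓡 4) g x v := by
  unfold mvfderiv
  rw [h.mfderiv_eq]
  rfl

variable [IsManifold (𝓡 4) ∞ X]

/-- The vector field that is constant in the chart at `x₀`. -/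
def coordField (x₀ : X) (w : R4) (y : X) : T y :=
  (trivializationAt R4 (TangentSpace (𝓡 4) : X → Type _) x₀).symm y w

/-- Both are constant in the trivialization centred at x. Thus the extensions in the definition of
the curvature and in the `L^∞_1` norm of `ϑ₀` are coordinate fields. -/
lemma extend_eq_coordField {x : X} (v : T x) :
    (FiberBundle.extend R4 v : ∀ y : X, T y) = coordField x
      (trivializationAt R4 (TangentSpace (𝓡 4) : X → Type _) x ⟨x, v⟩).2 := rfl

lemma mfderiv_extChartAt_coordField {x₀ y : X} (hy : y ∈ (chartAt R4 x₀).source) (w : R4) :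
    mfderiv (𝓡 4) 𝓘(ℝ, R4) (extChartAt (𝓡 4) x₀) y (coordField x₀ w y) = w := by
  rw [← TangentBundle.continuousLinearMapAt_trivializationAt hy]
  have h := Bundle.Trivialization.continuousLinearMapAt_symmL (R := ℝ)
    (trivializationAt R4 (TangentSpace (𝓡 4) : X → Type _) x₀) (b := y) (by simpa using hy) w
  rwa [Bundle.Trivialization.symmL_apply _ (by simpa using hy)] at h

lemma differentiableAt_comp_extChartAt_symm {f : X → G} {x₀ y : X}
    (hy : y ∈ (chartAt R4 x₀).source) (hf : MDifferentiableAt (𝓡 4) 𝓘(ℝ, G) f y) :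
    DifferentiableAt ℝ (f ∘ (extChartAt (𝓡 4) x₀).symm) (extChartAt (𝓡 4) x₀ y) := by
  rw [← mdifferentiableAt_iff_differentiableAt]
  have hy' : y ∈ (extChartAt (𝓡 4) x₀).source := by rwa [extChartAt_source]
  refine MDifferentiableAt.comp _ ?_ ?_ (I' := 𝓡 4)
  · rwa [(extChartAt (𝓡 4) x₀).left_inv hy']
  · have := mdifferentiableWithinAt_extChartAt_symm (I := 𝓡 4) (x := x₀)
      ((extChartAt (𝓡 4) x₀).map_source hy')
    rwa [ModelWithCorners.range_eq_univ, mdifferentiableWithinAt_univ] at this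

/-- A derivative of a function on the manifold, computed in the chart at `x₀`. -/
lemma mvfderiv_eq_fderiv {f : X → G} {x₀ y : X} (hy : y ∈ (chartAt R4 x₀).source)
    (hf : MDifferentiableAt (𝓡 4) 𝓘(ℝ, G) f y) (v : T y) (w : R4)
    (hw : mfderiv (𝓡 4) 𝓘(ℝ, R4) (extChartAt (𝓡 4) x₀) y v = w) :
    mvfderiv (𝓡 4) f y v =
      fderiv ℝ (f ∘ (extChartAt (𝓡 4) x₀).symm) (extChartAt (𝓡 4) x₀ y) w := by
  have hy' : y ∈ (extChartAt (𝓡 4) x₀).source := by rwa [extChartAt_source]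
  have h1 : f =ᶠ[𝓝 y] (f ∘ (extChartAt (𝓡 4) x₀).symm) ∘ extChartAt (𝓡 4) x₀ := by
    filter_upwards [extChartAt_source_mem_nhds' hy'] with z hz
    simp only [Function.comp_apply, (extChartAt (𝓡 4) x₀).left_inv hz]
  have h2 := mfderiv_comp_apply (I := 𝓡 4) (I' := 𝓘(ℝ, R4)) (I'' := 𝓘(ℝ, G))
    (g := f ∘ (extChartAt (𝓡 4) x₀).symm) (f := extChartAt (𝓡 4) x₀) y
    (differentiableAt_comp_extChartAt_symm hy hf).mdifferentiableAt
    (mdifferentiableAt_extChartAt hy) v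
  rw [mvfderiv_congr h1]
  refine h2.trans ?_
  rw [hw]
  have h3 : mfderiv 𝓘(ℝ, R4) 𝓘(ℝ, G) (f ∘ (extChartAt (𝓡 4) x₀).symm)
    (extChartAt (𝓡 4) x₀ y) = fderiv ℝ (f ∘ (extChartAt (𝓡 4) x₀).symm)
      (extChartAt (𝓡 4) x₀ y) := mfderiv_eq_fderiv
  exact DFunLike.congr_fun h3 w

lemma mvfderiv_coordField {f : X → G} {x₀ y : X} (hy : y ∈ (chartAt R4 x₀).source)
    (hf : MDifferentiableAt (𝓡 4) 𝓘(ℝ, G) f y) (w : R4) :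
    mvfderiv (𝓡 4) f y (coordField x₀ w y) =
      fderiv ℝ (f ∘ (extChartAt (𝓡 4) x₀).symm) (extChartAt (𝓡 4) x₀ y) w :=
  mvfderiv_eq_fderiv hy hf _ w (mfderiv_extChartAt_coordField hy w)

lemma contMDiffAt_coordField {x₀ y : X} (hy : y ∈ (chartAt R4 x₀).source) (w : R4) :
    ContMDiffAt (𝓡 4) ((𝓡 4).prod 𝓘(ℝ, R4)) ∞
      (fun x => (⟨x, coordField x₀ w x⟩ : Bundle.TotalSpace R4 (TangentSpace (𝓡 4) : X → Type _)))
      y := by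
  set t := trivializationAt R4 (TangentSpace (𝓡 4) : X → Type _) x₀
  have hy' : y ∈ t.baseSet := by simpa [t] using hy
  refine (t.contMDiffAt_section_iff hy').2 ?_
  refine (contMDiffAt_const (c := w)).congr_of_eventuallyEq ?_
  filter_upwards [t.open_baseSet.mem_nhds hy'] with z hz
  exact congrArg Prod.snd (t.apply_mk_symm hz w)

/-- Near y both fields are pullbacks under the chart of constant fields, and the bracket commutes
with pullback. -/
lemma mlieBracket_coordField {x₀ y : X} (hy : y ∈ (chartAt R4 x₀).source) (w z : R4) :
    VectorField.mlieBracket (𝓡 4) (coordField x₀ w) (coordField x₀ z) y = 0 := by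
  have hp : ∀ w : R4, coordField x₀ w =ᶠ[𝓝 y]
      VectorField.mpullback (𝓡 4) 𝓘(ℝ, R4) (extChartAt (𝓡 4) x₀)
        (fun _ => w : ∀ p : R4, TangentSpace 𝓘(ℝ, R4) p) := by
    intro w
    filter_upwards [(chartAt R4 x₀).open_source.mem_nhds hy] with x hx
    have hx' : x ∈ (extChartAt (𝓡 4) x₀).source := by rwa [extChartAt_source]
    have hinv := isInvertible_mfderiv_extChartAt (I := 𝓡 4) hx'
    have h1 := congrArg (mfderiv (𝓡 4) 𝓘(ℝ, R4) (extChartAt (𝓡 4) x₀) x).inverse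
      (mfderiv_extChartAt_coordField hx w)
    have h2 := DFunLike.congr_fun hinv.inverse_comp_self (coordField x₀ w x)
    exact h2.symm.trans h1
  rw [Filter.EventuallyEq.mlieBracket_vectorField_eq (hp w) (hp z)]
  have hc : ∀ w p : R4, MDifferentiableAt 𝓘(ℝ, R4) (𝓘(ℝ, R4).prod 𝓘(ℝ, R4))
      (fun q => (⟨q, w⟩ : Bundle.TotalSpace R4 (TangentSpace 𝓘(ℝ, R4) : R4 → Type _))) p :=
    fun w p => (contMDiffAt_vectorSpace_iff_contDiffAt (n := 1).2
      contDiffAt_const).mdifferentiableAt one_ne_zero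
  have : IsManifold (𝓡 4) (minSmoothness ℝ 2) X := by
    rw [minSmoothness_of_isRCLikeNormedField]; infer_instance
  rw [← VectorField.mpullback_mlieBracket (n := 2) (hc w _) (hc z _)
    (contMDiffAt_extChartAt' (n := 2) hy) (by rw [minSmoothness_of_isRCLikeNormedField])]
  have h1 : ∀ V W : ∀ p : R4, TangentSpace 𝓘(ℝ, R4) p,
      VectorField.mlieBracket 𝓘(ℝ, R4) V W = VectorField.lieBracket ℝ V W := fun V W => by
    rw [← VectorField.mlieBracketWithin_univ, VectorField.mlieBracketWithin_eq_lieBracketWithin]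
    exact VectorField.lieBracketWithin_univ
  have h0 : VectorField.mlieBracket 𝓘(ℝ, R4) (fun _ => w : ∀ p : R4, TangentSpace 𝓘(ℝ, R4) p)
      (fun _ => z) = 0 := by
    refine (h1 _ _).trans (funext fun p => ?_)
    change fderiv ℝ (fun _ : R4 => z) p w - fderiv ℝ (fun _ : R4 => w) p z = 0
    simp
  rw [h0]
  exact map_zero _

end ChartCalculus

/-! ### Calculus of scalar and vector valued functions on the manifold -/

section ScalarCalculus

variable {X : Type*} [TopologicalSpace X] [ChartedSpace R4 X]
variable {G H K : Type*} [NormedAddCommGroup G] [NormedSpace ℝ G] [NormedAddCommGroup H]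
  [NormedSpace ℝ H] [NormedAddCommGroup K] [NormedSpace ℝ K]

lemma mvfderiv_clm_comp (L : G →L[ℝ] H) {f : X → G} {x : X}
    (hf : MDifferentiableAt (𝓡 4) 𝓘(ℝ, G) f x) (v : T x) :
    mvfderiv (𝓡 4) (fun y => L (f y)) x v = L (mvfderiv (𝓡 4) f x v) := by
  have h := mfderiv_comp_apply (I := 𝓡 4) (I' := 𝓘(ℝ, G)) (I'' := 𝓘(ℝ, H)) (g := L) (f := f) x
    L.mdifferentiableAt hf v
  refine Eq.trans h ?_
  have h2 : mfderiv 𝓘(ℝ, G) 𝓘(ℝ, H) L (f x) = L := by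
    rw [mfderiv_eq_fderiv, L.fderiv]
  exact DFunLike.congr_fun h2 _

lemma contMDiffAt_bilin {n : WithTop ℕ∞} (B : G →L[ℝ] H →L[ℝ] K) {f : X → G} {g : X → H} {x : X}
    (hf : ContMDiffAt (𝓡 4) 𝓘(ℝ, G) n f x) (hg : ContMDiffAt (𝓡 4) 𝓘(ℝ, H) n g x) :
    ContMDiffAt (𝓡 4) 𝓘(ℝ, K) n (fun y => B (f y) (g y)) x :=
  ((B.contMDiff.contMDiffAt.comp x hf :
    ContMDiffAt (𝓡 4) 𝓘(ℝ, H →L[ℝ] K) n (fun y => B (f y)) x)).clm_apply hg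

variable [IsManifold (𝓡 4) ∞ X]

omit [IsManifold (𝓡 4) ∞ X] in
lemma contMDiffAt_complex_mul {n : WithTop ℕ∞} {f g : X → ℂ} {x : X}
    (hf : ContMDiffAt (𝓡 4) 𝓘(ℝ, ℂ) n f x) (hg : ContMDiffAt (𝓡 4) 𝓘(ℝ, ℂ) n g x) :
    ContMDiffAt (𝓡 4) 𝓘(ℝ, ℂ) n (fun y => f y * g y) x :=
  contMDiffAt_bilin (ContinuousLinearMap.mul ℝ ℂ) hf hg

omit [IsManifold (𝓡 4) ∞ X] in
lemma contMDiffAt_conj {n : WithTop ℕ∞} {f : X → ℂ} {x : X}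
    (hf : ContMDiffAt (𝓡 4) 𝓘(ℝ, ℂ) n f x) :
    ContMDiffAt (𝓡 4) 𝓘(ℝ, ℂ) n (fun y => (starRingEnd ℂ) (f y)) x :=
  (Complex.conjCLE : ℂ →L[ℝ] ℂ).contMDiff.contMDiffAt.comp x hf

omit [IsManifold (𝓡 4) ∞ X] in
lemma contMDiffAt_re {n : WithTop ℕ∞} {f : X → ℂ} {x : X}
    (hf : ContMDiffAt (𝓡 4) 𝓘(ℝ, ℂ) n f x) :
    ContMDiffAt (𝓡 4) 𝓘(ℝ, ℝ) n (fun y => (f y).re) x :=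
  Complex.reCLM.contMDiff.contMDiffAt.comp x hf

omit [IsManifold (𝓡 4) ∞ X] in
lemma contMDiffAt_im {n : WithTop ℕ∞} {f : X → ℂ} {x : X}
    (hf : ContMDiffAt (𝓡 4) 𝓘(ℝ, ℂ) n f x) :
    ContMDiffAt (𝓡 4) 𝓘(ℝ, ℝ) n (fun y => (f y).im) x :=
  Complex.imCLM.contMDiff.contMDiffAt.comp x hf

omit [IsManifold (𝓡 4) ∞ X] in
lemma mvfderiv_conj {f : X → ℂ} {x : X} (hf : MDifferentiableAt (𝓡 4) 𝓘(ℝ, ℂ) f x) (v : T x) :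
    mvfderiv (𝓡 4) (fun y => (starRingEnd ℂ) (f y)) x v =
      (starRingEnd ℂ) (mvfderiv (𝓡 4) f x v) :=
  mvfderiv_clm_comp (Complex.conjCLE : ℂ →L[ℝ] ℂ) hf v

omit [IsManifold (𝓡 4) ∞ X] in
lemma mvfderiv_fun_const (c : G) (x : X) (v : T x) : mvfderiv (𝓡 4) (fun _ : X => c) x v = 0 := by
  rw [mvfderiv_const]; rfl

omit [IsManifold (𝓡 4) ∞ X] in
lemma mvfderiv_fun_add {f g : X → G} {x : X} (hf : MDifferentiableAt (𝓡 4) 𝓘(ℝ, G) f x)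
    (hg : MDifferentiableAt (𝓡 4) 𝓘(ℝ, G) g x) (v : T x) :
    mvfderiv (𝓡 4) (fun y => f y + g y) x v = mvfderiv (𝓡 4) f x v + mvfderiv (𝓡 4) g x v :=
  DFunLike.congr_fun (mvfderiv_add hf hg) v

omit [IsManifold (𝓡 4) ∞ X] in
lemma contMDiffAt_fun_sum {n : WithTop ℕ∞} {ι : Type*} {s : Finset ι} {f : ι → X → G} {x : X}
    (hf : ∀ i ∈ s, ContMDiffAt (𝓡 4) 𝓘(ℝ, G) n (f i) x) :
    ContMDiffAt (𝓡 4) 𝓘(ℝ, G) n (fun y => ∑ i ∈ s, f i y) x := by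
  have := contMDiffAt_finsetSum hf
  simpa [Finset.sum_apply] using this

omit [IsManifold (𝓡 4) ∞ X] in
lemma mvfderiv_fun_sum {ι : Type*} {s : Finset ι} {f : ι → X → G} {x : X}
    (hf : ∀ i ∈ s, ContMDiffAt (𝓡 4) 𝓘(ℝ, G) 1 (f i) x) (v : T x) :
    mvfderiv (𝓡 4) (fun y => ∑ i ∈ s, f i y) x v = ∑ i ∈ s, mvfderiv (𝓡 4) (f i) x v := by
  classical
  induction s using Finset.induction_on with
  | empty => simpa using mvfderiv_fun_const (0 : G) x v
  | insert a s ha h =>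
    simp only [Finset.mem_insert, forall_eq_or_imp] at hf
    simp only [Finset.sum_insert ha, ← h hf.2]
    exact mvfderiv_fun_add (hf.1.mdifferentiableAt one_ne_zero)
      ((contMDiffAt_fun_sum hf.2).mdifferentiableAt one_ne_zero) v

/-- Second derivatives of a `C²` function commute in chart directions. -/
lemma mvfderiv_coordField_comm {f : X → G} {x₀ y : X} (hy : y ∈ (chartAt R4 x₀).source)
    (hf : ContMDiffAt (𝓡 4) 𝓘(ℝ, G) 2 f y) (w z : R4) :
    mvfderiv (𝓡 4) (fun q => mvfderiv (𝓡 4) f q (coordField x₀ w q)) y (coordField x₀ z y) =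
      mvfderiv (𝓡 4) (fun q => mvfderiv (𝓡 4) f q (coordField x₀ z q)) y (coordField x₀ w y) := by
  set φ := extChartAt (𝓡 4) x₀
  have hy' : y ∈ φ.source := by rwa [extChartAt_source]
  have hF : ContDiffAt ℝ 2 (f ∘ φ.symm) (φ y) := by
    rw [← contMDiffAt_iff_contDiffAt]
    have h1 : ContMDiffAt 𝓘(ℝ, R4) (𝓡 4) 2 φ.symm (φ y) :=
      (contMDiffOn_extChartAt_symm x₀).contMDiffAt
        ((isOpen_extChartAt_target x₀).mem_nhds (φ.map_source hy'))
    refine ContMDiffAt.comp _ ?_ h1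
    rwa [φ.left_inv hy']
  have hev : ∀ᶠ q in 𝓝 y, q ∈ (chartAt R4 x₀).source ∧ MDifferentiableAt (𝓡 4) 𝓘(ℝ, G) f q :=
    Filter.Eventually.and ((chartAt R4 x₀).open_source.mem_nhds hy) <|
      ((contMDiffAt_iff_contMDiffAt_nhds (by simp)).1 hf).mono fun q hq => hq.mdifferentiableAt two_ne_zero
  have hd : ∀ w : R4, (fun q => mvfderiv (𝓡 4) f q (coordField x₀ w q)) =ᶠ[𝓝 y]
      (fun p => fderiv ℝ (f ∘ φ.symm) p w) ∘ φ := fun w => by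
    filter_upwards [hev] with q hq using mvfderiv_coordField hq.1 hq.2 w
  have hF' : DifferentiableAt ℝ (fderiv ℝ (f ∘ φ.symm)) (φ y) :=
    (hF.fderiv_right (m := 1) (by norm_num)).differentiableAt one_ne_zero
  have key : ∀ w z : R4, mvfderiv (𝓡 4) (fun q => mvfderiv (𝓡 4) f q (coordField x₀ w q)) y
      (coordField x₀ z y) = fderiv ℝ (fderiv ℝ (f ∘ φ.symm)) (φ y) z w := fun w z => by
    have hdif : DifferentiableAt ℝ (fun p => fderiv ℝ (f ∘ φ.symm) p w) (φ y) :=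
      hF'.clm_apply (differentiableAt_const w)
    have hdm : MDifferentiableAt (𝓡 4) 𝓘(ℝ, G) ((fun p => fderiv ℝ (f ∘ φ.symm) p w) ∘ φ) y :=
      hdif.comp_mdifferentiableAt (mdifferentiableAt_extChartAt hy)
    rw [mvfderiv_congr (hd w), mvfderiv_coordField hy hdm]
    have he : ((fun p => fderiv ℝ (f ∘ φ.symm) p w) ∘ φ) ∘ φ.symm =ᶠ[𝓝 (φ y)]
        fun p => fderiv ℝ (f ∘ φ.symm) p w := by
      filter_upwards [(isOpen_extChartAt_target x₀).mem_nhds (φ.map_source hy')] with p hp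
      simp only [Function.comp_apply, φ.right_inv hp]
    have he' := he.fderiv_eq (𝕜 := ℝ)
    refine (DFunLike.congr_fun he' z).trans ?_
    rw [fderiv_clm_apply hF' (differentiableAt_const w)]
    simp
  rw [key, key]
  exact (hF.isSymmSndFDerivAt (by simp)).eq z w

end ScalarCalculus

/-! ### Extending local sections to global ones -/

section BundleSections

variable {X : Type*} [TopologicalSpace X] [ChartedSpace R4 X] [IsManifold (𝓡 4) ∞ X]
  {F : Type*} [NormedAddCommGroup F] [NormedSpace ℝ F] {V : X → Type*}
  [TopologicalSpace (Bundle.TotalSpace F V)] [∀ x, AddCommGroup (V x)] [∀ x, Module ℝ (V x)]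
  [∀ x, TopologicalSpace (V x)] [FiberBundle F V] [VectorBundle ℝ F V]
  [ContMDiffVectorBundle ∞ F V (𝓡 4)]

/-- A local section of class `C^n` agrees near a given point with a global one. -/
lemma exists_contMDiff_eventuallyEq [T2Space X] {n : WithTop ℕ∞} (hn : n ≤ (∞ : WithTop ℕ∞))
    {x : X} {s : ∀ x, V x}
    (hs : ∀ᶠ y in 𝓝 x, ContMDiffAt (𝓡 4) ((𝓡 4).prod 𝓘(ℝ, F)) n
      (fun y => (⟨y, s y⟩ : Bundle.TotalSpace F V)) y) :
    ∃ s' : ∀ x, V x, ContMDiff (𝓡 4) ((𝓡 4).prod 𝓘(ℝ, F)) n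
      (fun y => (⟨y, s' y⟩ : Bundle.TotalSpace F V)) ∧ ∀ᶠ y in 𝓝 x, s' y = s y := by
  have : ContMDiffVectorBundle n F V (𝓡 4) := ContMDiffVectorBundle.of_le hn
  obtain ⟨f, -, hf⟩ := (SmoothBumpFunction.nhds_basis_tsupport (I := 𝓡 4) (c := x)).mem_iff.1 hs
  refine ⟨fun y => f y • s y, fun y => ?_, ?_⟩
  · by_cases hy : y ∈ tsupport f
    · exact ContMDiffAt.smul_section (f.contMDiffAt.of_le hn) (hf hy)
    · have h0 : ∀ᶠ z in 𝓝 y, f z = 0 := (notMem_tsupport_iff_eventuallyEq.1 hy)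
      have hz : ContMDiffAt (𝓡 4) ((𝓡 4).prod 𝓘(ℝ, F)) n
          (fun y => (⟨y, 0⟩ : Bundle.TotalSpace F V)) y :=
        (Bundle.contMDiff_zeroSection ℝ V).contMDiffAt
      exact hz.congr_of_eventuallyEq (h0.mono fun z hz => by simp [hz])
  · filter_upwards [f.eventuallyEq_one] with y hy
    rw [hy]; simp

end BundleSections

/-! ### Regularity of sections of Hermitian plane bundles -/

section SectionCalculus

set_option linter.unusedSectionVars false

variable {X : Type*} [TopologicalSpace X] [ChartedSpace R4 X] {V : HermitianPlaneBundle X}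

instance instRealInnerProductFiber (V : HermitianPlaneBundle X) (x : X) :
    InnerProductSpace ℝ (V.fiber x) := InnerProductSpace.complexToReal

/-- The section `s` of `V` is of class `C^n` at `x`. -/
def IsSectionAt (V : HermitianPlaneBundle X) (n : WithTop ℕ∞) (s : ∀ x, V.fiber x) (x : X) : Prop :=
  ContMDiffAt (𝓡 4) ((𝓡 4).prod 𝓘(ℝ, C2)) n
    (fun x => (⟨x, s x⟩ : Bundle.TotalSpace C2 V.fiber)) x

lemma IsSection.at {n : WithTop ℕ∞} {s : ∀ x, V.fiber x} (h : IsSection V n s) (x : X) :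
    IsSectionAt V n s x := h x

namespace IsSectionAt

variable {n m : WithTop ℕ∞} {s t : ∀ x, V.fiber x} {x : X}

lemma of_le (h : IsSectionAt V n s x) (hm : m ≤ n) : IsSectionAt V m s x :=
  ContMDiffAt.of_le h hm

lemma diffAt (h : IsSectionAt V 1 s x) : SectionDiffAt V s x :=
  ContMDiffAt.mdifferentiableAt h one_ne_zero

lemma congr (h : IsSectionAt V n s x) (hst : ∀ᶠ y in 𝓝 x, t y = s y) : IsSectionAt V n t x :=
  ContMDiffAt.congr_of_eventuallyEq h (hst.mono fun y hy => by simp [hy])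

lemma add (hs : IsSectionAt V n s x) (ht : IsSectionAt V n t x) :
    IsSectionAt V n (fun y => s y + t y) x :=
  ContMDiffAt.add_section hs ht

lemma sub (hs : IsSectionAt V n s x) (ht : IsSectionAt V n t x) :
    IsSectionAt V n (fun y => s y - t y) x :=
  ContMDiffAt.sub_section hs ht

lemma real_smul {f : X → ℝ} (hf : ContMDiffAt (𝓡 4) 𝓘(ℝ, ℝ) n f x) (hs : IsSectionAt V n s x) :
    IsSectionAt V n (fun y => f y • s y) x :=
  ContMDiffAt.smul_section hf hs

lemma sum {ι : Type*} {S : Finset ι} {s : ι → ∀ x, V.fiber x}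
    (hs : ∀ i ∈ S, IsSectionAt V n (s i) x) : IsSectionAt V n (fun y => ∑ i ∈ S, s i y) x :=
  ContMDiffAt.sum_section hs

/-- The smooth structure is that of a real bundle. The trivializations are complex linear, however,
so multiplication by I becomes a constant linear map in them. -/
lemma I_smul (hn : n ≤ (∞ : WithTop ℕ∞)) (hs : IsSectionAt V n s x) : IsSectionAt V n (fun y => Complex.I • s y) x := by
  have : ContMDiffVectorBundle n C2 V.fiber (𝓡 4) := ContMDiffVectorBundle.of_le hn
  set t := trivializationAt C2 V.fiber x
  have hx : x ∈ t.baseSet := FiberBundle.mem_baseSet_trivializationAt' x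
  have h1 := (t.contMDiffAt_section_iff hx).1 hs
  refine (t.contMDiffAt_section_iff hx).2 ?_
  have h2 : ContMDiffAt (𝓡 4) 𝓘(ℝ, C2) n (fun y => Complex.I • (t ⟨y, s y⟩).2) x :=
    ((Complex.I • ContinuousLinearMap.id ℝ C2 : C2 →L[ℝ] C2).contMDiff.contMDiffAt.comp x h1)
  refine h2.congr_of_eventuallyEq ?_
  filter_upwards [t.open_baseSet.mem_nhds hx] with y hy
  exact (t.linear ℂ hy).map_smul Complex.I (s y)

lemma smul (hn : n ≤ (∞ : WithTop ℕ∞)) {f : X → ℂ} (hf : ContMDiffAt (𝓡 4) 𝓘(ℝ, ℂ) n f x) (hs : IsSectionAt V n s x) :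
    IsSectionAt V n (fun y => f y • s y) x := by
  refine ((hs.real_smul (contMDiffAt_re hf)).add ((hs.I_smul hn).real_smul (contMDiffAt_im hf))).congr
    (.of_forall fun y => ?_)
  conv_lhs => rw [← Complex.re_add_im (f y)]
  rw [add_smul, mul_smul]
  rfl

lemma real_inner (hn : n ≤ (∞ : WithTop ℕ∞)) (hs : IsSectionAt V n s x) (ht : IsSectionAt V n t x) :
    ContMDiffAt (𝓡 4) 𝓘(ℝ, ℝ) n (fun y => (inner ℝ (s y) (t y) : ℝ)) x := by
  have h := V.smoothMetric
  have h' : IsContMDiffRiemannianBundle (𝓡 4) n C2 V.fiber :=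
    IsContMDiffRiemannianBundle.of_le hn
  exact ContMDiffAt.inner_bundle hs ht

/-- Smoothness of the metric is assumed for its real part only. The imaginary part of ⟨s, t⟩ is the
real product of I s with t. -/
lemma complex_inner (hn : n ≤ (∞ : WithTop ℕ∞)) (hs : IsSectionAt V n s x) (ht : IsSectionAt V n t x) :
    ContMDiffAt (𝓡 4) 𝓘(ℝ, ℂ) n (fun y => (inner ℂ (s y) (t y) : ℂ)) x := by
  have h1 := hs.real_inner hn ht
  have h2 := (hs.I_smul hn).real_inner hn ht
  have e1 : ContMDiffAt (𝓡 4) 𝓘(ℝ, ℂ) n (fun y => ((inner ℝ (s y) (t y) : ℝ) : ℂ)) x :=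
    Complex.ofRealCLM.contMDiff.contMDiffAt.comp x h1
  have e2 : ContMDiffAt (𝓡 4) 𝓘(ℝ, ℂ) n
      (fun y => ((inner ℝ (Complex.I • s y) (t y) : ℝ) : ℂ) * Complex.I) x :=
    contMDiffAt_complex_mul (Complex.ofRealCLM.contMDiff.contMDiffAt.comp x h2) contMDiffAt_const
  refine (e1.add e2).congr_of_eventuallyEq (.of_forall fun y => ?_)
  have r1 : (inner ℝ (s y) (t y) : ℝ) = (inner ℂ (s y) (t y) : ℂ).re := rfl
  have r2 : (inner ℝ (Complex.I • s y) (t y) : ℝ) = (inner ℂ (s y) (t y) : ℂ).im := by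
    change (inner ℂ (Complex.I • s y) (t y) : ℂ).re = _
    rw [inner_smul_left]
    simp
  change (inner ℂ (s y) (t y) : ℂ) = _ + _
  simp only [r1, r2, Complex.re_add_im]

end IsSectionAt

lemma isSectionAt_extend [IsManifold (𝓡 4) ∞ X] {x : X} (σ : V.fiber x) :
    ∀ᶠ y in 𝓝 x, IsSectionAt V ∞ (FiberBundle.extend C2 σ) y := by
  obtain ⟨s, hs, h⟩ := FiberBundle.exists_contMDiffOn_extend (k := ∞) (𝓡 4) C2 σ
  filter_upwards [eventually_mem_nhds_iff.2 hs] with y hy using h.contMDiffAt hy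

lemma exists_isSection_eventuallyEq [IsManifold (𝓡 4) ∞ X] [T2Space X] {x : X}
    {s : ∀ x, V.fiber x} (hs : ∀ᶠ y in 𝓝 x, IsSectionAt V ∞ s y) :
    ∃ s', IsSection V ∞ s' ∧ ∀ᶠ y in 𝓝 x, s' y = s y :=
  exists_contMDiff_eventuallyEq le_rfl hs

end SectionCalculus

/-! ### Rules for unitary connections -/

section ConnectionCalculus

set_option linter.unusedSectionVars false

lemma one_le_infty : (1 : WithTop ℕ∞) ≤ (∞ : WithTop ℕ∞) := by exact_mod_cast le_top

variable {X : Type*} [TopologicalSpace X] [ChartedSpace R4 X] [IsManifold (𝓡 4) ∞ X]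
  {V : HermitianPlaneBundle X} (A : Connection V) {s t : ∀ x, V.fiber x} {x : X}

lemma connection_congr (hs : IsSectionAt V 1 s x) (h : ∀ᶠ y in 𝓝 x, t y = s y) (v : T x) :
    A t x v = A s x v := by
  have := A.isCovariantDerivativeOn (s := Set.univ) |>.congr_of_eventuallyEq (hs.congr h).diffAt
    hs.diffAt Filter.univ_mem h
  rw [this]

lemma connection_add (hs : IsSectionAt V 1 s x) (ht : IsSectionAt V 1 t x) (v : T x) :
    A (fun y => s y + t y) x v = A s x v + A t x v := by
  have := (A.isCovariantDerivativeOn (s := Set.univ)).add hs.diffAt ht.diffAt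
  exact DFunLike.congr_fun this v

lemma connection_real_smul {f : X → ℝ} (hf : ContMDiffAt (𝓡 4) 𝓘(ℝ, ℝ) 1 f x)
    (hs : IsSectionAt V 1 s x) (v : T x) :
    A (fun y => f y • s y) x v = f x • A s x v + mvfderiv (𝓡 4) f x v • s x := by
  have := (A.isCovariantDerivativeOn (s := Set.univ)).leibniz hs.diffAt
    (hf.mdifferentiableAt one_ne_zero)
  exact DFunLike.congr_fun this v

variable {A} (hA : IsUnitary A)
include hA

/-- A covariant derivative carries only the real Leibniz rule. Splitting `f` into real and imaginary
parts and using that the connection commutes with I extends it to complex functions. -/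
lemma IsUnitary.leibniz {f : X → ℂ} (hf : ContMDiffAt (𝓡 4) 𝓘(ℝ, ℂ) 1 f x)
    (hs : IsSectionAt V 1 s x) (v : T x) :
    A (fun y => f y • s y) x v = f x • A s x v + mvfderiv (𝓡 4) f x v • s x := by
  have hf1 := contMDiffAt_re hf
  have hf2 := contMDiffAt_im hf
  have e : (fun y => f y • s y) = fun y => (f y).re • s y + (f y).im • (Complex.I • s y) := by
    funext y
    conv_lhs => rw [← Complex.re_add_im (f y)]
    rw [add_smul, mul_smul]
    rfl
  have d1 : mvfderiv (𝓡 4) (fun y => (f y).re) x v = (mvfderiv (𝓡 4) f x v).re :=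
    mvfderiv_clm_comp Complex.reCLM (hf.mdifferentiableAt one_ne_zero) v
  have d2 : mvfderiv (𝓡 4) (fun y => (f y).im) x v = (mvfderiv (𝓡 4) f x v).im :=
    mvfderiv_clm_comp Complex.imCLM (hf.mdifferentiableAt one_ne_zero) v
  rw [e, connection_add A (hs.real_smul hf1) ((hs.I_smul one_le_infty).real_smul hf2),
    connection_real_smul A hf1 hs, connection_real_smul A hf2 (hs.I_smul one_le_infty), hA.smul s x v hs.diffAt,
    d1, d2]
  conv_rhs => rw [← Complex.re_add_im (f x), ← Complex.re_add_im (mvfderiv (𝓡 4) f x v)]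
  simp only [add_smul, mul_smul, Complex.coe_smul]
  abel

lemma IsUnitary.map_sum {ι : Type*} {S : Finset ι} {s : ι → ∀ x, V.fiber x}
    (hs : ∀ i ∈ S, IsSectionAt V 1 (s i) x) (v : T x) :
    A (fun y => ∑ i ∈ S, s i y) x v = ∑ i ∈ S, A (s i) x v := by
  classical
  induction S using Finset.induction_on with
  | empty =>
    have := A.isCovariantDerivativeOn (s := Set.univ) |>.zero (x := x)
    exact DFunLike.congr_fun this v
  | insert a S ha h =>
    simp only [Finset.mem_insert, forall_eq_or_imp] at hs
    simp only [Finset.sum_insert ha, ← h hs.2]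
    exact connection_add A hs.1 (.sum hs.2) v

lemma IsUnitary.mvfderiv_inner (hs : IsSectionAt V 1 s x) (ht : IsSectionAt V 1 t x) (v : T x) :
    mvfderiv (𝓡 4) (fun y => (inner ℂ (s y) (t y) : ℂ)) x v =
      inner ℂ (A s x v) (t x) + inner ℂ (s x) (A t x v) :=
  hA.metric s t x v hs.diffAt ht.diffAt

end ConnectionCalculus

/-! ### The curvature operator of a connection with `C¹` symbols -/

section MetricConnections

set_option linter.unusedSectionVars false

lemma two_le_infty : (2 : WithTop ℕ∞) ≤ (∞ : WithTop ℕ∞) := by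
  exact WithTop.coe_le_coe.2 (le_top : (2 : ℕ∞) ≤ ⊤)

variable {X : Type*} [TopologicalSpace X] [ChartedSpace R4 X] [IsManifold (𝓡 4) ∞ X]
  {F : Type*} [NormedAddCommGroup F] [NormedSpace ℝ F] {V : X → Type*}
  [TopologicalSpace (Bundle.TotalSpace F V)] [∀ x, NormedAddCommGroup (V x)]
  [∀ x, InnerProductSpace ℝ (V x)] [FiberBundle F V] [VectorBundle ℝ F V]
  [ContMDiffVectorBundle ∞ F V (𝓡 4)]

/-- The section `s` of a vector bundle is of class `C^n` at `x`. -/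
def SecAt (F : Type*) [NormedAddCommGroup F] [NormedSpace ℝ F] {V : X → Type*}
    [TopologicalSpace (Bundle.TotalSpace F V)] [∀ x, NormedAddCommGroup (V x)] [FiberBundle F V]
    (n : WithTop ℕ∞) (s : ∀ x, V x) (x : X) : Prop :=
  ContMDiffAt (𝓡 4) ((𝓡 4).prod 𝓘(ℝ, F)) n (fun y => (⟨y, s y⟩ : Bundle.TotalSpace F V)) x

omit [IsManifold (𝓡 4) ∞ X] [∀ x, InnerProductSpace ℝ (V x)] in
lemma SecAt.mdiff {s : ∀ x, V x} {x : X} (h : SecAt F 1 s x) :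
    MDifferentiableAt (𝓡 4) ((𝓡 4).prod 𝓘(ℝ, F))
      (fun y => (⟨y, s y⟩ : Bundle.TotalSpace F V)) x :=
  ContMDiffAt.mdifferentiableAt h one_ne_zero

omit [IsManifold (𝓡 4) ∞ X] [∀ x, InnerProductSpace ℝ (V x)] in
lemma SecAt.of_le {m n : WithTop ℕ∞} {s : ∀ x, V x} {x : X} (h : SecAt F n s x) (hm : m ≤ n) :
    SecAt F m s x :=
  ContMDiffAt.of_le h hm

omit [∀ x, InnerProductSpace ℝ (V x)] in
lemma secAt_extend [∀ x, InnerProductSpace ℝ (V x)] [VectorBundle ℝ F V]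
    [ContMDiffVectorBundle ∞ F V (𝓡 4)] {x : X} (σ : V x) :
    ∀ᶠ y in 𝓝 x, SecAt F ∞ (FiberBundle.extend F σ) y := by
  obtain ⟨s, hs, h⟩ := FiberBundle.exists_contMDiffOn_extend (k := ∞) (𝓡 4) F σ
  filter_upwards [eventually_mem_nhds_iff.2 hs] with y hy using h.contMDiffAt hy

lemma covariantDerivative_congr (D : CovariantDerivative (𝓡 4) F V) {s t : ∀ x, V x} {x : X}
    (hs : SecAt F 1 s x) (h : ∀ᶠ y in 𝓝 x, t y = s y) (v : T x) : D t x v = D s x v := by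
  have ht : SecAt F 1 t x := ContMDiffAt.congr_of_eventuallyEq hs (h.mono fun y hy => by simp [hy])
  have := D.isCovariantDerivativeOn (s := Set.univ) |>.congr_of_eventuallyEq ht.mdiff
    hs.mdiff Filter.univ_mem h
  rw [this]

/-- The connection `D` maps smooth sections to sections of class `C^1`: its Christoffel symbols are
of class `C^1`. -/
def HasC1Symbols (D : CovariantDerivative (𝓡 4) F V) : Prop :=
  ∀ s : ∀ x, V x, ContMDiff (𝓡 4) ((𝓡 4).prod 𝓘(ℝ, F)) ∞
    (fun y => (⟨y, s y⟩ : Bundle.TotalSpace F V)) → ContMDiff (𝓡 4)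
      ((𝓡 4).prod 𝓘(ℝ, R4 →L[ℝ] F)) 1 (fun y => (⟨y, D s y⟩ :
        Bundle.TotalSpace (R4 →L[ℝ] F) fun y => TangentSpace (𝓡 4) y →L[ℝ] V y))

lemma hasC1Symbols_of_class {n : WithTop ℕ∞} {D : CovariantDerivative (𝓡 4) F V}
    (hD : D.ContMDiffCovariantDerivative n) (h1 : 1 ≤ n) (hn : n + 1 ≤ (∞ : WithTop ℕ∞)) :
    HasC1Symbols D := fun _ hs =>
  (contMDiffOn_univ.1 (hD.contMDiff.contMDiff (contMDiffOn_univ.2 (hs.of_le hn)))).of_le h1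

/-- `HasC1Symbols` speaks of global smooth sections; a cutoff makes it available for local ones. -/
lemma exists_contMDiff_covariantDerivative [T2Space X]
    {D : CovariantDerivative (𝓡 4) F V} (hD : HasC1Symbols D) {s : ∀ x, V x}
    {x : X} (hs : ∀ᶠ y in 𝓝 x, SecAt F ∞ s y) :
    ∃ s' : ∀ x, V x, (∀ᶠ y in 𝓝 x, s' y = s y) ∧ ContMDiffAt (𝓡 4)
      ((𝓡 4).prod 𝓘(ℝ, R4 →L[ℝ] F)) 1 (fun y => (⟨y, D s' y⟩ :
        Bundle.TotalSpace (R4 →L[ℝ] F) fun y => TangentSpace (𝓡 4) y →L[ℝ] V y)) x := by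
  obtain ⟨s', h1, h2⟩ := exists_contMDiff_eventuallyEq le_rfl hs
  exact ⟨s', h2, (hD s' h1).contMDiffAt⟩

lemma secAt_covariantDerivative [T2Space X]
    {D : CovariantDerivative (𝓡 4) F V} (hD : HasC1Symbols D) {s : ∀ x, V x}
    {x : X} (hs : ∀ᶠ y in 𝓝 x, SecAt F ∞ s y)
    {v : ∀ x : X, T x} (hv : ContMDiffAt (𝓡 4) ((𝓡 4).prod 𝓘(ℝ, R4)) 1 (fun y => (⟨y, v y⟩ :
        Bundle.TotalSpace R4 (TangentSpace (𝓡 4) : X → Type _))) x) :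
    SecAt F 1 (fun y => D s y (v y)) x := by
  obtain ⟨s', h2, h3⟩ := exists_contMDiff_covariantDerivative hD hs
  refine ContMDiffAt.congr_of_eventuallyEq (ContMDiffAt.clm_bundle_apply h3 hv) ?_
  filter_upwards [hs, h2.eventually_nhds] with y hy1 hy2
  rw [covariantDerivative_congr D (hy1.of_le one_le_infty) hy2]

lemma mdifferentiableAt_covariantDerivative [T2Space X]
    {D : CovariantDerivative (𝓡 4) F V} (hD : HasC1Symbols D) {s : ∀ x, V x}
    {x : X} (hs : ∀ᶠ y in 𝓝 x, SecAt F ∞ s y)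
    {v : ∀ x : X, T x} (hv : VectorFieldDiffAt v x) :
    MDifferentiableAt (𝓡 4) ((𝓡 4).prod 𝓘(ℝ, F))
      (fun y => (⟨y, D s y (v y)⟩ : Bundle.TotalSpace F V)) x := by
  obtain ⟨s', h2, h3⟩ := exists_contMDiff_covariantDerivative hD hs
  refine MDifferentiableAt.congr_of_eventuallyEq
    (MDifferentiableAt.clm_bundle_apply (h3.mdifferentiableAt one_ne_zero) hv) ?_
  filter_upwards [hs, h2.eventually_nhds] with y hy1 hy2
  rw [covariantDerivative_congr D (hy1.of_le one_le_infty) hy2]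

/-- The curvature operator of a connection on vector fields and sections. -/
def curvOp (D : CovariantDerivative (𝓡 4) F V) (u v : ∀ x : X, T x) (s : ∀ x, V x) (x : X) : V x :=
  D (fun y => D s y (v y)) x (u x) - D (fun y => D s y (u y)) x (v x)
    - D s x (VectorField.mlieBracket (𝓡 4) u v x)

lemma curvature_eq_curvOp_extend (D : CovariantDerivative (𝓡 4) F V) (x : X) (u v : T x) (s : V x) :
    curvature D x u v s = curvOp D (FiberBundle.extend R4 u) (FiberBundle.extend R4 v)
      (FiberBundle.extend F s) x := by
  simp only [curvature, curvOp, FiberBundle.extend_apply_self]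

lemma curvOp_swap (D : CovariantDerivative (𝓡 4) F V) (u v : ∀ x : X, T x) (s : ∀ x, V x) (x : X) :
    curvOp D v u s x = -curvOp D u v s x := by
  simp only [curvOp, VectorField.mlieBracket_swap_apply (V := v) (W := u), map_neg]
  abel

variable [T2Space X]

/-- The term df(u)∇_v s from the Leibniz rule cancels against the same term in the bracket [u, f v].
-/
lemma tensorialAt_curvOp_right {D : CovariantDerivative (𝓡 4) F V}
    (hD : HasC1Symbols D) {s : ∀ x, V x} {x : X}
    (hs : ∀ᶠ y in 𝓝 x, SecAt F ∞ s y) (u : ∀ x : X, T x) :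
    TensorialAt (𝓡 4) R4 (fun v : ∀ x : X, T x => curvOp D u v s x) x where
  smul {f v} hf hv := by
    have h1 : D (fun y => D s y ((f • v) y)) x (u x) =
        f x • D (fun y => D s y (v y)) x (u x) + mvfderiv (𝓡 4) f x (u x) • D s x (v x) := by
      have e : (fun y => D s y ((f • v) y)) = f • fun y => D s y (v y) := by
        funext y; exact (D s y).map_smul _ _
      rw [e, (D.isCovariantDerivativeOn (s := Set.univ)).leibniz
        (mdifferentiableAt_covariantDerivative hD hs hv) hf]
      rfl
    have h2 := VectorField.mlieBracket_smul_right (V := u) hf hv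
    have h3 : (f • v) x = f x • v x := rfl
    simp only [curvOp, h1, h2, h3, map_add, map_smul, smul_sub]
    abel
  add {v v'} hv hv' := by
    have h1 : D (fun y => D s y ((v + v') y)) x (u x) =
        D (fun y => D s y (v y)) x (u x) + D (fun y => D s y (v' y)) x (u x) := by
      have e : (fun y => D s y ((v + v') y)) = (fun y => D s y (v y)) + fun y => D s y (v' y) := by
        funext y; exact map_add _ _ _
      rw [e, (D.isCovariantDerivativeOn (s := Set.univ)).add
        (mdifferentiableAt_covariantDerivative hD hs hv)
        (mdifferentiableAt_covariantDerivative hD hs hv')]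
      rfl
    have h2 := VectorField.mlieBracket_add_right (V := u) hv hv'
    have h3 : (v + v') x = v x + v' x := rfl
    simp only [curvOp, h1, h2, h3, map_add]
    abel

lemma tensorialAt_curvOp_left {D : CovariantDerivative (𝓡 4) F V}
    (hD : HasC1Symbols D) {s : ∀ x, V x} {x : X}
    (hs : ∀ᶠ y in 𝓝 x, SecAt F ∞ s y) (v : ∀ x : X, T x) :
    TensorialAt (𝓡 4) R4 (fun u : ∀ x : X, T x => curvOp D u v s x) x where
  smul {f u} hf hu := by
    rw [curvOp_swap D v, curvOp_swap D v, (tensorialAt_curvOp_right hD hs v).smul hf hu, smul_neg]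
  add {u u'} hu hu' := by
    rw [curvOp_swap D v, curvOp_swap D v, curvOp_swap D v,
      (tensorialAt_curvOp_right hD hs v).add hu hu', neg_add]

lemma curvOp_congr {D : CovariantDerivative (𝓡 4) F V}
    (hD : HasC1Symbols D) {s : ∀ x, V x} {x : X}
    (hs : ∀ᶠ y in 𝓝 x, SecAt F ∞ s y) {u u' v v' : ∀ x : X, T x} (hu : VectorFieldDiffAt u x)
    (hu' : VectorFieldDiffAt u' x) (hv : VectorFieldDiffAt v x) (hv' : VectorFieldDiffAt v' x)
    (huu : u x = u' x) (hvv : v x = v' x) : curvOp D u v s x = curvOp D u' v' s x :=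
  TensorialAt.pointwise₂ (Φ := fun u v => curvOp D u v s x)
    (fun v _ => tensorialAt_curvOp_left hD hs v)
    (fun u _ => tensorialAt_curvOp_right hD hs u) hu hu' hv hv' huu hvv

end MetricConnections

/-! ### Curvature of metric connections as a tensor -/

section MetricCurvature

set_option linter.unusedSectionVars false

variable {X : Type*} [TopologicalSpace X] [ChartedSpace R4 X] [IsManifold (𝓡 4) ∞ X] [T2Space X]
  {F : Type*} [NormedAddCommGroup F] [NormedSpace ℝ F] {V : X → Type*}
  [TopologicalSpace (Bundle.TotalSpace F V)] [∀ x, NormedAddCommGroup (V x)]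
  [∀ x, InnerProductSpace ℝ (V x)] [FiberBundle F V] [VectorBundle ℝ F V]
  [ContMDiffVectorBundle ∞ F V (𝓡 4)] [IsContMDiffRiemannianBundle (𝓡 4) ∞ F V]

/-- The connection `D` is compatible with the metric. -/
def IsMetric (D : CovariantDerivative (𝓡 4) F V) : Prop :=
  ∀ (s t : ∀ x, V x) (x : X) (v : T x), SecAt F 1 s x → SecAt F 1 t x →
    mvfderiv (𝓡 4) (fun y => (inner ℝ (s y) (t y) : ℝ)) x v =
      inner ℝ (D s x v) (t x) + inner ℝ (s x) (D t x v)

lemma SecAt.inner {n : WithTop ℕ∞} (hn : n ≤ (∞ : WithTop ℕ∞)) {s t : ∀ x, V x} {x : X}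
    (hs : SecAt F n s x) (ht : SecAt F n t x) :
    ContMDiffAt (𝓡 4) 𝓘(ℝ, ℝ) n (fun y => (Inner.inner ℝ (s y) (t y) : ℝ)) x := by
  have h' : IsContMDiffRiemannianBundle (𝓡 4) n F V := IsContMDiffRiemannianBundle.of_le hn
  exact ContMDiffAt.inner_bundle hs ht

variable {D : CovariantDerivative (𝓡 4) F V} (hD : HasC1Symbols D)
  (hM : IsMetric D)
include hD hM

/-- The curvature of a metric connection is skew-adjoint. -/
lemma inner_curvOp_coordField {x₀ y : X} (hy : y ∈ (chartAt R4 x₀).source) (w z : R4)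
    {s t : ∀ x, V x} (hs : ∀ᶠ q in 𝓝 y, SecAt F ∞ s q) (ht : ∀ᶠ q in 𝓝 y, SecAt F ∞ t q) :
    (inner ℝ (curvOp D (coordField x₀ w) (coordField x₀ z) s y) (t y) : ℝ) =
      -inner ℝ (s y) (curvOp D (coordField x₀ w) (coordField x₀ z) t y) := by
  have hc : ∀ w : R4, ∀ q ∈ (chartAt R4 x₀).source, ContMDiffAt (𝓡 4) ((𝓡 4).prod 𝓘(ℝ, R4)) 1
      (fun x => (⟨x, coordField x₀ w x⟩ : Bundle.TotalSpace R4 (TangentSpace (𝓡 4) : X → Type _)))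
      q := fun w q hq => (contMDiffAt_coordField hq w).of_le one_le_infty
  have hDs : ∀ {s : ∀ x, V x} (_ : ∀ᶠ q in 𝓝 y, SecAt F ∞ s q) (w : R4),
      SecAt F 1 (fun q => D s q (coordField x₀ w q)) y := fun {s} hs w =>
    secAt_covariantDerivative hD hs (hc w y hy)
  have hs1 : SecAt F 1 s y := hs.self_of_nhds.of_le one_le_infty
  have ht1 : SecAt F 1 t y := ht.self_of_nhds.of_le one_le_infty
  have hd : ∀ w : R4, (fun q => mvfderiv (𝓡 4) (fun q => (inner ℝ (s q) (t q) : ℝ)) q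
      (coordField x₀ w q)) =ᶠ[𝓝 y] fun q => (inner ℝ (D s q (coordField x₀ w q)) (t q) : ℝ) +
        inner ℝ (s q) (D t q (coordField x₀ w q)) := fun w => by
    filter_upwards [hs, ht] with q hq hq'
    exact hM s t q _ (hq.of_le one_le_infty) (hq'.of_le one_le_infty)
  have key : ∀ w z : R4, mvfderiv (𝓡 4) (fun q => mvfderiv (𝓡 4)
      (fun q => (inner ℝ (s q) (t q) : ℝ)) q (coordField x₀ w q)) y (coordField x₀ z y) =
      (inner ℝ (D (fun q => D s q (coordField x₀ w q)) y (coordField x₀ z y)) (t y) +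
        inner ℝ (D s y (coordField x₀ w y)) (D t y (coordField x₀ z y))) +
      (inner ℝ (D s y (coordField x₀ z y)) (D t y (coordField x₀ w y)) +
        inner ℝ (s y) (D (fun q => D t q (coordField x₀ w q)) y (coordField x₀ z y))) := by
    intro w z
    rw [mvfderiv_congr (hd w), mvfderiv_fun_add, hM _ _ _ _ (hDs hs w) ht1,
      hM _ _ _ _ hs1 (hDs ht w)]
    · exact ((hDs hs w).inner one_le_infty ht1).mdifferentiableAt one_ne_zero
    · exact (hs1.inner one_le_infty (hDs ht w)).mdifferentiableAt one_ne_zero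
  -- Second derivatives of ⟨s, t⟩ commute, and the mixed products ⟨∇s, ∇t⟩ are symmetric in the two
  -- directions. What remains is the skewness of the commutator.
  have hcomm := mvfderiv_coordField_comm hy
    ((hs.self_of_nhds.inner le_rfl ht.self_of_nhds).of_le two_le_infty) w z
  rw [key, key] at hcomm
  simp only [curvOp, mlieBracket_coordField hy, map_zero, sub_zero, inner_sub_left,
    inner_sub_right]
  linarith

/-- Skewness replaces a proof of tensoriality in the section: paired with a test vector, the
operator moves to the extension of that vector, and only the value of `s` at y remains. Hence the
choice of extension is irrelevant. -/
lemma curvature_eq_curvOp {x₀ y : X} (hy : y ∈ (chartAt R4 x₀).source) (w z : R4)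
    {s : ∀ x, V x} (hs : ∀ᶠ q in 𝓝 y, SecAt F ∞ s q) :
    curvature D y (coordField x₀ w y) (coordField x₀ z y) (s y) =
      curvOp D (coordField x₀ w) (coordField x₀ z) s y := by
  have hc : ∀ w : R4, VectorFieldDiffAt (coordField x₀ w) y := fun w =>
    (contMDiffAt_coordField hy w).mdifferentiableAt (by simp)
  have he : ∀ v : T y, VectorFieldDiffAt (FiberBundle.extend R4 v) y := fun v =>
    FiberBundle.mdifferentiableAt_extend _ _ _
  have hx : ∀ σ : V y, ∀ᶠ q in 𝓝 y, SecAt F ∞ (FiberBundle.extend F σ) q := fun σ =>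
    secAt_extend σ
  rw [curvature_eq_curvOp_extend, curvOp_congr hD (hx _) (he _) (hc w) (he _) (hc z)
    (FiberBundle.extend_apply_self _ _) (FiberBundle.extend_apply_self _ _)]
  refine ext_inner_right ℝ fun τ => ?_
  have h1 := inner_curvOp_coordField hD hM hy w z (hx (s y)) (hx τ)
  have h2 := inner_curvOp_coordField hD hM hy w z hs (hx τ)
  simp only [FiberBundle.extend_apply_self] at h1 h2
  rw [h1, h2]

omit hD hM in
lemma exists_coordField_eq {x₀ y : X} (hy : y ∈ (chartAt R4 x₀).source) (v : T y) :
    ∃ w : R4, coordField x₀ w y = v := by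
  set t := trivializationAt R4 (TangentSpace (𝓡 4) : X → Type _) x₀
  have hy' : y ∈ t.baseSet := by simpa [t] using hy
  exact ⟨(t ⟨y, v⟩).2, t.symm_apply_apply_mk hy' v⟩

omit hD hM in
lemma exists_coordField_self (x : X) (v : T x) :
    ∃ w : R4, coordField x w x = v ∧ (FiberBundle.extend R4 v : ∀ y : X, T y) = coordField x w :=
  ⟨_, FiberBundle.extend_apply_self _ v, extend_eq_coordField v⟩

lemma inner_curvature_skew (x : X) (u v : T x) (s t : V x) :
    (inner ℝ (curvature D x u v s) t : ℝ) = -inner ℝ s (curvature D x u v t) := by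
  have hx : ∀ σ : V x, ∀ᶠ q in 𝓝 x, SecAt F ∞ (FiberBundle.extend F σ) q := fun σ =>
    secAt_extend σ
  have h := inner_curvOp_coordField hD hM (mem_chart_source R4 x)
    (trivializationAt R4 (TangentSpace (𝓡 4) : X → Type _) x ⟨x, u⟩).2
    (trivializationAt R4 (TangentSpace (𝓡 4) : X → Type _) x ⟨x, v⟩).2 (hx s) (hx t)
  simp only [FiberBundle.extend_apply_self] at h
  rw [curvature_eq_curvOp_extend, curvature_eq_curvOp_extend]
  exact h

omit hD hM in
lemma curvature_swap (x : X) (u v : T x) (s : V x) :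
    curvature D x v u s = -curvature D x u v s := by
  rw [curvature_eq_curvOp_extend, curvature_eq_curvOp_extend, curvOp_swap]

/-- The curvature as a trilinear map. -/
def curvatureMap (x : X) : T x →ₗ[ℝ] T x →ₗ[ℝ] V x →ₗ[ℝ] V x :=
  have hx : ∀ σ : V x, ∀ᶠ q in 𝓝 x, SecAt F ∞ (FiberBundle.extend F σ) q := fun σ =>
    secAt_extend σ
  have ht : ∀ (v : T x) (s : V x), TensorialAt (𝓡 4) R4 (fun u : ∀ x : X, T x =>
      curvOp D u (FiberBundle.extend R4 v) (FiberBundle.extend F s) x) x := fun v s =>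
    tensorialAt_curvOp_left hD (hx s) _
  have ha : ∀ (u u' v : T x) (s : V x), curvature D x (u + u') v s =
      curvature D x u v s + curvature D x u' v s := fun u u' v s => by
    simp only [curvature_eq_curvOp_extend]
    exact map_add (TensorialAt.mkHom _ x (ht v s)) u u'
  have hm : ∀ (c : ℝ) (u v : T x) (s : V x), curvature D x (c • u) v s =
      c • curvature D x u v s := fun c u v s => by
    simp only [curvature_eq_curvOp_extend]
    exact map_smul (TensorialAt.mkHom _ x (ht v s)) c u
  LinearMap.mk₂ ℝ (fun u v =>
    { toFun := fun s => curvature D x u v s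
      -- Linearity in the section comes from skewness as well: once the curvature has moved to `t`,
      -- the expression is linear in `s`.
      map_add' := fun s s' => ext_inner_right ℝ fun t => by
        simp only [inner_add_left, inner_curvature_skew hD hM]
        ring
      map_smul' := fun c s => ext_inner_right ℝ fun t => by
        simp only [RingHom.id_apply, inner_smul_left, inner_curvature_skew hD hM, RCLike.conj_to_real]
        ring })
    (fun u u' v => LinearMap.ext fun s => ha u u' v s)
    (fun c u v => LinearMap.ext fun s => hm c u v s)
    (fun u v v' => LinearMap.ext fun s => by
      have := ha v v' u s
      simp only [LinearMap.coe_mk, AddHom.coe_mk, LinearMap.add_apply]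
      rw [curvature_swap x (v + v') u, curvature_swap x v u, curvature_swap x v' u, this, neg_add])
    (fun c u v => LinearMap.ext fun s => by
      have := hm c v u s
      simp only [LinearMap.coe_mk, AddHom.coe_mk, LinearMap.smul_apply]
      rw [curvature_swap x (c • v) u, curvature_swap x v u, this, smul_neg])

end MetricCurvature

/-! ### Curvature of unitary connections as a complex endomorphism -/

section HermitianCurvature

set_option linter.unusedSectionVars false

variable {X : Type*} [TopologicalSpace X] [ChartedSpace R4 X] [IsManifold (𝓡 4) ∞ X] [T2Space X]
  {V : HermitianPlaneBundle X}

instance instRiemannianFiber (V : HermitianPlaneBundle X) :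
    IsContMDiffRiemannianBundle (𝓡 4) ∞ C2 V.fiber := V.smoothMetric

lemma IsUnitary.isMetric {A : Connection V} (hA : IsUnitary A) : IsMetric A := by
  intro s t x v hs ht
  have h := hA.mvfderiv_inner hs ht v
  have h2 := mvfderiv_clm_comp Complex.reCLM
    ((IsSectionAt.complex_inner one_le_infty hs ht).mdifferentiableAt one_ne_zero) v
  rw [h] at h2
  refine h2.trans ?_
  simp only [map_add]
  rfl

variable {A : Connection V} (hA : IsUnitary A) (hA1 : HasC1Symbols A)
include hA hA1

lemma IsUnitary.curvature_I_smul (x : X) (u v : T x) (s : V.fiber x) :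
    curvature A x u v (Complex.I • s) = Complex.I • curvature A x u v s := by
  obtain ⟨w, hw, -⟩ := exists_coordField_self x u
  obtain ⟨z, hz, -⟩ := exists_coordField_self x v
  have hx := mem_chart_source R4 x
  have hσ := isSectionAt_extend s
  have hσ' : ∀ᶠ q in 𝓝 x, IsSectionAt V ∞ (fun y => Complex.I • FiberBundle.extend C2 s y) q :=
    hσ.mono fun q hq => hq.I_smul le_rfl
  have h1 := curvature_eq_curvOp hA1 hA.isMetric hx w z hσ
  have h2 := curvature_eq_curvOp hA1 hA.isMetric hx w z hσ'
  simp only [FiberBundle.extend_apply_self, hw, hz] at h1 h2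
  rw [h1, h2]
  have hc : ∀ w : R4, ∀ᶠ q in 𝓝 x, ContMDiffAt (𝓡 4) ((𝓡 4).prod 𝓘(ℝ, R4)) 1
      (fun y => (⟨y, coordField x w y⟩ : Bundle.TotalSpace R4 (TangentSpace (𝓡 4) : X → Type _)))
      q := fun w => by
    filter_upwards [(chartAt R4 x).open_source.mem_nhds hx] with q hq
    exact (contMDiffAt_coordField hq w).of_le one_le_infty
  have hD : ∀ w, IsSectionAt V 1 (fun q => A (FiberBundle.extend C2 s) q (coordField x w q)) x :=
    fun w => secAt_covariantDerivative hA1 hσ (hc w).self_of_nhds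
  have e : ∀ w z, A (fun q => A (fun y => Complex.I • FiberBundle.extend C2 s y) q
      (coordField x w q)) x (coordField x z x) =
      Complex.I • A (fun q => A (FiberBundle.extend C2 s) q (coordField x w q)) x
        (coordField x z x) := fun w z => by
    rw [← hA.smul _ _ _ (hD w).diffAt]
    refine connection_congr A ((hD w).I_smul one_le_infty) ?_ _
    filter_upwards [hσ] with q hq
    exact hA.smul _ _ _ (hq.of_le one_le_infty).diffAt
  simp only [curvOp, mlieBracket_coordField hx, map_zero, sub_zero, e, smul_sub]

/-- `curvatureEnd` is prescribed on a basis. It agrees with the curvature everywhere because the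
curvature is real linear in the section and commutes with I. -/
lemma curvatureEnd_apply (x : X) (u v : T x) (s : V.fiber x) :
    curvatureEnd A x u v s = curvature A x u v s := by
  let L : V.fiber x →ₗ[ℂ] V.fiber x :=
    { toFun := fun s => curvature A x u v s
      map_add' := fun s t => (curvatureMap hA1 hA.isMetric x u v).map_add s t
      map_smul' := fun c s => by
        have h1 : ∀ r : ℝ, ∀ t, curvature A x u v (r • t) = r • curvature A x u v t := fun r t =>
          (curvatureMap hA1 hA.isMetric x u v).map_smul r t
        have h2 : ∀ t t', curvature A x u v (t + t') = curvature A x u v t + curvature A x u v t' :=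
          fun t t' => (curvatureMap hA1 hA.isMetric x u v).map_add t t'
        have e : ∀ t : V.fiber x, c • t = c.re • t + c.im • (Complex.I • t) := fun t => by
          conv_lhs => rw [← Complex.re_add_im c]
          rw [add_smul, mul_smul]
          rfl
        rw [RingHom.id_apply, e, e, h2, h1, h1, hA.curvature_I_smul hA1] }
  have h : curvatureEnd A x u v = L := by
    refine (fiberBasis V x).toBasis.ext fun b => ?_
    rw [curvatureEnd, Module.Basis.constr_basis, OrthonormalBasis.coe_toBasis]
    rfl
  rw [h]
  rfl

lemma curvatureEnd_swap (x : X) (u v : T x) : curvatureEnd A x v u = -curvatureEnd A x u v := by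
  ext s
  rw [LinearMap.neg_apply, curvatureEnd_apply hA hA1, curvatureEnd_apply hA hA1, curvature_swap]

/-- The curvature as a bilinear map into the endomorphisms. -/
def curvatureEndMap (x : X) : T x →ₗ[ℝ] T x →ₗ[ℝ] Module.End ℂ (V.fiber x) :=
  LinearMap.mk₂ ℝ (fun u v => curvatureEnd A x u v)
    (fun u u' v => LinearMap.ext fun s => by
      simp only [LinearMap.add_apply, curvatureEnd_apply hA hA1]
      exact congrArg (fun f => f v s) ((curvatureMap hA1 hA.isMetric x).map_add u u'))
    (fun c u v => LinearMap.ext fun s => by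
      simp only [LinearMap.smul_apply, curvatureEnd_apply hA hA1]
      exact congrArg (fun f => f v s) ((curvatureMap hA1 hA.isMetric x).map_smul c u))
    (fun u v v' => LinearMap.ext fun s => by
      simp only [LinearMap.add_apply, curvatureEnd_apply hA hA1]
      exact congrArg (fun f => f s) ((curvatureMap hA1 hA.isMetric x u).map_add v v'))
    (fun c u v => LinearMap.ext fun s => by
      simp only [LinearMap.smul_apply, curvatureEnd_apply hA hA1]
      exact congrArg (fun f => f s) ((curvatureMap hA1 hA.isMetric x u).map_smul c v))

end HermitianCurvature

/-! ### Local orthonormal frames of Hermitian plane bundles -/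

section OrthonormalFrames

variable {X : Type*} [TopologicalSpace X] [ChartedSpace R4 X] {V : HermitianPlaneBundle X}

lemma finrank_fiber (V : HermitianPlaneBundle X) (x : X) : Module.finrank ℂ (V.fiber x) = 2 := by
  have e := ((trivializationAt C2 V.fiber x).continuousLinearEquivAt ℂ x
    (FiberBundle.mem_baseSet_trivializationAt' x)).toLinearEquiv.finrank_eq
  rw [e]; simp

lemma exists_orthonormalBasis {y : X} {s : Fin 2 → V.fiber y} (hs : Orthonormal ℂ s) :
    ∃ b : OrthonormalBasis (Fin 2) ℂ (V.fiber y), ∀ a, b a = s a :=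
  ⟨(basisOfOrthonormalOfCardEqFinrank hs (by simp [finrank_fiber])).toOrthonormalBasis (by simpa),
    fun a => by simp⟩

lemma eventually_normalize {x : X} {s : ∀ x, V.fiber x} (hs : ∀ᶠ y in 𝓝 x, IsSectionAt V ∞ s y)
    (hx : s x ≠ 0) : ∀ᶠ y in 𝓝 x, IsSectionAt V ∞ (fun y => (‖s y‖⁻¹ : ℝ) • s y) y ∧
      ‖(‖s y‖⁻¹ : ℝ) • s y‖ = 1 := by
  have hsq : ∀ y, ‖s y‖ = √(inner ℝ (s y) (s y) : ℝ) := fun y => by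
    rw [real_inner_self_eq_norm_sq, Real.sqrt_sq (norm_nonneg _)]
  have hc : ContinuousAt (fun y => ‖s y‖) x := by
    simp only [hsq]
    exact (hs.self_of_nhds.real_inner le_rfl hs.self_of_nhds).continuousAt.sqrt
  have hne : ∀ᶠ y in 𝓝 x, ‖s y‖ ≠ 0 := hc.eventually_ne (norm_ne_zero_iff.2 hx)
  filter_upwards [hs, hne] with y hy hy0
  refine ⟨IsSectionAt.real_smul ?_ hy, ?_⟩
  · have h1 : ContDiffAt ℝ ∞ (fun r : ℝ => (√r)⁻¹) (inner ℝ (s y) (s y)) :=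
      (Real.contDiffAt_sqrt (by rw [real_inner_self_eq_norm_sq]; positivity)).inv
        (by rw [← hsq]; exact hy0)
    simp only [hsq]
    exact ContMDiffAt.comp (I' := 𝓘(ℝ, ℝ)) y (g := fun r : ℝ => (√r)⁻¹)
      (f := fun y => (inner ℝ (s y) (s y) : ℝ)) h1.contMDiffAt (hy.real_inner le_rfl hy)
  · rw [norm_smul, norm_inv, norm_norm, inv_mul_cancel₀ hy0]

/-- Gram–Schmidt near x, starting from extensions of an orthonormal basis, followed by a cutoff. The
sections are global and smooth, but orthonormal only near x. -/
lemma exists_orthonormal_frame [IsManifold (𝓡 4) ∞ X] [T2Space X] (V : HermitianPlaneBundle X)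
    (x : X) : ∃ s : Fin 2 → ∀ y, V.fiber y, (∀ a, IsSection V ∞ (s a)) ∧
      ∀ᶠ y in 𝓝 x, Orthonormal ℂ fun a => s a y := by
  let b : OrthonormalBasis (Fin 2) ℂ (V.fiber x) :=
    (stdOrthonormalBasis ℂ (V.fiber x)).reindex (finCongr (finrank_fiber V x))
  have h0 : ∀ a, FiberBundle.extend C2 (b a) x = b a := fun a => FiberBundle.extend_apply_self _ _
  have hb : ∀ a, ‖b a‖ = 1 := b.orthonormal.1
  have n0 := eventually_normalize (isSectionAt_extend (b 0)) (by
    rw [h0]; exact norm_ne_zero_iff.1 (by simp [hb]))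
  set s₀ : ∀ y, V.fiber y := fun y =>
    (‖(FiberBundle.extend C2 (b 0) y : V.fiber y)‖⁻¹ : ℝ) • FiberBundle.extend C2 (b 0) y
  have hs₀ : s₀ x = b 0 := by simp [s₀, hb]
  set τ : ∀ y, V.fiber y := fun y => FiberBundle.extend C2 (b 1) y -
    (inner ℂ (s₀ y) (FiberBundle.extend C2 (b 1) y) : ℂ) • s₀ y
  have hτ : ∀ᶠ y in 𝓝 x, IsSectionAt V ∞ τ y := by
    filter_upwards [n0, isSectionAt_extend (b 1)] with y hy hy1
    exact hy1.sub (hy.1.smul le_rfl (hy.1.complex_inner le_rfl hy1))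
  have hτx : τ x = b 1 := by
    have : (inner ℂ (b 0) (b 1) : ℂ) = 0 := b.orthonormal.2 (by decide)
    simp [τ, hs₀, this]
  have n1 := eventually_normalize hτ (by rw [hτx]; exact norm_ne_zero_iff.1 (by simp [hb]))
  obtain ⟨t₀, ht₀, e₀⟩ := exists_isSection_eventuallyEq (n0.mono fun y hy => hy.1)
  obtain ⟨t₁, ht₁, e₁⟩ := exists_isSection_eventuallyEq (n1.mono fun y hy => hy.1)
  refine ⟨![t₀, t₁], fun a => by fin_cases a <;> assumption, ?_⟩
  filter_upwards [n0, n1, e₀, e₁] with y h₀ h₁ f₀ f₁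
  have horth : (inner ℂ (s₀ y) (τ y) : ℂ) = 0 := by
    have hn : (inner ℂ (s₀ y) (s₀ y) : ℂ) = 1 := by
      rw [inner_self_eq_norm_sq_to_K, h₀.2]; simp
    simp only [τ, inner_sub_right, inner_smul_right, hn]
    ring
  refine ⟨fun a => ?_, fun a c hac => ?_⟩
  · fin_cases a
    · simpa [f₀] using h₀.2
    · simpa [f₁] using h₁.2
  · have h01 : (inner ℂ (s₀ y) ((‖τ y‖⁻¹ : ℝ) • τ y) : ℂ) = 0 := by
      rw [← Complex.coe_smul, inner_smul_right, horth, mul_zero]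
    fin_cases a <;> fin_cases c
    · exact absurd rfl hac
    · change (inner ℂ (t₀ y) (t₁ y) : ℂ) = 0
      rw [f₀, f₁, h01]
    · change (inner ℂ (t₁ y) (t₀ y) : ℂ) = 0
      rw [f₀, f₁, inner_eq_zero_symm, h01]
    · exact absurd rfl hac

end OrthonormalFrames

/-! ### Contractions in the fibres of V ⊗ E -/

section TensorAlgebra

set_option linter.unusedSectionVars false

variable {X : Type*} [TopologicalSpace X] [ChartedSpace R4 X] [IsManifold (𝓡 4) ∞ X]
  [Bundle.RiemannianBundle (fun x : X => TangentSpace (𝓡 4) x)]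
  {V V' E : HermitianPlaneBundle X} {x : X}

@[simp]
lemma contract_tmul (s : E.fiber x) (w : V.fiber x) (ξ : E.fiber x) :
    contract s (w ⊗ₜ[ℂ] ξ) = (inner ℂ s ξ : ℂ) • w := by
  simp [contract]

lemma contract_add_left (s t : E.fiber x) (Φ : Tensor V E x) :
    contract (s + t) Φ = contract s Φ + contract t Φ := by
  simp [contract, LinearMap.lTensor_add]

lemma contract_smul_left (c : ℂ) (s : E.fiber x) (Φ : Tensor V E x) :
    contract (c • s) Φ = (starRingEnd ℂ) c • contract s Φ := by
  simp [contract, LinearMap.lTensor_smul]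

lemma contract_sum_left {ι : Type*} (S : Finset ι) (s : ι → E.fiber x) (Φ : Tensor V E x) :
    contract (∑ i ∈ S, s i) Φ = ∑ i ∈ S, contract (s i) Φ := by
  induction S using Finset.cons_induction with
  | empty => simp [contract]
  | cons a S ha h => rw [Finset.sum_cons, Finset.sum_cons, contract_add_left, h]

lemma sum_contract_tmul {ι : Type*} [Fintype ι] (t : OrthonormalBasis ι ℂ (E.fiber x))
    (Φ : Tensor V E x) : ∑ b, contract (t b) Φ ⊗ₜ[ℂ] t b = Φ := by
  induction Φ using TensorProduct.induction_on with
  | zero => simp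
  | tmul w ξ =>
    simp only [contract_tmul, TensorProduct.smul_tmul, ← TensorProduct.tmul_sum]
    rw [t.sum_repr' ξ]
  | add Φ Ψ h1 h2 => simp only [map_add, TensorProduct.add_tmul, Finset.sum_add_distrib, h1, h2]

lemma inner_tmul_left (w : V.fiber x) (ξ : E.fiber x) (Φ : Tensor V E x) :
    (inner ℂ (w ⊗ₜ[ℂ] ξ) Φ : ℂ) = inner ℂ w (contract ξ Φ) := by
  induction Φ using TensorProduct.induction_on with
  | zero => simp
  | tmul w' ξ' => simp [mul_comm]
  | add Φ Ψ h1 h2 => simp only [map_add, inner_add_right, h1, h2]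

lemma inner_eq_sum_contract {ι : Type*} [Fintype ι] (t : OrthonormalBasis ι ℂ (E.fiber x))
    (Φ Ψ : Tensor V E x) :
    (inner ℂ Φ Ψ : ℂ) = ∑ b, inner ℂ (contract (t b) Φ) (contract (t b) Ψ) := by
  conv_lhs => rw [← sum_contract_tmul t Φ]
  simp only [sum_inner, inner_tmul_left]

/-- An element is recovered from its contractions with an orthonormal basis, so identities in V ⊗ E
can be checked in V. -/
lemma tensor_ext {Φ Ψ : Tensor V E x} (h : ∀ s : E.fiber x, contract s Φ = contract s Ψ) :
    Φ = Ψ := by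
  rw [← sum_contract_tmul (stdOrthonormalBasis ℂ (E.fiber x)) Φ,
    ← sum_contract_tmul (stdOrthonormalBasis ℂ (E.fiber x)) Ψ]
  simp only [h]

lemma contract_rTensor (f : V.fiber x →ₗ[ℂ] V'.fiber x) (s : E.fiber x) (Φ : Tensor V E x) :
    contract s (LinearMap.rTensor (E.fiber x) f Φ) = f (contract s Φ) := by
  induction Φ using TensorProduct.induction_on with
  | zero => simp
  | tmul w ξ => simp
  | add Φ Ψ h1 h2 => simp only [map_add, h1, h2]

end TensorAlgebra

/-! ### The tensor product connection -/

section TensorCalculus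

set_option linter.unusedSectionVars false

variable {X : Type*} [TopologicalSpace X] [ChartedSpace R4 X] [IsManifold (𝓡 4) ∞ X] [T2Space X]
  [Bundle.RiemannianBundle (fun x : X => TangentSpace (𝓡 4) x)]
  {V V' E : HermitianPlaneBundle X} {x : X} {n : WithTop ℕ∞}

/-- The section `Φ` of `V ⊗ E` is of class `C^n` at `x`. -/
def TensorAt (V E : HermitianPlaneBundle X) (n : WithTop ℕ∞) (Φ : ∀ x, Tensor V E x) (x : X) :
    Prop :=
  ∀ s : ∀ x, E.fiber x, IsSectionAt E n s x → IsSectionAt V n (fun y => contract (s y) (Φ y)) x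

/-- A section is a combination of the members of an orthonormal frame. -/
lemma eventually_eq_sum_frame {t : Fin 2 → ∀ y, E.fiber y}
    (ht : ∀ᶠ y in 𝓝 x, Orthonormal ℂ fun a => t a y) (s : ∀ y, E.fiber y) :
    ∀ᶠ y in 𝓝 x, s y = ∑ b, (inner ℂ (t b y) (s y) : ℂ) • t b y := by
  filter_upwards [ht] with y hy
  obtain ⟨b, hb⟩ := exists_orthonormalBasis hy
  simp only [← hb, b.sum_repr']

lemma eventually_contract_eq_sum {t : Fin 2 → ∀ y, E.fiber y}
    (ht : ∀ᶠ y in 𝓝 x, Orthonormal ℂ fun a => t a y) (s : ∀ y, E.fiber y)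
    (Φ : ∀ y, Tensor V E y) : ∀ᶠ y in 𝓝 x, contract (s y) (Φ y) =
      ∑ b, (starRingEnd ℂ) (inner ℂ (t b y) (s y) : ℂ) • contract (t b y) (Φ y) := by
  filter_upwards [eventually_eq_sum_frame ht s] with y hy
  conv_lhs => rw [hy]
  simp only [contract_sum_left, contract_smul_left]

/-- Smooth test sections suffice: a test section of class `C^n` has coefficients of class `C^n` in a
smooth orthonormal frame. -/
lemma IsTensorSection.at {Φ : ∀ x, Tensor V E x} (hn : n ≤ (∞ : WithTop ℕ∞))
    (h : IsTensorSection V E n Φ) (x : X) : TensorAt V E n Φ x := by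
  intro s hs
  obtain ⟨t, ht, hto⟩ := exists_orthonormal_frame E x
  refine IsSectionAt.congr ?_ (eventually_contract_eq_sum hto s Φ)
  exact .sum fun b _ => .smul hn (contMDiffAt_conj ((((ht b).at x).of_le hn).complex_inner hn hs))
    (h _ (ht b) x)

namespace TensorAt

variable {Φ Ψ : ∀ x, Tensor V E x}

/-- Lowering the class enlarges the family of test sections, so monotonicity is not formal;
expansion in a smooth frame is needed again. -/
lemma of_le_one (h : TensorAt V E n Φ x) (h1 : 1 ≤ n) (hn : n ≤ (∞ : WithTop ℕ∞)) :
    TensorAt V E 1 Φ x := by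
  intro s hs
  obtain ⟨t, ht, hto⟩ := exists_orthonormal_frame E x
  refine IsSectionAt.congr ?_ (eventually_contract_eq_sum hto s Φ)
  exact .sum fun b _ => .smul one_le_infty
    (contMDiffAt_conj ((((ht b).at x).of_le one_le_infty).complex_inner one_le_infty hs))
    ((h _ ((ht b x).of_le hn)).of_le h1)

lemma add (hΦ : TensorAt V E n Φ x) (hΨ : TensorAt V E n Ψ x) :
    TensorAt V E n (fun y => Φ y + Ψ y) x := fun s hs => by
  simp only [map_add]
  exact (hΦ s hs).add (hΨ s hs)

lemma smul (hn : n ≤ (∞ : WithTop ℕ∞)) {f : X → ℂ} (hf : ContMDiffAt (𝓡 4) 𝓘(ℝ, ℂ) n f x)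
    (hΦ : TensorAt V E n Φ x) : TensorAt V E n (fun y => f y • Φ y) x := fun s hs => by
  simp only [map_smul]
  exact (hΦ s hs).smul hn hf

lemma sum {ι : Type*} {S : Finset ι} {Φ : ι → ∀ x, Tensor V E x}
    (h : ∀ i ∈ S, TensorAt V E n (Φ i) x) : TensorAt V E n (fun y => ∑ i ∈ S, Φ i y) x :=
  fun s hs => by
    simp only [map_sum]
    exact .sum fun i hi => h i hi s hs

lemma congr (hΦ : TensorAt V E n Φ x) (h : ∀ᶠ y in 𝓝 x, Ψ y = Φ y) : TensorAt V E n Ψ x :=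
  fun s hs => (hΦ s hs).congr (h.mono fun y hy => by rw [hy])

lemma tmul (hn : n ≤ (∞ : WithTop ℕ∞)) {s : ∀ x, V.fiber x} {t : ∀ x, E.fiber x}
    (hs : IsSectionAt V n s x) (ht : IsSectionAt E n t x) :
    TensorAt V E n (fun y => s y ⊗ₜ[ℂ] t y) x := fun r hr => by
  simp only [contract_tmul]
  exact .smul hn (hr.complex_inner hn ht) hs

lemma inner (hn : n ≤ (∞ : WithTop ℕ∞)) (hΦ : TensorAt V E n Φ x) (hΨ : TensorAt V E n Ψ x) :
    ContMDiffAt (𝓡 4) 𝓘(ℝ, ℂ) n (fun y => (inner ℂ (Φ y) (Ψ y) : ℂ)) x := by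
  obtain ⟨t, ht, hto⟩ := exists_orthonormal_frame E x
  have h : ContMDiffAt (𝓡 4) 𝓘(ℝ, ℂ) n (fun y => ∑ b,
      (Inner.inner ℂ (contract (t b y) (Φ y)) (contract (t b y) (Ψ y)) : ℂ)) x :=
    contMDiffAt_fun_sum fun b _ => (hΦ _ ((ht b x).of_le hn)).complex_inner hn
      (hΨ _ ((ht b x).of_le hn))
  refine h.congr_of_eventuallyEq ?_
  filter_upwards [hto] with y hy
  obtain ⟨b, hb⟩ := exists_orthonormalBasis hy
  simp only [← hb, inner_eq_sum_contract b]

end TensorAt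

variable {B : Connection V} (hB : IsUnitary B) {A : Connection E} (hA : IsUnitary A)
  {Φ Ψ : ∀ x, Tensor V E x}
include hB hA

/-- The defining property of the tensor product connection. -/
lemma contract_tensorDeriv (hΦ : TensorAt V E 1 Φ x) {t : ∀ x, E.fiber x}
    (ht : IsSectionAt E 1 t x) (v : T x) :
    contract (t x) (tensorDeriv B A Φ x v) =
      B (fun y => contract (t y) (Φ y)) x v - contract (A t x v) (Φ x) := by
  obtain ⟨r, hr, hro⟩ := exists_orthonormal_frame E x
  have hr1 : ∀ b, IsSectionAt E 1 (r b) x := fun b => (hr b x).of_le one_le_infty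
  set T : (∀ x, E.fiber x) → V.fiber x := fun t =>
    B (fun y => contract (t y) (Φ y)) x v - contract (A t x v) (Φ x)
  -- The derivatives of the coefficients of `t` cancel between the two terms of `T`. Hence `T`
  -- depends on `t` only through its value at x, conjugate linearly, and the extensions used in
  -- `tensorDeriv` do not matter.
  have key : ∀ t, IsSectionAt E 1 t x → T t =
      ∑ b, (starRingEnd ℂ) (inner ℂ (r b x) (t x) : ℂ) • T (r b) := by
    intro t ht
    have hc : ∀ b, ContMDiffAt (𝓡 4) 𝓘(ℝ, ℂ) 1 (fun y => (inner ℂ (r b y) (t y) : ℂ)) x := fun b =>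
      (hr1 b).complex_inner one_le_infty ht
    have h1 : B (fun y => contract (t y) (Φ y)) x v = ∑ b,
        ((starRingEnd ℂ) (inner ℂ (r b x) (t x) : ℂ) • B (fun y => contract (r b y) (Φ y)) x v +
        (starRingEnd ℂ) (mvfderiv (𝓡 4) (fun y => (inner ℂ (r b y) (t y) : ℂ)) x v) •
          contract (r b x) (Φ x)) := by
      have hs : ∀ b ∈ Finset.univ, IsSectionAt V 1 (fun y => (starRingEnd ℂ)
          (inner ℂ (r b y) (t y) : ℂ) • contract (r b y) (Φ y)) x := fun b _ =>
        .smul one_le_infty (contMDiffAt_conj (hc b)) (hΦ _ (hr1 b))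
      rw [connection_congr B (.sum hs) (eventually_contract_eq_sum hro t Φ), hB.map_sum hs]
      refine Finset.sum_congr rfl fun b _ => ?_
      rw [hB.leibniz (contMDiffAt_conj (hc b)) (hΦ _ (hr1 b)),
        mvfderiv_conj ((hc b).mdifferentiableAt one_ne_zero)]
    have h2 : A t x v = ∑ b, ((inner ℂ (r b x) (t x) : ℂ) • A (r b) x v +
        mvfderiv (𝓡 4) (fun y => (inner ℂ (r b y) (t y) : ℂ)) x v • r b x) := by
      have hs : ∀ b ∈ Finset.univ, IsSectionAt E 1 (fun y => (inner ℂ (r b y) (t y) : ℂ) • r b y) x :=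
        fun b _ => .smul one_le_infty (hc b) (hr1 b)
      rw [connection_congr A (.sum hs) (eventually_eq_sum_frame hro t), hA.map_sum hs]
      exact Finset.sum_congr rfl fun b _ => hA.leibniz (hc b) (hr1 b) v
    simp only [T, h1, h2, contract_sum_left, contract_add_left, contract_smul_left, smul_sub,
      Finset.sum_add_distrib, Finset.sum_sub_distrib]
    abel
  obtain ⟨rb, hrb⟩ := exists_orthonormalBasis hro.self_of_nhds
  have he : ∀ b, IsSectionAt E 1 (FiberBundle.extend C2 (fiberBasis E x b)) x := fun b =>
    (isSectionAt_extend _).self_of_nhds.of_le one_le_infty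
  have e1 : tensorDeriv B A Φ x v =
      ∑ b, T (FiberBundle.extend C2 (fiberBasis E x b)) ⊗ₜ[ℂ] fiberBasis E x b := rfl
  rw [e1, map_sum]
  change _ = T t
  simp only [contract_tmul, key _ (he _), key t ht, FiberBundle.extend_apply_self, Finset.smul_sum,
    smul_smul]
  rw [Finset.sum_comm]
  refine Finset.sum_congr rfl fun b _ => ?_
  rw [← Finset.sum_smul]
  congr 1
  simp only [inner_conj_symm]
  exact (fiberBasis E x).sum_inner_mul_inner (t x) (r b x)

omit hB hA in
lemma exists_isSection_eq (σ : E.fiber x) : ∃ s, IsSection E ∞ s ∧ s x = σ := by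
  obtain ⟨s, hs, h⟩ := exists_isSection_eventuallyEq (isSectionAt_extend σ)
  exact ⟨s, hs, by rw [h.self_of_nhds, FiberBundle.extend_apply_self]⟩

/-- The contraction rule characterises the derivative; the algebraic rules below are verified
through it. -/
lemma tensorDeriv_eq_of_contract (hΦ : TensorAt V E 1 Φ x) (v : T x) {Ξ : Tensor V E x}
    (h : ∀ t, IsSection E ∞ t → contract (t x) Ξ =
      B (fun y => contract (t y) (Φ y)) x v - contract (A t x v) (Φ x)) :
    tensorDeriv B A Φ x v = Ξ := by
  refine tensor_ext fun σ => ?_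
  obtain ⟨t, ht, rfl⟩ := exists_isSection_eq σ
  rw [contract_tensorDeriv hB hA hΦ ((ht x).of_le one_le_infty), h t ht]

lemma tensorDeriv_congr (hΦ : TensorAt V E 1 Φ x) (h : ∀ᶠ y in 𝓝 x, Ψ y = Φ y) (v : T x) :
    tensorDeriv B A Ψ x v = tensorDeriv B A Φ x v := by
  refine tensorDeriv_eq_of_contract hB hA (hΦ.congr h) v fun t ht => ?_
  have ht1 : IsSectionAt E 1 t x := (ht x).of_le one_le_infty
  have hc : ∀ᶠ y in 𝓝 x, contract (t y) (Ψ y) = contract (t y) (Φ y) := h.mono fun y hy => by rw [hy]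
  rw [contract_tensorDeriv hB hA hΦ ht1, h.self_of_nhds, connection_congr B (hΦ t ht1) hc]

lemma tensorDeriv_add (hΦ : TensorAt V E 1 Φ x) (hΨ : TensorAt V E 1 Ψ x) (v : T x) :
    tensorDeriv B A (fun y => Φ y + Ψ y) x v = tensorDeriv B A Φ x v + tensorDeriv B A Ψ x v := by
  refine tensorDeriv_eq_of_contract hB hA (hΦ.add hΨ) v fun t ht => ?_
  have ht1 : IsSectionAt E 1 t x := (ht x).of_le one_le_infty
  simp only [map_add]
  rw [contract_tensorDeriv hB hA hΦ ht1, contract_tensorDeriv hB hA hΨ ht1,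
    connection_add B (hΦ t ht1) (hΨ t ht1)]
  abel

lemma tensorDeriv_sum {ι : Type*} {S : Finset ι} {Φ : ι → ∀ x, Tensor V E x}
    (h : ∀ i ∈ S, TensorAt V E 1 (Φ i) x) (v : T x) :
    tensorDeriv B A (fun y => ∑ i ∈ S, Φ i y) x v = ∑ i ∈ S, tensorDeriv B A (Φ i) x v := by
  refine tensorDeriv_eq_of_contract hB hA (.sum h) v fun t ht => ?_
  have ht1 : IsSectionAt E 1 t x := (ht x).of_le one_le_infty
  simp only [map_sum]
  rw [hB.map_sum fun i hi => h i hi t ht1, ← Finset.sum_sub_distrib]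
  exact Finset.sum_congr rfl fun i hi => contract_tensorDeriv hB hA (h i hi) ht1 v

lemma tensorDeriv_smul {f : X → ℂ} (hf : ContMDiffAt (𝓡 4) 𝓘(ℝ, ℂ) 1 f x)
    (hΦ : TensorAt V E 1 Φ x) (v : T x) :
    tensorDeriv B A (fun y => f y • Φ y) x v =
      f x • tensorDeriv B A Φ x v + mvfderiv (𝓡 4) f x v • Φ x := by
  refine tensorDeriv_eq_of_contract hB hA (hΦ.smul one_le_infty hf) v fun t ht => ?_
  have ht1 : IsSectionAt E 1 t x := (ht x).of_le one_le_infty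
  simp only [map_add, map_smul]
  rw [contract_tensorDeriv hB hA hΦ ht1, hB.leibniz hf (hΦ t ht1), smul_sub]
  abel

lemma tensorDeriv_tmul {s : ∀ x, V.fiber x} {t : ∀ x, E.fiber x} (hs : IsSectionAt V 1 s x)
    (ht : IsSectionAt E 1 t x) (v : T x) :
    tensorDeriv B A (fun y => s y ⊗ₜ[ℂ] t y) x v = B s x v ⊗ₜ[ℂ] t x + s x ⊗ₜ[ℂ] A t x v := by
  refine tensorDeriv_eq_of_contract hB hA (.tmul one_le_infty hs ht) v fun r hr => ?_
  have hr1 : IsSectionAt E 1 r x := (hr x).of_le one_le_infty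
  simp only [map_add, contract_tmul]
  rw [hB.leibniz (hr1.complex_inner one_le_infty ht) hs, hA.mvfderiv_inner hr1 ht, add_smul]
  abel

/-- The tensor product connection is unitary. -/
lemma mvfderiv_inner_tensor (hΦ : TensorAt V E 1 Φ x) (hΨ : TensorAt V E 1 Ψ x) (v : T x) :
    mvfderiv (𝓡 4) (fun y => (inner ℂ (Φ y) (Ψ y) : ℂ)) x v =
      inner ℂ (tensorDeriv B A Φ x v) (Ψ x) + inner ℂ (Φ x) (tensorDeriv B A Ψ x v) := by
  obtain ⟨r, hr, hro⟩ := exists_orthonormal_frame E x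
  have hr1 : ∀ b, IsSectionAt E 1 (r b) x := fun b => (hr b x).of_le one_le_infty
  have h : (fun y => (inner ℂ (Φ y) (Ψ y) : ℂ)) =ᶠ[𝓝 x] fun y => ∑ b,
      (inner ℂ (contract (r b y) (Φ y)) (contract (r b y) (Ψ y)) : ℂ) := by
    filter_upwards [hro] with y hy
    obtain ⟨b, hb⟩ := exists_orthonormalBasis hy
    simp only [← hb, inner_eq_sum_contract b]
  obtain ⟨rb, hrb⟩ := exists_orthonormalBasis hro.self_of_nhds
  -- The connection matrix in an orthonormal frame is skew-Hermitian, which cancels the terms of the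
  -- connection on E in `e3`.
  have hsk : ∀ b c, (inner ℂ (A (r b) x v) (r c x) : ℂ) + inner ℂ (r b x) (A (r c) x v) = 0 := by
    intro b c
    rw [← hA.mvfderiv_inner (hr1 b) (hr1 c)]
    have : (fun y => (inner ℂ (r b y) (r c y) : ℂ)) =ᶠ[𝓝 x] fun _ => if b = c then 1 else 0 := by
      filter_upwards [hro] with y hy using orthonormal_iff_ite.1 hy b c
    rw [mvfderiv_congr this, mvfderiv_fun_const]
  have hexp : ∀ b, A (r b) x v = ∑ c, (inner ℂ (r c x) (A (r b) x v) : ℂ) • r c x := fun b => by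
    simp only [← hrb, rb.sum_repr']
  have hdf : ∀ b ∈ Finset.univ, ContMDiffAt (𝓡 4) 𝓘(ℝ, ℂ) 1 (fun y =>
      (inner ℂ (contract (r b y) (Φ y)) (contract (r b y) (Ψ y)) : ℂ)) x := fun b _ =>
    (hΦ _ (hr1 b)).complex_inner one_le_infty (hΨ _ (hr1 b))
  rw [mvfderiv_congr h, mvfderiv_fun_sum hdf, inner_eq_sum_contract rb, inner_eq_sum_contract rb]
  simp only [hrb, contract_tensorDeriv hB hA hΦ (hr1 _), contract_tensorDeriv hB hA hΨ (hr1 _),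
    hB.mvfderiv_inner (hΦ _ (hr1 _)) (hΨ _ (hr1 _)), inner_sub_left, inner_sub_right,
    Finset.sum_add_distrib, Finset.sum_sub_distrib]
  have e1 : ∑ b, (inner ℂ (contract (A (r b) x v) (Φ x)) (contract (r b x) (Ψ x)) : ℂ) =
      ∑ b, ∑ c, (inner ℂ (r c x) (A (r b) x v) : ℂ) *
        inner ℂ (contract (r c x) (Φ x)) (contract (r b x) (Ψ x)) := by
    refine Finset.sum_congr rfl fun b _ => ?_
    conv_lhs => rw [hexp b]
    simp only [contract_sum_left, contract_smul_left, sum_inner, inner_smul_left, Complex.conj_conj]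
  have e2 : ∑ b, (inner ℂ (contract (r b x) (Φ x)) (contract (A (r b) x v) (Ψ x)) : ℂ) =
      ∑ b, ∑ c, (inner ℂ (A (r c) x v) (r b x) : ℂ) *
        inner ℂ (contract (r c x) (Φ x)) (contract (r b x) (Ψ x)) := by
    rw [Finset.sum_comm]
    refine Finset.sum_congr rfl fun b _ => ?_
    conv_lhs => rw [hexp b]
    simp only [contract_sum_left, contract_smul_left, inner_sum, inner_smul_right, inner_conj_symm]
  have e3 : ∑ b, (inner ℂ (contract (A (r b) x v) (Φ x)) (contract (r b x) (Ψ x)) : ℂ) +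
      ∑ b, (inner ℂ (contract (r b x) (Φ x)) (contract (A (r b) x v) (Ψ x)) : ℂ) = 0 := by
    rw [e1, e2, ← Finset.sum_add_distrib]
    refine Finset.sum_eq_zero fun b _ => ?_
    rw [← Finset.sum_add_distrib]
    refine Finset.sum_eq_zero fun c _ => ?_
    rw [← add_mul, add_comm, hsk c b, zero_mul]
  linear_combination e3

end TensorCalculus

/-! ### Vector fields and the Levi-Civita connection -/

section TangentCalculus

set_option linter.unusedSectionVars false

variable {X : Type*} [TopologicalSpace X] [ChartedSpace R4 X] [IsManifold (𝓡 4) ∞ X]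
  [Bundle.RiemannianBundle (fun x : X => TangentSpace (𝓡 4) x)]
  [IsContMDiffRiemannianBundle (𝓡 4) ∞ R4 (fun x : X => TangentSpace (𝓡 4) x)]

/-- The vector field `Y` is of class `C^n` at `x`. -/
def FieldAt (n : WithTop ℕ∞) (Y : ∀ x : X, T x) (x : X) : Prop :=
  ContMDiffAt (𝓡 4) ((𝓡 4).prod 𝓘(ℝ, R4)) n
    (fun x => (⟨x, Y x⟩ : Bundle.TotalSpace R4 (TangentSpace (𝓡 4) : X → Type _))) x

lemma FieldAt.of_le {m n : WithTop ℕ∞} {Y : ∀ x : X, T x} {x : X} (h : FieldAt n Y x)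
    (hm : m ≤ n) : FieldAt m Y x :=
  ContMDiffAt.of_le h hm

lemma FieldAt.diffAt {Y : ∀ x : X, T x} {x : X} (h : FieldAt 1 Y x) : VectorFieldDiffAt Y x :=
  ContMDiffAt.mdifferentiableAt h one_ne_zero

lemma FieldAt.inner {n : WithTop ℕ∞} (hn : n ≤ (∞ : WithTop ℕ∞)) {Y Z : ∀ x : X, T x} {x : X}
    (hY : FieldAt n Y x) (hZ : FieldAt n Z x) :
    ContMDiffAt (𝓡 4) 𝓘(ℝ, ℝ) n (fun y => (Inner.inner ℝ (Y y) (Z y) : ℝ)) x := by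
  have h' : IsContMDiffRiemannianBundle (𝓡 4) n R4 (fun x : X => TangentSpace (𝓡 4) x) :=
    IsContMDiffRiemannianBundle.of_le hn
  exact ContMDiffAt.inner_bundle hY hZ

variable {D : TangentConnection X} (hD : IsLeviCivita D)
include hD

lemma IsLeviCivita.isMetric : IsMetric D := fun s t x v hs ht =>
  hD.metric s t x v (FieldAt.diffAt hs) (FieldAt.diffAt ht)

lemma IsLeviCivita.hasC1Symbols : HasC1Symbols D :=
  hasC1Symbols_of_class hD.smooth one_le_infty le_rfl

end TangentCalculus

/-! ### Coordinate frames and their dual fields -/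

section DualFrames

set_option linter.unusedSectionVars false

variable {X : Type*} [TopologicalSpace X] [ChartedSpace R4 X]

lemma contMDiffAt_det {n : WithTop ℕ∞} {ι : Type*} [Fintype ι] [DecidableEq ι]
    {G : X → Matrix ι ι ℝ} {x : X}
    (hG : ∀ i j, ContMDiffAt (𝓡 4) 𝓘(ℝ, ℝ) n (fun y => G y i j) x) :
    ContMDiffAt (𝓡 4) 𝓘(ℝ, ℝ) n (fun y => (G y).det) x := by
  simp only [Matrix.det_apply']
  refine contMDiffAt_fun_sum fun σ _ => ?_
  exact contMDiffAt_const.mul (contMDiffAt_finsetProd fun i _ => hG _ _)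

lemma contMDiffAt_matrix_inv {n : WithTop ℕ∞} {ι : Type*} [Fintype ι] [DecidableEq ι]
    {G : X → Matrix ι ι ℝ} {x : X}
    (hG : ∀ i j, ContMDiffAt (𝓡 4) 𝓘(ℝ, ℝ) n (fun y => G y i j) x) (hx : (G x).det ≠ 0) (i j : ι) :
    ContMDiffAt (𝓡 4) 𝓘(ℝ, ℝ) n (fun y => (G y)⁻¹ i j) x := by
  simp only [Matrix.inv_def, Ring.inverse_eq_inv, Matrix.smul_apply, smul_eq_mul]
  refine ((contMDiffAt_det hG).inv₀ hx).mul ?_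
  simp only [Matrix.adjugate_apply]
  refine contMDiffAt_det fun k l => ?_
  by_cases hk : k = j
  · subst hk
    simpa using contMDiffAt_const
  · simpa [Matrix.updateRow_ne hk] using hG k l

variable [IsManifold (𝓡 4) ∞ X] [T2Space X]
  [Bundle.RiemannianBundle (fun x : X => TangentSpace (𝓡 4) x)]
  [IsContMDiffRiemannianBundle (𝓡 4) ∞ R4 (fun x : X => TangentSpace (𝓡 4) x)]

/-- A coordinate frame that is orthonormal at `x₀`, with smooth fields that are dual to it near
`x₀`. -/
lemma exists_dual_frame (x₀ : X) : ∃ (w : Fin 4 → R4) (f : Fin 4 → ∀ y : X, T y),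
    (∀ i, coordField x₀ (w i) x₀ = frame x₀ i) ∧
    (∀ i, (FiberBundle.extend R4 (frame x₀ i) : ∀ y : X, T y) = coordField x₀ (w i)) ∧
    (∀ j, IsVectorField ∞ (f j)) ∧
    ∀ᶠ y in 𝓝 x₀, ∀ j k, (inner ℝ (f j y) (coordField x₀ (w k) y) : ℝ) = if j = k then 1 else 0 := by
  choose w hw hwe using fun i => exists_coordField_self x₀ (frame x₀ i)
  have he : ∀ i, ∀ y ∈ (chartAt R4 x₀).source, FieldAt ∞ (coordField x₀ (w i)) y := fun i y hy =>
    contMDiffAt_coordField hy (w i)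
  -- The Gram matrix of the coordinate frame is the identity at `x₀`, hence invertible nearby; its
  -- inverse supplies the coefficients of the dual fields.
  set G : X → Matrix (Fin 4) (Fin 4) ℝ := fun y =>
    Matrix.of fun i j => inner ℝ (coordField x₀ (w i) y) (coordField x₀ (w j) y)
  have hG : ∀ y ∈ (chartAt R4 x₀).source, ∀ i j,
      ContMDiffAt (𝓡 4) 𝓘(ℝ, ℝ) ∞ (fun y => G y i j) y := fun y hy i j =>
    (he i y hy).inner le_rfl (he j y hy)
  have hx := mem_chart_source R4 x₀
  have h0 : G x₀ = 1 := by
    ext i j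
    simp only [G, Matrix.of_apply, hw, Matrix.one_apply]
    exact orthonormal_iff_ite.1 (frame x₀).orthonormal i j
  have hdet : ∀ᶠ y in 𝓝 x₀, (G y).det ≠ 0 :=
    (contMDiffAt_det (hG x₀ hx)).continuousAt.eventually_ne (by simp [h0])
  have hsrc : ∀ᶠ y in 𝓝 x₀, y ∈ (chartAt R4 x₀).source := (chartAt R4 x₀).open_source.mem_nhds hx
  have hf : ∀ j, ∀ᶠ y in 𝓝 x₀,
      FieldAt ∞ (fun y => ∑ k, (G y)⁻¹ j k • coordField x₀ (w k) y) y := fun j => by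
    filter_upwards [hdet, hsrc] with y hy hy'
    exact ContMDiffAt.sum_section fun k _ =>
      ContMDiffAt.smul_section (contMDiffAt_matrix_inv (hG y hy') hy j k) (he k y hy')
  choose f hf1 hf2 using fun j => exists_contMDiff_eventuallyEq (F := R4)
    (V := (TangentSpace (𝓡 4) : X → Type _)) le_rfl (hf j)
  refine ⟨w, f, hw, hwe, hf1, ?_⟩
  filter_upwards [hdet, Filter.eventually_all.2 hf2] with y hy hfy j k
  rw [hfy, sum_inner]
  have : ∀ l, (inner ℝ ((G y)⁻¹ j l • coordField x₀ (w l) y) (coordField x₀ (w k) y) : ℝ) =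
      (G y)⁻¹ j l * G y l k := fun l => real_inner_smul_left _ _ _
  rw [Finset.sum_congr rfl fun l _ => this l, ← Matrix.mul_apply,
    Matrix.nonsing_inv_mul _ (isUnit_iff_ne_zero.2 hy), Matrix.one_apply]

end DualFrames

/-! ### Linear algebra of dual bases -/

section DualBases

set_option linter.unusedSectionVars false

variable {H G : Type*} [NormedAddCommGroup H] [InnerProductSpace ℝ H] [FiniteDimensional ℝ H]
  [AddCommGroup G] [Module ℝ G] {ι : Type*} [Fintype ι] [DecidableEq ι]

/-- Biorthogonality forces linear independence, and the count of vectors then makes `e` a basis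
whose coordinates are the products with `f`. -/
lemma eq_sum_dual (hι : Fintype.card ι = Module.finrank ℝ H) {f e : ι → H}
    (h : ∀ j k, (inner ℝ (f j) (e k) : ℝ) = if j = k then 1 else 0) (v : H) :
    v = ∑ k, (inner ℝ (f k) v : ℝ) • e k := by
  have hli : LinearIndependent ℝ e := by
    refine Fintype.linearIndependent_iff.2 fun g hg i => ?_
    have := congrArg (fun v => (inner ℝ (f i) v : ℝ)) hg
    simpa [inner_sum, inner_smul_right, h] using this
  let b := basisOfLinearIndependentOfCardEqFinrank' e hli hι
  have hb : ∀ k, b k = e k := fun k => by simp [b]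
  have hv := b.sum_repr v
  simp only [hb] at hv
  have hc : ∀ k, (inner ℝ (f k) v : ℝ) = b.repr v k := fun k => by
    conv_lhs => rw [← hv]
    simp [inner_sum, inner_smul_right, h]
  simp only [hc, hv]

lemma dual_symm {f e : ι → H} (h : ∀ j k, (inner ℝ (f j) (e k) : ℝ) = if j = k then 1 else 0)
    (j k : ι) : (inner ℝ (e j) (f k) : ℝ) = if j = k then 1 else 0 := by
  rw [real_inner_comm, h]
  simp only [eq_comm]

/-- A metric trace may be computed in any pair of dual bases. This exchanges the pointwise chosen
`frame`, which need not vary continuously, for smooth fields. -/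
lemma sum_orthonormal_eq_sum_dual (hι : Fintype.card ι = Module.finrank ℝ H) {f e : ι → H}
    (h : ∀ j k, (inner ℝ (f j) (e k) : ℝ) = if j = k then 1 else 0) {κ : Type*} [Fintype κ]
    (b : OrthonormalBasis κ ℝ H) (B : H →ₗ[ℝ] H →ₗ[ℝ] G) :
    ∑ k, B (b k) (b k) = ∑ j, B (f j) (e j) := by
  have h1 : ∀ k, B (b k) (b k) = ∑ j, (inner ℝ (e j) (b k) : ℝ) • B (f j) (b k) := fun k => by
    conv_lhs => arg 1; rw [eq_sum_dual hι (dual_symm h) (b k)]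
    simp only [map_sum, LinearMap.sum_apply, map_smul, LinearMap.smul_apply]
  simp only [h1]
  rw [Finset.sum_comm]
  refine Finset.sum_congr rfl fun j _ => ?_
  conv_rhs => rw [← b.sum_repr' (e j), map_sum]
  simp only [map_smul, real_inner_comm]

end DualBases

/-! ### Clifford multiplication and the Dirac operator in a dual frame -/

section CliffordCalculus

set_option linter.unusedSectionVars false

variable {X : Type*} [TopologicalSpace X] [ChartedSpace R4 X] [IsManifold (𝓡 4) ∞ X] [T2Space X]
  [Bundle.RiemannianBundle (fun x : X => TangentSpace (𝓡 4) x)]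
  [IsContMDiffRiemannianBundle (𝓡 4) ∞ R4 (fun x : X => TangentSpace (𝓡 4) x)]
  {o : ManifoldOrientation X} {D : TangentConnection X}

lemma tensor_real_smul {V E : HermitianPlaneBundle X} {x : X} (r : ℝ) (Ψ : Tensor V E x) :
    r • Ψ = (r : ℂ) • Ψ := by
  induction Ψ using TensorProduct.induction_on with
  | zero => simp
  | tmul w ξ => rw [TensorProduct.smul_tmul', TensorProduct.smul_tmul', Complex.coe_smul]
  | add Φ Ψ h1 h2 => rw [smul_add, smul_add, h1, h2]

section LeviCivita

variable (hD : IsLeviCivita D)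
include hD

/-- Coordinate fields have zero bracket, so vanishing torsion becomes the symmetry of the
Christoffel symbols. -/
lemma IsLeviCivita.symm_coordField {x₀ y : X} (hy : y ∈ (chartAt R4 x₀).source) (w z : R4) :
    D (coordField x₀ z) y (coordField x₀ w y) = D (coordField x₀ w) y (coordField x₀ z y) := by
  have hc : ∀ w : R4, VectorFieldDiffAt (coordField x₀ w) y := fun w =>
    (contMDiffAt_coordField hy w).mdifferentiableAt (by simp)
  have h := hD.torsion_free (coordField x₀ w) (coordField x₀ z) y (hc w) (hc z)
  rw [mlieBracket_coordField hy, sub_eq_zero] at h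
  exact h

/-- The covariant derivatives of a dual frame. -/
lemma IsLeviCivita.dual_deriv {f e : Fin 4 → ∀ y : X, T y} {y : X} (hf : ∀ j, FieldAt 1 (f j) y)
    (he : ∀ j, FieldAt 1 (e j) y)
    (h : ∀ᶠ q in 𝓝 y, ∀ j k, (inner ℝ (f j q) (e k q) : ℝ) = if j = k then 1 else 0)
    (j : Fin 4) (v : T y) :
    D (f j) y v = -∑ l, (inner ℝ (f j y) (D (e l) y v) : ℝ) • f l y := by
  have hfin : Fintype.card (Fin 4) = Module.finrank ℝ (T y) :=
    (Fintype.card_fin 4).trans (Fact.out (p := Module.finrank ℝ (T y) = 4)).symm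
  have h1 : ∀ l, (inner ℝ (e l y) (D (f j) y v) : ℝ) = -inner ℝ (f j y) (D (e l) y v) := fun l => by
    have hm := hD.metric (f j) (e l) y v (hf j).diffAt (he l).diffAt
    have hc : (fun q => (inner ℝ (f j q) (e l q) : ℝ)) =ᶠ[𝓝 y] fun _ => if j = l then 1 else 0 :=
      h.mono fun q hq => hq j l
    rw [mvfderiv_congr hc, mvfderiv_fun_const] at hm
    rw [real_inner_comm]
    linarith
  rw [eq_sum_dual hfin (dual_symm h.self_of_nhds) (D (f j) y v), ← Finset.sum_neg_distrib]
  refine Finset.sum_congr rfl fun l _ => ?_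
  rw [h1, neg_smul]

end LeviCivita

variable (S : SpincStructure o D) {E : HermitianPlaneBundle X}

/-- Clifford multiplication `ρ(v) ⊗ id` on `W⁺ ⊗ E`. -/
def cliff (E : HermitianPlaneBundle X) {x : X} (v : T x) :
    Tensor S.Wplus E x →ₗ[ℂ] Tensor S.Wminus E x :=
  LinearMap.rTensor (E.fiber x) (S.rho x v)

/-- Clifford multiplication as a real linear map. -/
def cliffMap (E : HermitianPlaneBundle X) (x : X) :
    T x →ₗ[ℝ] (Tensor S.Wplus E x →ₗ[ℂ] Tensor S.Wminus E x) where
  toFun := cliff S E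
  map_add' u v := by simp [cliff, LinearMap.rTensor_add]
  map_smul' r v := by
    have h : ∀ f : S.Wplus.fiber x →ₗ[ℂ] S.Wminus.fiber x, r • f = (r : ℂ) • f := fun f => by
      ext; simp
    have h' : ∀ f : Tensor S.Wplus E x →ₗ[ℂ] Tensor S.Wminus E x, r • f = (r : ℂ) • f := fun f =>
      LinearMap.ext fun Ψ => tensor_real_smul r _
    simp only [cliff, map_smul, RingHom.id_apply, h, h', LinearMap.rTensor_smul]

lemma cliffMap_apply (x : X) (v : T x) : cliffMap S E x v = cliff S E v := rfl

lemma contract_cliff {x : X} (v : T x) (s : E.fiber x) (Φ : Tensor S.Wplus E x) :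
    contract s (cliff S E v Φ) = S.rho x v (contract s Φ) := contract_rTensor _ _ _

/-- The structure gives smoothness of `rho` on smooth spinors only; expansion in a smooth frame
passes to spinors of class `C^n`. -/
lemma isSectionAt_rho {n : WithTop ℕ∞} (hn : n ≤ (∞ : WithTop ℕ∞)) {Y : ∀ x : X, T x}
    (hY : IsVectorField ∞ Y) {φ : ∀ x, S.Wplus.fiber x} {x : X} (hφ : IsSectionAt S.Wplus n φ x) :
    IsSectionAt S.Wminus n (fun y => S.rho y (Y y) (φ y)) x := by
  obtain ⟨s, hs, hso⟩ := exists_orthonormal_frame S.Wplus x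
  have h : IsSectionAt S.Wminus n (fun y => ∑ a, (inner ℂ (s a y) (φ y) : ℂ) •
      S.rho y (Y y) (s a y)) x := .sum fun a _ =>
    .smul hn ((((hs a).at x).of_le hn).complex_inner hn hφ)
      (((S.rho_smooth Y (s a) hY (hs a)).at x).of_le hn)
  refine h.congr ?_
  filter_upwards [eventually_eq_sum_frame hso φ] with y hy
  conv_lhs => rw [hy]
  simp

lemma TensorAt.cliff {n : WithTop ℕ∞} (hn : n ≤ (∞ : WithTop ℕ∞)) {Y : ∀ x : X, T x}
    (hY : IsVectorField ∞ Y) {Φ : ∀ x, Tensor S.Wplus E x} {x : X}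
    (hΦ : TensorAt S.Wplus E n Φ x) :
    TensorAt S.Wminus E n (fun y => cliff S E (Y y) (Φ y)) x := fun s hs => by
  simp only [contract_cliff]
  exact isSectionAt_rho S hn hY (hΦ s hs)

variable {A : Connection E} (hA : IsUnitary A)
include hA

/-- Clifford multiplication is parallel. -/
lemma tensorDeriv_cliff {Y : ∀ x : X, T x} (hY : IsVectorField ∞ Y)
    {Φ : ∀ x, Tensor S.Wplus E x} {x : X} (hΦ : TensorAt S.Wplus E 1 Φ x) (v : T x) :
    tensorDeriv S.nablaMinus A (fun y => cliff S E (Y y) (Φ y)) x v =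
      cliff S E (D Y x v) (Φ x) + cliff S E (Y x) (tensorDeriv S.nablaPlus A Φ x v) := by
  refine tensorDeriv_eq_of_contract S.nablaMinus_unitary hA (hΦ.cliff S one_le_infty hY) v
    fun t ht => ?_
  have ht1 : IsSectionAt E 1 t x := (ht.at x).of_le one_le_infty
  simp only [contract_cliff, map_add]
  rw [S.compatible Y _ x v (FieldAt.diffAt ((hY x).of_le one_le_infty)) (hΦ t ht1).diffAt,
    contract_tensorDeriv S.nablaPlus_unitary hA hΦ ht1, map_sub]
  abel

omit hA in
/-- The value `∇_v Φ` is linear in `v`. -/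
def tensorDerivMap {V : HermitianPlaneBundle X} (B : Connection V) (A : Connection E)
    (Φ : ∀ x, Tensor V E x) (x : X) : T x →ₗ[ℝ] Tensor V E x where
  toFun v := tensorDeriv B A Φ x v
  map_add' u v := by
    have h1 : ∀ s, B s x (u + v) = B s x u + B s x v := fun s => map_add _ _ _
    have h2 : ∀ s, A s x (u + v) = A s x u + A s x v := fun s => map_add _ _ _
    simp only [tensorDeriv, h1, h2, contract_add_left, ← Finset.sum_add_distrib,
      ← TensorProduct.add_tmul]
    refine Finset.sum_congr rfl fun b _ => ?_
    congr 1
    abel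
  map_smul' r v := by
    have h1 : ∀ s, B s x (r • v) = (r : ℂ) • B s x v := fun s => (map_smul _ _ _).trans (by simp)
    have h2 : ∀ s, A s x (r • v) = (r : ℂ) • A s x v := fun s => (map_smul _ _ _).trans (by simp)
    simp only [tensorDeriv, h1, h2, contract_smul_left, Complex.conj_ofReal, ← smul_sub,
      RingHom.id_apply, Finset.smul_sum, TensorProduct.smul_tmul']
    simp only [Complex.coe_smul]

omit hA in
-- The Dirac operator is a metric trace. Differentiating along coordinate fields and multiplying by
-- their duals matches the shape of `LocalDirac`.
lemma dirac_eq_sum_dual (Φ : ∀ x, Tensor S.Wplus E x) {x : X} {f e : Fin 4 → T x}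
    (h : ∀ j k, (inner ℝ (f j) (e k) : ℝ) = if j = k then 1 else 0) :
    dirac S A Φ x = ∑ j, cliff S E (f j) (tensorDeriv S.nablaPlus A Φ x (e j)) := by
  have hfin : Fintype.card (Fin 4) = Module.finrank ℝ (T x) :=
    (Fintype.card_fin 4).trans (Fact.out (p := Module.finrank ℝ (T x) = 4)).symm
  let B : T x →ₗ[ℝ] T x →ₗ[ℝ] Tensor S.Wminus E x :=
    LinearMap.mk₂ ℝ (fun u v => cliffMap S E x u (tensorDerivMap S.nablaPlus A Φ x v))
      (fun u u' v => by simp) (fun c u v => by simp) (fun u v v' => by simp)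
      (fun c u v => by
        rw [map_smul, tensor_real_smul, map_smul, tensor_real_smul])
  exact sum_orthonormal_eq_sum_dual hfin h (frame x) B

end CliffordCalculus

/-! ### Moving functions from the manifold to ℝ⁴ -/

section Localization

set_option linter.unusedSectionVars false

variable {X : Type*} [TopologicalSpace X] [ChartedSpace R4 X] [IsManifold (𝓡 4) ∞ X]
  {G : Type*} [NormedAddCommGroup G] [NormedSpace ℝ G]

/-- `χ` is a smooth function in the chart at `x₀` that is `1` on the neighbourhood `U` of `x₀` and
is supported where `P` holds. -/
structure IsCutoff (x₀ : X) (P : X → Prop) (χ : R4 → ℝ) (U : Set R4) : Prop where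
  smooth : ContDiff ℝ ∞ χ
  isOpen : IsOpen U
  mem : extChartAt (𝓡 4) x₀ x₀ ∈ U
  eq_one : ∀ p ∈ U, χ p = 1
  supp : ∀ p ∈ tsupport χ, p ∈ (extChartAt (𝓡 4) x₀).target ∧ P ((extChartAt (𝓡 4) x₀).symm p)

lemma exists_isCutoff {x₀ : X} {P : X → Prop} (hP : ∀ᶠ y in 𝓝 x₀, P y) :
    ∃ χ U, IsCutoff x₀ P χ U := by
  set φ := extChartAt (𝓡 4) x₀
  have h1 : ∀ᶠ p in 𝓝 (φ x₀), p ∈ φ.target ∧ P (φ.symm p) := by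
    refine Filter.Eventually.and (extChartAt_target_mem_nhds x₀) ?_
    have hc : ContinuousAt φ.symm (φ x₀) := continuousAt_extChartAt_symm x₀
    refine hc.eventually ?_
    rwa [show φ.symm (φ x₀) = x₀ from extChartAt_to_inv x₀]
  obtain ⟨ε, hε, hs⟩ := Metric.nhds_basis_closedBall.mem_iff.1 h1
  let b : ContDiffBump (φ x₀) := ⟨ε / 2, ε, by positivity, by linarith⟩
  refine ⟨b, Metric.ball (φ x₀) (ε / 2), b.contDiff, Metric.isOpen_ball,
    Metric.mem_ball_self (by positivity), fun p hp => ?_, fun p hp => ?_⟩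
  · exact b.one_of_mem_closedBall (Metric.ball_subset_closedBall hp)
  · rw [b.tsupport_eq] at hp
    exact hs hp

/-- The function on `ℝ⁴` that agrees with `f` in the chart at `x₀` where `χ = 1`. -/
def localize (x₀ : X) (χ : R4 → ℝ) (f : X → G) (p : R4) : G :=
  χ p • f ((extChartAt (𝓡 4) x₀).symm p)

namespace IsCutoff

variable {x₀ : X} {P : X → Prop} {χ : R4 → ℝ} {U : Set R4} (h : IsCutoff x₀ P χ U)
  {n : WithTop ℕ∞} {f : X → G} {p : R4}
include h

lemma mem_tsupport (hp : p ∈ U) : p ∈ tsupport χ :=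
  subset_tsupport _ (by simp [h.eq_one p hp])

lemma mem_target (hp : p ∈ U) : p ∈ (extChartAt (𝓡 4) x₀).target :=
  (h.supp p (h.mem_tsupport hp)).1

lemma prop (hp : p ∈ U) : P ((extChartAt (𝓡 4) x₀).symm p) :=
  (h.supp p (h.mem_tsupport hp)).2

lemma mem_source (hp : p ∈ U) : (extChartAt (𝓡 4) x₀).symm p ∈ (chartAt R4 x₀).source := by
  rw [← extChartAt_source (𝓡 4)]
  exact (extChartAt (𝓡 4) x₀).map_target (h.mem_target hp)

lemma localize_eq (hp : p ∈ U) (f : X → G) :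
    localize x₀ χ f p = f ((extChartAt (𝓡 4) x₀).symm p) := by
  rw [localize, h.eq_one p hp, one_smul]

lemma localize_eq_at (hp : p ∈ U) {y : X} (hpy : (extChartAt (𝓡 4) x₀).symm p = y) (f : X → G) :
    localize x₀ χ f p = f y := by
  rw [h.localize_eq hp, hpy]

lemma contDiff (hn : n ≤ (∞ : WithTop ℕ∞)) (hf : ∀ y, P y → ContMDiffAt (𝓡 4) 𝓘(ℝ, G) n f y) :
    ContDiff ℝ n (localize x₀ χ f) := by
  refine contDiff_iff_contDiffAt.2 fun p => ?_
  by_cases hp : p ∈ tsupport χ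
  · refine (h.smooth.contDiffAt.of_le hn).smul (𝕜 := ℝ)
      (g := fun p => f ((extChartAt (𝓡 4) x₀).symm p)) ?_
    rw [← contMDiffAt_iff_contDiffAt]
    have h1 : ContMDiffAt 𝓘(ℝ, R4) (𝓡 4) n (extChartAt (𝓡 4) x₀).symm p :=
      ((contMDiffOn_extChartAt_symm (I := 𝓡 4) (n := ∞) x₀).contMDiffAt
        ((isOpen_extChartAt_target x₀).mem_nhds (h.supp p hp).1)).of_le hn
    exact ContMDiffAt.comp p (hf _ (h.supp p hp).2) h1
  · have h0 : ∀ᶠ q in 𝓝 p, χ q = 0 := notMem_tsupport_iff_eventuallyEq.1 hp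
    refine (contDiffAt_const (c := (0 : G))).congr_of_eventuallyEq ?_
    filter_upwards [h0] with q hq
    simp [localize, hq]

lemma fderiv_localize (hp : p ∈ U)
    (hf : MDifferentiableAt (𝓡 4) 𝓘(ℝ, G) f ((extChartAt (𝓡 4) x₀).symm p)) (w : R4) :
    fderiv ℝ (localize x₀ χ f) p w = mvfderiv (𝓡 4) f ((extChartAt (𝓡 4) x₀).symm p)
      (coordField x₀ w ((extChartAt (𝓡 4) x₀).symm p)) := by
  have h1 : localize x₀ χ f =ᶠ[𝓝 p] f ∘ (extChartAt (𝓡 4) x₀).symm := by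
    filter_upwards [h.isOpen.mem_nhds hp] with q hq using h.localize_eq hq f
  rw [h1.fderiv_eq, mvfderiv_coordField (h.mem_source hp) hf,
    (extChartAt (𝓡 4) x₀).right_inv (h.mem_target hp)]

lemma eventually_symm {Q : X → Prop} (hp : p ∈ U)
    (hQ : ∀ᶠ y in 𝓝 ((extChartAt (𝓡 4) x₀).symm p), Q y) :
    ∀ᶠ q in 𝓝 p, q ∈ U ∧ Q ((extChartAt (𝓡 4) x₀).symm q) :=
  (h.isOpen.eventually_mem hp).and ((continuousAt_extChartAt_symm'' (h.mem_target hp)).eventually hQ)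

end IsCutoff

end Localization

/-! ### Matrices acting on the model fibre -/

section MovingFrames

set_option linter.unusedSectionVars false

/-- The model fibre of the tensor product of two Hermitian plane bundles. -/
abbrev C4 := EuclideanSpace ℂ (Fin 2 × Fin 2)

/-- The action of a complex matrix on `C4` as a real linear map. -/
def matCLM : (Fin 2 × Fin 2 → Fin 2 × Fin 2 → ℂ) →L[ℝ] (C4 →L[ℝ] C4) :=
  LinearMap.toContinuousLinearMap
    { toFun := fun M => LinearMap.toContinuousLinearMap
        ((Matrix.toEuclideanLin (Matrix.of M)).restrictScalars ℝ)
      map_add' := fun M N => by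
        ext c i
        simp [← Matrix.of_add_of]
      map_smul' := fun r M => by
        ext c i
        simp [Matrix.toLpLin_apply, Matrix.mulVec, dotProduct, Finset.mul_sum, mul_assoc] }

lemma matCLM_apply (M : Fin 2 × Fin 2 → Fin 2 × Fin 2 → ℂ) (c : C4) (α : Fin 2 × Fin 2) :
    matCLM M c α = ∑ β, M α β * c β := by
  simp [matCLM, Matrix.toLpLin_apply, Matrix.mulVec, dotProduct]

lemma C4_real_inner (c d : C4) : (inner ℝ c d : ℝ) = (inner ℂ c d : ℂ).re := by
  rfl

end MovingFrames

/-! ### Components and connection forms in a frame of V ⊗ E -/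

section TensorFrames

set_option linter.unusedSectionVars false

variable {X : Type*} [TopologicalSpace X] [ChartedSpace R4 X] [IsManifold (𝓡 4) ∞ X] [T2Space X]
  [Bundle.RiemannianBundle (fun x : X => TangentSpace (𝓡 4) x)]
  {V V' E : HermitianPlaneBundle X}

lemma tensor_inner_smul_right {x : X} (Φ Ψ : Tensor V E x) (c : ℂ) :
    (inner ℂ Φ (c • Ψ) : ℂ) = c * inner ℂ Φ Ψ :=
  inner_smul_right (𝕜 := ℂ) (E := Tensor V E x) Φ Ψ c

lemma tensor_inner_smul_left {x : X} (Φ Ψ : Tensor V E x) (c : ℂ) :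
    (inner ℂ (c • Φ) Ψ : ℂ) = (starRingEnd ℂ) c * inner ℂ Φ Ψ :=
  inner_smul_left (𝕜 := ℂ) (E := Tensor V E x) Φ Ψ c

lemma tensor_inner_conj_symm {x : X} (Φ Ψ : Tensor V E x) :
    (starRingEnd ℂ) (inner ℂ Φ Ψ : ℂ) = inner ℂ Ψ Φ :=
  inner_conj_symm (𝕜 := ℂ) (E := Tensor V E x) Ψ Φ

lemma tensor_norm_sq {x : X} (Φ : Tensor V E x) : ‖Φ‖ ^ 2 = (inner ℂ Φ Φ : ℂ).re :=
  norm_sq_eq_re_inner (𝕜 := ℂ) (E := Tensor V E x) Φ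

/-- The frame `s_a ⊗ t_b` of `V ⊗ E`. -/
def tframe (s : Fin 2 → ∀ y, V.fiber y) (t : Fin 2 → ∀ y, E.fiber y) (α : Fin 2 × Fin 2) (y : X) :
    Tensor V E y := s α.1 y ⊗ₜ[ℂ] t α.2 y

/-- The components of an element of `V_y ⊗ E_y` in the frame `s_a ⊗ t_b`. -/
def compAt (s : Fin 2 → ∀ y, V.fiber y) (t : Fin 2 → ∀ y, E.fiber y) (y : X) (ψ : Tensor V E y) :
    C4 := WithLp.toLp 2 fun α => inner ℂ (tframe s t α y) ψ

/-- The section with constant components in the frame `s_a ⊗ t_b`. -/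
def coefSec (s : Fin 2 → ∀ y, V.fiber y) (t : Fin 2 → ∀ y, E.fiber y) (c : C4) (y : X) :
    Tensor V E y := ∑ α, c α • tframe s t α y

/-- The frames `s_a` and `t_b` are orthonormal at `y`. -/
def OrthoAt (s : Fin 2 → ∀ y, V.fiber y) (t : Fin 2 → ∀ y, E.fiber y) (y : X) : Prop :=
  Orthonormal ℂ (fun a => s a y) ∧ Orthonormal ℂ (fun b => t b y)

variable {s : Fin 2 → ∀ y, V.fiber y} {s' : Fin 2 → ∀ y, V'.fiber y} {t : Fin 2 → ∀ y, E.fiber y}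
  {y : X}

lemma OrthoAt.exists_basis (h : OrthoAt s t y) :
    ∃ b : OrthonormalBasis (Fin 2 × Fin 2) ℂ (Tensor V E y), ∀ α, b α = tframe s t α y := by
  obtain ⟨b, hb⟩ := exists_orthonormalBasis h.1
  obtain ⟨c, hc⟩ := exists_orthonormalBasis h.2
  exact ⟨b.tensorProduct c, fun α => by
    rw [OrthonormalBasis.tensorProduct_apply', hb, hc, tframe]⟩

lemma compAt_apply (ψ : Tensor V E y) (α : Fin 2 × Fin 2) :
    compAt s t y ψ α = inner ℂ (tframe s t α y) ψ := rfl

lemma OrthoAt.compAt_eq (h : OrthoAt s t y) :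
    ∃ b : OrthonormalBasis (Fin 2 × Fin 2) ℂ (Tensor V E y), (∀ α, b α = tframe s t α y) ∧
      ∀ ψ, compAt s t y ψ = b.repr ψ := by
  obtain ⟨b, hb⟩ := h.exists_basis
  refine ⟨b, hb, fun ψ => ?_⟩
  ext α
  rw [compAt_apply, b.repr_apply_apply, hb]

lemma OrthoAt.compAt_coefSec (h : OrthoAt s t y) (c : C4) :
    compAt s t y (coefSec s t c y) = c := by
  obtain ⟨b, hb, hc⟩ := h.compAt_eq
  rw [hc, coefSec]
  simp only [← hb, b.sum_repr_symm, LinearIsometryEquiv.apply_symm_apply]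

lemma OrthoAt.coefSec_compAt (h : OrthoAt s t y) (ψ : Tensor V E y) :
    coefSec s t (compAt s t y ψ) y = ψ := by
  obtain ⟨b, hb, hc⟩ := h.compAt_eq
  rw [hc, coefSec]
  simp only [← hb, b.sum_repr]

lemma OrthoAt.inner_compAt (h : OrthoAt s t y) (ψ χ : Tensor V E y) :
    (inner ℂ (compAt s t y ψ) (compAt s t y χ) : ℂ) = inner ℂ ψ χ := by
  obtain ⟨b, hb, hc⟩ := h.compAt_eq
  rw [hc, hc, b.repr.inner_map_map]

lemma compAt_sum {ι : Type*} (S : Finset ι) (ψ : ι → Tensor V E y) :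
    compAt s t y (∑ i ∈ S, ψ i) = ∑ i ∈ S, compAt s t y (ψ i) := by
  ext α
  simp [compAt_apply, inner_sum]

lemma compAt_add (ψ χ : Tensor V E y) :
    compAt s t y (ψ + χ) = compAt s t y ψ + compAt s t y χ := by
  ext α
  simp [compAt_apply, inner_add_right]

lemma compAt_sub (ψ χ : Tensor V E y) :
    compAt s t y (ψ - χ) = compAt s t y ψ - compAt s t y χ := by
  ext α
  simp [compAt_apply, inner_sub_right]

lemma compAt_neg (ψ : Tensor V E y) : compAt s t y (-ψ) = -compAt s t y ψ := by
  ext α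
  simp [compAt_apply]

lemma compAt_real_smul (r : ℝ) (ψ : Tensor V E y) :
    compAt s t y ((r : ℂ) • ψ) = r • compAt s t y ψ := by
  ext α
  rw [compAt_apply, tensor_inner_smul_right, PiLp.smul_apply, compAt_apply, Complex.real_smul]

lemma OrthoAt.matCLM_compAt (h : OrthoAt s t y) (L : Tensor V E y →ₗ[ℂ] Tensor V' E y)
    (ψ : Tensor V E y) :
    matCLM (fun α β => inner ℂ (tframe s' t α y) (L (tframe s t β y))) (compAt s t y ψ) =
      compAt s' t y (L ψ) := by
  ext α
  rw [matCLM_apply, compAt_apply]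
  conv_rhs => rw [← h.coefSec_compAt ψ, coefSec, map_sum, inner_sum]
  refine Finset.sum_congr rfl fun β _ => ?_
  rw [map_smul, tensor_inner_smul_right, mul_comm]

variable (hs : ∀ a, IsSection V ∞ (s a)) (ht : ∀ b, IsSection E ∞ (t b))
include hs ht

lemma tensorAt_tframe (α : Fin 2 × Fin 2) (y : X) : TensorAt V E ∞ (tframe s t α) y :=
  .tmul le_rfl ((hs _).at y) ((ht _).at y)

lemma tensorAt_coefSec (c : C4) (y : X) : TensorAt V E ∞ (coefSec s t c) y :=
  .sum fun α _ => (tensorAt_tframe hs ht α y).smul le_rfl contMDiffAt_const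

lemma contMDiffAt_comps {n : WithTop ℕ∞} (hn : n ≤ (∞ : WithTop ℕ∞)) {Φ : ∀ y, Tensor V E y}
    (hΦ : TensorAt V E n Φ y) :
    ContMDiffAt (𝓡 4) 𝓘(ℝ, C4) n (fun y => compAt s t y (Φ y)) y := by
  have h1 : ContMDiffAt (𝓡 4) 𝓘(ℝ, Fin 2 × Fin 2 → ℂ) n
      (fun y => fun α => (inner ℂ (tframe s t α y) (Φ y) : ℂ)) y :=
    contMDiffAt_pi_space.2 fun α => by
      refine TensorAt.inner hn (fun r hr => ?_) hΦ
      simp only [tframe, contract_tmul]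
      exact .smul hn (hr.complex_inner hn (((ht _).at y).of_le hn)) (((hs _).at y).of_le hn)
  exact (((PiLp.continuousLinearEquiv 2 ℝ fun _ : Fin 2 × Fin 2 => ℂ).symm :
    (Fin 2 × Fin 2 → ℂ) →L[ℝ] C4).contMDiff.contMDiffAt
    (x := fun α => (inner ℂ (tframe s t α y) (Φ y) : ℂ))).comp y h1

variable {B : Connection V} (hB : IsUnitary B) {A : Connection E} (hA : IsUnitary A)
include hB hA

omit hs ht hB hA in
/-- The connection form of the tensor product connection in the frame `s_a ⊗ t_b`. -/
def connForm (B : Connection V) (A : Connection E) (s : Fin 2 → ∀ y, V.fiber y)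
    (t : Fin 2 → ∀ y, E.fiber y) (Y : ∀ y : X, T y) (y : X) (α β : Fin 2 × Fin 2) : ℂ :=
  inner ℂ (tframe s t α y) (tensorDeriv B A (tframe s t β) y (Y y))

lemma tensorAt_tensorDeriv_tframe (hB1 : HasC1Symbols B) (hA1 : HasC1Symbols A) {Y : ∀ y : X, T y}
    (hY : FieldAt 1 Y y) (β : Fin 2 × Fin 2) :
    TensorAt V E 1 (fun y => tensorDeriv B A (tframe s t β) y (Y y)) y := by
  have hs1 : ∀ a y, IsSectionAt V 1 (s a) y := fun a y => ((hs a).at y).of_le one_le_infty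
  have ht1 : ∀ a y, IsSectionAt E 1 (t a) y := fun a y => ((ht a).at y).of_le one_le_infty
  have h : TensorAt V E 1 (fun y => B (s β.1) y (Y y) ⊗ₜ[ℂ] t β.2 y +
      s β.1 y ⊗ₜ[ℂ] A (t β.2) y (Y y)) y :=
    .add (.tmul one_le_infty (secAt_covariantDerivative hB1 (.of_forall fun q => hs _ q) hY)
      (ht1 _ y)) (.tmul one_le_infty (hs1 _ y)
      (secAt_covariantDerivative hA1 (.of_forall fun q => ht _ q) hY))
  exact h.congr (.of_forall fun q => tensorDeriv_tmul hB hA (hs1 _ q) (ht1 _ q) _)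

lemma contMDiffAt_connForm (hB1 : HasC1Symbols B) (hA1 : HasC1Symbols A) {Y : ∀ y : X, T y}
    (hY : FieldAt 1 Y y) :
    ContMDiffAt (𝓡 4) 𝓘(ℝ, C4 →L[ℝ] C4) 1 (fun y => matCLM (connForm B A s t Y y)) y := by
  have h1 : ContMDiffAt (𝓡 4) 𝓘(ℝ, Fin 2 × Fin 2 → Fin 2 × Fin 2 → ℂ) 1 (connForm B A s t Y) y :=
    contMDiffAt_pi_space.2 fun α => contMDiffAt_pi_space.2 fun β =>
      TensorAt.inner one_le_infty ((tensorAt_tframe hs ht α y).of_le_one one_le_infty le_rfl)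
        (tensorAt_tensorDeriv_tframe hs ht hB hA hB1 hA1 hY β)
  exact (matCLM.contMDiff.contMDiffAt (x := connForm B A s t Y y)).comp y h1

/-- The inner products of the frame are locally constant, and the tensor product connection is
unitary. -/
lemma connForm_skew (ho : ∀ᶠ q in 𝓝 y, OrthoAt s t q) (Y : ∀ y : X, T y) (α β : Fin 2 × Fin 2) :
    (inner ℂ (tensorDeriv B A (tframe s t α) y (Y y)) (tframe s t β y) : ℂ) =
      -connForm B A s t Y y α β := by
  have h1 := fun α => (tensorAt_tframe hs ht α y).of_le_one one_le_infty le_rfl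
  have h := mvfderiv_inner_tensor hB hA (h1 α) (h1 β) (Y y)
  have hc : (fun q => (inner ℂ (tframe s t α q) (tframe s t β q) : ℂ)) =ᶠ[𝓝 y]
      fun _ => if α = β then 1 else 0 := by
    filter_upwards [ho] with q hq
    obtain ⟨b, hb⟩ := hq.exists_basis
    simp only [← hb, orthonormal_iff_ite.1 b.orthonormal α β]
  rw [mvfderiv_congr hc, mvfderiv_fun_const] at h
  exact eq_neg_of_add_eq_zero_left h.symm

/-- Covariant derivatives in the frame `s_a ⊗ t_b`. -/
lemma compAt_tensorDeriv (ho : ∀ᶠ q in 𝓝 y, OrthoAt s t q) (Y : ∀ y : X, T y)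
    {Φ : ∀ y, Tensor V E y} (hΦ : TensorAt V E 1 Φ y) :
    compAt s t y (tensorDeriv B A Φ y (Y y)) =
      mvfderiv (𝓡 4) (fun y => compAt s t y (Φ y)) y (Y y) +
        matCLM (connForm B A s t Y y) (compAt s t y (Φ y)) := by
  have h1 := fun α => (tensorAt_tframe hs ht α y).of_le_one one_le_infty le_rfl
  ext α
  have hc := mvfderiv_clm_comp ((EuclideanSpace.proj α : C4 →L[ℂ] ℂ).restrictScalars ℝ)
    ((contMDiffAt_comps hs ht one_le_infty hΦ).mdifferentiableAt one_ne_zero) (Y y)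
  have hd := mvfderiv_inner_tensor hB hA (h1 α) hΦ (Y y)
  have e : (mvfderiv (𝓡 4) (fun y => compAt s t y (Φ y)) y (Y y)) α =
      mvfderiv (𝓡 4) (fun y => (inner ℂ (tframe s t α y) (Φ y) : ℂ)) y (Y y) := hc.symm
  rw [PiLp.add_apply, e, hd, compAt_apply, matCLM_apply]
  have h2 : (inner ℂ (tensorDeriv B A (tframe s t α) y (Y y)) (Φ y) : ℂ) =
      -∑ β, connForm B A s t Y y α β * compAt s t y (Φ y) β := by
    conv_lhs => rw [← ho.self_of_nhds.coefSec_compAt (Φ y), coefSec, inner_sum]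
    rw [← Finset.sum_neg_distrib]
    refine Finset.sum_congr rfl fun β _ => ?_
    rw [tensor_inner_smul_right, connForm_skew hs ht hB hA ho Y]
    ring
  rw [h2]
  ring

/-- Covariant derivatives in the frame `s_a ⊗ t_b` and in a chart. -/
lemma covDeriv_localize {x₀ : X} {P : X → Prop} {χ : R4 → ℝ} {U : Set R4} (h : IsCutoff x₀ P χ U)
    {p : R4} (hp : p ∈ U) (hpy : (extChartAt (𝓡 4) x₀).symm p = y)
    (ho : ∀ᶠ q in 𝓝 y, OrthoAt s t q) (w : R4) {Φ : ∀ y, Tensor V E y} (hΦ : TensorAt V E 1 Φ y) :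
    covDeriv (localize x₀ χ fun y => matCLM (connForm B A s t (coordField x₀ w) y)) w
      (localize x₀ χ fun y => compAt s t y (Φ y)) p =
      compAt s t y (tensorDeriv B A Φ y (coordField x₀ w y)) := by
  subst hpy
  rw [covDeriv, h.fderiv_localize hp
    ((contMDiffAt_comps hs ht one_le_infty hΦ).mdifferentiableAt one_ne_zero),
    h.localize_eq hp, h.localize_eq hp, compAt_tensorDeriv hs ht hB hA ho _ hΦ]

end TensorFrames

/-! ### Curvature of the tensor product connection in a chart -/

section TensorCurvature

set_option linter.unusedSectionVars false

variable {X : Type*} [TopologicalSpace X] [ChartedSpace R4 X] [IsManifold (𝓡 4) ∞ X] [T2Space X]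
  [Bundle.RiemannianBundle (fun x : X => TangentSpace (𝓡 4) x)]
  {V V' E : HermitianPlaneBundle X}

lemma covDeriv_congr {Γ : R4 → C4 →L[ℝ] C4} {w p : R4} {u v : R4 → C4} (h : u =ᶠ[𝓝 p] v) :
    covDeriv Γ w u p = covDeriv Γ w v p := by
  simp only [covDeriv, h.fderiv_eq, h.self_of_nhds]

/-- The curvature `F_B ⊗ id + id ⊗ F_A` of the tensor product connection. -/
def curvTensor (B : Connection V) (A : Connection E) (x : X) (u v : T x) :
    Tensor V E x →ₗ[ℂ] Tensor V E x :=
  LinearMap.rTensor (E.fiber x) (curvatureEnd B x u v) +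
    LinearMap.lTensor (V.fiber x) (curvatureEnd A x u v)

variable {B : Connection V} (hB : IsUnitary B) (hB1 : HasC1Symbols B)
  {A : Connection E} (hA : IsUnitary A) (hA1 : HasC1Symbols A)
  {s : Fin 2 → ∀ y, V.fiber y} {t : Fin 2 → ∀ y, E.fiber y} {y : X}
  (hs : ∀ a, IsSection V ∞ (s a)) (ht : ∀ b, IsSection E ∞ (t b))
include hB hA hs ht

lemma tensorDeriv_coefSec (c : C4) (v : T y) :
    tensorDeriv B A (coefSec s t c) y v = ∑ α, c α • tensorDeriv B A (tframe s t α) y v := by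
  have h1 : ∀ α, TensorAt V E 1 (tframe s t α) y := fun α =>
    (tensorAt_tframe hs ht α y).of_le_one one_le_infty le_rfl
  refine (tensorDeriv_sum hB hA (fun α _ => (h1 α).smul one_le_infty contMDiffAt_const) v).trans ?_
  refine Finset.sum_congr rfl fun α _ => ?_
  rw [tensorDeriv_smul hB hA contMDiffAt_const (h1 α), mvfderiv_fun_const, zero_smul, add_zero]

include hB1 hA1

lemma tensorAt_tensorDeriv_coefSec {Y : ∀ y : X, T y} (hY : FieldAt 1 Y y) (c : C4) :
    TensorAt V E 1 (fun y => tensorDeriv B A (coefSec s t c) y (Y y)) y := by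
  simp only [tensorDeriv_coefSec hB hA hs ht]
  exact .sum fun α _ => (tensorAt_tensorDeriv_tframe hs ht hB hA hB1 hA1 hY α).smul one_le_infty
    contMDiffAt_const

/-- The commutator of covariant derivatives along coordinate fields is the curvature. -/
lemma tensorDeriv_comm_coefSec {x₀ : X} (hy : y ∈ (chartAt R4 x₀).source) (w z : R4) (c : C4) :
    tensorDeriv B A (fun q => tensorDeriv B A (coefSec s t c) q (coordField x₀ z q)) y
        (coordField x₀ w y) -
      tensorDeriv B A (fun q => tensorDeriv B A (coefSec s t c) q (coordField x₀ w q)) y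
        (coordField x₀ z y) =
      curvTensor B A y (coordField x₀ w y) (coordField x₀ z y) (coefSec s t c y) := by
  have hc : ∀ w : R4, FieldAt 1 (coordField x₀ w) y := fun w =>
    (contMDiffAt_coordField hy w).of_le one_le_infty
  have hs1 : ∀ a y, IsSectionAt V 1 (s a) y := fun a y => ((hs a).at y).of_le one_le_infty
  have ht1 : ∀ a y, IsSectionAt E 1 (t a) y := fun a y => ((ht a).at y).of_le one_le_infty
  have hsD : ∀ a w, IsSectionAt V 1 (fun q => B (s a) q (coordField x₀ w q)) y := fun a w =>
    secAt_covariantDerivative hB1 (.of_forall fun q => hs a q) (hc w)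
  have htD : ∀ b w, IsSectionAt E 1 (fun q => A (t b) q (coordField x₀ w q)) y := fun b w =>
    secAt_covariantDerivative hA1 (.of_forall fun q => ht b q) (hc w)
  -- The two mixed terms, with one derivative on each factor, are symmetric in w and z and vanish
  -- from the commutator.
  have key : ∀ w z, tensorDeriv B A (fun q => tensorDeriv B A (coefSec s t c) q (coordField x₀ z q))
      y (coordField x₀ w y) = ∑ α, c α •
        (B (fun q => B (s α.1) q (coordField x₀ z q)) y (coordField x₀ w y) ⊗ₜ[ℂ] t α.2 y +
          B (s α.1) y (coordField x₀ z y) ⊗ₜ[ℂ] A (t α.2) y (coordField x₀ w y) +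
          (B (s α.1) y (coordField x₀ w y) ⊗ₜ[ℂ] A (t α.2) y (coordField x₀ z y) +
          s α.1 y ⊗ₜ[ℂ] A (fun q => A (t α.2) q (coordField x₀ z q)) y (coordField x₀ w y))) := by
    intro w z
    simp only [tensorDeriv_coefSec hB hA hs ht]
    have h1 : ∀ α, TensorAt V E 1 (fun q => tensorDeriv B A (tframe s t α) q (coordField x₀ z q)) y :=
      tensorAt_tensorDeriv_tframe hs ht hB hA hB1 hA1 (hc z)
    refine (tensorDeriv_sum hB hA (fun α _ => (h1 α).smul one_le_infty contMDiffAt_const) _).trans ?_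
    refine Finset.sum_congr rfl fun α _ => ?_
    rw [tensorDeriv_smul hB hA contMDiffAt_const (h1 α), mvfderiv_fun_const, zero_smul, add_zero]
    congr 1
    have h2 : TensorAt V E 1 (fun q => B (s α.1) q (coordField x₀ z q) ⊗ₜ[ℂ] t α.2 q) y :=
      .tmul one_le_infty (hsD _ _) (ht1 _ y)
    have h3 : TensorAt V E 1 (fun q => s α.1 q ⊗ₜ[ℂ] A (t α.2) q (coordField x₀ z q)) y :=
      .tmul one_le_infty (hs1 _ y) (htD _ _)
    refine (tensorDeriv_congr hB hA (h2.add h3)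
      (.of_forall fun q => tensorDeriv_tmul hB hA (hs1 _ q) (ht1 _ q) _) _).trans ?_
    rw [tensorDeriv_add hB hA h2 h3, tensorDeriv_tmul hB hA (hsD _ _) (ht1 _ y),
      tensorDeriv_tmul hB hA (hs1 _ y) (htD _ _)]
  have hV : ∀ a, curvatureEnd B y (coordField x₀ w y) (coordField x₀ z y) (s a y) =
      B (fun q => B (s a) q (coordField x₀ z q)) y (coordField x₀ w y) -
      B (fun q => B (s a) q (coordField x₀ w q)) y (coordField x₀ z y) := fun a => by
    rw [curvatureEnd_apply hB hB1]
    refine (curvature_eq_curvOp hB1 hB.isMetric hy w z (.of_forall fun q => hs a q)).trans ?_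
    simp only [curvOp, mlieBracket_coordField hy, map_zero, sub_zero]
  have hE : ∀ a, curvatureEnd A y (coordField x₀ w y) (coordField x₀ z y) (t a y) =
      A (fun q => A (t a) q (coordField x₀ z q)) y (coordField x₀ w y) -
      A (fun q => A (t a) q (coordField x₀ w q)) y (coordField x₀ z y) := fun a => by
    rw [curvatureEnd_apply hA hA1]
    refine (curvature_eq_curvOp hA1 hA.isMetric hy w z (.of_forall fun q => ht a q)).trans ?_
    simp only [curvOp, mlieBracket_coordField hy, map_zero, sub_zero]
  rw [key, key, ← Finset.sum_sub_distrib, coefSec, map_sum]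
  refine Finset.sum_congr rfl fun α _ => ?_
  rw [map_smul, ← smul_sub]
  congr 1
  simp only [curvTensor, tframe, LinearMap.add_apply, LinearMap.rTensor_tmul, LinearMap.lTensor_tmul,
    hV, hE, TensorProduct.sub_tmul, TensorProduct.tmul_sub]
  abel

omit hB1 hA1 in
-- A section with constant components has no component derivative, so its covariant derivative is
-- given by the connection matrix alone.
lemma matCLM_connForm (ho : ∀ᶠ q in 𝓝 y, OrthoAt s t q) (Y : ∀ y : X, T y) (c : C4) :
    matCLM (connForm B A s t Y y) c = compAt s t y (tensorDeriv B A (coefSec s t c) y (Y y)) := by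
  rw [compAt_tensorDeriv hs ht hB hA ho Y
    ((tensorAt_coefSec hs ht c y).of_le_one one_le_infty le_rfl), ho.self_of_nhds.compAt_coefSec]
  have h : (fun y => compAt s t y (coefSec s t c y)) =ᶠ[𝓝 y] fun _ => c :=
    ho.mono fun q hq => hq.compAt_coefSec c
  rw [mvfderiv_congr h, mvfderiv_fun_const, zero_add]

/-- The curvature of the connection forms in a chart. -/
lemma curvForm_localize {x₀ : X} {P : X → Prop} {χ : R4 → ℝ} {U : Set R4} (h : IsCutoff x₀ P χ U)
    (hP : ∀ y, P y → y ∈ (chartAt R4 x₀).source ∧ ∀ᶠ q in 𝓝 y, OrthoAt s t q)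
    {p : R4} (hp : p ∈ U) (hpy : (extChartAt (𝓡 4) x₀).symm p = y) (w z : R4)
    (ψ : Tensor V E y) :
    curvForm (localize x₀ χ fun y => matCLM (connForm B A s t (coordField x₀ w) y))
      (localize x₀ χ fun y => matCLM (connForm B A s t (coordField x₀ z) y)) w z p
      (compAt s t y ψ) =
      compAt s t y (curvTensor B A y (coordField x₀ w y) (coordField x₀ z y) ψ) := by
  have hPy : P y := hpy ▸ h.prop hp
  set c := compAt s t y ψ
  obtain ⟨hy, ho⟩ := hP y hPy
  have hcs : ∀ w, ∀ y, P y → FieldAt 1 (coordField x₀ w) y := fun w y hy =>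
    (contMDiffAt_coordField (hP y hy).1 w).of_le one_le_infty
  set Γ : R4 → R4 → C4 →L[ℝ] C4 := fun w =>
    localize x₀ χ fun y => matCLM (connForm B A s t (coordField x₀ w) y)
  have hd : ∀ w, DifferentiableAt ℝ (Γ w) p := fun w =>
    (h.contDiff one_le_infty fun y hy =>
      contMDiffAt_connForm hs ht hB hA hB1 hA1 (hcs w y hy)).differentiable one_ne_zero p
  -- By `matCLM_connForm`, `Γ z c` holds the components of the first covariant derivative of the
  -- section with constant components `c`. Its covariant derivative along w is therefore a second
  -- covariant derivative, and the commutator is the curvature.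
  have h1 : ∀ w z, covDeriv (Γ w) w (fun q => Γ z q c) p =
      compAt s t y (tensorDeriv B A (fun q => tensorDeriv B A (coefSec s t c) q (coordField x₀ z q))
        y (coordField x₀ w y)) := fun w z => by
    rw [← covDeriv_localize hs ht hB hA h hp hpy ho w
      (tensorAt_tensorDeriv_coefSec hB hB1 hA hA1 hs ht (hcs z y hPy) c)]
    refine covDeriv_congr ?_
    filter_upwards [h.isOpen.mem_nhds hp] with q hq
    rw [show Γ z q = _ from h.localize_eq hq _, h.localize_eq hq,
      matCLM_connForm hB hA hs ht (hP _ (h.prop hq)).2 (coordField x₀ z) c]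
  have h2 : ∀ w z, covDeriv (Γ w) w (fun q => Γ z q c) p = fderiv ℝ (Γ z) p w c + Γ w p (Γ z p c) :=
    fun w z => by
      rw [covDeriv, fderiv_clm_apply (hd z) (differentiableAt_const c)]
      simp
  have h3 := tensorDeriv_comm_coefSec hB hB1 hA hA1 hs ht hy w z c
  rw [ho.self_of_nhds.coefSec_compAt] at h3
  rw [← h3, compAt_sub, ← h1, ← h1, h2, h2]
  simp only [curvForm, sub_apply, add_apply,
    ContinuousLinearMap.comp_apply]
  abel

end TensorCurvature

/-! ### The Bochner formula on the manifold -/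

section ManifoldBochner

set_option linter.unusedSectionVars false

variable {X : Type*} [TopologicalSpace X] [ChartedSpace R4 X] [IsManifold (𝓡 4) ∞ X] [T2Space X]
  [Bundle.RiemannianBundle (fun x : X => TangentSpace (𝓡 4) x)]
  [IsContMDiffRiemannianBundle (𝓡 4) ∞ R4 (fun x : X => TangentSpace (𝓡 4) x)]
  {o : ManifoldOrientation X} {D : TangentConnection X}
  (S : SpincStructure o D) {E : HermitianPlaneBundle X}

lemma inner_rho_rho {x : X} (v : T x) (φ ψ : S.Wplus.fiber x) :
    (inner ℂ (S.rho x v φ) (S.rho x v ψ) : ℂ) = (‖v‖ ^ 2 : ℝ) * inner ℂ φ ψ := by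
  rw [← LinearMap.adjoint_inner_right, ← LinearMap.comp_apply, S.clifford, LinearMap.smul_apply,
    LinearMap.id_apply, inner_smul_right]

/-- Polarisation of `clifford` in the vector argument. -/
lemma inner_rho_rho_add {x : X} (u v : T x) (φ ψ : S.Wplus.fiber x) :
    (inner ℂ (S.rho x u φ) (S.rho x v ψ) : ℂ) + inner ℂ (S.rho x v φ) (S.rho x u ψ) =
      2 * (inner ℝ u v : ℝ) * inner ℂ φ ψ := by
  have h := inner_rho_rho S (u + v) φ ψ
  rw [map_add, LinearMap.add_apply, LinearMap.add_apply, inner_add_left, inner_add_right,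
    inner_add_right, inner_rho_rho, inner_rho_rho, norm_add_sq_real] at h
  push_cast at h ⊢
  linear_combination h

lemma inner_cliff_cliff_add {x : X} (u v : T x) (Φ Ψ : Tensor S.Wplus E x) :
    (inner ℂ (cliff S E u Φ) (cliff S E v Ψ) : ℂ) + inner ℂ (cliff S E v Φ) (cliff S E u Ψ) =
      2 * (inner ℝ u v : ℝ) * inner ℂ Φ Ψ := by
  rw [inner_eq_sum_contract (fiberBasis E x), inner_eq_sum_contract (fiberBasis E x),
    inner_eq_sum_contract (fiberBasis E x), ← Finset.sum_add_distrib, Finset.mul_sum]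
  refine Finset.sum_congr rfl fun b _ => ?_
  rw [contract_cliff, contract_cliff, contract_cliff, contract_cliff, inner_rho_rho_add]

variable (hD : IsLeviCivita D) {A : Connection E} (hA : IsUnitary A) (hA1 : HasC1Symbols A)
  {w : Fin 4 → R4} {f : Fin 4 → ∀ y : X, T y} {x₀ : X}
  {s : Fin 2 → ∀ y, S.Wplus.fiber y} {s' : Fin 2 → ∀ y, S.Wminus.fiber y}
  {t : Fin 2 → ∀ y, E.fiber y}

/-- The matrix of Clifford multiplication by a vector field. -/
def cliffMat (Y : ∀ y : X, T y) (s : Fin 2 → ∀ y, S.Wplus.fiber y)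
    (s' : Fin 2 → ∀ y, S.Wminus.fiber y) (t : Fin 2 → ∀ y, E.fiber y) (y : X)
    (α β : Fin 2 × Fin 2) : ℂ :=
  inner ℂ (tframe s' t α y) (cliff S E (Y y) (tframe s t β y))

/-- Near `y` the three frames are orthonormal and `f` is dual to the coordinate frame. -/
def IsAdapted (w : Fin 4 → R4) (f : Fin 4 → ∀ y : X, T y) (x₀ : X)
    (s : Fin 2 → ∀ y, S.Wplus.fiber y) (s' : Fin 2 → ∀ y, S.Wminus.fiber y)
    (t : Fin 2 → ∀ y, E.fiber y) (y : X) : Prop :=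
  y ∈ (chartAt R4 x₀).source ∧ (∀ᶠ q in 𝓝 y, OrthoAt s t q) ∧ (∀ᶠ q in 𝓝 y, OrthoAt s' t q) ∧
    ∀ᶠ q in 𝓝 y, ∀ j k, (inner ℝ (f j q) (coordField x₀ (w k) q) : ℝ) = if j = k then 1 else 0

variable (hs : ∀ a, IsSection S.Wplus ∞ (s a)) (hs' : ∀ a, IsSection S.Wminus ∞ (s' a))
  (ht : ∀ b, IsSection E ∞ (t b)) (hf : ∀ j, IsVectorField ∞ (f j))
  {χ : R4 → ℝ} {U : Set R4} (h : IsCutoff x₀ (IsAdapted S w f x₀ s s' t) χ U)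
include hs hs' ht

lemma contMDiffAt_cliffMat {Y : ∀ y : X, T y} (hY : IsVectorField ∞ Y) (y : X) :
    ContMDiffAt (𝓡 4) 𝓘(ℝ, C4 →L[ℝ] C4) 1 (fun y => matCLM (cliffMat S Y s s' t y)) y := by
  have h1 : ContMDiffAt (𝓡 4) 𝓘(ℝ, Fin 2 × Fin 2 → Fin 2 × Fin 2 → ℂ) 1 (cliffMat S Y s s' t) y :=
    contMDiffAt_pi_space.2 fun α => contMDiffAt_pi_space.2 fun β =>
      TensorAt.inner one_le_infty ((tensorAt_tframe hs' ht α y).of_le_one one_le_infty le_rfl)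
        (((tensorAt_tframe hs ht β y).of_le_one one_le_infty le_rfl).cliff S one_le_infty hY)
  exact (matCLM.contMDiff.contMDiffAt (x := cliffMat S Y s s' t y)).comp y h1

include hA hf h hD

/-- Clifford multiplication is parallel, so the only derivative left is that of the vector field.
The identity is read off by differentiating the product of the Clifford matrix with a constant
vector. -/
lemma covDerivHom_cliff {p : R4} (hp : p ∈ U) {y : X} (hpy : (extChartAt (𝓡 4) x₀).symm p = y)
    (i j : Fin 4) (ψ : Tensor S.Wplus E y) :
    covDerivHom
      (localize x₀ χ fun y => matCLM (connForm S.nablaPlus A s t (coordField x₀ (w i)) y))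
      (localize x₀ χ fun y => matCLM (connForm S.nablaMinus A s' t (coordField x₀ (w i)) y)) (w i)
      (localize x₀ χ fun y => matCLM (cliffMat S (f j) s s' t y)) p (compAt s t y ψ) =
      compAt s' t y (cliff S E (D (f j) y (coordField x₀ (w i) y)) ψ) := by
  set Γ := localize x₀ χ fun y => matCLM (connForm S.nablaPlus A s t (coordField x₀ (w i)) y)
  set Γ' := localize x₀ χ fun y => matCLM (connForm S.nablaMinus A s' t (coordField x₀ (w i)) y)
  set γ := localize x₀ χ fun y => matCLM (cliffMat S (f j) s s' t y)
  obtain ⟨hy, ho, ho', hd⟩ : IsAdapted S w f x₀ s s' t y := hpy ▸ h.prop hp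
  set c := compAt s t y ψ with hc
  have h1 : TensorAt S.Wplus E 1 (coefSec s t c) y :=
    (tensorAt_coefSec hs ht c y).of_le_one one_le_infty le_rfl
  have hγ : ContDiff ℝ 1 γ := h.contDiff one_le_infty fun y _ =>
    contMDiffAt_cliffMat S hs hs' ht (hf j) y
  have e1 := covDeriv_clm_apply (Γ := Γ) (Γ' := Γ') hγ (contDiff_const (c := c)) (w i) p
  have e2 : covDeriv Γ (w i) (fun _ => c) p =
      compAt s t y (tensorDeriv S.nablaPlus A (coefSec s t c) y (coordField x₀ (w i) y)) := by
    have : covDeriv Γ (w i) (fun _ => c) p = Γ p c := by simp [covDeriv]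
    rw [this, show Γ p = _ from h.localize_eq hp _, hpy,
      matCLM_connForm S.nablaPlus_unitary hA hs ht ho]
  have e3 : ∀ φ, γ p (compAt s t y φ) = compAt s' t y (cliff S E (f j y) φ) := fun φ => by
    rw [show γ p = _ from h.localize_eq hp _, hpy]
    exact ho.self_of_nhds.matCLM_compAt (cliff S E (f j y)) φ
  have e4 : (fun q => γ q c) =ᶠ[𝓝 p] localize x₀ χ fun y => compAt s' t y
      (cliff S E (f j y) (coefSec s t c y)) := by
    filter_upwards [h.isOpen.mem_nhds hp] with q hq
    have hoq := (h.prop hq).2.1.self_of_nhds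
    rw [show γ q = _ from h.localize_eq hq _, h.localize_eq hq]
    conv_lhs => rw [← hoq.compAt_coefSec c]
    exact hoq.matCLM_compAt (cliff S E (f j _)) _
  rw [covDeriv_congr e4, covDeriv_localize hs' ht S.nablaMinus_unitary hA h hp hpy ho' (w i)
    (h1.cliff S one_le_infty (hf j)), tensorDeriv_cliff S hA (hf j) h1, e2, e3, compAt_add,
    add_left_inj, ho.self_of_nhds.coefSec_compAt] at e1
  exact e1.symm

include hA1

/-- Here `a` is the metric on one-forms, given by the products of the dual fields, and `C i l j` is
the Christoffel symbol Γ^j_{il}. Its symmetry is vanishing torsion, and the formula for ∇γ_j is the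
covariant derivative of a dual frame. -/
lemma localDirac_localize : LocalDirac w U
    (fun i j => localize x₀ χ fun y => (inner ℝ (f i y) (f j y) : ℝ))
    (fun i l j => localize x₀ χ fun y =>
      (inner ℝ (f j y) (D (coordField x₀ (w l)) y (coordField x₀ (w i) y)) : ℝ))
    (fun i => localize x₀ χ fun y => matCLM (connForm S.nablaPlus A s t (coordField x₀ (w i)) y))
    (fun i => localize x₀ χ fun y => matCLM (connForm S.nablaMinus A s' t (coordField x₀ (w i)) y))
    (fun j => localize x₀ χ fun y => matCLM (cliffMat S (f j) s s' t y)) := by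
  have hf1 : ∀ j y, FieldAt 1 (f j) y := fun j y => (hf j y).of_le one_le_infty
  have he : ∀ k, ∀ y ∈ (chartAt R4 x₀).source, FieldAt 1 (coordField x₀ (w k)) y := fun k y hy =>
    (contMDiffAt_coordField hy _).of_le one_le_infty
  have hΓ := fun i => h.contDiff (f := fun y =>
    matCLM (connForm S.nablaPlus A s t (coordField x₀ (w i)) y)) one_le_infty fun y hy =>
    contMDiffAt_connForm hs ht S.nablaPlus_unitary hA
      (hasC1Symbols_of_class S.nablaPlus_smooth one_le_infty le_rfl) hA1 (he i y hy.1)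
  have hΓ' := fun i => h.contDiff (f := fun y =>
    matCLM (connForm S.nablaMinus A s' t (coordField x₀ (w i)) y)) one_le_infty fun y hy =>
    contMDiffAt_connForm hs' ht S.nablaMinus_unitary hA
      (hasC1Symbols_of_class S.nablaMinus_smooth one_le_infty le_rfl) hA1 (he i y hy.1)
  have hskew : ∀ {V : HermitianPlaneBundle X} {B : Connection V} (_ : IsUnitary B)
      {r : Fin 2 → ∀ y, V.fiber y} (_ : ∀ a, IsSection V ∞ (r a)) (y : X)
      (_ : ∀ᶠ q in 𝓝 y, OrthoAt r t q) (i : Fin 4),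
      IsSkew (matCLM (connForm B A r t (coordField x₀ (w i)) y)) := by
    intro V B hB r hr y ho i c d
    have hanti : ∀ α β, (starRingEnd ℂ) (connForm B A r t (coordField x₀ (w i)) y β α) =
        -connForm B A r t (coordField x₀ (w i)) y α β := fun α β => by
      rw [← connForm_skew hr ht hB hA ho, connForm, tensor_inner_conj_symm]
    rw [C4_real_inner, C4_real_inner, ← Complex.neg_re]
    congr 1
    simp only [PiLp.inner_apply, matCLM_apply, RCLike.inner_apply, map_sum,
      map_mul, hanti, Finset.mul_sum, Finset.sum_mul]
    rw [Finset.sum_comm, ← Finset.sum_neg_distrib]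
    refine Finset.sum_congr rfl fun α _ => ?_
    rw [← Finset.sum_neg_distrib]
    refine Finset.sum_congr rfl fun β _ => ?_
    ring
  refine ⟨fun i j => ?_, fun i l j => ?_, hΓ, fun i => (hΓ' i).continuous, fun j => ?_,
    fun p hp i j => ?_, fun p hp x => ?_, fun p hp i l j => ?_, fun p hp i => ?_, fun p hp i => ?_,
    fun p hp i j x y => ?_, fun p hp i j x => ?_⟩
  · exact h.contDiff one_le_infty fun y _ => (hf1 i y).inner one_le_infty (hf1 j y)
  · refine (h.contDiff one_le_infty fun y hy => (hf1 j y).inner one_le_infty ?_).continuous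
    refine secAt_covariantDerivative hD.hasC1Symbols ?_ (he i y hy.1)
    filter_upwards [(chartAt R4 x₀).open_source.mem_nhds hy.1] with q hq
    exact contMDiffAt_coordField hq _
  · exact h.contDiff one_le_infty fun y _ => contMDiffAt_cliffMat S hs hs' ht (hf j) y
  · rw [h.localize_eq hp, h.localize_eq hp, real_inner_comm]
  · simp only [h.localize_eq hp]
    have : (∑ i, ∑ j, (inner ℝ (f i ((extChartAt (𝓡 4) x₀).symm p))
        (f j ((extChartAt (𝓡 4) x₀).symm p)) : ℝ) * x i * x j) =
        inner ℝ (∑ i, x i • f i ((extChartAt (𝓡 4) x₀).symm p))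
          (∑ i, x i • f i ((extChartAt (𝓡 4) x₀).symm p)) := by
      rw [sum_inner]
      refine Finset.sum_congr rfl fun i _ => ?_
      rw [inner_sum]
      refine Finset.sum_congr rfl fun j _ => ?_
      rw [real_inner_smul_left, real_inner_smul_right]
      ring
    rw [this]
    exact real_inner_self_nonneg
  · rw [h.localize_eq hp, h.localize_eq hp, hD.symm_coordField (h.mem_source hp)]
  · rw [h.localize_eq hp]
    exact hskew S.nablaPlus_unitary hs _ (h.prop hp).2.1 i
  · rw [h.localize_eq hp]
    exact hskew S.nablaMinus_unitary hs' _ (h.prop hp).2.2.1 i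
  · obtain ⟨hy, ho, ho', hd⟩ := h.prop hp
    have hm : ∀ j ψ, matCLM (cliffMat S (f j) s s' t ((extChartAt (𝓡 4) x₀).symm p))
        (compAt s t _ ψ) = compAt s' t _ (cliff S E (f j ((extChartAt (𝓡 4) x₀).symm p)) ψ) :=
      fun j ψ => ho.self_of_nhds.matCLM_compAt _ ψ
    rw [h.localize_eq hp, h.localize_eq hp, h.localize_eq hp,
      ← ho.self_of_nhds.compAt_coefSec x, ← ho.self_of_nhds.compAt_coefSec y]
    simp only [hm, C4_real_inner, ho.self_of_nhds.inner_compAt,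
      ho'.self_of_nhds.inner_compAt]
    rw [← Complex.add_re, inner_cliff_cliff_add, ← Complex.re_ofReal_mul]
    push_cast
    rfl
  · obtain ⟨hy, ho, ho', hd⟩ := h.prop hp
    have hm : ∀ j ψ, matCLM (cliffMat S (f j) s s' t ((extChartAt (𝓡 4) x₀).symm p))
        (compAt s t _ ψ) = compAt s' t _ (cliff S E (f j ((extChartAt (𝓡 4) x₀).symm p)) ψ) :=
      fun j ψ => ho.self_of_nhds.matCLM_compAt _ ψ
    rw [← ho.self_of_nhds.compAt_coefSec x, covDerivHom_cliff S hD hA hs hs' ht hf h hp rfl,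
      hD.dual_deriv (fun j => hf1 j _) (fun k => he k _ hy) hd, ← cliffMap_apply, map_neg, map_sum]
    simp only [h.localize_eq hp, hm]
    simp only [map_smul, cliffMap_apply, LinearMap.neg_apply, LinearMap.sum_apply,
      LinearMap.smul_apply, tensor_real_smul]
    rw [compAt_neg, compAt_sum]
    simp only [compAt_real_smul]

omit hs hs' ht hf h in
/-- The Bochner formula at a local maximum of the norm of a `C¹` section with `C¹` Dirac
derivative. -/
theorem bochner_at_local_max {Φ : ∀ x, Tensor S.Wplus E x}
    (hΦ : ∀ x, TensorAt S.Wplus E 1 Φ x) (hv : ∀ x, TensorAt S.Wminus E 1 (dirac S A Φ) x)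
    (hmax : IsLocalMax (fun y => ‖Φ y‖ ^ 2) x₀) :
    (∑ i, ‖tensorDeriv S.nablaPlus A Φ x₀ (frame x₀ i)‖ ^ 2)
      + ∑ i, (inner ℂ (tensorDeriv S.nablaMinus A (dirac S A Φ) x₀ (frame x₀ i))
          (cliff S E (frame x₀ i) (Φ x₀)) : ℂ).re
      - 1 / 2 * ∑ i, ∑ j, (inner ℂ (cliff S E (frame x₀ j)
          (curvTensor S.nablaPlus A x₀ (frame x₀ i) (frame x₀ j) (Φ x₀)))
          (cliff S E (frame x₀ i) (Φ x₀)) : ℂ).re ≤ 0 := by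
  obtain ⟨w, f, hw, -, hf, hd⟩ := exists_dual_frame x₀
  obtain ⟨s, hs, hso⟩ := exists_orthonormal_frame S.Wplus x₀
  obtain ⟨s', hs', hso'⟩ := exists_orthonormal_frame S.Wminus x₀
  obtain ⟨t, ht, hto⟩ := exists_orthonormal_frame E x₀
  have hP : ∀ᶠ y in 𝓝 x₀, IsAdapted S w f x₀ s s' t y :=
    Filter.Eventually.and ((chartAt R4 x₀).open_source.mem_nhds (mem_chart_source R4 x₀))
      ((hso.and hto).eventually_nhds.and ((hso'.and hto).eventually_nhds.and hd.eventually_nhds))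
  obtain ⟨χ, U, h⟩ := exists_isCutoff hP
  obtain ⟨hx, ho, ho', hd'⟩ := hP.self_of_nhds
  set p₀ := extChartAt (𝓡 4) x₀ x₀
  have hp₀ : p₀ ∈ U := h.mem
  have hpx : (extChartAt (𝓡 4) x₀).symm p₀ = x₀ := extChartAt_to_inv x₀
  -- At the centre the coordinate frame is orthonormal and so equals its dual. The local formula
  -- evaluated there is the one in `frame x₀`.
  have hfx : ∀ j, f j x₀ = frame x₀ j := fun j => by
    conv_lhs => rw [← (frame x₀).sum_repr' (f j x₀)]
    simp only [← hw, real_inner_comm, hd'.self_of_nhds, ite_smul, one_smul, zero_smul]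
    simp
  have hL := localDirac_localize S hD hA hA1 hs hs' ht hf h
  set u : R4 → C4 := localize x₀ χ fun y => compAt s t y (Φ y)
  set v : R4 → C4 := localize x₀ χ fun y => compAt s' t y (dirac S A Φ y)
  have hu : ContDiff ℝ 1 u := h.contDiff one_le_infty fun y _ =>
    contMDiffAt_comps hs ht one_le_infty (hΦ y)
  have hv' : ContDiff ℝ 1 v := h.contDiff one_le_infty fun y _ =>
    contMDiffAt_comps hs' ht one_le_infty (hv y)
  have hm : ∀ y, OrthoAt s t y → ∀ j ψ, matCLM (cliffMat S (f j) s s' t y)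
      (compAt s t _ ψ) = compAt s' t _ (cliff S E (f j y) ψ) :=
    fun y ho j ψ => ho.matCLM_compAt _ ψ
  have hDir : ∀ p ∈ U, ∑ j, (localize x₀ χ fun y => matCLM (cliffMat S (f j) s s' t y)) p
      (covDeriv (localize x₀ χ fun y => matCLM (connForm S.nablaPlus A s t
        (coordField x₀ (w j)) y)) (w j) u p) = v p := fun p hp => by
    have hq := h.prop hp
    simp only [v, u, h.localize_eq hp, covDeriv_localize hs ht S.nablaPlus_unitary hA h hp rfl hq.2.1 _
      (hΦ _), hm _ hq.2.1.self_of_nhds]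
    rw [dirac_eq_sum_dual S Φ hq.2.2.2.self_of_nhds, compAt_sum]
  have hmax' : IsLocalMax (fun p => ‖u p‖ ^ 2) p₀ := by
    have e := h.eventually_symm hp₀ (Q := fun y => ‖Φ y‖ ^ 2 ≤ ‖Φ x₀‖ ^ 2) (by rw [hpx]; exact hmax)
    have hn : ∀ p ∈ U, ‖u p‖ ^ 2 = ‖Φ ((extChartAt (𝓡 4) x₀).symm p)‖ ^ 2 := fun p hp => by
      simp only [u, h.localize_eq hp]
      rw [norm_sq_eq_re_inner (𝕜 := ℂ), (h.prop hp).2.1.self_of_nhds.inner_compAt, tensor_norm_sq]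
      rfl
    filter_upwards [e] with p hp
    rw [hn p hp.1, hn p₀ hp₀, hpx]
    exact hp.2
  -- Components in orthonormal frames preserve inner products, so every local expression translates
  -- back term by term.
  have key := hL.bochner_at_local_max h.isOpen hp₀ hu hv' hDir hmax'
  simp only [v, u, h.localize_eq_at hp₀ hpx,
    covDeriv_localize hs ht S.nablaPlus_unitary hA h hp₀ hpx ho _ (hΦ _),
    covDeriv_localize hs' ht S.nablaMinus_unitary hA h hp₀ hpx ho' _ (hv _),
    curvForm_localize S.nablaPlus_unitary
      (hasC1Symbols_of_class S.nablaPlus_smooth one_le_infty le_rfl) hA hA1 hs ht h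
      (fun y hy => ⟨hy.1, hy.2.1⟩) hp₀ hpx, hm _ ho.self_of_nhds, hfx, hw, C4_real_inner,
    ho.self_of_nhds.inner_compAt, ho'.self_of_nhds.inner_compAt,
    orthonormal_iff_ite.1 (frame x₀).orthonormal, ite_mul, one_mul, zero_mul,
    Finset.sum_ite_eq, Finset.mem_univ, if_true] at key
  convert key using 4
  rw [tensor_norm_sq]

end ManifoldBochner

/-! ### Bounds for the perturbations of the Dirac equation -/

section PerturbedDirac

set_option linter.unusedSectionVars false

lemma norm_le_toReal_of_enorm_le {K : Type*} [SeminormedAddCommGroup K] {z : K} {M : ℝ≥0∞}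
    (h : ‖z‖ₑ ≤ M) (hM : M ≠ ⊤) : ‖z‖ ≤ M.toReal := by
  simpa using ENNReal.toReal_mono hM h

lemma norm_le_mul_norm_of_unit {H K : Type*} [NormedAddCommGroup H] [NormedSpace ℂ H]
    [NormedAddCommGroup K] [NormedSpace ℂ K] {g : H → K} {N : ℝ}
    (hg : ∀ (c : ℂ) h, g (c • h) = c • g h) (hN : ∀ h, ‖h‖ ≤ 1 → ‖g h‖ ≤ N) (h : H) :
    ‖g h‖ ≤ N * ‖h‖ := by
  by_cases h0 : h = 0
  · have := hg 0 0
    simp only [zero_smul] at this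
    simp [h0, this]
  · have hpos : 0 < ‖h‖ := norm_pos_iff.2 h0
    have h1 := hN ((‖h‖⁻¹ : ℂ) • h) (by
      rw [norm_smul]
      simp [hpos.ne'])
    rw [hg, norm_smul, norm_inv, Complex.norm_real, norm_norm, inv_mul_le_iff₀ hpos] at h1
    linarith

variable {X : Type*} [TopologicalSpace X] [ChartedSpace R4 X] [IsManifold (𝓡 4) ∞ X] [T2Space X]
  [Bundle.RiemannianBundle (fun x : X => TangentSpace (𝓡 4) x)]
  [IsContMDiffRiemannianBundle (𝓡 4) ∞ R4 (fun x : X => TangentSpace (𝓡 4) x)]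
  {o : ManifoldOrientation X} {D : TangentConnection X}
  (S : SpincStructure o D) {E : HermitianPlaneBundle X}

lemma norm_cliff {x : X} (v : T x) (Φ : Tensor S.Wplus E x) : ‖cliff S E v Φ‖ = ‖v‖ * ‖Φ‖ := by
  have h := inner_cliff_cliff_add S v v Φ Φ
  have h2 : ‖cliff S E v Φ‖ ^ 2 = (‖v‖ * ‖Φ‖) ^ 2 := by
    rw [mul_pow, tensor_norm_sq, tensor_norm_sq, ← real_inner_self_eq_norm_sq]
    have h3 := congrArg Complex.re h
    rw [Complex.add_re, mul_assoc, ← Complex.ofReal_ofNat, Complex.re_ofReal_mul,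
      Complex.re_ofReal_mul] at h3
    linarith
  exact (pow_left_inj₀ (norm_nonneg _) (by positivity) two_ne_zero).1 h2

lemma rhoOneForm_eq_sum_dual (x : X) (θ : T x →ₗ[ℝ] ℂ) (Φ : Tensor S.Wplus E x)
    {f e : Fin 4 → T x} (h : ∀ j k, (inner ℝ (f j) (e k) : ℝ) = if j = k then 1 else 0) :
    LinearMap.rTensor (E.fiber x) (rhoOneForm S x θ) Φ = ∑ j, θ (e j) • cliff S E (f j) Φ := by
  have hfin : Fintype.card (Fin 4) = Module.finrank ℝ (T x) :=
    (Fintype.card_fin 4).trans (Fact.out (p := Module.finrank ℝ (T x) = 4)).symm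
  let B : T x →ₗ[ℝ] T x →ₗ[ℝ] Tensor S.Wminus E x :=
    LinearMap.mk₂ ℝ (fun u v => θ v • cliffMap S E x u Φ)
      (fun u u' v => by simp) (fun c u v => by
        rw [map_smul, LinearMap.smul_apply, tensor_real_smul, tensor_real_smul, smul_comm])
      (fun u v v' => by simp [add_smul])
      (fun c u v => by
        rw [map_smul, tensor_real_smul, Complex.real_smul, mul_smul])
  have e1 : LinearMap.rTensor (E.fiber x) (rhoOneForm S x θ) Φ =
      ∑ k, θ (frame x k) • cliff S E (frame x k) Φ := by
    refine tensor_ext fun s => ?_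
    rw [contract_rTensor, map_sum, rhoOneForm, LinearMap.sum_apply]
    simp only [LinearMap.smul_apply, map_smul, contract_cliff]
  rw [e1]
  exact sum_orthonormal_eq_sum_dual hfin h (frame x) B

variable (hD : IsLeviCivita D) {A : Connection E} (hA : IsUnitary A)
  (P : Perturbation S E) {Φ : ∀ x, Tensor S.Wplus E x} {x : X}

lemma isTensorSection_coefSec {V : HermitianPlaneBundle X} {s : Fin 2 → ∀ y, V.fiber y}
    {t : Fin 2 → ∀ y, E.fiber y} (hs : ∀ a, IsSection V ∞ (s a)) (ht : ∀ b, IsSection E ∞ (t b))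
    (c : C4) : IsTensorSection V E ∞ (coefSec s t c) := fun r hr y =>
  tensorAt_coefSec hs ht c y r (hr.at y)

lemma isTensorSection_tframe {V : HermitianPlaneBundle X} {s : Fin 2 → ∀ y, V.fiber y}
    {t : Fin 2 → ∀ y, E.fiber y} (hs : ∀ a, IsSection V ∞ (s a)) (ht : ∀ b, IsSection E ∞ (t b))
    (α : Fin 2 × Fin 2) : IsTensorSection V E ∞ (tframe s t α) := fun r hr y =>
  tensorAt_tframe hs ht α y r (hr.at y)

lemma eventually_eq_sum_tframe {V : HermitianPlaneBundle X} {s : Fin 2 → ∀ y, V.fiber y}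
    {t : Fin 2 → ∀ y, E.fiber y} (ho : ∀ᶠ q in 𝓝 x, OrthoAt s t q) (Φ : ∀ x, Tensor V E x) :
    ∀ᶠ q in 𝓝 x, Φ q = ∑ α, (inner ℂ (tframe s t α q) (Φ q) : ℂ) • tframe s t α q :=
  ho.mono fun q hq => (hq.coefSec_compAt (Φ q)).symm

lemma tensorAt_theta (hΦ : TensorAt S.Wplus E 1 Φ x) :
    TensorAt S.Wminus E 1 (fun y => P.theta y (Φ y)) x := by
  obtain ⟨s, hs, hso⟩ := exists_orthonormal_frame S.Wplus x
  obtain ⟨t, ht, hto⟩ := exists_orthonormal_frame E x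
  have hα : ∀ α, TensorAt S.Wplus E 1 (tframe s t α) x := fun α =>
    (tensorAt_tframe hs ht α x).of_le_one one_le_infty le_rfl
  have h1 : TensorAt S.Wminus E 1 (fun y => ∑ α, (inner ℂ (tframe s t α y) (Φ y) : ℂ) •
      P.theta y (tframe s t α y)) x := .sum fun α _ =>
    .smul one_le_infty ((hα α).inner one_le_infty hΦ)
      ((P.theta_C1 _ (isTensorSection_tframe hs ht α)).at one_le_infty x)
  refine h1.congr ?_
  filter_upwards [eventually_eq_sum_tframe (hso.and hto) Φ] with y hy
  conv_lhs => rw [hy]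
  simp only [map_sum, map_smul]

lemma norm_theta_le (hN : P.thetaNorm A ≠ ⊤) (ψ : Tensor S.Wplus E x) :
    ‖P.theta x ψ‖ ≤ (P.thetaNorm A).toReal * ‖ψ‖ := by
  refine norm_le_mul_norm_of_unit (g := fun ψ => P.theta x ψ) (fun c ψ => map_smul _ _ _)
    (fun ψ hψ => norm_le_toReal_of_enorm_le ?_ hN) ψ
  refine le_trans ?_ (le_max_left _ _)
  exact le_iSup_of_le x (le_iSup₂_of_le ψ hψ le_rfl)

include hA in
/-- The derivative of `ϑ Φ` is bounded by the `L^∞_1` norm of `ϑ`. -/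
lemma norm_tensorDeriv_theta_le (hN : P.thetaNorm A ≠ ⊤) (hΦ : TensorAt S.Wplus E 1 Φ x)
    {v : T x} (hv : ‖v‖ ≤ 1) :
    ‖tensorDeriv S.nablaMinus A (fun y => P.theta y (Φ y)) x v‖ ≤
      (P.thetaNorm A).toReal * (‖Φ x‖ + ‖tensorDeriv S.nablaPlus A Φ x v‖) := by
  obtain ⟨s, hs, hso⟩ := exists_orthonormal_frame S.Wplus x
  obtain ⟨t, ht, hto⟩ := exists_orthonormal_frame E x
  have ho : ∀ᶠ q in 𝓝 x, OrthoAt s t q := hso.and hto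
  have hα : ∀ α, TensorAt S.Wplus E 1 (tframe s t α) x := fun α =>
    (tensorAt_tframe hs ht α x).of_le_one one_le_infty le_rfl
  have hθα : ∀ α, TensorAt S.Wminus E 1 (fun y => P.theta y (tframe s t α y)) x := fun α =>
    (P.theta_C1 _ (isTensorSection_tframe hs ht α)).at one_le_infty x
  have hu : ∀ α, ContMDiffAt (𝓡 4) 𝓘(ℝ, ℂ) 1 (fun y => (inner ℂ (tframe s t α y) (Φ y) : ℂ)) x :=
    fun α => (hα α).inner one_le_infty hΦ
  set g : Fin 2 × Fin 2 → Tensor S.Wminus E x := fun α =>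
    tensorDeriv S.nablaMinus A (fun y => P.theta y (tframe s t α y)) x v -
      P.theta x (tensorDeriv S.nablaPlus A (tframe s t α) x v)
  have e1 : tensorDeriv S.nablaMinus A (fun y => P.theta y (Φ y)) x v =
      ∑ α, ((inner ℂ (tframe s t α x) (Φ x) : ℂ) •
        tensorDeriv S.nablaMinus A (fun y => P.theta y (tframe s t α y)) x v +
        mvfderiv (𝓡 4) (fun y => (inner ℂ (tframe s t α y) (Φ y) : ℂ)) x v •
          P.theta x (tframe s t α x)) := by
    have hsum := fun α (_ : α ∈ Finset.univ) => (hθα α).smul one_le_infty (hu α)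
    have hc : ∀ᶠ q in 𝓝 x, P.theta q (Φ q) = ∑ α, (inner ℂ (tframe s t α q) (Φ q) : ℂ) •
        P.theta q (tframe s t α q) := by
      filter_upwards [eventually_eq_sum_tframe ho Φ] with y hy
      conv_lhs => rw [hy]
      simp only [map_sum, map_smul]
    rw [tensorDeriv_congr S.nablaMinus_unitary hA (.sum hsum) hc,
      tensorDeriv_sum S.nablaMinus_unitary hA hsum]
    exact Finset.sum_congr rfl fun α _ => tensorDeriv_smul S.nablaMinus_unitary hA (hu α) (hθα α) v
  have e2 : tensorDeriv S.nablaPlus A Φ x v =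
      ∑ α, ((inner ℂ (tframe s t α x) (Φ x) : ℂ) • tensorDeriv S.nablaPlus A (tframe s t α) x v +
        mvfderiv (𝓡 4) (fun y => (inner ℂ (tframe s t α y) (Φ y) : ℂ)) x v • tframe s t α x) := by
    have hsum := fun α (_ : α ∈ Finset.univ) => (hα α).smul one_le_infty (hu α)
    rw [tensorDeriv_congr S.nablaPlus_unitary hA (.sum hsum) (eventually_eq_sum_tframe ho Φ),
      tensorDeriv_sum S.nablaPlus_unitary hA hsum]
    exact Finset.sum_congr rfl fun α _ => tensorDeriv_smul S.nablaPlus_unitary hA (hu α) (hα α) v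
  have e3 : tensorDeriv S.nablaMinus A (fun y => P.theta y (Φ y)) x v =
      ∑ α, (inner ℂ (tframe s t α x) (Φ x) : ℂ) • g α +
        P.theta x (tensorDeriv S.nablaPlus A Φ x v) := by
    rw [e1, e2, map_sum, ← Finset.sum_add_distrib]
    refine Finset.sum_congr rfl fun α _ => ?_
    simp only [g, map_add, map_smul, smul_sub]
    abel
  -- The supremum in `thetaNorm` runs over smooth sections, while Φ is only `C¹`. The covariant
  -- derivative of `ϑ` is tensorial, so it may be evaluated on the smooth section whose constant
  -- components are those of Φ at x.
  have hg : ∀ c : C4, ∑ α, c α • g α =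
      tensorDeriv S.nablaMinus A (fun y => P.theta y (coefSec s t c y)) x v -
        P.theta x (tensorDeriv S.nablaPlus A (coefSec s t c) x v) := fun c => by
    have hsum := fun α (_ : α ∈ Finset.univ) =>
      (hθα α).smul (f := fun _ => c α) one_le_infty contMDiffAt_const
    have hc : ∀ᶠ q in 𝓝 x, P.theta q (coefSec s t c q) = ∑ α, c α •
        P.theta q (tframe s t α q) := .of_forall fun q => by
      simp only [coefSec, map_sum, map_smul]
    rw [tensorDeriv_congr S.nablaMinus_unitary hA (.sum hsum) hc,
      tensorDeriv_sum S.nablaMinus_unitary hA hsum,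
      tensorDeriv_coefSec S.nablaPlus_unitary hA hs ht, map_sum, ← Finset.sum_sub_distrib]
    refine Finset.sum_congr rfl fun α _ => ?_
    rw [tensorDeriv_smul S.nablaMinus_unitary hA contMDiffAt_const (hθα α), mvfderiv_fun_const,
      zero_smul, add_zero, map_smul, ← smul_sub]
  have hnorm : ∀ ψ, ‖compAt s t x ψ‖ = ‖ψ‖ := fun ψ => by
    refine (pow_left_inj₀ (norm_nonneg _) (norm_nonneg _) two_ne_zero).1 ?_
    rw [norm_sq_eq_re_inner (𝕜 := ℂ), ho.self_of_nhds.inner_compAt, tensor_norm_sq]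
    rfl
  have h4 := norm_le_mul_norm_of_unit (N := (P.thetaNorm A).toReal)
    (g := fun c : C4 => ∑ α, c α • g α) (fun c d => by
      simp only [PiLp.smul_apply, smul_eq_mul, mul_smul, Finset.smul_sum]) (fun c hc => by
      rw [hg]
      refine norm_le_toReal_of_enorm_le (le_trans ?_ (le_max_right _ _)) hN
      have hc' : ‖coefSec s t c x‖ ≤ 1 := by
        rwa [← hnorm, ho.self_of_nhds.compAt_coefSec]
      exact le_iSup_of_le x (le_iSup₂_of_le v (coefSec s t c) (le_iSup₂_of_le hv hc'
        (le_iSup_of_le (isTensorSection_coefSec hs ht c) le_rfl)))) (compAt s t x (Φ x))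
  rw [hnorm] at h4
  rw [e3]
  refine (norm_add_le _ _).trans ?_
  rw [mul_add]
  exact add_le_add h4 (norm_theta_le S P hN _)

lemma contMDiffAt_theta0 {Y : ∀ y : X, T y} (hY : ∀ᶠ y in 𝓝 x, FieldAt ∞ Y y) :
    ContMDiffAt (𝓡 4) 𝓘(ℝ, ℂ) 1 (fun y => P.theta0 y (Y y)) x := by
  obtain ⟨Y', h1, h2⟩ := exists_contMDiff_eventuallyEq (F := R4)
    (V := (TangentSpace (𝓡 4) : X → Type _)) le_rfl hY
  refine ((P.theta0_C1 Y' h1).contMDiffAt (x := x)).congr_of_eventuallyEq ?_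
  filter_upwards [h2] with y hy
  rw [hy]

lemma eventually_fieldAt_coordField (x : X) (w : R4) :
    ∀ᶠ y in 𝓝 x, FieldAt ∞ (coordField x w) y := by
  filter_upwards [(chartAt R4 x).open_source.mem_nhds (mem_chart_source R4 x)] with y hy
  exact contMDiffAt_coordField hy w

lemma tensorAt_rhoOneForm (hΦ : TensorAt S.Wplus E 1 Φ x) :
    TensorAt S.Wminus E 1
      (fun y => LinearMap.rTensor (E.fiber y) (rhoOneForm S y (P.theta0 y)) (Φ y)) x := by
  obtain ⟨w, f, hw, -, hf, hd⟩ := exists_dual_frame x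
  have h1 : TensorAt S.Wminus E 1 (fun y => ∑ j, P.theta0 y (coordField x (w j) y) •
      cliff S E (f j y) (Φ y)) x := .sum fun j _ =>
    .smul one_le_infty (contMDiffAt_theta0 S P (eventually_fieldAt_coordField x (w j)))
      (hΦ.cliff S one_le_infty (hf j))
  refine h1.congr ?_
  filter_upwards [hd] with y hy using rhoOneForm_eq_sum_dual S y _ _ hy

/-- The 4 counts the frame vectors, each of which acts isometrically. -/
lemma norm_rhoOneForm_le (hN : P.theta0Norm ≠ ⊤) (ψ : Tensor S.Wplus E x) :
    ‖LinearMap.rTensor (E.fiber x) (rhoOneForm S x (P.theta0 x)) ψ‖ ≤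
      4 * P.theta0Norm.toReal * ‖ψ‖ := by
  rw [rhoOneForm_eq_sum_dual S x _ ψ (orthonormal_iff_ite.1 (frame x).orthonormal)]
  refine (norm_sum_le_of_le Finset.univ (n := fun _ => P.theta0Norm.toReal * ‖ψ‖)
    fun j _ => ?_).trans (by simp [mul_assoc])
  have h1 : ‖frame x j‖ = 1 := (frame x).orthonormal.1 j
  rw [norm_smul, norm_cliff, h1, one_mul]
  gcongr
  refine norm_le_toReal_of_enorm_le (le_trans ?_ (le_max_left _ _)) hN
  exact le_iSup_of_le x (le_iSup₂_of_le (frame x j) h1.le le_rfl)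

include hA hD in
/-- The derivative of `ρ(ϑ₀) Φ` is bounded by the `L^∞_1` norm of `ϑ₀`. -/
lemma norm_tensorDeriv_rhoOneForm_le (hN : P.theta0Norm ≠ ⊤) (hΦ : TensorAt S.Wplus E 1 Φ x)
    {v : T x} (hv : ‖v‖ ≤ 1) :
    ‖tensorDeriv S.nablaMinus A
        (fun y => LinearMap.rTensor (E.fiber y) (rhoOneForm S y (P.theta0 y)) (Φ y)) x v‖ ≤
      4 * P.theta0Norm.toReal * (‖Φ x‖ + ‖tensorDeriv S.nablaPlus A Φ x v‖) := by
  obtain ⟨w, f, hw, hwe, hf, hd⟩ := exists_dual_frame x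
  have hθ : ∀ j, ContMDiffAt (𝓡 4) 𝓘(ℝ, ℂ) 1 (fun y => P.theta0 y (coordField x (w j) y)) x :=
    fun j => contMDiffAt_theta0 S P (eventually_fieldAt_coordField x (w j))
  have hc : ∀ j, TensorAt S.Wminus E 1 (fun y => cliff S E (f j y) (Φ y)) x := fun j =>
    hΦ.cliff S one_le_infty (hf j)
  have hsum := fun j (_ : j ∈ Finset.univ) => (hc j).smul one_le_infty (hθ j)
  have hfx : ∀ j, f j x = frame x j := fun j => by
    conv_lhs => rw [← (frame x).sum_repr' (f j x)]
    simp only [← hw, real_inner_comm, hd.self_of_nhds, ite_smul, one_smul, zero_smul]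
    simp
  have hdual : ∀ j, D (f j) x v =
      -∑ l, (inner ℝ (f j x) (D (coordField x (w l)) x v) : ℝ) • f l x := fun j =>
    hD.dual_deriv (fun j => (hf j x).of_le one_le_infty)
      (fun k => (contMDiffAt_coordField (mem_chart_source R4 x) (w k)).of_le one_le_infty) hd j v
  -- The derivatives of the dual fields combine with those of the coefficients of `ϑ₀` into the
  -- covariant derivative of the one-form, the quantity bounded by `theta0Norm`.
  have e1 : tensorDeriv S.nablaMinus A
      (fun y => LinearMap.rTensor (E.fiber y) (rhoOneForm S y (P.theta0 y)) (Φ y)) x v =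
      ∑ j, (mvfderiv (𝓡 4) (fun y => P.theta0 y (coordField x (w j) y)) x v -
        P.theta0 x (D (coordField x (w j)) x v)) • cliff S E (f j x) (Φ x) +
      LinearMap.rTensor (E.fiber x) (rhoOneForm S x (P.theta0 x))
        (tensorDeriv S.nablaPlus A Φ x v) := by
    rw [tensorDeriv_congr S.nablaMinus_unitary hA (.sum hsum)
      (hd.mono fun y hy => rhoOneForm_eq_sum_dual S y _ _ hy),
      tensorDeriv_sum S.nablaMinus_unitary hA hsum,
      rhoOneForm_eq_sum_dual S x _ _ hd.self_of_nhds]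
    have h1 : ∀ j, tensorDeriv S.nablaMinus A (fun y => P.theta0 y (coordField x (w j) y) •
        cliff S E (f j y) (Φ y)) x v =
        -∑ l, (P.theta0 x (coordField x (w j) x) *
          ((inner ℝ (f j x) (D (coordField x (w l)) x v) : ℝ) : ℂ)) • cliff S E (f l x) (Φ x) +
        P.theta0 x (coordField x (w j) x) • cliff S E (f j x) (tensorDeriv S.nablaPlus A Φ x v) +
        mvfderiv (𝓡 4) (fun y => P.theta0 y (coordField x (w j) y)) x v •
          cliff S E (f j x) (Φ x) := fun j => by
      rw [tensorDeriv_smul S.nablaMinus_unitary hA (hθ j) (hc j), tensorDeriv_cliff S hA (hf j) hΦ,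
        hdual, ← cliffMap_apply, map_neg, map_sum, smul_add, LinearMap.neg_apply,
        LinearMap.sum_apply, smul_neg, Finset.smul_sum]
      simp only [map_smul, LinearMap.smul_apply, tensor_real_smul, cliffMap_apply, mul_smul]
    have h2 : ∀ l, P.theta0 x (D (coordField x (w l)) x v) = ∑ j,
        P.theta0 x (coordField x (w j) x) *
          ((inner ℝ (f j x) (D (coordField x (w l)) x v) : ℝ) : ℂ) := fun l => by
      conv_lhs => rw [← (frame x).sum_repr' (D (coordField x (w l)) x v), map_sum]
      refine Finset.sum_congr rfl fun j _ => ?_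
      rw [map_smul, hw, hfx, Complex.real_smul, mul_comm]
    simp only [h1, h2, sub_smul, Finset.sum_add_distrib, Finset.sum_sub_distrib,
      Finset.sum_neg_distrib, Finset.sum_smul]
    rw [Finset.sum_comm]
    abel
  rw [e1, mul_add]
  refine (norm_add_le _ _).trans (add_le_add ?_ (norm_rhoOneForm_le S P hN _))
  refine (norm_sum_le_of_le Finset.univ (n := fun _ => P.theta0Norm.toReal * ‖Φ x‖)
    fun j _ => ?_).trans (by simp [mul_assoc])
  have h1 : ‖frame x j‖ = 1 := (frame x).orthonormal.1 j
  rw [norm_smul, norm_cliff, hfx, h1, one_mul, ← hwe]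
  gcongr
  refine norm_le_toReal_of_enorm_le (le_trans ?_ (le_max_right _ _)) hN
  exact le_iSup_of_le x (le_iSup₂_of_le v (frame x j) (le_iSup₂_of_le hv h1.le le_rfl))

end PerturbedDirac

/-! ### Absorbing the gradient at a maximum -/

section MonopoleBochner

set_option linter.unusedSectionVars false

variable {X : Type*} [TopologicalSpace X] [ChartedSpace R4 X] [IsManifold (𝓡 4) ∞ X] [T2Space X]
  [Bundle.RiemannianBundle (fun x : X => TangentSpace (𝓡 4) x)]
  [IsContMDiffRiemannianBundle (𝓡 4) ∞ R4 (fun x : X => TangentSpace (𝓡 4) x)]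
  {o : ManifoldOrientation X} {D : TangentConnection X}

lemma tensor_norm_inner_le {V E : HermitianPlaneBundle X} {x : X} (Φ Ψ : Tensor V E x) :
    ‖(inner ℂ Φ Ψ : ℂ)‖ ≤ ‖Φ‖ * ‖Ψ‖ :=
  norm_inner_le_norm (𝕜 := ℂ) (E := Tensor V E x) Φ Ψ

lemma continuous_norm_sq_of_tensorAt {V E : HermitianPlaneBundle X} {Φ : ∀ x, Tensor V E x}
    (hΦ : ∀ x, TensorAt V E 1 Φ x) : Continuous fun y => ‖Φ y‖ ^ 2 := by
  refine continuous_iff_continuousAt.2 fun x => ?_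
  simp only [tensor_norm_sq]
  exact Complex.continuous_re.continuousAt.comp
    ((hΦ x).inner one_le_infty (hΦ x)).continuousAt

/-- The weighted sum of gradients that Young's inequality absorbs. -/
lemma le_of_gradient_absorption {a : Fin 4 → ℝ} {b : Fin 4 → ℝ} {θ φ t : ℝ} (h0 : 0 ≤ θ)
    (h1 : θ ≤ 1) (hb : ∀ i, |b i| ≤ 4 * θ * (φ + a i) * φ)
    (h : ∑ i, a i ^ 2 + ∑ i, b i - t ≤ 0) : -t ≤ 32 * θ * φ ^ 2 := by
  -- Completing the square, a² - 4θφa ≥ -4θ²φ² ≥ -4θφ² since θ ≤ 1; the remaining part of the bound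
  -- on b_i costs another 4θφ². Four directions give 32.
  have hi : ∀ i, -8 * θ * φ ^ 2 ≤ a i ^ 2 + b i := fun i => by
    have h2 := (abs_le.1 (hb i)).1
    have h3 : 0 ≤ (a i - 2 * θ * φ) ^ 2 := sq_nonneg _
    have h4 : θ ^ 2 * φ ^ 2 ≤ θ * φ ^ 2 := by
      refine mul_le_mul_of_nonneg_right ?_ (sq_nonneg _)
      nlinarith
    nlinarith
  have hs := Finset.sum_le_sum fun i (_ : i ∈ Finset.univ) => hi i
  rw [Finset.sum_add_distrib] at hs
  simp only [Finset.sum_const, Finset.card_univ, Fintype.card_fin, nsmul_eq_mul] at hs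
  push_cast at hs
  linarith

variable (S : SpincStructure o D) {E : HermitianPlaneBundle X} (hD : IsLeviCivita D)
  {A : Connection E} (hA : IsUnitary A) (P : Perturbation S E) {Φ : ∀ x, Tensor S.Wplus E x}

/-- The right-hand side contains no derivative of Φ. This makes the Dirac derivative of class `C¹`,
the regularity that the Bochner formula requires. -/
lemma dirac_eq_neg (hM : IsMonopole S P A Φ) : dirac S A Φ = fun y => (-1 : ℂ) •
    (LinearMap.rTensor (E.fiber y) (rhoOneForm S y (P.theta0 y)) (Φ y) + P.theta y (Φ y)) := by
  funext y
  have h := hM.dirac_eq y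
  rw [add_assoc] at h
  rw [eq_neg_of_add_eq_zero_left h, neg_smul, one_smul]

lemma Perturbation.IsAdmissible.theta0_ne_top {P : Perturbation S E} (h : P.IsAdmissible A) :
    P.theta0Norm ≠ ⊤ := fun h' => by
  have := h.theta_le
  simp [h'] at this

lemma Perturbation.IsAdmissible.theta_ne_top {P : Perturbation S E} (h : P.IsAdmissible A) :
    P.thetaNorm A ≠ ⊤ := fun h' => by
  have := h.theta_le
  simp [h'] at this

include hA hD in
lemma norm_tensorDeriv_dirac_le (hP : P.IsAdmissible A) (hM : IsMonopole S P A Φ) {x : X}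
    (hΦ : TensorAt S.Wplus E 1 Φ x) {v : T x} (hv : ‖v‖ ≤ 1) :
    ‖tensorDeriv S.nablaMinus A (dirac S A Φ) x v‖ ≤
      4 * (P.theta0Norm + P.thetaNorm A).toReal *
        (‖Φ x‖ + ‖tensorDeriv S.nablaPlus A Φ x v‖) := by
  have h0 := tensorAt_rhoOneForm S P hΦ
  have h1 := tensorAt_theta S P hΦ
  rw [dirac_eq_neg S P hM, tensorDeriv_smul S.nablaMinus_unitary hA contMDiffAt_const (h0.add h1),
    mvfderiv_fun_const, zero_smul, add_zero, neg_smul, one_smul, norm_neg,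
    tensorDeriv_add S.nablaMinus_unitary hA h0 h1,
    ENNReal.toReal_add hP.theta0_ne_top hP.theta_ne_top]
  refine (norm_add_le _ _).trans ((add_le_add
    (norm_tensorDeriv_rhoOneForm_le S hD hA P hP.theta0_ne_top hΦ hv)
    (norm_tensorDeriv_theta_le S hA P hP.theta_ne_top hΦ hv)).trans ?_)
  have : 0 ≤ (P.thetaNorm A).toReal * (‖Φ x‖ + ‖tensorDeriv S.nablaPlus A Φ x v‖) := by positivity
  linarith

include hA hD in
/-- The Weitzenböck term at a maximum of `|Φ|²`. -/
theorem weitzenbock_le_at_local_max (hA1 : HasC1Symbols A) (hP : P.IsAdmissible A)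
    (hM : IsMonopole S P A Φ) (hΦ : ∀ x, TensorAt S.Wplus E 1 Φ x) {x₀ : X}
    (hmax : IsLocalMax (fun y => ‖Φ y‖ ^ 2) x₀) :
    -(1 / 2 * ∑ i, ∑ j, (inner ℂ (cliff S E (frame x₀ j)
          (curvTensor S.nablaPlus A x₀ (frame x₀ i) (frame x₀ j) (Φ x₀)))
          (cliff S E (frame x₀ i) (Φ x₀)) : ℂ).re) ≤
      32 * (P.theta0Norm + P.thetaNorm A).toReal * ‖Φ x₀‖ ^ 2 := by
  have hv : ∀ x, TensorAt S.Wminus E 1 (dirac S A Φ) x := fun x => by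
    rw [dirac_eq_neg S P hM]
    exact .smul one_le_infty contMDiffAt_const
      ((tensorAt_rhoOneForm S P (hΦ x)).add (tensorAt_theta S P (hΦ x)))
  refine le_of_gradient_absorption ENNReal.toReal_nonneg
    (by simpa using ENNReal.toReal_mono ENNReal.one_ne_top hP.theta_le) (fun i => ?_)
    (bochner_at_local_max S hD hA hA1 hΦ hv hmax)
  have h1 : ‖frame x₀ i‖ = 1 := (frame x₀).orthonormal.1 i
  refine (Complex.abs_re_le_norm _).trans ((tensor_norm_inner_le _ _).trans ?_)
  rw [norm_cliff, h1, one_mul]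
  gcongr
  exact norm_tensorDeriv_dirac_le S hD hA P hP hM (hΦ x₀) h1.le

end MonopoleBochner

/-! ### Symmetries of the Riemann tensor and the spin curvature -/

section CurvatureIdentities

set_option linter.unusedSectionVars false

variable {X : Type*} [TopologicalSpace X] [ChartedSpace R4 X] [IsManifold (𝓡 4) ∞ X] [T2Space X]
  [Bundle.RiemannianBundle (fun x : X => TangentSpace (𝓡 4) x)]
  [IsContMDiffRiemannianBundle (𝓡 4) ∞ R4 (fun x : X => TangentSpace (𝓡 4) x)]
  {o : ManifoldOrientation X} {D : TangentConnection X}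

lemma exists_isVectorField_eq {x : X} (v : T x) :
    ∃ Y : ∀ y : X, T y, IsVectorField ∞ Y ∧ Y x = v := by
  obtain ⟨Y, hY, h⟩ := exists_contMDiff_eventuallyEq (F := R4)
    (V := (TangentSpace (𝓡 4) : X → Type _)) le_rfl (secAt_extend (F := R4) v)
  exact ⟨Y, hY, h.self_of_nhds.trans (FiberBundle.extend_apply_self _ v)⟩

section Bianchi

variable (hD : IsLeviCivita D)
include hD

lemma IsLeviCivita.curvOp_coordField {x₀ : X} (w z s : R4) :
    curvOp D (coordField x₀ w) (coordField x₀ z) (coordField x₀ s) x₀ =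
      D (fun q => D (coordField x₀ s) q (coordField x₀ z q)) x₀ (coordField x₀ w x₀) -
      D (fun q => D (coordField x₀ s) q (coordField x₀ w q)) x₀ (coordField x₀ z x₀) := by
  rw [curvOp, mlieBracket_coordField (mem_chart_source R4 x₀), map_zero, sub_zero]

lemma IsLeviCivita.deriv_deriv_coordField_symm {x₀ : X} (w z s : R4) :
    D (fun q => D (coordField x₀ s) q (coordField x₀ z q)) x₀ (coordField x₀ w x₀) =
      D (fun q => D (coordField x₀ z) q (coordField x₀ s q)) x₀ (coordField x₀ w x₀) := by
  refine covariantDerivative_congr D ?_ ?_ _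
  · exact secAt_covariantDerivative hD.hasC1Symbols
      (eventually_fieldAt_coordField x₀ z) ((contMDiffAt_coordField (mem_chart_source R4 x₀) s).of_le
        one_le_infty)
  · filter_upwards [(chartAt R4 x₀).open_source.mem_nhds (mem_chart_source R4 x₀)] with q hq
    exact hD.symm_coordField hq z s

/-- The first Bianchi identity. -/
lemma IsLeviCivita.bianchi (x : X) (u v w : T x) :
    curvature D x u v w + curvature D x v w u + curvature D x w u v = 0 := by
  obtain ⟨a, ha, -⟩ := exists_coordField_self x u
  obtain ⟨b, hb, -⟩ := exists_coordField_self x v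
  obtain ⟨c, hc, -⟩ := exists_coordField_self x w
  have h : ∀ a b c : R4, curvature D x (coordField x a x) (coordField x b x) (coordField x c x) =
      curvOp D (coordField x a) (coordField x b) (coordField x c) x := fun a b c =>
    curvature_eq_curvOp hD.hasC1Symbols hD.isMetric (mem_chart_source R4 x) a b
      (eventually_fieldAt_coordField x c)
  rw [← ha, ← hb, ← hc, h, h, h, hD.curvOp_coordField, hD.curvOp_coordField, hD.curvOp_coordField,
    hD.deriv_deriv_coordField_symm a b c, hD.deriv_deriv_coordField_symm b a c,
    hD.deriv_deriv_coordField_symm c b a]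
  abel

end Bianchi

/-- The Riemann curvature tensor `⟨R(e_i, e_j) e_k, e_l⟩` in the orthonormal frame. -/
def riem (D : TangentConnection X) (x : X) (i j k l : Fin 4) : ℝ :=
  inner ℝ (curvature D x (frame x i) (frame x j) (frame x k)) (frame x l)

lemma riem_skew_left (x : X) (i j k l : Fin 4) : riem D x j i k l = -riem D x i j k l := by
  rw [riem, curvature_swap, inner_neg_left, riem]

lemma IsLeviCivita.riem_skew_right (hD : IsLeviCivita D) (x : X) (i j k l : Fin 4) :
    riem D x i j l k = -riem D x i j k l := by
  rw [riem, inner_curvature_skew hD.hasC1Symbols hD.isMetric, real_inner_comm, riem]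

lemma IsLeviCivita.riem_bianchi (hD : IsLeviCivita D) (x : X) (i j k l : Fin 4) :
    riem D x i j k l + riem D x j k i l + riem D x k i j l = 0 := by
  simp only [riem, ← inner_add_left]
  rw [hD.bianchi, inner_zero_left]

/-- The classical argument: four Bianchi identities, one for each cyclic rotation of the indices,
combined with the two skew symmetries. -/
lemma IsLeviCivita.riem_pair (hD : IsLeviCivita D) (x : X) (i j k l : Fin 4) :
    riem D x i j k l = riem D x k l i j := by
  have h := hD.riem_bianchi x
  have s := riem_skew_left (D := D) x
  have r := hD.riem_skew_right x
  have h1 := h i j k l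
  have h2 := h j k l i
  have h3 := h k l i j
  have h4 := h l i j k
  linarith [r i j l k, r j k i l, r k i j l, s j k l i, r j k l i, r k l j i, s l j k i, r l j k i,
    r j l k i, s j l k i, s k l i j, s l i k j, r l i k j, r i k l j, s i k l j, s k i l j,
    s l i j k, r l i j k, s i j l k, s j l i k, r j l i k, s k l j i]

variable (S : SpincStructure o D)

/-- Expansion in the smooth dual frame allows a vector field that is merely `C¹`. This is applied to
∇Y, whose covariant derivative enters the second derivatives of ρ(Y)φ. -/
lemma isSectionAt_rho_of_fieldAt {Y : ∀ x : X, T x} {φ : ∀ x, S.Wplus.fiber x} {x : X}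
    (hY : FieldAt 1 Y x) (hφ : IsSectionAt S.Wplus 1 φ x) :
    IsSectionAt S.Wminus 1 (fun y => S.rho y (Y y) (φ y)) x := by
  obtain ⟨w, f, -, -, hf, hd⟩ := exists_dual_frame x
  have hfin : ∀ y : X, Fintype.card (Fin 4) = Module.finrank ℝ (T y) := fun y =>
    (Fintype.card_fin 4).trans (Fact.out (p := Module.finrank ℝ (T y) = 4)).symm
  have hc : ∀ k, ContMDiffAt (𝓡 4) 𝓘(ℝ, ℂ) 1
      (fun y => ((inner ℝ (coordField x (w k) y) (Y y) : ℝ) : ℂ)) x := fun k =>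
    (Complex.ofRealCLM.contMDiff.contMDiffAt).comp x (FieldAt.inner one_le_infty
      ((contMDiffAt_coordField (mem_chart_source R4 x) (w k)).of_le one_le_infty) hY)
  have h : IsSectionAt S.Wminus 1 (fun y => ∑ k, ((inner ℝ (coordField x (w k) y) (Y y) : ℝ) : ℂ) •
      S.rho y (f k y) (φ y)) x := .sum fun k _ =>
    .smul one_le_infty (hc k) (isSectionAt_rho S one_le_infty (hf k) hφ)
  refine h.congr ?_
  filter_upwards [hd] with y hy
  conv_lhs => rw [eq_sum_dual (hfin y) (dual_symm hy) (Y y)]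
  simp only [map_sum, map_smul, LinearMap.sum_apply, LinearMap.smul_apply, Complex.coe_smul]

/-- The curvatures of the spin connections and of the Levi-Civita connection are related by
Clifford multiplication. -/
lemma curvature_rho (hD : IsLeviCivita D) (x : X) (u v w : T x) (φ : S.Wplus.fiber x) :
    curvature S.nablaMinus x u v (S.rho x w φ) =
      S.rho x (curvature D x u v w) φ + S.rho x w (curvature S.nablaPlus x u v φ) := by
  obtain ⟨a, rfl, -⟩ := exists_coordField_self x u
  obtain ⟨b, rfl, -⟩ := exists_coordField_self x v
  obtain ⟨Y, hY, rfl⟩ := exists_isVectorField_eq w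
  obtain ⟨s, hs, rfl⟩ := exists_isSection_eq φ
  have hx := mem_chart_source R4 x
  have hP : HasC1Symbols S.nablaPlus := hasC1Symbols_of_class S.nablaPlus_smooth one_le_infty le_rfl
  have hN : HasC1Symbols S.nablaMinus :=
    hasC1Symbols_of_class S.nablaMinus_smooth one_le_infty le_rfl
  have hYs : ∀ y, FieldAt ∞ Y y := fun y => hY y
  have hss : ∀ y, IsSectionAt S.Wplus ∞ s y := fun y => hs y
  have hc : ∀ w : R4, FieldAt 1 (coordField x w) x := fun w =>
    (contMDiffAt_coordField hx w).of_le one_le_infty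
  have hDY : ∀ w : R4, FieldAt 1 (fun q => D Y q (coordField x w q)) x := fun w =>
    secAt_covariantDerivative hD.hasC1Symbols (.of_forall hYs) (hc w)
  have hDs : ∀ w : R4, IsSectionAt S.Wplus 1 (fun q => S.nablaPlus s q (coordField x w q)) x :=
    fun w => secAt_covariantDerivative hP (.of_forall hss) (hc w)
  have h1 : ∀ q (v : T q), S.nablaMinus (fun y => S.rho y (Y y) (s y)) q v =
      S.rho q (D Y q v) (s q) + S.rho q (Y q) (S.nablaPlus s q v) := fun q v =>
    S.compatible Y s q v (FieldAt.diffAt ((hYs q).of_le one_le_infty))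
      (IsSectionAt.diffAt ((hss q).of_le one_le_infty))
  -- The product rule applied twice; the two mixed terms are interchanged when the directions are,
  -- and so cancel in the commutator.
  have h2 : ∀ (w : R4) (v : T x), S.nablaMinus (fun q =>
      S.nablaMinus (fun y => S.rho y (Y y) (s y)) q (coordField x w q)) x v =
      S.rho x (D (fun q => D Y q (coordField x w q)) x v) (s x) +
        S.rho x (D Y x (coordField x w x)) (S.nablaPlus s x v) +
      (S.rho x (D Y x v) (S.nablaPlus s x (coordField x w x)) +
        S.rho x (Y x) (S.nablaPlus (fun q => S.nablaPlus s q (coordField x w q)) x v)) :=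
    fun w v => by
      simp only [h1]
      have e1 := isSectionAt_rho_of_fieldAt S (hDY w) ((hss x).of_le one_le_infty)
      have e2 := isSectionAt_rho S one_le_infty hY (hDs w)
      rw [connection_add _ e1 e2, S.compatible _ _ x v (hDY w).diffAt
        (IsSectionAt.diffAt ((hss x).of_le one_le_infty)), S.compatible _ _ x v
        (FieldAt.diffAt ((hYs x).of_le one_le_infty)) (IsSectionAt.diffAt (hDs w))]
  rw [curvature_eq_curvOp hN S.nablaMinus_unitary.isMetric hx a b
      (s := fun y => S.rho y (Y y) (s y)) (.of_forall fun q => S.rho_smooth Y s hY hs q),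
    curvature_eq_curvOp hP S.nablaPlus_unitary.isMetric hx a b (.of_forall hss),
    curvature_eq_curvOp hD.hasC1Symbols hD.isMetric hx a b (.of_forall hYs), curvOp, curvOp, curvOp,
    h2, h2, h1]
  simp only [map_sub, LinearMap.sub_apply]
  abel

end CurvatureIdentities

/-! ### The volume form on a basis -/

section LeviCivitaSymbol

/-- The Levi-Civita symbol. -/
def leviCivita (i j k l : Fin 4) : ℤ :=
  (Matrix.of fun a b => if a = ![i, j, k, l] b then (1 : ℤ) else 0).det

/-- For `a = 0, 1, 2`, the pair of indices complementary to `(0, a + 1)`, in positive order. -/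
def compl₁ : Fin 3 → Fin 4 := ![2, 3, 1]

/-- The second entry of the complementary pair `(compl₁ a, compl₂ a)`. -/
def compl₂ : Fin 3 → Fin 4 := ![3, 1, 2]

lemma leviCivita_zero_succ : ∀ (a : Fin 3) (k l : Fin 4), leviCivita 0 a.succ k l =
    if k = compl₁ a ∧ l = compl₂ a then 1 else if k = compl₂ a ∧ l = compl₁ a then -1 else 0 := by
  decide +kernel

lemma leviCivita_compl : ∀ (a : Fin 3) (k l : Fin 4), leviCivita (compl₁ a) (compl₂ a) k l =
    if k = 0 ∧ l = a.succ then 1 else if k = a.succ ∧ l = 0 then -1 else 0 := by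
  decide +kernel

lemma det_basis_eq_leviCivita {H : Type*} [AddCommGroup H] [Module ℝ H]
    (e : Module.Basis (Fin 4) ℝ H) (i j k l : Fin 4) :
    e.det ![e i, e j, e k, e l] = leviCivita i j k l := by
  rw [Module.Basis.det_apply, leviCivita, Int.cast_det]
  congr 1
  ext a b
  have h : ![e i, e j, e k, e l] b = e (![i, j, k, l] b) := by fin_cases b <;> rfl
  rw [Module.Basis.toMatrix_apply, h, Module.Basis.repr_self, Finsupp.single_apply]
  simp [eq_comm]

lemma sum_sum_smul_ite {G : Type*} [AddCommGroup G] [Module ℝ G] (η : Fin 4 → Fin 4 → G) (r : ℝ)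
    {p q : Fin 4} (hpq : p ≠ q) :
    ∑ k, ∑ l, (r * (if k = p ∧ l = q then 1 else if k = q ∧ l = p then -1 else 0 : ℤ)) • η k l =
      r • (η p q - η q p) := by
  have h : ∀ k l, (r * (if k = p ∧ l = q then 1 else if k = q ∧ l = p then -1 else 0 : ℤ)) • η k l =
      (if k = p then if l = q then r • η p q else 0 else 0) -
        (if k = q then if l = p then r • η q p else 0 else 0) := fun k l => by
    by_cases h1 : k = p
    · have h2 : k ≠ q := h1 ▸ hpq
      by_cases h3 : l = q <;> simp [h1, h3, hpq]
    · by_cases h2 : k = q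
      · by_cases h3 : l = p <;> simp [h2, h3, hpq.symm]
      · simp [h1, h2]
  simp only [h]
  simp [Finset.sum_sub_distrib, smul_sub]

end LeviCivitaSymbol

/-! ### Quaternions from Clifford multiplication -/

section FrameAlgebra

set_option linter.unusedSectionVars false

variable {X : Type*} [TopologicalSpace X] [ChartedSpace R4 X] [IsManifold (𝓡 4) ∞ X] [T2Space X]
  [Bundle.RiemannianBundle (fun x : X => TangentSpace (𝓡 4) x)]
  [IsContMDiffRiemannianBundle (𝓡 4) ∞ R4 (fun x : X => TangentSpace (𝓡 4) x)]
  {o : ManifoldOrientation X} {D : TangentConnection X}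

/-- The sign of the frame at `x` with respect to the orientation. -/
def frameSign (o : ManifoldOrientation X) (x : X) : ℝ := (o.at_ x).volumeForm (frame x)

lemma volumeForm_frame (o : ManifoldOrientation X) (x : X) (i j k l : Fin 4) :
    (o.at_ x).volumeForm ![frame x i, frame x j, frame x k, frame x l] =
      frameSign o x * leviCivita i j k l := by
  have h := AlternatingMap.eq_smul_basis_det (frame x).toBasis (o.at_ x).volumeForm
  have h1 := det_basis_eq_leviCivita (frame x).toBasis i j k l
  simp only [OrthonormalBasis.coe_toBasis] at h h1
  rw [h, AlternatingMap.smul_apply, h1]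
  rfl

lemma compl_ne (a : Fin 3) : compl₁ a ≠ compl₂ a := by
  revert a
  decide

section Hodge

variable {G : Type*} [AddCommGroup G] [Module ℝ G] {x : X} (η : Bilin x G)

lemma hodgeStar_zero_succ (a : Fin 3) : hodgeStar o η (frame x 0) (frame x a.succ) =
    (frameSign o x / 2) • (η (frame x (compl₁ a)) (frame x (compl₂ a)) -
      η (frame x (compl₂ a)) (frame x (compl₁ a))) := by
  simp only [hodgeStar, volumeForm_frame, leviCivita_zero_succ]
  rw [sum_sum_smul_ite (fun k l => η (frame x k) (frame x l)) _ (compl_ne a), smul_smul]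
  congr 1
  ring

lemma hodgeStar_compl (a : Fin 3) :
    hodgeStar o η (frame x (compl₁ a)) (frame x (compl₂ a)) =
      (frameSign o x / 2) • (η (frame x 0) (frame x a.succ) - η (frame x a.succ) (frame x 0)) := by
  simp only [hodgeStar, volumeForm_frame, leviCivita_compl]
  rw [sum_sum_smul_ite (fun k l => η (frame x k) (frame x l)) _ (Fin.succ_ne_zero a).symm, smul_smul]
  congr 1
  ring

end Hodge

variable (S : SpincStructure o D) (x : X)

/-- The endomorphism `ρ(e_i)† ρ(e_j)` of `W⁺`. -/
def cliffEnd (i j : Fin 4) : Module.End ℂ (S.Wplus.fiber x) :=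
  LinearMap.adjoint (S.rho x (frame x i)) ∘ₗ S.rho x (frame x j)

/-- The endomorphism `ρ(e_0)† ρ(e_a)` of `W⁺`; these three generate a quaternion algebra. -/
def quat (a : Fin 3) : Module.End ℂ (S.Wplus.fiber x) := cliffEnd S x 0 a.succ

lemma inner_cliffEnd (i j : Fin 4) (φ ψ : S.Wplus.fiber x) :
    (inner ℂ (cliffEnd S x i j φ) ψ : ℂ) =
      inner ℂ (S.rho x (frame x j) φ) (S.rho x (frame x i) ψ) := by
  rw [cliffEnd, LinearMap.comp_apply, LinearMap.adjoint_inner_left]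

lemma adjoint_cliffEnd (i j : Fin 4) :
    LinearMap.adjoint (cliffEnd S x i j) = cliffEnd S x j i := by
  simp [cliffEnd, LinearMap.adjoint_comp]

lemma cliffEnd_add_swap (i j : Fin 4) :
    cliffEnd S x i j + cliffEnd S x j i = if i = j then 2 else 0 := by
  refine LinearMap.ext fun φ => ext_inner_right ℂ fun ψ => ?_
  have h := inner_rho_rho_add S (frame x j) (frame x i) φ ψ
  rw [LinearMap.add_apply, inner_add_left, inner_cliffEnd, inner_cliffEnd, h,
    orthonormal_iff_ite.1 (frame x).orthonormal]
  by_cases hij : i = j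
  · simp [hij, Module.End.ofNat_apply, two_smul, inner_add_left, two_mul]
  · simp [hij, Ne.symm hij]

lemma cliffEnd_self (i : Fin 4) : cliffEnd S x i i = 1 := by
  have h := cliffEnd_add_swap S x i i
  rw [if_pos rfl, ← two_smul ℂ] at h
  have h2 : (2 : ℂ) • cliffEnd S x i i = (2 : ℂ) • (1 : Module.End ℂ (S.Wplus.fiber x)) := by
    rw [h]; ext; simp [Module.End.ofNat_apply, two_smul]
  exact smul_right_injective _ two_ne_zero h2

lemma cliffEnd_swap {i j : Fin 4} (h : i ≠ j) : cliffEnd S x j i = -cliffEnd S x i j := by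
  have := cliffEnd_add_swap S x i j
  rw [if_neg h] at this
  exact eq_neg_of_add_eq_zero_right this

/-- `clifford` makes the adjoint a left inverse. Since W⁺ and W⁻ have the same rank, it is also a
right inverse. -/
lemma rho_comp_adjoint (i : Fin 4) :
    S.rho x (frame x i) ∘ₗ LinearMap.adjoint (S.rho x (frame x i)) = LinearMap.id := by
  have h : ∀ φ, LinearMap.adjoint (S.rho x (frame x i)) (S.rho x (frame x i) φ) = φ := fun φ =>
    LinearMap.congr_fun (cliffEnd_self S x i) φ
  have hs : Function.Surjective (S.rho x (frame x i)) :=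
    (LinearMap.injective_iff_surjective_of_finrank_eq_finrank
      ((finrank_fiber _ _).trans (finrank_fiber _ _).symm)).1 (Function.LeftInverse.injective h)
  ext ψ
  obtain ⟨φ, rfl⟩ := hs ψ
  rw [LinearMap.comp_apply, h, LinearMap.id_apply]

/-- The inner factor ρ(e_j)ρ(e_j)† is the identity. -/
lemma cliffEnd_mul (i j k : Fin 4) :
    cliffEnd S x i j * cliffEnd S x j k = cliffEnd S x i k := by
  ext φ
  exact congrArg (LinearMap.adjoint (S.rho x (frame x i))) (LinearMap.congr_fun
    (rho_comp_adjoint S x j) (S.rho x (frame x k) φ))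

lemma adjoint_quat (a : Fin 3) : LinearMap.adjoint (quat S x a) = -quat S x a := by
  rw [quat, adjoint_cliffEnd, cliffEnd_swap S x (Fin.succ_ne_zero a).symm]

lemma quat_mul_eq {a b : Fin 3} : quat S x a * quat S x b = -cliffEnd S x a.succ b.succ := by
  rw [← cliffEnd_mul S x a.succ 0 b.succ, cliffEnd_swap S x (Fin.succ_ne_zero a).symm, neg_mul,
    neg_neg, quat, quat]

lemma quat_sq (a : Fin 3) : quat S x a * quat S x a = -1 := by
  rw [quat_mul_eq, cliffEnd_self]

lemma quat_anticomm (a b : Fin 3) :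
    quat S x a * quat S x b + quat S x b * quat S x a = if a = b then -2 else 0 := by
  rw [quat_mul_eq, quat_mul_eq, ← neg_add, cliffEnd_add_swap]
  simp only [Fin.succ_inj]
  split_ifs <;> simp

/-- `frame x` need not be oriented. It differs from an oriented orthonormal basis by signs r_i whose
product is `frameSign`, and the chirality relation is multilinear in the basis. -/
lemma frameSign_mul_self_and_chirality : frameSign o x * frameSign o x = 1 ∧
    cliffEnd S x 0 1 * cliffEnd S x 2 3 = -((frameSign o x : ℂ) • 1) := by
  let e := (frame x).adjustToOrientation (o.at_ x)
  have he : e.toBasis.orientation = o.at_ x := (frame x).orientation_adjustToOrientation _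
  have hs : ∀ i, ∃ r : ℝ, r * r = 1 ∧ frame x i = r • e i := fun i => by
    rcases (frame x).adjustToOrientation_apply_eq_or_eq_neg (o.at_ x) i with h | h
    · exact ⟨1, by norm_num, by rw [one_smul]; exact h.symm⟩
    · exact ⟨-1, by norm_num, by rw [neg_smul, one_smul]; exact (neg_eq_iff_eq_neg.2 h).symm⟩
  choose r hr hf using hs
  have hε : frameSign o x = r 0 * r 1 * r 2 * r 3 := by
    have h1 : (frame x : Fin 4 → T x) = fun i => r i • e i := funext hf
    have h2 := e.toBasis.det_self
    rw [OrthonormalBasis.coe_toBasis] at h2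
    rw [frameSign, h1, AlternatingMap.map_smul_univ, (o.at_ x).volumeForm_robust e he, h2,
      smul_eq_mul, mul_one, Fin.prod_univ_four]
  refine ⟨by rw [hε]; linear_combination (r 1 * r 1 * (r 2 * r 2) * (r 3 * r 3)) * hr 0 +
    (r 2 * r 2 * (r 3 * r 3)) * hr 1 + (r 3 * r 3) * hr 2 + hr 3, ?_⟩
  have hc := S.chirality x e he
  have hsm : ∀ (c : ℝ) (f : S.Wplus.fiber x →ₗ[ℂ] S.Wminus.fiber x), c • f = (c : ℂ) • f :=
    fun c f => by ext; simp
  have hm : ∀ i, S.rho x (frame x i) = (r i : ℂ) • S.rho x (e i) := fun i => by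
    rw [hf, map_smul, hsm]
  have hcc : ∀ i j, cliffEnd S x i j = ((r i * r j : ℝ) : ℂ) •
      (LinearMap.adjoint (S.rho x (e i)) ∘ₗ S.rho x (e j)) := fun i j => by
    rw [cliffEnd, hm, hm, map_smulₛₗ, Complex.conj_ofReal,
      LinearMap.smul_comp, LinearMap.comp_smul, smul_smul, Complex.ofReal_mul]
  rw [hcc, hcc, smul_mul_smul_comm, hε]
  have hc' : (LinearMap.adjoint (S.rho x (e 0)) ∘ₗ S.rho x (e 1)) *
      (LinearMap.adjoint (S.rho x (e 2)) ∘ₗ S.rho x (e 3)) = -1 := by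
    simp only [LinearMap.neg_comp, LinearMap.comp_neg, neg_neg] at hc
    exact hc
  rw [hc', smul_neg]
  congr 2
  push_cast
  ring

include S in
lemma frameSign_mul_self : frameSign o x * frameSign o x = 1 :=
  (frameSign_mul_self_and_chirality S x).1

/-- Chirality fixes the product of the three units `quat`. Multiplying it by single units gives the
cyclic quaternion relations; they say that e_0 ∧ e_a and its complementary two-form act alike up to
the sign of the frame. -/
lemma cliffEnd_compl (a : Fin 3) :
    cliffEnd S x (compl₁ a) (compl₂ a) = (frameSign o x : ℂ) • quat S x a := by
  have h := (frameSign_mul_self_and_chirality S x).2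
  have h1 : quat S x 0 * (quat S x 1 * quat S x 2) = (frameSign o x : ℂ) • 1 := by
    rw [quat_mul_eq, mul_neg, neg_eq_iff_eq_neg]
    exact h
  have q : ∀ a, quat S x a * quat S x a = -1 := quat_sq S x
  have h2 : quat S x 1 * quat S x 2 = -((frameSign o x : ℂ) • quat S x 0) := by
    have := congrArg (quat S x 0 * ·) h1
    simp only [← mul_assoc, q] at this
    rw [mul_smul_comm, mul_one, neg_mul, neg_mul, one_mul, neg_eq_iff_eq_neg] at this
    exact this
  have h3 : quat S x 0 * quat S x 1 = -((frameSign o x : ℂ) • quat S x 2) := by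
    have := congrArg (· * quat S x 2) h1
    simp only [mul_assoc, q] at this
    rw [smul_mul_assoc, one_mul, mul_neg, mul_neg, mul_one, neg_eq_iff_eq_neg] at this
    exact this
  have h4 : quat S x 2 * quat S x 0 = -((frameSign o x : ℂ) • quat S x 1) := by
    have h5 : quat S x 1 * (quat S x 2 * quat S x 0) = (frameSign o x : ℂ) • 1 := by
      rw [← mul_assoc, h2, neg_mul, smul_mul_assoc, q, smul_neg, neg_neg]
    have := congrArg (quat S x 1 * ·) h5
    simp only [← mul_assoc, q] at this
    rw [mul_smul_comm, mul_one, neg_mul, neg_mul, one_mul, neg_eq_iff_eq_neg] at this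
    exact this
  fin_cases a
  · exact neg_injective ((quat_mul_eq S x (a := 1) (b := 2)).symm.trans h2)
  · exact neg_injective ((quat_mul_eq S x (a := 2) (b := 0)).symm.trans h4)
  · exact neg_injective ((quat_mul_eq S x (a := 0) (b := 1)).symm.trans h3)

/-- Clifford multiplication kills the anti-self-dual part of a two-form. -/
lemma sum_cliffEnd {G M : Type*} [AddCommGroup G] [Module ℂ G] [AddCommGroup M] [Module ℂ M]
    (B : Module.End ℂ (S.Wplus.fiber x) →ₗ[ℂ] G →ₗ[ℂ] M) {η : Fin 4 → Fin 4 → G}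
    (hη : ∀ i j, η j i = -η i j) :
    ∑ i, ∑ j, B (cliffEnd S x i j) (η i j) = (2 : ℂ) • ∑ a : Fin 3, B (quat S x a)
      (η 0 a.succ + (frameSign o x : ℂ) • η (compl₁ a) (compl₂ a)) := by
  have h0 : ∀ i, η i i = 0 := fun i => by
    have h := hη i i
    rw [eq_neg_iff_add_eq_zero, ← two_smul ℂ, smul_eq_zero] at h
    exact h.resolve_left two_ne_zero
  have hs : ∀ i j, i ≠ j → B (cliffEnd S x j i) (η j i) = B (cliffEnd S x i j) (η i j) :=
    fun i j hij => by rw [cliffEnd_swap S x hij, hη]; simp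
  have hc : ∀ a, B (cliffEnd S x (compl₁ a) (compl₂ a)) (η (compl₁ a) (compl₂ a)) =
      B (quat S x a) ((frameSign o x : ℂ) • η (compl₁ a) (compl₂ a)) := fun a => by
    rw [cliffEnd_compl]; simp
  have e0 : B (cliffEnd S x 2 3) (η 2 3) = _ := hc 0
  have e1 : B (cliffEnd S x 3 1) (η 3 1) = _ := hc 1
  have e2 : B (cliffEnd S x 1 2) (η 1 2) = _ := hc 2
  simp only [Fin.sum_univ_four, Fin.sum_univ_three, map_add, ← e0, ← e1, ← e2, h0, map_zero]
  rw [hs 0 1 (by decide), hs 0 2 (by decide), hs 0 3 (by decide), hs 1 2 (by decide),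
    hs 2 3 (by decide), ← hs 1 3 (by decide)]
  simp only [quat]
  simp only [show Fin.succ (0 : Fin 3) = 1 from rfl, show Fin.succ (1 : Fin 3) = 2 from rfl,
    show Fin.succ (2 : Fin 3) = 3 from rfl, two_smul]
  abel

end FrameAlgebra

/-! ### The quaternion basis of End(W⁺) -/

section QuaternionBasis

set_option linter.unusedSectionVars false

variable {X : Type*} [TopologicalSpace X] [ChartedSpace R4 X] [IsManifold (𝓡 4) ∞ X] [T2Space X]
  [Bundle.RiemannianBundle (fun x : X => TangentSpace (𝓡 4) x)]
  [IsContMDiffRiemannianBundle (𝓡 4) ∞ R4 (fun x : X => TangentSpace (𝓡 4) x)]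
  {o : ManifoldOrientation X} {D : TangentConnection X} (S : SpincStructure o D) (x : X)

lemma trace_one_fiber (V : HermitianPlaneBundle X) :
    LinearMap.trace ℂ (V.fiber x) (1 : Module.End ℂ (V.fiber x)) = 2 := by
  rw [LinearMap.trace_one, finrank_fiber]; norm_num

lemma trace_quat_mul {a b : Fin 3} (h : a ≠ b) :
    LinearMap.trace ℂ _ (quat S x a * quat S x b) = 0 := by
  have h1 := congrArg (LinearMap.trace ℂ _) (quat_anticomm S x a b)
  rw [if_neg h, map_add, map_zero, LinearMap.trace_mul_comm ℂ (quat S x b), ← two_mul] at h1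
  simpa using h1

/-- With another unit b, the product b(ab) equals a by anticommutation, while cyclicity gives it the
trace of (ab)b = -a. -/
lemma trace_quat (a : Fin 3) : LinearMap.trace ℂ _ (quat S x a) = 0 := by
  obtain ⟨b, hb⟩ : ∃ b : Fin 3, b ≠ a := exists_ne a
  have h1 : quat S x b * (quat S x a * quat S x b) = quat S x a := by
    have := quat_anticomm S x a b
    rw [if_neg hb.symm, add_eq_zero_iff_eq_neg] at this
    rw [this, mul_neg, ← mul_assoc, quat_sq, neg_mul, one_mul, neg_neg]
  have h2 : LinearMap.trace ℂ _ (quat S x b * (quat S x a * quat S x b)) =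
      -LinearMap.trace ℂ _ (quat S x a) := by
    rw [LinearMap.trace_mul_comm, mul_assoc, quat_sq, mul_neg, mul_one, map_neg]
  rw [h1, eq_neg_iff_add_eq_zero, ← two_mul] at h2
  simpa using h2

/-- The identity and the three units are orthogonal for the trace form, and End(W⁺) has dimension
four. -/
lemma exists_eq_quat_sum (M : Module.End ℂ (S.Wplus.fiber x)) :
    ∃ (m₀ : ℂ) (m : Fin 3 → ℂ), M = m₀ • 1 + ∑ a, m a • quat S x a := by
  let b : Option (Fin 3) → Module.End ℂ (S.Wplus.fiber x) := fun i => i.elim 1 (quat S x)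
  have hli : LinearIndependent ℂ b := by
    refine Fintype.linearIndependent_iff.2 fun g hg => ?_
    rw [Fintype.sum_option] at hg
    simp only [b, Option.elim] at hg
    have h0 : g none = 0 := by
      have := congrArg (LinearMap.trace ℂ _) hg
      simpa [finrank_fiber, trace_quat] using this
    rintro (_ | a)
    · exact h0
    · rw [h0, zero_smul, zero_add] at hg
      have := congrArg (fun N => LinearMap.trace ℂ _ (N * quat S x a)) hg
      simp only [Finset.sum_mul, smul_mul_assoc, map_sum, map_smul, zero_mul, map_zero] at this
      rw [Finset.sum_eq_single a (fun c _ hc => by rw [trace_quat_mul S x hc, smul_zero])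
        (by simp), quat_sq, map_neg, trace_one_fiber] at this
      simpa using this
  have hcard : Fintype.card (Option (Fin 3)) =
      Module.finrank ℂ (Module.End ℂ (S.Wplus.fiber x)) := by
    rw [Module.finrank_linearMap, finrank_fiber]; rfl
  let B := basisOfLinearIndependentOfCardEqFinrank hli hcard
  have hB := B.sum_repr M
  rw [Fintype.sum_option] at hB
  refine ⟨B.repr M none, fun a => B.repr M (some a), hB.symm.trans ?_⟩
  simp [B, b]

lemma quat_conj (a b : Fin 3) : quat S x b * quat S x a * quat S x b =
    if a = b then -quat S x a else quat S x a := by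
  have h := quat_anticomm S x a b
  split_ifs at h ⊢ with hab
  · subst hab
    rw [quat_sq, neg_mul, one_mul]
  · rw [eq_neg_of_add_eq_zero_right h, neg_mul, mul_assoc, quat_sq, mul_neg, mul_one, neg_neg]

/-- Averaging over the quaternion group projects onto the scalars. -/
lemma sum_cliffEnd_conj (M : Module.End ℂ (S.Wplus.fiber x)) :
    ∃ m : ℂ, ∑ k, cliffEnd S x k 0 * M * cliffEnd S x 0 k = m • 1 := by
  obtain ⟨m₀, m, rfl⟩ := exists_eq_quat_sum S x M
  refine ⟨4 * m₀, ?_⟩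
  have h0 : ∀ a : Fin 3, cliffEnd S x a.succ 0 = -quat S x a := fun a =>
    cliffEnd_swap S x (Fin.succ_ne_zero a).symm
  have h1 : ∀ a : Fin 3, cliffEnd S x 0 a.succ = quat S x a := fun a => rfl
  have h2 : ∀ b : Fin 3, -quat S x b * (m₀ • 1 + ∑ a, m a • quat S x a) * quat S x b =
      m₀ • 1 - ∑ a, m a • (if a = b then -quat S x a else quat S x a) := fun b => by
    rw [mul_add, add_mul, mul_smul_comm, smul_mul_assoc, mul_one, neg_mul, quat_sq, neg_neg,
      Finset.mul_sum, Finset.sum_mul, sub_eq_add_neg, ← Finset.sum_neg_distrib]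
    congr 1
    refine Finset.sum_congr rfl fun a _ => ?_
    rw [mul_smul_comm, smul_mul_assoc, neg_mul, neg_mul, quat_conj, smul_neg]
  rw [Fin.sum_univ_succ, cliffEnd_self, one_mul, mul_one]
  simp only [h0, h1, h2]
  simp only [Fin.sum_univ_three, Fin.reduceEq, if_true, if_false]
  module

end QuaternionBasis

/-! ### The spin curvature in terms of the Riemann tensor -/

section WeitzenbockTerm

set_option linter.unusedSectionVars false

variable {X : Type*} [TopologicalSpace X] [ChartedSpace R4 X] [IsManifold (𝓡 4) ∞ X] [T2Space X]
  [Bundle.RiemannianBundle (fun x : X => TangentSpace (𝓡 4) x)]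
  [IsContMDiffRiemannianBundle (𝓡 4) ∞ R4 (fun x : X => TangentSpace (𝓡 4) x)]
  {o : ManifoldOrientation X} {D : TangentConnection X} (S : SpincStructure o D)
  (hD : IsLeviCivita D) (x : X)

@[simp]
lemma ofFrame_frame {G : Type*} [AddCommGroup G] [Module ℝ G] (f : T x → T x → G) (i j : Fin 4) :
    ofFrame x f (frame x i) (frame x j) = f (frame x i) (frame x j) := by
  have h := (frame x).toBasis.constr_basis ℝ (fun i => (frame x).toBasis.constr ℝ fun j =>
    f (frame x i) (frame x j)) i
  have h2 := (frame x).toBasis.constr_basis ℝ (fun j => f (frame x i) (frame x j)) j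
  rw [OrthonormalBasis.coe_toBasis] at h h2
  rw [ofFrame, h, h2]

/-- The components `R_{ij0a} + ε R_{ijbc}` of the Riemann tensor. -/
def riemPlus (o : ManifoldOrientation X) (D : TangentConnection X) (x : X) (i j : Fin 4)
    (a : Fin 3) : ℝ :=
  riem D x i j 0 a.succ + frameSign o x * riem D x i j (compl₁ a) (compl₂ a)

include hD in
lemma sum_riem_cliffEnd (i j : Fin 4) :
    ∑ k, ∑ l, (riem D x i j k l : ℂ) • cliffEnd S x k l =
      (2 : ℂ) • ∑ a, (riemPlus o D x i j a : ℂ) • quat S x a := by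
  have h := sum_cliffEnd S x ((LinearMap.lsmul ℂ (Module.End ℂ (S.Wplus.fiber x))).flip)
    (η := fun k l => (riem D x i j k l : ℂ)) (fun k l => by simp [hD.riem_skew_right x i j k l])
  simp only [LinearMap.flip_apply, LinearMap.lsmul_apply] at h
  rw [h]
  simp only [riemPlus, smul_eq_mul]
  push_cast
  rfl

include hD in
-- Compatibility reads G'ρ_k = ∑_l R_{ijkl} ρ_l + ρ_k G for the curvatures G, G' on W⁺, W⁻.
-- Composing with ρ_k† and summing over k gives 4G plus the Clifford action of the Riemann tensor,
-- and also a quaternionic average, which is scalar. So the traceless part of G is determined,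
-- whatever the connection on det W⁺.
lemma curvatureEnd_nablaPlus (i j : Fin 4) :
    curvatureEnd S.nablaPlus x (frame x i) (frame x j) =
      (LinearMap.trace ℂ _ (curvatureEnd S.nablaPlus x (frame x i) (frame x j)) / 2) • 1 -
        (1 / 2 : ℂ) • ∑ a, (riemPlus o D x i j a : ℂ) • quat S x a := by
  set G := curvatureEnd S.nablaPlus x (frame x i) (frame x j)
  have hP : HasC1Symbols S.nablaPlus := hasC1Symbols_of_class S.nablaPlus_smooth one_le_infty le_rfl
  have hN : HasC1Symbols S.nablaMinus :=
    hasC1Symbols_of_class S.nablaMinus_smooth one_le_infty le_rfl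
  set G' := curvatureEnd S.nablaMinus x (frame x i) (frame x j)
  have h1 : ∀ k, G' ∘ₗ S.rho x (frame x k) =
      ∑ l, (riem D x i j k l : ℂ) • S.rho x (frame x l) + S.rho x (frame x k) ∘ₗ G := fun k => by
    ext φ
    have h := curvature_rho S hD x (frame x i) (frame x j) (frame x k) φ
    have hr : curvature D x (frame x i) (frame x j) (frame x k) =
        ∑ l, riem D x i j k l • frame x l := by
      conv_lhs => rw [← (frame x).sum_repr' (curvature D x (frame x i) (frame x j) (frame x k))]
      simp only [real_inner_comm, riem]
    simp only [G, G', LinearMap.comp_apply, LinearMap.add_apply, LinearMap.sum_apply,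
      LinearMap.smul_apply, curvatureEnd_apply S.nablaMinus_unitary hN,
      curvatureEnd_apply S.nablaPlus_unitary hP]
    rw [h, hr]
    simp only [map_sum, map_smul, LinearMap.sum_apply, LinearMap.smul_apply, Complex.coe_smul]
  set M : Module.End ℂ (S.Wplus.fiber x) :=
    LinearMap.adjoint (S.rho x (frame x 0)) ∘ₗ G' ∘ₗ S.rho x (frame x 0)
  have h2 : ∀ k, cliffEnd S x k 0 * M * cliffEnd S x 0 k =
      ∑ l, (riem D x i j k l : ℂ) • cliffEnd S x k l + G := fun k => by
    have e : cliffEnd S x k 0 * M * cliffEnd S x 0 k =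
        LinearMap.adjoint (S.rho x (frame x k)) ∘ₗ (G' ∘ₗ S.rho x (frame x k)) := by
      have h0 := fun ψ => LinearMap.congr_fun (rho_comp_adjoint S x 0) ψ
      simp only [LinearMap.comp_apply, LinearMap.id_apply] at h0
      ext φ
      simp only [M, cliffEnd, Module.End.mul_apply, LinearMap.comp_apply, h0]
    rw [e, h1]
    have h3 : LinearMap.adjoint (S.rho x (frame x k)) ∘ₗ S.rho x (frame x k) ∘ₗ G = G := by
      have := cliffEnd_self S x k
      ext φ
      exact LinearMap.congr_fun this (G φ)
    rw [LinearMap.comp_add, h3]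
    congr 1
    ext φ
    simp [cliffEnd]
  obtain ⟨m, hm⟩ := sum_cliffEnd_conj S x M
  simp only [h2, Finset.sum_add_distrib, sum_riem_cliffEnd S hD] at hm
  rw [Finset.sum_const, Finset.card_univ, Fintype.card_fin, ← Nat.cast_smul_eq_nsmul ℂ] at hm
  have h4 : G = (m / 4) • 1 - (1 / 2 : ℂ) • ∑ a, (riemPlus o D x i j a : ℂ) • quat S x a := by
    have := congrArg ((1 / 4 : ℂ) • ·) (eq_sub_of_add_eq' hm)
    simp only [smul_smul, smul_sub] at this
    norm_num at this
    rw [this]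
    congr 2
    ring
  have h5 : LinearMap.trace ℂ _ G = m / 2 := by
    rw [h4]
    simp only [map_sub, map_smul, map_sum, trace_quat, trace_one_fiber, smul_eq_mul,
      mul_zero, Finset.sum_const_zero, sub_zero]
    ring
  rw [h5]
  conv_lhs => rw [h4]
  congr 2
  ring

include hD in
/-- The Bianchi identity computes the trace of the self-dual part of the Riemann tensor. -/
lemma sum_riemPlus (hε : frameSign o x * frameSign o x = 1) :
    ∑ a : Fin 3, (riemPlus o D x 0 a.succ a +
      frameSign o x * riemPlus o D x (compl₁ a) (compl₂ a) a) = -(scalarCurvature D x / 2) := by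
  have s := riem_skew_left (D := D) x
  have r := hD.riem_skew_right x
  have p := hD.riem_pair x
  have d : ∀ i k l, riem D x i i k l = 0 := fun i k l => by linarith [s i i k l]
  have hs : scalarCurvature D x = ∑ i, ∑ j, riem D x i j j i := rfl
  have b := hD.riem_bianchi x 1 2 3 0
  rw [hs]
  simp only [riemPlus, Fin.sum_univ_three, Fin.sum_univ_four, d, compl₁, compl₂]
  simp only [show Fin.succ (0 : Fin 3) = 1 from rfl, show Fin.succ (1 : Fin 3) = 2 from rfl,
    show Fin.succ (2 : Fin 3) = 3 from rfl, Matrix.cons_val_zero, Matrix.cons_val_one,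
    Matrix.cons_val]
  have e1 := p 0 1 2 3
  have e2 := p 0 2 3 1
  have e3 := p 0 3 1 2
  have f1 := r 2 3 0 1
  have f2 := r 3 1 0 2
  have f3 := r 1 2 0 3
  -- The terms linear in the sign of the frame form cyclic sums and vanish by Bianchi. The others
  -- are the six sectional curvatures with a minus sign, half of the negative scalar curvature.
  have g : riem D x 2 3 0 1 + riem D x 3 1 0 2 + riem D x 1 2 0 3 = 0 := by linarith
  have g' : riem D x 0 1 2 3 + riem D x 0 2 3 1 + riem D x 0 3 1 2 = 0 := by linarith
  have k1 := r 0 1 0 1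
  have k2 := r 0 2 0 2
  have k3 := r 0 3 0 3
  have k4 := r 2 3 2 3
  have k5 := r 3 1 3 1
  have k6 := r 1 2 1 2
  have l1 := s 0 1 0 1
  have l2 := s 0 2 0 2
  have l3 := s 0 3 0 3
  have l4 := s 2 3 2 3
  have l5 := s 3 1 3 1
  have l6 := s 1 2 1 2
  linear_combination frameSign o x * g + frameSign o x * g' +
    (riem D x 2 3 2 3 + riem D x 3 1 3 1 + riem D x 1 2 1 2) * hε +
    (k1 + k2 + k3 + k4 + k5 + k6 + l1 + l2 + l3 + l4 + l5 + l6) / 2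

end WeitzenbockTerm

/-! ### The zeroth order term of the Weitzenböck formula -/

section WeitzenbockFormula

set_option linter.unusedSectionVars false

variable {X : Type*} [TopologicalSpace X] [ChartedSpace R4 X] [IsManifold (𝓡 4) ∞ X] [T2Space X]
  [Bundle.RiemannianBundle (fun x : X => TangentSpace (𝓡 4) x)]
  [IsContMDiffRiemannianBundle (𝓡 4) ∞ R4 (fun x : X => TangentSpace (𝓡 4) x)]
  {o : ManifoldOrientation X} {D : TangentConnection X} (S : SpincStructure o D) (x : X)
  {E : HermitianPlaneBundle X}

section SelfDual

variable {G : Type*} [AddCommGroup G] [Module ℝ G] {x} {η : Bilin x G}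

lemma selfDualPart_zero_succ (h : ∀ i j, η (frame x j) (frame x i) = -η (frame x i) (frame x j))
    (a : Fin 3) : selfDualPart o η (frame x 0) (frame x a.succ) = (1 / 2 : ℝ) •
      (η (frame x 0) (frame x a.succ) +
        frameSign o x • η (frame x (compl₁ a)) (frame x (compl₂ a))) := by
  rw [selfDualPart, ofFrame_frame, hodgeStar_zero_succ, h (compl₁ a) (compl₂ a), sub_neg_eq_add,
    ← two_smul ℝ, smul_smul, div_mul_cancel₀ _ two_ne_zero]

lemma selfDualPart_compl (h : ∀ i j, η (frame x j) (frame x i) = -η (frame x i) (frame x j))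
    (a : Fin 3) : selfDualPart o η (frame x (compl₁ a)) (frame x (compl₂ a)) = (1 / 2 : ℝ) •
      (η (frame x (compl₁ a)) (frame x (compl₂ a)) +
        frameSign o x • η (frame x 0) (frame x a.succ)) := by
  rw [selfDualPart, ofFrame_frame, hodgeStar_compl, h 0 a.succ, sub_neg_eq_add,
    ← two_smul ℝ, smul_smul, div_mul_cancel₀ _ two_ne_zero]

end SelfDual

lemma end_real_smul {H : Type*} [AddCommGroup H] [Module ℂ H] (r : ℝ) (M : Module.End ℂ H) :
    r • M = (r : ℂ) • M := by
  ext; simp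

/-- Clifford multiplication of two-forms in terms of the quaternions. -/
lemma rhoForm_eq {η : Bilin x (Module.End ℂ (E.fiber x))}
    (h : ∀ i j, η (frame x j) (frame x i) = -η (frame x i) (frame x j)) :
    rhoForm S η = -∑ a, TensorProduct.map (quat S x a) (η (frame x 0) (frame x a.succ) +
      frameSign o x • η (frame x (compl₁ a)) (frame x (compl₂ a))) := by
  have := sum_cliffEnd S x (TensorProduct.mapBilinear (RingHom.id ℂ) (S.Wplus.fiber x) (E.fiber x)
    (S.Wplus.fiber x) (E.fiber x)) (η := fun i j => η (frame x i) (frame x j)) h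
  simp only [TensorProduct.mapBilinear_apply] at this
  have h2 : ∀ i j, TensorProduct.map (-LinearMap.adjoint (S.rho x (frame x i)) ∘ₗ
      S.rho x (frame x j)) (η (frame x i) (frame x j)) =
      -TensorProduct.map (cliffEnd S x i j) (η (frame x i) (frame x j)) := fun i j => by
    exact LinearMap.congr_fun (map_neg (TensorProduct.mapBilinear (RingHom.id ℂ) (S.Wplus.fiber x)
      (E.fiber x) (S.Wplus.fiber x) (E.fiber x)) (cliffEnd S x i j)) (η (frame x i) (frame x j))
  simp only [rhoForm, h2, Finset.sum_neg_distrib, this, end_real_smul, smul_neg, smul_smul]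
  norm_num

/-- A symmetric matrix sees only the anticommutators, which are -2 on the diagonal and 0 off it. -/
lemma sum_symm_quat_mul {W : Fin 3 → Fin 3 → ℂ} (hW : ∀ a b, W a b = W b a) :
    ∑ a, ∑ b, W a b • (quat S x a * quat S x b) = -((∑ a, W a a) • 1) := by
  have h1 : ∑ a, ∑ b, W a b • (quat S x a * quat S x b) +
      ∑ a, ∑ b, W a b • (quat S x a * quat S x b) = (-2 : ℂ) • ((∑ a, W a a) • 1) := by
    have h2 : ∑ a, ∑ b, W a b • (quat S x a * quat S x b) =
        ∑ a, ∑ b, W a b • (quat S x b * quat S x a) := by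
      rw [Finset.sum_comm]
      exact Finset.sum_congr rfl fun a _ => Finset.sum_congr rfl fun b _ => by rw [hW]
    conv_lhs => rw [h2]
    conv_lhs => arg 2; rw [← h2]
    simp only [← Finset.sum_add_distrib, ← smul_add]
    conv_lhs => enter [2, a, 2, b]; rw [add_comm, quat_anticomm]
    have e : ∀ a b : Fin 3, W a b • (if a = b then -2 else 0 : Module.End ℂ (S.Wplus.fiber x)) =
        if a = b then (-2 * W a a) • 1 else 0 := fun a b => by
      split_ifs with h
      · subst h
        ext; simp [Module.End.ofNat_apply, mul_smul, two_smul, smul_add]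
      · simp
    simp only [e, Finset.sum_ite_eq, Finset.mem_univ, if_true]
    rw [← Finset.sum_smul, ← Finset.mul_sum, mul_smul]
  rw [← two_smul ℂ] at h1
  refine smul_right_injective _ (two_ne_zero (α := ℂ)) (h1.trans ?_)
  simp only [smul_neg, neg_smul]

/-- The components `e_0 ∧ e_a` of the self-dual part of a determinant curvature. -/
def detPlus (o : ManifoldOrientation X) {V : HermitianPlaneBundle X} (B : Connection V) (x : X)
    (a : Fin 3) : ℂ :=
  selfDualPart o (detCurvature B x) (frame x 0) (frame x a.succ)

lemma detCurvature_frame {V : HermitianPlaneBundle X} (B : Connection V) (i j : Fin 4) :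
    detCurvature B x (frame x i) (frame x j) =
      LinearMap.trace ℂ _ (curvatureEnd B x (frame x i) (frame x j)) := by
  rw [detCurvature, ofFrame_frame]

lemma detPlus_eq {V : HermitianPlaneBundle X} {B : Connection V} (hB : IsUnitary B)
    (hB1 : HasC1Symbols B) (a : Fin 3) : detPlus o B x a =
      1 / 2 * (LinearMap.trace ℂ _ (curvatureEnd B x (frame x 0) (frame x a.succ)) +
        frameSign o x * LinearMap.trace ℂ _
          (curvatureEnd B x (frame x (compl₁ a)) (frame x (compl₂ a)))) := by
  rw [detPlus, selfDualPart_zero_succ, detCurvature_frame, detCurvature_frame, Complex.real_smul,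
    Complex.real_smul]
  · norm_num
  · intro i j
    rw [detCurvature_frame, detCurvature_frame, curvatureEnd_swap hB hB1, map_neg]

/-- The Riemann part is a quadratic expression in the quaternions with a symmetric coefficient
matrix, so only the trace of that matrix survives, and `sum_riemPlus` evaluates it. The trace part
of the curvature gives the determinant term. -/
lemma sum_cliffEnd_mul_curvatureEnd (hD : IsLeviCivita D) :
    ∑ i, ∑ j, cliffEnd S x i j * curvatureEnd S.nablaPlus x (frame x i) (frame x j) =
      -((scalarCurvature D x / 2 : ℝ) : ℂ) • 1 +
        (2 : ℂ) • ∑ a, detPlus o S.nablaPlus x a • quat S x a := by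
  have hP : HasC1Symbols S.nablaPlus := hasC1Symbols_of_class S.nablaPlus_smooth one_le_infty le_rfl
  have h := sum_cliffEnd S x (LinearMap.mul ℂ (Module.End ℂ (S.Wplus.fiber x)))
    (η := fun i j => curvatureEnd S.nablaPlus x (frame x i) (frame x j))
    (fun i j => curvatureEnd_swap S.nablaPlus_unitary hP x _ _)
  simp only [LinearMap.mul_apply'] at h
  rw [h]
  set ε := frameSign o x
  let W : Fin 3 → Fin 3 → ℂ := fun a b =>
    ((riemPlus o D x 0 a.succ b + ε * riemPlus o D x (compl₁ a) (compl₂ a) b : ℝ) : ℂ)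
  -- Pair symmetry of the Riemann tensor.
  have hW : ∀ a b, W a b = W b a := fun a b => by
    simp only [W, riemPlus]
    rw [hD.riem_pair x 0 a.succ 0 b.succ, hD.riem_pair x 0 a.succ (compl₁ b) (compl₂ b),
      hD.riem_pair x (compl₁ a) (compl₂ a) 0 b.succ,
      hD.riem_pair x (compl₁ a) (compl₂ a) (compl₁ b) (compl₂ b)]
    congr 1
    ring
  have h1 : ∀ a : Fin 3, curvatureEnd S.nablaPlus x (frame x 0) (frame x a.succ) +
      (ε : ℂ) • curvatureEnd S.nablaPlus x (frame x (compl₁ a)) (frame x (compl₂ a)) =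
      detPlus o S.nablaPlus x a • 1 - (1 / 2 : ℂ) • ∑ b, W a b • quat S x b := fun a => by
    rw [detPlus_eq x S.nablaPlus_unitary hP]
    conv_lhs => rw [curvatureEnd_nablaPlus S hD x 0 a.succ,
      curvatureEnd_nablaPlus S hD x (compl₁ a) (compl₂ a)]
    simp only [W, Complex.ofReal_add, Complex.ofReal_mul, add_smul, Finset.sum_add_distrib, mul_smul,
      ← Finset.smul_sum]
    module
  simp only [h1, mul_sub, mul_smul_comm, mul_one, Finset.mul_sum, Finset.sum_sub_distrib,
    ← Finset.smul_sum]
  rw [sum_symm_quat_mul S x hW, smul_sub, ← Complex.ofReal_sum, sum_riemPlus hD x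
    (frameSign_mul_self S x)]
  push_cast
  module

variable {A : Connection E} (hA : IsUnitary A) (hA1 : HasC1Symbols A)

lemma inner_cliff_frame (i j : Fin 4) (Ψ Φ : Tensor S.Wplus E x) :
    (inner ℂ (cliff S E (frame x j) Ψ) (cliff S E (frame x i) Φ) : ℂ) =
      inner ℂ (LinearMap.rTensor (E.fiber x) (cliffEnd S x i j) Ψ) Φ := by
  rw [inner_eq_sum_contract (fiberBasis E x), inner_eq_sum_contract (fiberBasis E x)]
  simp only [contract_cliff, contract_rTensor, inner_cliffEnd]

include hA hA1 in
lemma adCurvature_skew (i j : Fin 4) : adCurvature A x (frame x j) (frame x i) =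
    -adCurvature A x (frame x i) (frame x j) := by
  rw [adCurvature, ofFrame_frame, ofFrame_frame, curvatureEnd_swap hA hA1, map_neg]

lemma eq_traceless_add (V : HermitianPlaneBundle X) (M : Module.End ℂ (V.fiber x)) :
    M = traceless M + (LinearMap.trace ℂ _ M / 2) • 1 := by
  rw [traceless, LinearMap.sub_apply, LinearMap.smulRight_apply, LinearMap.id_apply, smul_smul,
    mul_one_div, sub_add_cancel]

include hA hA1 in
-- The curvature of E is split into its traceless part and a multiple of the identity. The sign and
-- the 2 come from ρ₋ = -ρ₊† and from the ½ in `rhoForm`.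
lemma sum_map_cliffEnd_curvatureEnd :
    ∑ i, ∑ j, TensorProduct.map (cliffEnd S x i j) (curvatureEnd A x (frame x i) (frame x j)) =
      -((2 : ℂ) • rhoForm S (adCurvature A x)) +
        (2 : ℂ) • ∑ a, detPlus o A x a • LinearMap.rTensor (E.fiber x) (quat S x a) := by
  have h := sum_cliffEnd S x (TensorProduct.mapBilinear (RingHom.id ℂ) (S.Wplus.fiber x)
    (E.fiber x) (S.Wplus.fiber x) (E.fiber x))
    (η := fun i j => curvatureEnd A x (frame x i) (frame x j))
    (fun i j => curvatureEnd_swap hA hA1 x _ _)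
  simp only [TensorProduct.mapBilinear_apply] at h
  rw [h, rhoForm_eq S x (adCurvature_skew x hA hA1), smul_neg, neg_neg, ← smul_add,
    ← Finset.sum_add_distrib]
  congr 1
  refine Finset.sum_congr rfl fun a _ => ?_
  have h1 : curvatureEnd A x (frame x 0) (frame x a.succ) +
      (frameSign o x : ℂ) • curvatureEnd A x (frame x (compl₁ a)) (frame x (compl₂ a)) =
      (adCurvature A x (frame x 0) (frame x a.succ) +
        frameSign o x • adCurvature A x (frame x (compl₁ a)) (frame x (compl₂ a))) +
      detPlus o A x a • 1 := by
    rw [detPlus_eq x hA hA1, adCurvature, ofFrame_frame, ofFrame_frame, end_real_smul]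
    conv_lhs => rw [eq_traceless_add x E (curvatureEnd A x (frame x 0) (frame x a.succ)),
      eq_traceless_add x E (curvatureEnd A x (frame x (compl₁ a)) (frame x (compl₂ a)))]
    module
  rw [h1, TensorProduct.map_add_right, TensorProduct.map_smul_right]
  rfl

include hA hA1 in
/-- The Weitzenböck term. -/
theorem weitzenbock_term_eq (hD : IsLeviCivita D) (Φ : Tensor S.Wplus E x) :
    1 / 2 * ∑ i, ∑ j, (inner ℂ (cliff S E (frame x j)
        (curvTensor S.nablaPlus A x (frame x i) (frame x j) Φ)) (cliff S E (frame x i) Φ) : ℂ).re =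
      -(scalarCurvature D x / 4 * ‖Φ‖ ^ 2) - (inner ℂ (rhoForm S (adCurvature A x) Φ) Φ : ℂ).re +
        ∑ a, (inner ℂ ((detPlus o S.nablaPlus x a + detPlus o A x a) •
          LinearMap.rTensor (E.fiber x) (quat S x a) Φ) Φ : ℂ).re := by
  have h1 : ∑ i, ∑ j, LinearMap.rTensor (E.fiber x) (cliffEnd S x i j)
      (curvTensor S.nablaPlus A x (frame x i) (frame x j) Φ) =
      -((scalarCurvature D x / 2 : ℝ) : ℂ) • Φ - (2 : ℂ) • rhoForm S (adCurvature A x) Φ +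
        (2 : ℂ) • ∑ a, (detPlus o S.nablaPlus x a + detPlus o A x a) •
          LinearMap.rTensor (E.fiber x) (quat S x a) Φ := by
    -- The curvature of W⁺ ⊗ E is the sum of the two curvatures, which are then contracted
    -- separately.
    have e : ∀ i j, LinearMap.rTensor (E.fiber x) (cliffEnd S x i j)
        (curvTensor S.nablaPlus A x (frame x i) (frame x j) Φ) =
        LinearMap.rTensor (E.fiber x) (cliffEnd S x i j *
          curvatureEnd S.nablaPlus x (frame x i) (frame x j)) Φ +
        TensorProduct.map (cliffEnd S x i j) (curvatureEnd A x (frame x i) (frame x j)) Φ :=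
      fun i j => by
        rw [curvTensor, LinearMap.add_apply, map_add, LinearMap.rTensor_mul]
        congr 1
        rw [← LinearMap.comp_apply, LinearMap.rTensor_comp_lTensor]
    have f1 := congrArg (fun M => LinearMap.rTensor (E.fiber x) M Φ)
      (sum_cliffEnd_mul_curvatureEnd S x hD)
    have f2 := LinearMap.congr_fun (sum_map_cliffEnd_curvatureEnd S x hA hA1) Φ
    simp only [e, Finset.sum_add_distrib]
    simp only [LinearMap.rTensor_add, LinearMap.rTensor_smul, ← LinearMap.coe_rTensorHom, map_sum,
      map_smul, LinearMap.sum_apply, LinearMap.add_apply, LinearMap.smul_apply,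
      LinearMap.neg_apply] at f1 f2 ⊢
    rw [f1, f2]
    have h1 : LinearMap.rTensorHom (E.fiber x) (1 : Module.End ℂ (S.Wplus.fiber x)) Φ = Φ :=
      LinearMap.congr_fun (LinearMap.rTensor_id _ _) Φ
    rw [h1]
    simp only [add_smul, Finset.sum_add_distrib]
    module
  have h2 : ∑ i, ∑ j, (inner ℂ (cliff S E (frame x j)
      (curvTensor S.nablaPlus A x (frame x i) (frame x j) Φ)) (cliff S E (frame x i) Φ) : ℂ) =
      inner ℂ (∑ i, ∑ j, LinearMap.rTensor (E.fiber x) (cliffEnd S x i j)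
        (curvTensor S.nablaPlus A x (frame x i) (frame x j) Φ)) Φ := by
    simp only [inner_cliff_frame, sum_inner]
  have h3 := congrArg Complex.re h2
  simp only [Complex.re_sum] at h3
  rw [h3, h1, inner_add_left, inner_sub_left, tensor_inner_smul_left, tensor_inner_smul_left,
    tensor_inner_smul_left, sum_inner, tensor_norm_sq]
  simp only [Complex.conj_ofReal, Complex.add_re, Complex.sub_re,
    ← Complex.ofReal_neg, Complex.re_ofReal_mul, ← Complex.ofReal_ofNat, Complex.re_sum]
  ring

end WeitzenbockFormula

/-! ### The quadratic term (Φ ⊗ Φ*)₀₀ -/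

section QuadraticTerm

set_option linter.unusedSectionVars false

variable {X : Type*} [TopologicalSpace X] [ChartedSpace R4 X] [IsManifold (𝓡 4) ∞ X] [T2Space X]
  [Bundle.RiemannianBundle (fun x : X => TangentSpace (𝓡 4) x)]
  [IsContMDiffRiemannianBundle (𝓡 4) ∞ R4 (fun x : X => TangentSpace (𝓡 4) x)]
  {V E : HermitianPlaneBundle X} {x : X}

/-- The rank one endomorphism `v ↦ ⟨b, v⟩ a`. -/
abbrev rankOneEnd {H : Type*} [NormedAddCommGroup H] [InnerProductSpace ℂ H] (a b : H) :
    Module.End ℂ H :=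
  (InnerProductSpace.rankOne ℂ a b).toLinearMap

lemma traceless_rankOneEnd (V : HermitianPlaneBundle X) (a b : V.fiber x) :
    traceless (rankOneEnd a b) = rankOneEnd a b - (inner ℂ b a / 2 : ℂ) • 1 := by
  rw [traceless, LinearMap.sub_apply, LinearMap.smulRight_apply, LinearMap.id_apply, smul_smul,
    mul_one_div, InnerProductSpace.trace_rankOne]

lemma tensor_norm_sq_eq_sum {ι : Type*} [Fintype ι] (t : OrthonormalBasis ι ℂ (E.fiber x))
    (Φ : Tensor V E x) : ‖Φ‖ ^ 2 = ∑ b, ‖contract (t b) Φ‖ ^ 2 := by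
  rw [tensor_norm_sq, inner_eq_sum_contract t, Complex.re_sum]
  exact Finset.sum_congr rfl fun b _ => (norm_sq_eq_re_inner (𝕜 := ℂ) _).symm

lemma tracelessTraceless_sum {ι κ : Type*} [Fintype ι] [Fintype κ]
    (f : ι → κ → Module.End ℂ (V.fiber x)) (g : ι → κ → Module.End ℂ (E.fiber x)) :
    tracelessTraceless (∑ i, ∑ j, TensorProduct.map (f i j) (g i j)) =
      ∑ i, ∑ j, TensorProduct.map (traceless (f i j)) (traceless (g i j)) := by
  let L : Module.End ℂ (Tensor V E x) →ₗ[ℂ] Module.End ℂ (Tensor V E x) :=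
    (homTensorHomEquiv ℂ (V.fiber x) (E.fiber x) (V.fiber x) (E.fiber x)).toLinearMap ∘ₗ
      TensorProduct.map traceless traceless ∘ₗ
      (homTensorHomEquiv ℂ (V.fiber x) (E.fiber x) (V.fiber x) (E.fiber x)).symm.toLinearMap
  have h : ∀ (f : Module.End ℂ (V.fiber x)) (g : Module.End ℂ (E.fiber x)),
      L (TensorProduct.map f g) = TensorProduct.map (traceless f) (traceless g) := fun f g => by
    have e : (homTensorHomEquiv ℂ (V.fiber x) (E.fiber x) (V.fiber x) (E.fiber x)).symm
        (TensorProduct.map f g) = f ⊗ₜ g := by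
      rw [LinearEquiv.symm_apply_eq, homTensorHomEquiv_apply]
      rfl
    change homTensorHomEquiv ℂ (V.fiber x) (E.fiber x) (V.fiber x) (E.fiber x)
      (TensorProduct.map traceless traceless ((homTensorHomEquiv ℂ (V.fiber x) (E.fiber x)
        (V.fiber x) (E.fiber x)).symm (TensorProduct.map f g))) = _
    rw [e, TensorProduct.map_tmul, homTensorHomEquiv_apply]
    rfl
  change L _ = _
  rw [map_sum L]
  refine Finset.sum_congr rfl fun i _ => ?_
  rw [map_sum L]
  exact Finset.sum_congr rfl fun j _ => h _ _

/-- The partial trace of `Φ ⊗ Φ*` over `E`. -/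
def partialTraceRight (Φ : Tensor V E x) : Module.End ℂ (V.fiber x) :=
  ∑ b, rankOneEnd (contract (fiberBasis E x b) Φ) (contract (fiberBasis E x b) Φ)

/-- The partial trace of `Φ ⊗ Φ*` over `V`. -/
def partialTraceLeft (Φ : Tensor V E x) : Module.End ℂ (E.fiber x) :=
  ∑ b, ∑ c, (inner ℂ (contract (fiberBasis E x c) Φ) (contract (fiberBasis E x b) Φ) : ℂ) •
    rankOneEnd (fiberBasis E x b) (fiberBasis E x c)

lemma map_sub_smul_one (f : Module.End ℂ (V.fiber x)) (g : Module.End ℂ (E.fiber x)) (c d : ℂ) :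
    TensorProduct.map (f - c • 1) (g - d • 1) = TensorProduct.map f g -
      d • LinearMap.rTensor (E.fiber x) f - c • LinearMap.lTensor (V.fiber x) g +
        (c * d) • (1 : Module.End ℂ (Tensor V E x)) := by
  refine TensorProduct.ext' fun w ξ => ?_
  simp only [TensorProduct.map_tmul, LinearMap.sub_apply, LinearMap.add_apply, LinearMap.smul_apply,
    Module.End.one_apply, LinearMap.rTensor_tmul, LinearMap.lTensor_tmul, TensorProduct.sub_tmul,
    TensorProduct.tmul_sub, TensorProduct.tmul_smul, ← TensorProduct.smul_tmul', smul_sub, smul_smul]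
  rw [mul_comm]
  abel

lemma rankOneEnd_eq_sum (Φ : Tensor V E x) : rankOneEnd Φ Φ =
    ∑ b, ∑ c, TensorProduct.map
      (rankOneEnd (contract (fiberBasis E x b) Φ) (contract (fiberBasis E x c) Φ))
      (rankOneEnd (fiberBasis E x b) (fiberBasis E x c)) := by
  set t := fiberBasis E x
  refine TensorProduct.ext' fun w ξ => ?_
  simp only [LinearMap.sum_apply, TensorProduct.map_tmul, ContinuousLinearMap.coe_coe,
    InnerProductSpace.rankOne_apply, TensorProduct.smul_tmul_smul, ← Finset.sum_smul]
  rw [← Finset.smul_sum, sum_contract_tmul]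
  congr 1
  conv_lhs => rw [← sum_contract_tmul t Φ]
  simp only [sum_inner, TensorProduct.inner_tmul]

/-- The product of the two projections M - ½ tr(M) is expanded: removing one trace gives a partial
trace of Φ ⊗ Φ*, removing both gives the full trace |Φ|². -/
lemma quadratic_eq (Φ : Tensor V E x) : quadratic Φ =
    rankOneEnd Φ Φ - (1 / 2 : ℂ) • LinearMap.rTensor (E.fiber x) (partialTraceRight Φ) -
      (1 / 2 : ℂ) • LinearMap.lTensor (V.fiber x) (partialTraceLeft Φ) +
      ((‖Φ‖ ^ 2 / 4 : ℝ) : ℂ) • 1 := by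
  have h2 : quadratic Φ = tracelessTraceless (rankOneEnd Φ Φ) := rfl
  have hn : ((‖Φ‖ ^ 2 / 4 : ℝ) : ℂ) = 1 / 4 * ∑ b, inner ℂ (contract (fiberBasis E x b) Φ)
      (contract (fiberBasis E x b) Φ) := by
    rw [tensor_norm_sq_eq_sum (fiberBasis E x)]
    simp only [inner_self_eq_norm_sq_to_K]
    push_cast
    ring_nf
    rfl
  rw [h2, rankOneEnd_eq_sum, tracelessTraceless_sum]
  simp only [traceless_rankOneEnd, map_sub_smul_one, Finset.sum_add_distrib,
    Finset.sum_sub_distrib, orthonormal_iff_ite.1 (fiberBasis E x).orthonormal]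
  congr 1
  · congr 1
    · congr 1
      rw [partialTraceRight, ← LinearMap.coe_rTensorHom, map_sum, Finset.smul_sum]
      simp [ite_div, ite_smul]
    · simp only [partialTraceLeft, ← LinearMap.coe_lTensorHom, map_sum, Finset.smul_sum, map_smul,
        smul_smul, div_eq_inv_mul, mul_one]
  · rw [hn, Finset.mul_sum, Finset.sum_smul]
    refine Finset.sum_congr rfl fun b _ => ?_
    simp [ite_div, ite_smul, mul_ite]
    congr 1
    ring

/-- A partial trace of Φ ⊗ Φ* is a sum of rank one operators of total norm at most |Φ|², and
tensoring with the identity keeps the bound. -/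
lemma norm_rTensor_partialTraceRight_le (Φ Ψ : Tensor V E x) :
    ‖LinearMap.rTensor (E.fiber x) (partialTraceRight Φ) Ψ‖ ≤ ‖Φ‖ ^ 2 * ‖Ψ‖ := by
  have h : ∀ w : V.fiber x, ‖partialTraceRight Φ w‖ ≤ ‖Φ‖ ^ 2 * ‖w‖ := fun w => by
    rw [partialTraceRight, LinearMap.sum_apply, tensor_norm_sq_eq_sum (fiberBasis E x),
      Finset.sum_mul]
    refine norm_sum_le_of_le _ fun b _ => ?_
    rw [ContinuousLinearMap.coe_coe, InnerProductSpace.rankOne_apply, norm_smul]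
    have := norm_inner_le_norm (𝕜 := ℂ) (contract (fiberBasis E x b) Φ) w
    nlinarith [norm_nonneg (contract (fiberBasis E x b) Φ)]
  refine (pow_le_pow_iff_left₀ (norm_nonneg _) (by positivity) two_ne_zero).1 ?_
  rw [mul_pow, tensor_norm_sq_eq_sum (fiberBasis E x) (LinearMap.rTensor _ _ Ψ),
    tensor_norm_sq_eq_sum (fiberBasis E x) Ψ, Finset.mul_sum]
  refine Finset.sum_le_sum fun b _ => ?_
  rw [contract_rTensor, ← mul_pow]
  exact pow_le_pow_left₀ (norm_nonneg _) (h _) 2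

/-- In the basis of E the operator is given by the Gram matrix of the contractions of Φ;
Cauchy–Schwarz is applied to its entries and then to the sum over them. -/
lemma norm_lTensor_partialTraceLeft_le (Φ Ψ : Tensor V E x) :
    ‖LinearMap.lTensor (V.fiber x) (partialTraceLeft Φ) Ψ‖ ≤ ‖Φ‖ ^ 2 * ‖Ψ‖ := by
  set t := fiberBasis E x
  have hc : ∀ b, contract (t b) (LinearMap.lTensor (V.fiber x) (partialTraceLeft Φ) Ψ) =
      ∑ c, (inner ℂ (contract (t c) Φ) (contract (t b) Φ) : ℂ) • contract (t c) Ψ := fun b => by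
    induction Ψ using TensorProduct.induction_on with
    | zero => simp
    | tmul w ξ =>
      simp only [LinearMap.lTensor_tmul, contract_tmul, partialTraceLeft, LinearMap.sum_apply,
        LinearMap.smul_apply, ContinuousLinearMap.coe_coe, InnerProductSpace.rankOne_apply,
        inner_sum, inner_smul_right, smul_smul]
      simp [t, orthonormal_iff_ite.1 (fiberBasis E x).orthonormal, Finset.sum_smul]
    | add Ψ₁ Ψ₂ h1 h2 => simp only [map_add, h1, h2, smul_add, Finset.sum_add_distrib]
  refine (pow_le_pow_iff_left₀ (norm_nonneg _) (by positivity) two_ne_zero).1 ?_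
  have h1 : ∀ b, ‖contract (t b) (LinearMap.lTensor (V.fiber x) (partialTraceLeft Φ) Ψ)‖ ≤
      ‖contract (t b) Φ‖ * ∑ c, ‖contract (t c) Φ‖ * ‖contract (t c) Ψ‖ := fun b => by
    rw [hc, Finset.mul_sum]
    refine norm_sum_le_of_le _ fun c _ => ?_
    rw [norm_smul]
    have := mul_le_mul_of_nonneg_right (norm_inner_le_norm (𝕜 := ℂ) (contract (t c) Φ)
      (contract (t b) Φ)) (norm_nonneg (contract (t c) Ψ))
    linarith
  have h2 := Finset.sum_mul_sq_le_sq_mul_sq Finset.univ (fun c => ‖contract (t c) Φ‖)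
    (fun c => ‖contract (t c) Ψ‖)
  rw [← tensor_norm_sq_eq_sum, ← tensor_norm_sq_eq_sum] at h2
  rw [tensor_norm_sq_eq_sum t]
  calc _ ≤ ∑ b, ‖contract (t b) Φ‖ ^ 2 * (‖Φ‖ ^ 2 * ‖Ψ‖ ^ 2) := Finset.sum_le_sum fun b _ => by
        refine (pow_le_pow_left₀ (norm_nonneg _) (h1 b) 2).trans ?_
        rw [mul_pow]
        gcongr
    _ = _ := by
        rw [← Finset.sum_mul, ← tensor_norm_sq_eq_sum]
        ring

lemma tensor_norm_smul (c : ℂ) (Φ : Tensor V E x) : ‖c • Φ‖ = ‖c‖ * ‖Φ‖ :=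
  norm_smul (β := Tensor V E x) c Φ

lemma quadratic_apply (Φ Ψ : Tensor V E x) : quadratic Φ Ψ =
    (inner ℂ Φ Ψ : ℂ) • Φ - (1 / 2 : ℂ) • LinearMap.rTensor (E.fiber x) (partialTraceRight Φ) Ψ -
      (1 / 2 : ℂ) • LinearMap.lTensor (V.fiber x) (partialTraceLeft Φ) Ψ +
      ((‖Φ‖ ^ 2 / 4 : ℝ) : ℂ) • Ψ := by
  rw [quadratic_eq]
  rfl

/-- The triangle inequality over the four terms of the expansion: 9/4 = 1 + 1/2 + 1/2 + 1/4. -/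
lemma norm_quadratic_le (Φ Ψ : Tensor V E x) : ‖quadratic Φ Ψ‖ ≤ 9 / 4 * ‖Φ‖ ^ 2 * ‖Ψ‖ := by
  rw [quadratic_apply]
  have h1 := norm_rTensor_partialTraceRight_le Φ Ψ
  have h2 := norm_lTensor_partialTraceLeft_le Φ Ψ
  have h3 := mul_le_mul_of_nonneg_right (tensor_norm_inner_le Φ Ψ) (norm_nonneg Φ)
  have hh : ‖(1 / 2 : ℂ)‖ = 1 / 2 := by norm_num
  have h4 : ‖((‖Φ‖ ^ 2 / 4 : ℝ) : ℂ)‖ = ‖Φ‖ ^ 2 / 4 := by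
    rw [Complex.norm_real, Real.norm_of_nonneg (by positivity)]
  refine (norm_add_le _ _).trans ((add_le_add_left ((norm_sub_le _ _).trans
    (add_le_add_left (norm_sub_le _ _) _)) _).trans ?_)
  simp only [tensor_norm_smul, hh, h4]
  linarith

/-- The rank one term gives |Φ|⁴, each partial trace takes away at most half of it, and the scalar
term returns a quarter. This positivity is the source of the a priori bound. -/
lemma re_inner_quadratic_ge (Φ : Tensor V E x) :
    1 / 4 * ‖Φ‖ ^ 4 ≤ (inner ℂ (quadratic Φ Φ) Φ : ℂ).re := by
  have h1 := norm_rTensor_partialTraceRight_le Φ Φ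
  have h2 := norm_lTensor_partialTraceLeft_le Φ Φ
  have k1 := (Complex.re_le_norm _).trans (tensor_norm_inner_le
    (LinearMap.rTensor (E.fiber x) (partialTraceRight Φ) Φ) Φ)
  have k2 := (Complex.re_le_norm _).trans (tensor_norm_inner_le
    (LinearMap.lTensor (V.fiber x) (partialTraceLeft Φ) Φ) Φ)
  have m1 := mul_le_mul_of_nonneg_right h1 (norm_nonneg Φ)
  have m2 := mul_le_mul_of_nonneg_right h2 (norm_nonneg Φ)
  have hi : (inner ℂ Φ Φ : ℂ) = ((‖Φ‖ ^ 2 : ℝ) : ℂ) := by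
    rw [Complex.ofReal_pow]
    exact inner_self_eq_norm_sq_to_K (𝕜 := ℂ) (E := Tensor V E x) Φ
  have hh : (starRingEnd ℂ) (1 / 2 : ℂ) = ((1 / 2 : ℝ) : ℂ) := by
    rw [← Complex.conj_ofReal]; norm_num
  rw [quadratic_apply, inner_add_left, inner_sub_left, inner_sub_left, tensor_inner_smul_left,
    tensor_inner_smul_left, tensor_inner_smul_left, tensor_inner_smul_left, hi, hh,
    Complex.conj_ofReal, Complex.conj_ofReal, Complex.add_re, Complex.sub_re, Complex.sub_re,
    Complex.re_ofReal_mul, Complex.re_ofReal_mul, Complex.re_ofReal_mul, Complex.re_ofReal_mul,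
    Complex.ofReal_re]
  nlinarith

end QuadraticTerm

/-! ### Norms and squares in su(2) -/

section SpecialUnitary

set_option linter.unusedSectionVars false

variable {H : Type*} [NormedAddCommGroup H] [InnerProductSpace ℂ H] [FiniteDimensional ℂ H]
  {ι : Type*} [Fintype ι]

lemma endNorm_nonneg (M : Module.End ℂ H) : 0 ≤ endNorm M := Real.sqrt_nonneg _

lemma endNorm_sq (t : OrthonormalBasis ι ℂ H) (M : Module.End ℂ H) :
    endNorm M ^ 2 = 1 / 2 * ∑ b, ‖M (t b)‖ ^ 2 := by
  have h : (LinearMap.trace ℂ H (LinearMap.adjoint M * M)).re = ∑ b, ‖M (t b)‖ ^ 2 := by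
    rw [LinearMap.trace_eq_sum_inner _ t, Complex.re_sum]
    refine Finset.sum_congr rfl fun b _ => ?_
    rw [Module.End.mul_apply, LinearMap.adjoint_inner_right]
    exact (norm_sq_eq_re_inner (𝕜 := ℂ) _).symm
  rw [endNorm, h, Real.sq_sqrt (by positivity)]
  ring

lemma endNorm_smul (c : ℂ) (M : Module.End ℂ H) : endNorm (c • M) = ‖c‖ * endNorm M := by
  refine (pow_left_inj₀ (endNorm_nonneg _)
    (mul_nonneg (norm_nonneg _) (endNorm_nonneg _)) two_ne_zero).1 ?_
  rw [mul_pow, endNorm_sq (stdOrthonormalBasis ℂ H), endNorm_sq (stdOrthonormalBasis ℂ H)]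
  simp only [LinearMap.smul_apply, norm_smul, mul_pow, ← Finset.mul_sum]
  ring

lemma endNorm_real_smul (r : ℝ) (M : Module.End ℂ H) : endNorm (r • M) = |r| * endNorm M := by
  rw [end_real_smul, endNorm_smul, Complex.norm_real, Real.norm_eq_abs]

/-- The three real coordinates of a skew-Hermitian traceless endomorphism. -/
def suCoord (t : OrthonormalBasis (Fin 2) ℂ H) (b : Fin 3) : Module.End ℂ H →ₗ[ℝ] ℝ where
  toFun M := ![(inner ℂ (t 0) (M (t 0)) : ℂ).im, (inner ℂ (t 0) (M (t 1)) : ℂ).re,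
    (inner ℂ (t 0) (M (t 1)) : ℂ).im] b
  map_add' M N := by fin_cases b <;> simp
  map_smul' r M := by
    have h : ∀ v, (r • M) v = (r : ℂ) • M v := fun v => by simp
    fin_cases b <;> simp only [h, inner_smul_right] <;> simp

/-- Matrix entries of a skew-Hermitian traceless endomorphism. -/
lemma su_entries (t : OrthonormalBasis (Fin 2) ℂ H) {M : Module.End ℂ H} (hM : M ∈ su H) :
    ∃ (r : ℝ) (z : ℂ), inner ℂ (t 0) (M (t 0)) = r * Complex.I ∧ inner ℂ (t 0) (M (t 1)) = z ∧
      M (t 0) = (r * Complex.I : ℂ) • t 0 - (starRingEnd ℂ) z • t 1 ∧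
      M (t 1) = z • t 0 - (r * Complex.I : ℂ) • t 1 := by
  obtain ⟨hs, htr⟩ := hM
  rw [LinearMap.trace_eq_sum_inner _ t, Fin.sum_univ_two] at htr
  have h0 : (starRingEnd ℂ) (inner ℂ (t 0) (M (t 0)) : ℂ) = -inner ℂ (t 0) (M (t 0)) := by
    rw [inner_conj_symm, hs]
  have h1 : (inner ℂ (t 1) (M (t 0)) : ℂ) = -(starRingEnd ℂ) (inner ℂ (t 0) (M (t 1)) : ℂ) := by
    rw [inner_conj_symm, hs, neg_neg]
  have hr : (inner ℂ (t 0) (M (t 0)) : ℂ) = (inner ℂ (t 0) (M (t 0)) : ℂ).im * Complex.I := by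
    have := congrArg Complex.re h0
    simp only [Complex.conj_re, Complex.neg_re] at this
    refine Complex.ext ?_ ?_ <;> simp
    linarith
  refine ⟨(inner ℂ (t 0) (M (t 0)) : ℂ).im, inner ℂ (t 0) (M (t 1)), hr, rfl, ?_, ?_⟩
  · conv_lhs => rw [← t.sum_repr' (M (t 0)), Fin.sum_univ_two]
    rw [← hr, h1, neg_smul, sub_eq_add_neg]
  · conv_lhs => rw [← t.sum_repr' (M (t 1)), Fin.sum_univ_two]
    rw [← hr, eq_neg_of_add_eq_zero_right htr, neg_smul, sub_eq_add_neg]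

lemma endNorm_sq_eq_sum_suCoord (t : OrthonormalBasis (Fin 2) ℂ H) {M : Module.End ℂ H}
    (hM : M ∈ su H) : endNorm M ^ 2 = ∑ b, suCoord t b M ^ 2 := by
  obtain ⟨r, z, h0, h1, h2, h3⟩ := su_entries t hM
  have hn : ∀ c d : ℂ, ‖c • t 0 - d • t 1‖ ^ 2 = ‖c‖ ^ 2 + ‖d‖ ^ 2 := fun c d => by
    rw [← t.sum_sq_norm_inner_right (c • t 0 - d • t 1), Fin.sum_univ_two]
    simp [inner_sub_right, inner_smul_right, orthonormal_iff_ite.1 t.orthonormal]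
  rw [endNorm_sq t, Fin.sum_univ_two, h2, h3, hn, hn, Fin.sum_univ_three]
  simp only [suCoord, LinearMap.coe_mk, AddHom.coe_mk, h0, h1]
  simp [Complex.sq_norm, Complex.normSq_apply]
  ring

/-- With the factor ½ in `endNorm`, elements of norm one are imaginary unit quaternions. -/
lemma su_mul_self {M : Module.End ℂ H} (hH : Module.finrank ℂ H = 2) (hM : M ∈ su H) :
    M * M = -((endNorm M ^ 2 : ℝ) : ℂ) • 1 := by
  let t : OrthonormalBasis (Fin 2) ℂ H := (stdOrthonormalBasis ℂ H).reindex (finCongr hH)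
  rw [endNorm_sq_eq_sum_suCoord t hM]
  obtain ⟨r, z, h0, h1, h2, h3⟩ := su_entries t hM
  have hc : ((∑ b, suCoord t b M ^ 2 : ℝ) : ℂ) = r ^ 2 + z * (starRingEnd ℂ) z := by
    rw [Complex.mul_conj, Fin.sum_univ_three]
    simp only [suCoord, LinearMap.coe_mk, AddHom.coe_mk, h0, h1]
    simp [Complex.normSq_apply]
    ring
  rw [hc]
  refine t.toBasis.ext fun b => ?_
  rw [OrthonormalBasis.coe_toBasis, Module.End.mul_apply]
  have hI : (r * Complex.I : ℂ) * (r * Complex.I) = -r ^ 2 := by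
    linear_combination (r : ℂ) ^ 2 * Complex.I_sq
  fin_cases b
  · simp only [Fin.zero_eta, h2, h3, map_sub, map_smul, LinearMap.smul_apply,
      Module.End.one_apply, smul_sub, smul_smul, hI]
    module
  · simp only [Fin.mk_one, h2, h3, map_sub, map_smul, LinearMap.smul_apply,
      Module.End.one_apply, smul_sub, smul_smul, hI]
    module

end SpecialUnitary

/-! ### Norms of self-dual forms with values in su(E) -/

section FormNorms

set_option linter.unusedSectionVars false

variable {X : Type*} [TopologicalSpace X] [ChartedSpace R4 X] [IsManifold (𝓡 4) ∞ X] [T2Space X]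
  [Bundle.RiemannianBundle (fun x : X => TangentSpace (𝓡 4) x)]
  [IsContMDiffRiemannianBundle (𝓡 4) ∞ R4 (fun x : X => TangentSpace (𝓡 4) x)]
  {o : ManifoldOrientation X} {E : HermitianPlaneBundle X} {x : X}

section General

variable {G : Type*} [AddCommGroup G] [Module ℝ G] {ν : G → ℝ}

lemma formNorm_nonneg (ν : G → ℝ) (η : Bilin x G) : 0 ≤ formNorm ν η := Real.sqrt_nonneg _

lemma formNorm_sq (ν : G → ℝ) (η : Bilin x G) :
    formNorm ν η ^ 2 = 1 / 2 * ∑ i, ∑ j, ν (η (frame x i) (frame x j)) ^ 2 :=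
  Real.sq_sqrt (by positivity)

lemma formNorm_smul (hν : ∀ (r : ℝ) g, ν (r • g) = |r| * ν g) (r : ℝ) (η : Bilin x G) :
    formNorm ν (r • η) = |r| * formNorm ν η := by
  refine (pow_left_inj₀ (formNorm_nonneg _ _)
    (mul_nonneg (abs_nonneg _) (formNorm_nonneg _ _)) two_ne_zero).1 ?_
  rw [mul_pow, formNorm_sq, formNorm_sq]
  simp only [LinearMap.smul_apply, hν, mul_pow, ← Finset.mul_sum]
  ring

lemma le_two_mul_formNorm (hν : ∀ g, 0 ≤ ν g) (η : Bilin x G) (i j : Fin 4) :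
    ν (η (frame x i) (frame x j)) ≤ 2 * formNorm ν η := by
  refine (pow_le_pow_iff_left₀ (hν _) (mul_nonneg zero_le_two (formNorm_nonneg _ _))
    two_ne_zero).1 ?_
  rw [mul_pow, formNorm_sq]
  have h1 := Finset.single_le_sum (f := fun i => ∑ j, ν (η (frame x i) (frame x j)) ^ 2)
    (fun i _ => by positivity) (Finset.mem_univ i)
  have h2 := Finset.single_le_sum (f := fun j => ν (η (frame x i) (frame x j)) ^ 2)
    (fun j _ => by positivity) (Finset.mem_univ j)
  have h3 : 0 ≤ ν (η (frame x i) (frame x j)) ^ 2 := by positivity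
  linarith

/-- The norm of a self-dual form. -/
lemma formNorm_sq_of_selfDual (hν : ∀ (r : ℝ) g, ν (r • g) = |r| * ν g) {η : Bilin x G}
    (hε : |frameSign o x| = 1)
    (h : ∀ i j, η (frame x j) (frame x i) = -η (frame x i) (frame x j))
    (hc : ∀ a, η (frame x (compl₁ a)) (frame x (compl₂ a)) =
      frameSign o x • η (frame x 0) (frame x a.succ)) :
    formNorm ν η ^ 2 = 2 * ∑ a : Fin 3, ν (η (frame x 0) (frame x a.succ)) ^ 2 := by
  have hn : ∀ g, ν (-g) = ν g := fun g => by
    rw [← neg_one_smul ℝ, hν]; simp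
  have h0 : ∀ i, ν (η (frame x i) (frame x i)) = 0 := fun i => by
    have e : η (frame x i) (frame x i) = 0 := by
      have := h i i
      rwa [eq_neg_iff_add_eq_zero, ← two_smul ℝ, smul_eq_zero_iff_right two_ne_zero] at this
    rw [e, ← zero_smul ℝ (0 : G), hν, abs_zero, zero_mul]
  have hs : ∀ i j, ν (η (frame x j) (frame x i)) = ν (η (frame x i) (frame x j)) := fun i j => by
    rw [h, hn]
  have hc' : ∀ a, ν (η (frame x (compl₁ a)) (frame x (compl₂ a))) =
      ν (η (frame x 0) (frame x a.succ)) := fun a => by rw [hc, hν, hε, one_mul]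
  have e0 : ν (η (frame x 2) (frame x 3)) = ν (η (frame x 0) (frame x 1)) := hc' 0
  have e1 : ν (η (frame x 3) (frame x 1)) = ν (η (frame x 0) (frame x 2)) := hc' 1
  have e2 : ν (η (frame x 1) (frame x 2)) = ν (η (frame x 0) (frame x 3)) := hc' 2
  rw [formNorm_sq, Fin.sum_univ_three]
  simp only [Fin.sum_univ_four, h0]
  rw [hs 0 1, hs 0 2, hs 0 3, hs 1 2, hs 2 3, hs 3 1, e0, e1, e2]
  simp only [show Fin.succ (0 : Fin 3) = 1 from rfl, show Fin.succ (1 : Fin 3) = 2 from rfl,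
    show Fin.succ (2 : Fin 3) = 3 from rfl]
  ring

end General

lemma lambdaPlus_skew (ζ : LambdaPlus o x) (u v : T x) : ζ.1 v u = -ζ.1 u v := by
  have h := ζ.2.1 (u + v)
  simp only [map_add, LinearMap.add_apply, ζ.2.1 u, ζ.2.1 v] at h
  linarith

lemma lambdaPlus_compl (ζ : LambdaPlus o x) (a : Fin 3) :
    ζ.1 (frame x (compl₁ a)) (frame x (compl₂ a)) =
      frameSign o x * ζ.1 (frame x 0) (frame x a.succ) := by
  rw [← ζ.2.2, hodgeStar_compl, lambdaPlus_skew ζ (frame x 0), smul_eq_mul]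
  ring

variable (p : LambdaPlusSu o E x)

lemma toForm_tmul (ζ : LambdaPlus o x) (N : su (E.fiber x)) (u v : T x) :
    toForm o E x (ζ ⊗ₜ N) u v = ζ.1 u v • N.1 := rfl

lemma toForm_mem (u v : T x) : toForm o E x p u v ∈ su (E.fiber x) := by
  induction p using TensorProduct.induction_on with
  | zero => rw [map_zero]; exact zero_mem _
  | tmul ζ N => exact Submodule.smul_mem _ _ N.2
  | add p q h1 h2 => rw [map_add]; exact add_mem h1 h2

lemma toForm_skew (u v : T x) : toForm o E x p v u = -toForm o E x p u v := by
  induction p using TensorProduct.induction_on with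
  | zero => simp
  | tmul ζ N => rw [toForm_tmul, toForm_tmul, lambdaPlus_skew ζ, neg_smul]
  | add p q h1 h2 => simp only [map_add, LinearMap.add_apply, h1, h2, neg_add]

lemma toForm_compl (a : Fin 3) :
    toForm o E x p (frame x (compl₁ a)) (frame x (compl₂ a)) =
      frameSign o x • toForm o E x p (frame x 0) (frame x a.succ) := by
  induction p using TensorProduct.induction_on with
  | zero => simp
  | tmul ζ N => rw [toForm_tmul, toForm_tmul, lambdaPlus_compl ζ, mul_smul]
  | add p q h1 h2 => simp only [map_add, LinearMap.add_apply, h1, h2, smul_add]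

lemma lambdaPlusSuNorm_sq (hε : |frameSign o x| = 1) : lambdaPlusSuNorm p ^ 2 =
    2 * ∑ a : Fin 3, endNorm (toForm o E x p (frame x 0) (frame x a.succ)) ^ 2 :=
  formNorm_sq_of_selfDual endNorm_real_smul hε (fun _ _ => toForm_skew p _ _) (toForm_compl p)

lemma lambdaPlusSuNorm_smul (r : ℝ) : lambdaPlusSuNorm (r • p) = |r| * lambdaPlusSuNorm p := by
  rw [lambdaPlusSuNorm, map_smul, formNorm_smul endNorm_real_smul, lambdaPlusSuNorm]

/-- The coordinate `Λ⁺ ⊗ su(E) → Λ⁺` with respect to a basis of `su(E)`. -/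
def lambdaCoord (t : OrthonormalBasis (Fin 2) ℂ (E.fiber x)) (b : Fin 3) :
    LambdaPlusSu o E x →ₗ[ℝ] LambdaPlus o x :=
  (TensorProduct.rid ℝ (LambdaPlus o x)).toLinearMap ∘ₗ
    LinearMap.lTensor (LambdaPlus o x) (suCoord t b ∘ₗ (su (E.fiber x)).subtype)

lemma lambdaCoord_tmul (t : OrthonormalBasis (Fin 2) ℂ (E.fiber x)) (b : Fin 3)
    (ζ : LambdaPlus o x) (N : su (E.fiber x)) :
    lambdaCoord t b (ζ ⊗ₜ N) = suCoord t b N.1 • ζ := by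
  simp [lambdaCoord]

lemma suCoord_toForm (t : OrthonormalBasis (Fin 2) ℂ (E.fiber x)) (b : Fin 3) (u v : T x) :
    suCoord t b (toForm o E x p u v) = (lambdaCoord t b p).1 u v := by
  induction p using TensorProduct.induction_on with
  | zero => simp
  | tmul ζ N =>
    rw [toForm_tmul, lambdaCoord_tmul, map_smul, smul_eq_mul, mul_comm]
    rfl
  | add p q h1 h2 =>
    rw [map_add, map_add, LinearMap.add_apply, LinearMap.add_apply, map_add, h1, h2]
    rfl

lemma lambdaCoord_rTensor (t : OrthonormalBasis (Fin 2) ℂ (E.fiber x)) (b : Fin 3)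
    (f : LambdaPlus o x →ₗ[ℝ] LambdaPlus o x) :
    lambdaCoord t b (LinearMap.rTensor (su (E.fiber x)) f p) = f (lambdaCoord t b p) := by
  induction p using TensorProduct.induction_on with
  | zero => simp
  | tmul ζ N => rw [LinearMap.rTensor_tmul, lambdaCoord_tmul, lambdaCoord_tmul, map_smul]
  | add p q h1 h2 => simp only [map_add, h1, h2]

/-- The coordinates `suCoord` are orthonormal, so Λ⁺ ⊗ su(E) is an orthogonal sum of three copies of
Λ⁺. Hence τ₀ ⊗ id inherits the operator bound of τ₀. -/
lemma lambdaPlusSuNorm_sq_eq_sum (t : OrthonormalBasis (Fin 2) ℂ (E.fiber x)) :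
    lambdaPlusSuNorm p ^ 2 = ∑ b, formNorm abs (lambdaCoord t b p).1 ^ 2 := by
  rw [lambdaPlusSuNorm, formNorm_sq]
  simp only [formNorm_sq, endNorm_sq_eq_sum_suCoord t (toForm_mem p _ _), suCoord_toForm, sq_abs,
    ← Finset.mul_sum]
  congr 1
  conv_rhs => rw [Finset.sum_comm]
  exact Finset.sum_congr rfl fun i _ => Finset.sum_comm

/-- An operator norm bound for seminorms that may vanish on nonzero vectors. -/
lemma le_mul_of_unit_ball {G : Type*} [AddCommMonoid G] [Module ℝ G] {N : G → ℝ} {g : G →ₗ[ℝ] G}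
    (h0 : ∀ q, 0 ≤ N q) (hs : ∀ (r : ℝ) q, N (r • q) = |r| * N q) {C : ℝ}
    (h : ∀ q, N q ≤ 1 → N (g q) ≤ C) (q : G) : N (g q) ≤ C * N q := by
  rcases (h0 q).eq_or_lt with hq | hq
  · rw [← hq, mul_zero]
    by_contra! hlt
    have h1 : ∀ r : ℝ, |r| * N (g q) ≤ C := fun r => by
      rw [← hs, ← map_smul]
      exact h _ (by rw [hs, ← hq, mul_zero]; exact zero_le_one)
    have h2 := h1 ((|C| + 1) / N (g q))
    rw [abs_of_nonneg (by positivity), div_mul_cancel₀ _ hlt.ne'] at h2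
    linarith [le_abs_self C]
  · have h1 := h ((N q)⁻¹ • q) (by
      rw [hs, abs_of_pos (inv_pos.2 hq), inv_mul_cancel₀ hq.ne'])
    rw [map_smul, hs, abs_of_pos (inv_pos.2 hq), inv_mul_le_iff₀ hq] at h1
    linarith

end FormNorms

/-! ### The curvature equation: bounds and positivity -/

section CurvatureEstimates

set_option linter.unusedSectionVars false

variable {X : Type*} [TopologicalSpace X] [ChartedSpace R4 X] [IsManifold (𝓡 4) ∞ X] [T2Space X]
  [Bundle.RiemannianBundle (fun x : X => TangentSpace (𝓡 4) x)]
  [IsContMDiffRiemannianBundle (𝓡 4) ∞ R4 (fun x : X => TangentSpace (𝓡 4) x)]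
  {o : ManifoldOrientation X} {D : TangentConnection X} {V E : HermitianPlaneBundle X} {x : X}

lemma inner_lTensor_su {M : Module.End ℂ (E.fiber x)} (hM : M ∈ su (E.fiber x))
    (Φ Ψ : Tensor V E x) : (inner ℂ (LinearMap.lTensor (V.fiber x) M Φ) Ψ : ℂ) =
      -inner ℂ Φ (LinearMap.lTensor (V.fiber x) M Ψ) := by
  induction Φ using TensorProduct.induction_on with
  | zero => simp
  | add Φ₁ Φ₂ h1 h2 => rw [map_add, inner_add_left, inner_add_left, h1, h2, neg_add]
  | tmul w ξ =>
    induction Ψ using TensorProduct.induction_on with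
    | zero => simp
    | add Ψ₁ Ψ₂ h1 h2 => rw [map_add, inner_add_right, inner_add_right, h1, h2, neg_add]
    | tmul w' ξ' => simp [hM.1]

/-- `M` is skew and its square is a negative scalar, so it acts as a multiple of an isometry. -/
lemma norm_lTensor_su {M : Module.End ℂ (E.fiber x)} (hM : M ∈ su (E.fiber x))
    (Φ : Tensor V E x) : ‖LinearMap.lTensor (V.fiber x) M Φ‖ = endNorm M * ‖Φ‖ := by
  refine (pow_left_inj₀ (norm_nonneg _) (mul_nonneg (endNorm_nonneg _) (norm_nonneg _))
    two_ne_zero).1 ?_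
  have h1 : LinearMap.lTensor (V.fiber x) M (LinearMap.lTensor (V.fiber x) M Φ) =
      (-((endNorm M ^ 2 : ℝ) : ℂ)) • Φ := by
    rw [← Module.End.mul_apply, ← LinearMap.lTensor_mul, su_mul_self (finrank_fiber E x) hM,
      LinearMap.lTensor_smul, LinearMap.smul_apply]
    congr 1
    exact LinearMap.congr_fun (LinearMap.lTensor_id _ _) Φ
  rw [tensor_norm_sq, inner_lTensor_su hM, h1, tensor_inner_smul_right, neg_mul, neg_neg,
    Complex.re_ofReal_mul, mul_pow, tensor_norm_sq]

lemma exists_inner_self_eq_one (V : HermitianPlaneBundle X) (x : X) :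
    ∃ v : V.fiber x, (inner ℂ v v : ℂ) = 1 :=
  ⟨fiberBasis V x ⟨0, by rw [finrank_fiber]; norm_num⟩, by
    rw [orthonormal_iff_ite.1 (fiberBasis V x).orthonormal, if_pos rfl]⟩

/-- There is a unit vector in each fibre of `V ⊗ E`. -/
lemma exists_tensor_norm_eq_one (V E : HermitianPlaneBundle X) (x : X) :
    ∃ Ψ : Tensor V E x, ‖Ψ‖ = 1 := by
  obtain ⟨v, hv⟩ := exists_inner_self_eq_one V x
  obtain ⟨e, he⟩ := exists_inner_self_eq_one E x
  refine ⟨v ⊗ₜ e, ?_⟩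
  have h1 : ‖(v ⊗ₜ[ℂ] e : Tensor V E x)‖ ^ 2 = 1 := by
    rw [tensor_norm_sq, TensorProduct.inner_tmul, hv, he, mul_one, Complex.one_re]
  exact (pow_eq_one_iff_of_nonneg (norm_nonneg _) two_ne_zero).1 h1

/-- On su(E) the norm is the length of the image of any unit vector, so the triangle inequality
comes from the tensor product. -/
lemma endNorm_add_le_of_mem {M N : Module.End ℂ (E.fiber x)} (hM : M ∈ su (E.fiber x))
    (hN : N ∈ su (E.fiber x)) : endNorm (M + N) ≤ endNorm M + endNorm N := by
  obtain ⟨Ψ, hΨ⟩ := exists_tensor_norm_eq_one E E x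
  have e : ∀ {M : Module.End ℂ (E.fiber x)}, M ∈ su (E.fiber x) →
      ‖LinearMap.lTensor (E.fiber x) M Ψ‖ = endNorm M := fun h => by
    rw [norm_lTensor_su h, hΨ, mul_one]
  rw [← e hM, ← e hN, ← e (add_mem hM hN), LinearMap.lTensor_add, LinearMap.add_apply]
  exact norm_add_le _ _

variable (S : SpincStructure o D)

include S in
lemma abs_frameSign (x : X) : |frameSign o x| = 1 := by
  have h := frameSign_mul_self S x
  rw [← abs_mul_abs_self] at h
  nlinarith [abs_nonneg (frameSign o x)]

lemma norm_rTensor_quat (a : Fin 3) (Φ : Tensor S.Wplus E x) :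
    ‖LinearMap.rTensor (E.fiber x) (quat S x a) Φ‖ = ‖Φ‖ := by
  refine (pow_left_inj₀ (norm_nonneg _) (norm_nonneg _) two_ne_zero).1 ?_
  rw [tensor_norm_sq_eq_sum (fiberBasis E x), tensor_norm_sq_eq_sum (fiberBasis E x)]
  refine Finset.sum_congr rfl fun b _ => ?_
  rw [contract_rTensor, norm_sq_eq_re_inner (𝕜 := ℂ), ← LinearMap.adjoint_inner_right, adjoint_quat,
    LinearMap.neg_apply, ← Module.End.mul_apply, quat_sq, LinearMap.neg_apply, neg_neg,
    Module.End.one_apply, ← norm_sq_eq_re_inner]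

/-- For a self-dual form the components on e_0 ∧ e_a and on its complement contribute equally,
whence the 2. -/
lemma rhoForm_toForm (p : LambdaPlusSu o E x) : rhoForm S (toForm o E x p) =
    (-2 : ℂ) • ∑ a, TensorProduct.map (quat S x a)
      (toForm o E x p (frame x 0) (frame x a.succ)) := by
  have h : ∀ a, toForm o E x p (frame x 0) (frame x a.succ) +
      frameSign o x • toForm o E x p (frame x (compl₁ a)) (frame x (compl₂ a)) =
      (2 : ℂ) • toForm o E x p (frame x 0) (frame x a.succ) := fun a => by
    rw [toForm_compl, smul_smul, frameSign_mul_self S, one_smul, two_smul]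
  rw [rhoForm_eq S x (fun i j => toForm_skew p _ _)]
  simp only [h, TensorProduct.map_smul_right, ← Finset.smul_sum]
  exact (neg_smul _ _).symm

/-- The components of a self-dual form are recovered from its Clifford action. -/
lemma anticommutator_rhoForm_toForm (p : LambdaPlusSu o E x) (a : Fin 3)
    (Ψ : Tensor S.Wplus E x) :
    LinearMap.rTensor (E.fiber x) (quat S x a) (rhoForm S (toForm o E x p) Ψ) +
      rhoForm S (toForm o E x p) (LinearMap.rTensor (E.fiber x) (quat S x a) Ψ) =
    (4 : ℂ) • LinearMap.lTensor (S.Wplus.fiber x)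
      (toForm o E x p (frame x 0) (frame x a.succ)) Ψ := by
  set η := fun a : Fin 3 => toForm o E x p (frame x 0) (frame x a.succ)
  have h1 : ∀ b, LinearMap.rTensor (E.fiber x) (quat S x a) (TensorProduct.map (quat S x b) (η b) Ψ) +
      TensorProduct.map (quat S x b) (η b) (LinearMap.rTensor (E.fiber x) (quat S x a) Ψ) =
      if a = b then (-2 : ℂ) • LinearMap.lTensor (S.Wplus.fiber x) (η a) Ψ else 0 := fun b => by
    have e : LinearMap.rTensor (E.fiber x) (quat S x a) (TensorProduct.map (quat S x b) (η b) Ψ) +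
        TensorProduct.map (quat S x b) (η b) (LinearMap.rTensor (E.fiber x) (quat S x a) Ψ) =
        TensorProduct.map (quat S x a * quat S x b + quat S x b * quat S x a) (η b) Ψ := by
      rw [TensorProduct.map_add_left, LinearMap.add_apply]
      congr 1
      · rw [LinearMap.rTensor, ← LinearMap.comp_apply, ← TensorProduct.map_comp,
          LinearMap.id_comp]
        rfl
      · rw [LinearMap.rTensor, ← LinearMap.comp_apply, ← TensorProduct.map_comp,
          LinearMap.comp_id]
        rfl
    rw [e, quat_anticomm]
    split_ifs with hab
    · have h2 : (-2 : Module.End ℂ (S.Wplus.fiber x)) = (-2 : ℂ) • LinearMap.id := by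
        ext; simp [Module.End.ofNat_apply, two_smul]
      rw [h2, TensorProduct.map_smul_left, hab]
      rfl
    · rw [TensorProduct.map_zero_left, LinearMap.zero_apply]
  rw [rhoForm_toForm, LinearMap.smul_apply, LinearMap.smul_apply, map_smul, ← smul_add,
    LinearMap.sum_apply, LinearMap.sum_apply, map_sum, ← Finset.sum_add_distrib]
  simp only [η] at h1
  simp only [h1, Finset.sum_ite_eq, Finset.mem_univ, if_true, smul_smul]
  norm_num

/-- Four times a component is the anticommutator of ρ(q) with a unitary quaternion, so its norm is
at most a quarter of 2 · 9/4. -/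
lemma endNorm_le_of_rhoForm_eq {q : LambdaPlusSu o E x} {Φ : Tensor S.Wplus E x}
    (h : rhoForm S (toForm o E x q) = quadratic Φ) (a : Fin 3) :
    endNorm (toForm o E x q (frame x 0) (frame x a.succ)) ≤ 9 / 8 * ‖Φ‖ ^ 2 := by
  obtain ⟨Ψ, hΨ⟩ := exists_tensor_norm_eq_one S.Wplus E x
  have h1 := congrArg (fun Ψ => ‖Ψ‖) (anticommutator_rhoForm_toForm S q a Ψ)
  simp only [tensor_norm_smul, norm_lTensor_su (toForm_mem q _ _), hΨ, mul_one, h] at h1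
  have h2 := norm_add_le (LinearMap.rTensor (E.fiber x) (quat S x a) (quadratic Φ Ψ))
    (quadratic Φ (LinearMap.rTensor (E.fiber x) (quat S x a) Ψ))
  have h3 := norm_quadratic_le Φ Ψ
  have h4 := norm_quadratic_le Φ (LinearMap.rTensor (E.fiber x) (quat S x a) Ψ)
  rw [norm_rTensor_quat, hΨ, mul_one] at h4
  rw [hΨ, mul_one] at h3
  rw [h1, norm_rTensor_quat] at h2
  have h5 : ‖(4 : ℂ)‖ = 4 := by norm_num
  rw [h5] at h2
  linarith

lemma lambdaPlusSuNorm_nonneg (q : LambdaPlusSu o E x) : 0 ≤ lambdaPlusSuNorm q :=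
  formNorm_nonneg _ _

/-- The squared norm is twice the sum over three components, and 6 · (9/8)² is below (14/5)². -/
lemma lambdaPlusSuNorm_le_of_rhoForm_eq {q : LambdaPlusSu o E x} {Φ : Tensor S.Wplus E x}
    (h : rhoForm S (toForm o E x q) = quadratic Φ) : lambdaPlusSuNorm q ≤ 14 / 5 * ‖Φ‖ ^ 2 := by
  refine (pow_le_pow_iff_left₀ (lambdaPlusSuNorm_nonneg _) (by positivity) two_ne_zero).1 ?_
  rw [lambdaPlusSuNorm_sq q (abs_frameSign S x)]
  have h1 := Finset.sum_le_sum fun a (_ : a ∈ Finset.univ) =>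
    pow_le_pow_left₀ (endNorm_nonneg _) (endNorm_le_of_rhoForm_eq S h a) 2
  rw [Finset.sum_const, Finset.card_univ, Fintype.card_fin, nsmul_eq_mul] at h1
  push_cast at h1
  nlinarith [sq_nonneg (‖Φ‖ ^ 2)]

include S in
lemma endNorm_toForm_le (p : LambdaPlusSu o E x) (a : Fin 3) :
    endNorm (toForm o E x p (frame x 0) (frame x a.succ)) ≤ lambdaPlusSuNorm p := by
  refine (pow_le_pow_iff_left₀ (endNorm_nonneg _) (lambdaPlusSuNorm_nonneg _) two_ne_zero).1 ?_
  rw [lambdaPlusSuNorm_sq p (abs_frameSign S x)]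
  have h2 := Finset.single_le_sum (f := fun a : Fin 3 =>
    endNorm (toForm o E x p (frame x 0) (frame x a.succ)) ^ 2)
    (fun j _ => by positivity) (Finset.mem_univ a)
  have h3 : 0 ≤ endNorm (toForm o E x p (frame x 0) (frame x a.succ)) ^ 2 := by positivity
  linarith

/-- The operator norm of ρ(p) is at most twice the sum of the three component norms. By
Cauchy–Schwarz this is at most √6 times the norm of p, and 5/2 exceeds √6. -/
lemma abs_re_inner_rhoForm_le (p : LambdaPlusSu o E x) (Φ : Tensor S.Wplus E x) :
    |(inner ℂ (rhoForm S (toForm o E x p) Φ) Φ : ℂ).re| ≤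
      5 / 2 * lambdaPlusSuNorm p * ‖Φ‖ ^ 2 := by
  set m := fun a : Fin 3 => endNorm (toForm o E x p (frame x 0) (frame x a.succ))
  have h1 : ∀ a, ‖TensorProduct.map (quat S x a)
      (toForm o E x p (frame x 0) (frame x a.succ)) Φ‖ = m a * ‖Φ‖ := fun a => by
    rw [← LinearMap.rTensor_comp_lTensor, LinearMap.comp_apply, norm_rTensor_quat,
      norm_lTensor_su (toForm_mem p _ _)]
  have h2 : ‖rhoForm S (toForm o E x p) Φ‖ ≤ 2 * (∑ a, m a) * ‖Φ‖ := by
    have h5 : ‖(-2 : ℂ)‖ = 2 := by norm_num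
    rw [rhoForm_toForm, LinearMap.smul_apply, LinearMap.sum_apply, tensor_norm_smul, h5, mul_assoc,
      Finset.sum_mul]
    gcongr
    exact norm_sum_le_of_le _ fun a _ => (h1 a).le
  have h3 : 2 * ∑ a, m a ≤ 5 / 2 * lambdaPlusSuNorm p := by
    refine (pow_le_pow_iff_left₀ (mul_nonneg zero_le_two (Finset.sum_nonneg fun a _ =>
      endNorm_nonneg _)) (mul_nonneg (by norm_num) (lambdaPlusSuNorm_nonneg _)) two_ne_zero).1 ?_
    rw [mul_pow, mul_pow, lambdaPlusSuNorm_sq p (abs_frameSign S x)]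
    have h4 := sq_sum_le_card_mul_sum_sq (s := Finset.univ) (f := m)
    rw [Finset.card_univ, Fintype.card_fin] at h4
    push_cast at h4
    have h5 : 0 ≤ ∑ a, m a ^ 2 := by positivity
    change 2 ^ 2 * (∑ a, m a) ^ 2 ≤ (5 / 2) ^ 2 * (2 * ∑ a, m a ^ 2)
    linarith
  refine (Complex.abs_re_le_norm _).trans ((tensor_norm_inner_le _ _).trans ?_)
  rw [pow_two, ← mul_assoc]
  gcongr
  exact h2.trans (by gcongr)

variable (P : Perturbation S E)

lemma ofReal_le_toReal {r : ℝ} {M : ℝ≥0∞} (h : ENNReal.ofReal r ≤ M) (hM : M ≠ ⊤) :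
    r ≤ M.toReal :=
  (ENNReal.ofReal_le_iff_le_toReal hM).1 h

lemma lambdaPlusSuNorm_tau_le (hN : P.tauNorm ≠ ⊤) (q : LambdaPlusSu o E x) :
    lambdaPlusSuNorm (P.tau x q) ≤ P.tauNorm.toReal * lambdaPlusSuNorm q := by
  have h : ∀ q : LambdaPlusSu o E x, lambdaPlusSuNorm q ≤ 1 →
      ENNReal.ofReal (lambdaPlusSuNorm (P.tau x q)) ≤ P.tauNorm := fun q hq => by
    unfold Perturbation.tauNorm
    exact le_iSup_of_le x (le_iSup_of_le q (le_iSup_of_le hq le_rfl))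
  exact le_mul_of_unit_ball (g := P.tau x) (N := lambdaPlusSuNorm) lambdaPlusSuNorm_nonneg
    (fun r q => lambdaPlusSuNorm_smul q r) (fun q hq => ofReal_le_toReal (h q hq) hN) q

lemma formNorm_tau0_le (hN : P.tau0Norm ≠ ⊤) (ζ : LambdaPlus o x) :
    formNorm abs (P.tau0 x ζ).1 ≤ P.tau0Norm.toReal * formNorm abs ζ.1 := by
  have h : ∀ ζ : LambdaPlus o x, formNorm abs ζ.1 ≤ 1 →
      ENNReal.ofReal (formNorm abs (P.tau0 x ζ).1) ≤ P.tau0Norm := fun ζ hζ => by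
    unfold Perturbation.tau0Norm
    exact le_iSup_of_le x (le_iSup_of_le ζ (le_iSup_of_le hζ le_rfl))
  exact le_mul_of_unit_ball (g := P.tau0 x) (N := fun ζ : LambdaPlus o x => formNorm abs ζ.1)
    (fun ζ => formNorm_nonneg _ _) (fun r ζ => formNorm_smul (fun r g => abs_mul r g) r ζ.1)
    (fun ζ hζ => ofReal_le_toReal (h ζ hζ) hN) ζ

lemma lambdaPlusSuNorm_tau0_le (hN : P.tau0Norm ≠ ⊤) (q : LambdaPlusSu o E x) :
    lambdaPlusSuNorm (LinearMap.rTensor (su (E.fiber x)) (P.tau0 x) q) ≤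
      P.tau0Norm.toReal * lambdaPlusSuNorm q := by
  let t : OrthonormalBasis (Fin 2) ℂ (E.fiber x) :=
    (stdOrthonormalBasis ℂ (E.fiber x)).reindex (finCongr (finrank_fiber E x))
  refine (pow_le_pow_iff_left₀ (lambdaPlusSuNorm_nonneg _)
    (mul_nonneg ENNReal.toReal_nonneg (lambdaPlusSuNorm_nonneg _)) two_ne_zero).1 ?_
  rw [mul_pow, lambdaPlusSuNorm_sq_eq_sum _ t, lambdaPlusSuNorm_sq_eq_sum _ t, Finset.mul_sum]
  refine Finset.sum_le_sum fun b _ => ?_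
  rw [lambdaCoord_rTensor, ← mul_pow]
  exact pow_le_pow_left₀ (formNorm_nonneg _ _) (formNorm_tau0_le S P hN _) 2

variable {A : Connection E} {Φ : ∀ x, Tensor S.Wplus E x}

lemma lambdaPlusSuNorm_perturbation_le (hP : P.IsAdmissible A) (q : LambdaPlusSu o E x) :
    lambdaPlusSuNorm (LinearMap.rTensor (su (E.fiber x)) (P.tau0 x) q) +
      lambdaPlusSuNorm (P.tau x q) ≤ 1 / 64 * lambdaPlusSuNorm q := by
  have h64 : (1 / 64 : ℝ≥0∞) ≠ ⊤ := by simp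
  have h0 : P.tau0Norm ≠ ⊤ := ne_top_of_le_ne_top h64 (le_self_add.trans hP.tau_le)
  have h1 : P.tauNorm ≠ ⊤ := ne_top_of_le_ne_top h64 (le_add_self.trans hP.tau_le)
  have h2 := ENNReal.toReal_mono h64 hP.tau_le
  rw [ENNReal.toReal_add h0 h1] at h2
  have h3 : ((1 / 64 : ℝ≥0∞)).toReal = 1 / 64 := by simp
  rw [h3] at h2
  have h4 := mul_le_mul_of_nonneg_right h2 (lambdaPlusSuNorm_nonneg q)
  linarith [lambdaPlusSuNorm_tau0_le S P h0 q, lambdaPlusSuNorm_tau_le S P h1 q]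

/-- The self-dual curvature of a monopole is bounded by `|Φ|²`. -/
lemma formNorm_adCurvaturePlus_le (hP : P.IsAdmissible A) (hM : IsMonopole S P A Φ) (x : X) :
    formNorm endNorm (adCurvaturePlus o A x) ≤ 8 * ‖Φ x‖ ^ 2 := by
  obtain ⟨q, hq, hc⟩ := hM.curvature_eq x
  have h1 := lambdaPlusSuNorm_le_of_rhoForm_eq S hq
  have h2 := lambdaPlusSuNorm_perturbation_le S P hP q
  rw [hc]
  set p := q + LinearMap.rTensor (su (E.fiber x)) (P.tau0 x) q + P.tau x q
  -- The perturbation adds a factor 1 + 1/64, and 14/5 · 65/64 is below 3.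
  have h3 : ∀ a : Fin 3, endNorm (toForm o E x p (frame x 0) (frame x a.succ)) ≤
      3 * ‖Φ x‖ ^ 2 := fun a => by
    have e1 := endNorm_add_le_of_mem (toForm_mem (q + LinearMap.rTensor (su (E.fiber x))
      (P.tau0 x) q) (frame x 0) (frame x a.succ)) (toForm_mem (P.tau x q) (frame x 0) (frame x a.succ))
    have e2 := endNorm_add_le_of_mem (toForm_mem q (frame x 0) (frame x a.succ)) (toForm_mem
      (LinearMap.rTensor (su (E.fiber x)) (P.tau0 x) q) (frame x 0) (frame x a.succ))
    have f1 := endNorm_toForm_le S q a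
    have f2 := endNorm_toForm_le S (LinearMap.rTensor (su (E.fiber x)) (P.tau0 x) q) a
    have f3 := endNorm_toForm_le S (P.tau x q) a
    rw [← LinearMap.add_apply, ← LinearMap.add_apply, ← map_add] at e1 e2
    nlinarith [sq_nonneg ‖Φ x‖]
  refine (pow_le_pow_iff_left₀ (formNorm_nonneg _ _) (by positivity) two_ne_zero).1 ?_
  have h4 := lambdaPlusSuNorm_sq p (abs_frameSign S x)
  rw [lambdaPlusSuNorm] at h4
  rw [h4]
  have h5 := Finset.sum_le_sum fun a (_ : a ∈ Finset.univ) =>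
    pow_le_pow_left₀ (endNorm_nonneg _) (h3 a) 2
  rw [Finset.sum_const, Finset.card_univ, Fintype.card_fin, nsmul_eq_mul] at h5
  push_cast at h5
  -- The comparison is 2 · 3 · 3² = 54 ≤ 8².
  nlinarith [sq_nonneg (‖Φ x‖ ^ 2)]

include S in
lemma selfDualPart_add_compl {G : Type*} [AddCommGroup G] [Module ℝ G] {η : Bilin x G}
    (h : ∀ i j, η (frame x j) (frame x i) = -η (frame x i) (frame x j)) (a : Fin 3) :
    selfDualPart o η (frame x 0) (frame x a.succ) +
      frameSign o x • selfDualPart o η (frame x (compl₁ a)) (frame x (compl₂ a)) =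
    η (frame x 0) (frame x a.succ) + frameSign o x • η (frame x (compl₁ a)) (frame x (compl₂ a)) := by
  rw [selfDualPart_zero_succ h, selfDualPart_compl h, smul_comm (frameSign o x), ← smul_add,
    smul_add (frameSign o x), smul_smul (frameSign o x) (frameSign o x),
    frameSign_mul_self S, one_smul]
  module

/-- Clifford multiplication only sees the self-dual part of the curvature. -/
lemma rhoForm_adCurvature_eq (hA : IsUnitary A) (hA1 : HasC1Symbols A) {p : LambdaPlusSu o E x}
    (hp : adCurvaturePlus o A x = toForm o E x p) :
    rhoForm S (adCurvature A x) = rhoForm S (toForm o E x p) := by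
  have hs := fun i j => adCurvature_skew x hA hA1 i j
  rw [rhoForm_eq S x hs, rhoForm_eq S x (fun i j => toForm_skew p _ _), ← hp]
  simp only [adCurvaturePlus, selfDualPart_add_compl S hs]

/-- The quartic term dominates. -/
lemma re_inner_rhoForm_adCurvature_ge (hA : IsUnitary A) (hA1 : HasC1Symbols A)
    (hP : P.IsAdmissible A) (hM : IsMonopole S P A Φ) (x : X) :
    1 / 8 * ‖Φ x‖ ^ 4 ≤ (inner ℂ (rhoForm S (adCurvature A x) (Φ x)) (Φ x) : ℂ).re := by
  obtain ⟨q, hq, hc⟩ := hM.curvature_eq x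
  have h1 := lambdaPlusSuNorm_le_of_rhoForm_eq S hq
  have h2 := lambdaPlusSuNorm_perturbation_le S P hP q
  have hadd : ∀ p r : LambdaPlusSu o E x, rhoForm S (toForm o E x (p + r)) =
      rhoForm S (toForm o E x p) + rhoForm S (toForm o E x r) := fun p r => by
    simp only [rhoForm_toForm, ← smul_add, ← Finset.sum_add_distrib, ← TensorProduct.map_add_right,
      ← LinearMap.add_apply, ← map_add]
  rw [rhoForm_adCurvature_eq S hA hA1 hc, hadd, hadd, hq, LinearMap.add_apply, LinearMap.add_apply,
    inner_add_left, inner_add_left, Complex.add_re, Complex.add_re]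
  have h3 := re_inner_quadratic_ge (Φ x)
  have h4 := (abs_le.1 (abs_re_inner_rhoForm_le S
    (LinearMap.rTensor (su (E.fiber x)) (P.tau0 x) q) (Φ x))).1
  have h5 := (abs_le.1 (abs_re_inner_rhoForm_le S (P.tau x q) (Φ x))).1
  have h6 := mul_le_mul_of_nonneg_right (h2.trans (mul_le_mul_of_nonneg_left h1 (by norm_num)))
    (sq_nonneg ‖Φ x‖)
  have h7 : ‖Φ x‖ ^ 4 = ‖Φ x‖ ^ 2 * ‖Φ x‖ ^ 2 := by ring
  have h8 : 0 ≤ ‖Φ x‖ ^ 4 := by positivity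
  -- The perturbation costs at most 5/2 · 1/64 · 14/5 = 7/64 of |Φ|⁴, which leaves 1/4 - 7/64 = 9/64
  -- ≥ 1/8.
  nlinarith

end CurvatureEstimates

/-! ### The determinant curvature depends only on the determinant connection -/

section DeterminantConnections

set_option linter.unusedSectionVars false

variable {X : Type*} [TopologicalSpace X] [ChartedSpace R4 X] [IsManifold (𝓡 4) ∞ X] [T2Space X]
  [Bundle.RiemannianBundle (fun x : X => TangentSpace (𝓡 4) x)]
  {V : HermitianPlaneBundle X} {A A₀ : Connection V} {x : X}

/-- The difference of two unitary connections, in the direction `v`. -/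
def connectionSub (hA : IsUnitary A) (hA₀ : IsUnitary A₀) (x : X) (v : T x) :
    Module.End ℂ (V.fiber x) :=
  let d : V.fiber x → V.fiber x := fun σ =>
    (A.isCovariantDerivativeOn (s := Set.univ)).difference
      (A₀.isCovariantDerivativeOn (s := Set.univ)) x σ v
  have hd : ∀ s : ∀ y, V.fiber y, IsSectionAt V 1 s x → d (s x) = A s x v - A₀ s x v := fun s hs =>
    DFunLike.congr_fun (IsCovariantDerivativeOn.difference_apply
      (A.isCovariantDerivativeOn (s := Set.univ)) (A₀.isCovariantDerivativeOn (s := Set.univ))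
      (Set.mem_univ x) hs.diffAt) v
  { toFun := d
    map_add' := fun σ τ => by
      obtain ⟨s, hs, rfl⟩ := exists_isSection_eq σ
      obtain ⟨t, ht, rfl⟩ := exists_isSection_eq τ
      have hs1 := (hs.at x).of_le one_le_infty
      have ht1 := (ht.at x).of_le one_le_infty
      rw [hd s hs1, hd t ht1, hd _ (hs1.add ht1), connection_add A hs1 ht1,
        connection_add A₀ hs1 ht1]
      abel
    map_smul' := fun c σ => by
      obtain ⟨s, hs, rfl⟩ := exists_isSection_eq σ
      have hs1 := (hs.at x).of_le one_le_infty
      have hc : ContMDiffAt (𝓡 4) 𝓘(ℝ, ℂ) 1 (fun _ : X => c) x := contMDiffAt_const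
      rw [RingHom.id_apply, hd s hs1, hd _ (hs1.smul one_le_infty hc), hA.leibniz hc hs1,
        hA₀.leibniz hc hs1, mvfderiv_fun_const, zero_smul, add_zero, add_zero, smul_sub] }

lemma connectionSub_apply (hA : IsUnitary A) (hA₀ : IsUnitary A₀) (v : T x) {s : ∀ y, V.fiber y}
    (hs : IsSectionAt V 1 s x) : connectionSub hA hA₀ x v (s x) = A s x v - A₀ s x v :=
  DFunLike.congr_fun (IsCovariantDerivativeOn.difference_apply
    (A.isCovariantDerivativeOn (s := Set.univ)) (A₀.isCovariantDerivativeOn (s := Set.univ))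
    (Set.mem_univ x) hs.diffAt) v

lemma SameDeterminant.sum_inner_eq (h : SameDeterminant A A₀) (hA : IsUnitary A)
    (hA₀ : IsUnitary A₀) {s : Fin 2 → ∀ y, V.fiber y} (hs : ∀ a, IsSectionAt V 1 (s a) x)
    (ho : Orthonormal ℂ fun a => s a x) (v : T x) :
    ∑ a, (inner ℂ (s a x) (A (s a) x v) : ℂ) = ∑ a, inner ℂ (s a x) (A₀ (s a) x v) := by
  obtain ⟨t, ht⟩ := exists_orthonormalBasis ho
  have h1 : LinearMap.trace ℂ _ (connectionSub hA hA₀ x v) = 0 := by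
    rw [LinearMap.trace_eq_sum_inner _ (fiberBasis V x), ← h x v]
    refine Finset.sum_congr rfl fun b _ => ?_
    rw [← connectionSub_apply hA hA₀ v
      ((isSectionAt_extend (fiberBasis V x b)).self_of_nhds.of_le one_le_infty),
      FiberBundle.extend_apply_self]
  rw [LinearMap.trace_eq_sum_inner _ t] at h1
  simp only [ht, connectionSub_apply hA hA₀ v (hs _), inner_sub_right, Finset.sum_sub_distrib] at h1
  exact sub_eq_zero.1 h1

/-- The trace of the curvature is the exterior derivative of the trace of the connection form. -/
lemma trace_curvatureEnd_coordField (hA : IsUnitary A) (hA1 : HasC1Symbols A)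
    {s : Fin 2 → ∀ y, V.fiber y} (hs : ∀ a, IsSection V ∞ (s a))
    (ho : ∀ᶠ y in 𝓝 x, Orthonormal ℂ fun a => s a y) (w z : R4) :
    LinearMap.trace ℂ _ (curvatureEnd A x (coordField x w x) (coordField x z x)) =
      mvfderiv (𝓡 4) (fun q => ∑ a, (inner ℂ (s a q) (A (s a) q (coordField x z q)) : ℂ)) x
        (coordField x w x) -
      mvfderiv (𝓡 4) (fun q => ∑ a, (inner ℂ (s a q) (A (s a) q (coordField x w q)) : ℂ)) x
        (coordField x z x) := by
  obtain ⟨t, ht⟩ := exists_orthonormalBasis ho.self_of_nhds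
  have hx := mem_chart_source R4 x
  have hs1 : ∀ a, IsSectionAt V 1 (s a) x := fun a => ((hs a).at x).of_le one_le_infty
  have hAs : ∀ a (z : R4), IsSectionAt V 1 (fun q => A (s a) q (coordField x z q)) x := fun a z =>
    secAt_covariantDerivative hA1 (.of_forall fun y => (hs a).at y)
      ((contMDiffAt_coordField hx z).of_le one_le_infty)
  have hd : ∀ w z : R4, mvfderiv (𝓡 4) (fun q => ∑ a, (inner ℂ (s a q)
      (A (s a) q (coordField x z q)) : ℂ)) x (coordField x w x) =
      ∑ a, ((inner ℂ (A (s a) x (coordField x w x)) (A (s a) x (coordField x z x)) : ℂ) +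
        inner ℂ (s a x) (A (fun q => A (s a) q (coordField x z q)) x (coordField x w x))) :=
    fun w z => by
    rw [mvfderiv_fun_sum fun a _ => (hs1 a).complex_inner one_le_infty (hAs a z)]
    exact Finset.sum_congr rfl fun a _ => hA.mvfderiv_inner (hs1 a) (hAs a z) _
  have hskew : ∀ (a b : Fin 2) (v : T x), (inner ℂ (A (s a) x v) (s b x) : ℂ) =
      -inner ℂ (s a x) (A (s b) x v) := fun a b v => by
    have h1 := hA.mvfderiv_inner (hs1 a) (hs1 b) v
    have h2 : (fun y => (inner ℂ (s a y) (s b y) : ℂ)) =ᶠ[𝓝 x] fun _ => if a = b then 1 else 0 := by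
      filter_upwards [ho] with y hy using orthonormal_iff_ite.1 hy a b
    rw [mvfderiv_congr h2, mvfderiv_fun_const] at h1
    exact eq_neg_of_add_eq_zero_left h1.symm
  -- The sum is minus the trace of a product of two connection matrices, hence symmetric in the two
  -- directions. The quadratic part of the curvature has no trace.
  have hsymm : ∑ a, (inner ℂ (A (s a) x (coordField x w x)) (A (s a) x (coordField x z x)) : ℂ) =
      ∑ a, inner ℂ (A (s a) x (coordField x z x)) (A (s a) x (coordField x w x)) := by
    have e : ∀ (u v : T x) a, (inner ℂ (A (s a) x u) (A (s a) x v) : ℂ) =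
        ∑ b, -((inner ℂ (s a x) (A (s b) x u) : ℂ) * inner ℂ (s b x) (A (s a) x v)) :=
      fun u v a => by
      rw [← t.sum_inner_mul_inner]
      simp only [ht, hskew, neg_mul]
    simp only [e]
    rw [Finset.sum_comm]
    refine Finset.sum_congr rfl fun a _ => Finset.sum_congr rfl fun b _ => ?_
    rw [mul_comm]
  rw [LinearMap.trace_eq_sum_inner _ t, hd, hd]
  have hc : ∀ a, (inner ℂ (t a) (curvatureEnd A x (coordField x w x) (coordField x z x) (t a)) : ℂ) =
      inner ℂ (s a x) (A (fun q => A (s a) q (coordField x z q)) x (coordField x w x)) -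
        inner ℂ (s a x) (A (fun q => A (s a) q (coordField x w q)) x (coordField x z x)) := fun a => by
    rw [ht, curvatureEnd_apply hA hA1, curvature_eq_curvOp hA1 hA.isMetric hx w z
      (.of_forall fun y => (hs a).at y), curvOp, mlieBracket_coordField hx, map_zero, sub_zero,
      inner_sub_right]
  simp only [hc, Finset.sum_add_distrib, Finset.sum_sub_distrib, hsymm]
  ring

variable [IsContMDiffRiemannianBundle (𝓡 4) ∞ R4 (fun x : X => TangentSpace (𝓡 4) x)]

/-- The connection forms of both connections have the same trace in a common frame on a whole
neighbourhood, and the determinant curvature is its exterior derivative. -/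
theorem SameDeterminant.detCurvature_eq (h : SameDeterminant A A₀) (hA : IsUnitary A)
    (hA1 : HasC1Symbols A) (hA₀ : IsUnitary A₀) (hA₀1 : HasC1Symbols A₀) (x : X) :
    detCurvature A x = detCurvature A₀ x := by
  obtain ⟨s, hs, ho⟩ := exists_orthonormal_frame V x
  refine (frame x).toBasis.ext fun i => (frame x).toBasis.ext fun j => ?_
  rw [OrthonormalBasis.coe_toBasis, detCurvature_frame, detCurvature_frame]
  obtain ⟨w, hw⟩ := exists_coordField_eq (mem_chart_source R4 x) (frame x i)
  obtain ⟨z, hz⟩ := exists_coordField_eq (mem_chart_source R4 x) (frame x j)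
  have he : ∀ z : R4, (fun q => ∑ a, (inner ℂ (s a q) (A (s a) q (coordField x z q)) : ℂ)) =ᶠ[𝓝 x]
      fun q => ∑ a, inner ℂ (s a q) (A₀ (s a) q (coordField x z q)) := fun z => by
    filter_upwards [ho] with q hq using
      h.sum_inner_eq hA hA₀ (fun a => ((hs a).at q).of_le one_le_infty) hq _
  rw [← hw, ← hz, trace_curvatureEnd_coordField hA hA1 hs ho,
    trace_curvatureEnd_coordField hA₀ hA₀1 hs ho, mvfderiv_congr (he z), mvfderiv_congr (he w)]

end DeterminantConnections

/-! ### Finiteness of the `C⁰` norms of the curvatures -/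

section CurvatureFiniteness

set_option linter.unusedSectionVars false

lemma norm_linear_sum_le {H G ι : Type*} [AddCommGroup H] [Module ℝ H] [NormedAddCommGroup G]
    [NormedSpace ℝ G] [Fintype ι] (f : H →ₗ[ℝ] G) {e : ι → H} {c : ι → ℝ} {C : ℝ}
    (hc : ∀ k, |c k| ≤ C) : ‖f (∑ k, c k • e k)‖ ≤ ∑ k, C * ‖f (e k)‖ := by
  rw [map_sum]
  refine norm_sum_le_of_le _ fun k _ => ?_
  rw [map_smul, norm_smul, Real.norm_eq_abs]
  exact mul_le_mul_of_nonneg_right (hc k) (norm_nonneg _)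

lemma norm_bilin_sum_le {H G ι : Type*} [AddCommGroup H] [Module ℝ H] [NormedAddCommGroup G]
    [NormedSpace ℝ G] [Fintype ι] (B : H →ₗ[ℝ] H →ₗ[ℝ] G) {e : ι → H} {c d : ι → ℝ} {C : ℝ}
    (hC : 0 ≤ C) (hc : ∀ k, |c k| ≤ C) (hd : ∀ k, |d k| ≤ C) :
    ‖B (∑ k, c k • e k) (∑ k, d k • e k)‖ ≤ ∑ l, C * ∑ k, C * ‖B (e k) (e l)‖ :=
  (norm_linear_sum_le _ hd).trans (Finset.sum_le_sum fun l _ =>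
    mul_le_mul_of_nonneg_left (norm_linear_sum_le (B.flip (e l)) hc) hC)

lemma abs_inner_sum_le {H ι : Type*} [NormedAddCommGroup H] [InnerProductSpace ℝ H] [Fintype ι]
    (M : H →ₗ[ℝ] H →ₗ[ℝ] H →ₗ[ℝ] H) {e : ι → H} {c d : ι → ℝ} {C : ℝ} (hC : 0 ≤ C)
    (hc : ∀ k, |c k| ≤ C) (hd : ∀ k, |d k| ≤ C) :
    |(inner ℝ (M (∑ k, c k • e k) (∑ k, d k • e k) (∑ k, d k • e k)) (∑ k, c k • e k) : ℝ)| ≤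
      ∑ n, C * ∑ m, C * ∑ l, C * ∑ k, C * |(inner ℝ (M (e k) (e l) (e m)) (e n) : ℝ)| := by
  refine (norm_linear_sum_le (innerₗ H _) hc).trans (Finset.sum_le_sum fun n _ =>
    mul_le_mul_of_nonneg_left ?_ hC)
  refine (norm_linear_sum_le ((innerₗ H).flip (e n) ∘ₗ M _ _) hd).trans
    (Finset.sum_le_sum fun m _ => mul_le_mul_of_nonneg_left ?_ hC)
  exact norm_bilin_sum_le (LinearMap.mk₂ ℝ (fun u v => (inner ℝ (M u v (e m)) (e n) : ℝ))
    (fun u u' v => by simp [inner_add_left]) (fun r u v => by simp [inner_smul_left])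
    (fun u v v' => by simp [inner_add_left]) (fun r u v => by simp [inner_smul_left])) hC hc hd

variable {X : Type*} [TopologicalSpace X] [ChartedSpace R4 X] [IsManifold (𝓡 4) ∞ X]

/-- Only local upper bounds are required, because the curvatures are written in `frame`, whose
dependence on the point is arbitrary. Finiteness matters since `toReal` and `toNNReal` send ⊤ to 0.
-/
lemma C0norm_ne_top [CompactSpace X] {f : X → ℝ} (h : ∀ x, ∃ C : ℝ, ∀ᶠ y in 𝓝 x, f y ≤ C) :
    C0norm f ≠ ⊤ := by
  choose C hC using h
  obtain ⟨t, -, ht⟩ := isCompact_univ.elim_nhds_subcover (fun x => {y | f y ≤ C x})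
    fun x _ => hC x
  refine ne_top_of_le_ne_top (b := ENNReal.ofReal (∑ x ∈ t, |C x|)) ENNReal.ofReal_ne_top
    (iSup_le fun y => ENNReal.ofReal_le_ofReal ?_)
  obtain ⟨x, hx, hy⟩ := Set.mem_iUnion₂.1 (ht (Set.mem_univ y))
  exact (Set.mem_ofPred.1 hy).trans ((le_abs_self _).trans
    (Finset.single_le_sum (f := fun x => |C x|) (fun _ _ => abs_nonneg _) hx))

lemma continuousAt_mvfderiv_coordField {G : Type*} [NormedAddCommGroup G] [NormedSpace ℝ G]
    {f : X → G} {x : X} (hf : ∀ᶠ y in 𝓝 x, ContMDiffAt (𝓡 4) 𝓘(ℝ, G) 1 f y) (w : R4) :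
    ContinuousAt (fun y => mvfderiv (𝓡 4) f y (coordField x w y)) x := by
  set φ := extChartAt (𝓡 4) x
  have hx := mem_chart_source R4 x
  have hF : ContDiffAt ℝ 1 (f ∘ φ.symm) (φ x) := by
    rw [← contMDiffAt_iff_contDiffAt]
    have h1 : ContMDiffAt 𝓘(ℝ, R4) (𝓡 4) 1 φ.symm (φ x) :=
      (contMDiffOn_extChartAt_symm x).contMDiffAt (extChartAt_target_mem_nhds x)
    refine ContMDiffAt.comp _ ?_ h1
    rw [extChartAt_to_inv x]
    exact hf.self_of_nhds
  have h2 : ContinuousAt (fun p => fderiv ℝ (f ∘ φ.symm) p w) (φ x) :=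
    (hF.fderiv_right (m := 0) (by norm_num)).continuousAt.clm_apply continuousAt_const
  refine (h2.comp (continuousAt_extChartAt x)).congr ?_
  filter_upwards [hf, (chartAt R4 x).open_source.mem_nhds hx] with y hy hys
  exact (mvfderiv_coordField hys (hy.mdifferentiableAt one_ne_zero) w).symm

variable [T2Space X]

section Metric

variable {F : Type*} [NormedAddCommGroup F] [NormedSpace ℝ F] {V : X → Type*}
  [TopologicalSpace (Bundle.TotalSpace F V)] [∀ x, NormedAddCommGroup (V x)]
  [∀ x, InnerProductSpace ℝ (V x)] [FiberBundle F V] [VectorBundle ℝ F V]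
  [ContMDiffVectorBundle ∞ F V (𝓡 4)] [IsContMDiffRiemannianBundle (𝓡 4) ∞ F V]
  {D : CovariantDerivative (𝓡 4) F V} (hD : HasC1Symbols D) (hM : IsMetric D)
include hD hM

/-- Metric compatibility writes ⟨∇_w∇_z s, t⟩ as ∂_w⟨∇_z s, t⟩ - ⟨∇_z s, ∇_w t⟩, which is continuous
as soon as ∇s is `C¹`. -/
lemma continuousAt_inner_curvature {x : X} {s t : ∀ x, V x} (hs : ∀ᶠ y in 𝓝 x, SecAt F ∞ s y)
    (ht : ∀ᶠ y in 𝓝 x, SecAt F ∞ t y) (w z : R4) : ContinuousAt (fun y => (inner ℝ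
      (curvature D y (coordField x w y) (coordField x z y) (s y)) (t y) : ℝ)) x := by
  have hx : ∀ᶠ y in 𝓝 x, y ∈ (chartAt R4 x).source :=
    (chartAt R4 x).open_source.mem_nhds (mem_chart_source R4 x)
  have hDs : ∀ {s : ∀ x, V x} (_ : ∀ᶠ q in 𝓝 x, SecAt F ∞ s q) (w : R4),
      ∀ᶠ y in 𝓝 x, SecAt F 1 (fun q => D s q (coordField x w q)) y := fun {s} hs w => by
    filter_upwards [hs.eventually_nhds, hx] with y hy hyx
    exact secAt_covariantDerivative hD hy ((contMDiffAt_coordField hyx w).of_le one_le_infty)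
  have h1 : ∀ w z : R4, ContinuousAt (fun y => mvfderiv (𝓡 4) (fun q => (inner ℝ
      (D s q (coordField x z q)) (t q) : ℝ)) y (coordField x w y) -
      inner ℝ (D s y (coordField x z y)) (D t y (coordField x w y))) x := fun w z => by
    refine (continuousAt_mvfderiv_coordField ?_ w).sub
      ((hDs hs z).self_of_nhds.inner one_le_infty (hDs ht w).self_of_nhds).continuousAt
    filter_upwards [hDs hs z, ht] with y hy hty
    exact hy.inner one_le_infty (hty.of_le one_le_infty)
  refine ((h1 w z).sub (h1 z w)).congr ?_
  filter_upwards [hx, hs.eventually_nhds, ht, hDs hs z, hDs hs w] with y hyx hsy hty hz hw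
  rw [Pi.sub_apply, curvature_eq_curvOp hD hM hyx w z hsy, curvOp, mlieBracket_coordField hyx, map_zero, sub_zero,
    inner_sub_left, hM (fun q => D s q (coordField x z q)) _ _ _ hz (hty.of_le one_le_infty),
    hM (fun q => D s q (coordField x w q)) _ _ _ hw (hty.of_le one_le_infty)]
  ring

end Metric

variable [Bundle.RiemannianBundle (fun x : X => TangentSpace (𝓡 4) x)]
  [IsContMDiffRiemannianBundle (𝓡 4) ∞ R4 (fun x : X => TangentSpace (𝓡 4) x)]

/-- The orthonormal frames have bounded coefficients in a coordinate frame. -/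
lemma exists_frame_bound (x : X) : ∃ (w : Fin 4 → R4) (C : ℝ), 0 ≤ C ∧ ∀ᶠ y in 𝓝 x, ∀ i,
    ∃ c : Fin 4 → ℝ, (∀ k, |c k| ≤ C) ∧ frame y i = ∑ k, c k • coordField x (w k) y := by
  obtain ⟨w, f, -, -, hf, hd⟩ := exists_dual_frame x
  have hc : ∀ k, ContinuousAt (fun y => (inner ℝ (f k y) (f k y) : ℝ)) x := fun k =>
    (FieldAt.inner le_rfl (hf k x) (hf k x)).continuousAt
  -- The coefficients are products of unit vectors with the dual fields. Near x one has |f_k|² ≤ 1 +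
  -- |f_k(x)|², and 2|f_k| ≤ |f_k|² + 1 turns this into a bound on |f_k|.
  set C : ℝ := 2 + ∑ k, ‖f k x‖ ^ 2
  have hb : ∀ᶠ y in 𝓝 x, ∀ k, (inner ℝ (f k y) (f k y) : ℝ) ≤ 1 + inner ℝ (f k x) (f k x) :=
    Filter.eventually_all.2 fun k => ((hc k).eventually_lt continuousAt_const (by simp)).mono
      fun y hy => hy.le
  refine ⟨w, C, by positivity, ?_⟩
  filter_upwards [hd, hb] with y hy hby i
  refine ⟨fun k => inner ℝ (f k y) (frame y i), fun k => ?_, ?_⟩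
  · refine (abs_real_inner_le_norm _ _).trans ?_
    rw [(frame y).orthonormal.1 i, mul_one]
    have h1 := hby k
    rw [real_inner_self_eq_norm_sq, real_inner_self_eq_norm_sq] at h1
    have h2 := Finset.single_le_sum (f := fun k => ‖f k x‖ ^ 2) (fun _ _ => by positivity)
      (Finset.mem_univ k)
    nlinarith [sq_nonneg (‖f k y‖ - 1)]
  · exact eq_sum_dual (by rw [Fintype.card_fin]; exact (instFactFinrankTangent y).out.symm) hy _

lemma IsLeviCivita.C0norm_scalarCurvature_ne_top [CompactSpace X] {D : TangentConnection X}
    (hD : IsLeviCivita D) : C0norm (fun x => |scalarCurvature D x|) ≠ ⊤ := by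
  refine C0norm_ne_top fun x => ?_
  obtain ⟨w, C, hC, hw⟩ := exists_frame_bound x
  set G : X → ℝ := fun y => ∑ n, C * ∑ m, C * ∑ l, C * ∑ k, C * |(inner ℝ (curvature D y
    (coordField x (w k) y) (coordField x (w l) y) (coordField x (w m) y)) (coordField x (w n) y) : ℝ)|
  have hG : ContinuousAt G x := tendsto_finsetSum _ fun n _ => continuousAt_const.mul <|
    tendsto_finsetSum _ fun m _ => continuousAt_const.mul <| tendsto_finsetSum _ fun l _ =>
    continuousAt_const.mul <| tendsto_finsetSum _ fun k _ => continuousAt_const.mul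
    (continuousAt_inner_curvature hD.hasC1Symbols hD.isMetric
      (eventually_fieldAt_coordField x (w m)) (eventually_fieldAt_coordField x (w n)) _ _).abs
  refine ⟨16 * (G x + 1), ((hG.eventually_lt continuousAt_const (lt_add_one _)).and hw).mono ?_⟩
  rintro y ⟨h1, h2⟩
  choose c hcC hc using h2
  have h3 : ∀ i j, |(inner ℝ (curvature D y (frame y i) (frame y j) (frame y j)) (frame y i) : ℝ)| ≤
      G x + 1 := fun i j => by
    rw [hc i, hc j]
    exact (abs_inner_sum_le (curvatureMap hD.hasC1Symbols hD.isMetric y) hC (hcC i) (hcC j)).trans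
      h1.le
  rw [scalarCurvature, ← Real.norm_eq_abs]
  refine (norm_sum_le_of_le _ fun i _ => norm_sum_le_of_le _ fun j _ => h3 i j).trans (le_of_eq ?_)
  rw [Finset.sum_const, Finset.sum_const, Finset.card_univ, Fintype.card_fin, smul_smul,
    nsmul_eq_mul]
  norm_num

lemma IsUnitary.C0norm_detCurvature_ne_top [CompactSpace X] {V : HermitianPlaneBundle X}
    {B : Connection V} (hB : IsUnitary B) (hB1 : HasC1Symbols B) :
    C0norm (fun x => formNorm (fun z : ℂ => ‖z‖) (detCurvature B x)) ≠ ⊤ := by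
  refine C0norm_ne_top fun x => ?_
  obtain ⟨w, C, hC, hw⟩ := exists_frame_bound x
  obtain ⟨s, hs, ho⟩ := exists_orthonormal_frame V x
  have hsI : ∀ a y, IsSectionAt V ∞ (fun y => Complex.I • s a y) y := fun a y =>
    ((hs a).at y).I_smul le_rfl
  set g : R4 → R4 → X → ℝ := fun w z y => ∑ a,
    (|(inner ℝ (curvature B y (coordField x w y) (coordField x z y) (s a y)) (s a y) : ℝ)| +
      |(inner ℝ (curvature B y (coordField x w y) (coordField x z y) (s a y))
        (Complex.I • s a y) : ℝ)|)
  have hg : ∀ w z, ContinuousAt (g w z) x := fun w z => tendsto_finsetSum _ fun a _ =>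
    (continuousAt_inner_curvature hB1 hB.isMetric (.of_forall fun y => (hs a).at y)
      (.of_forall fun y => (hs a).at y) w z).abs.add
    (continuousAt_inner_curvature hB1 hB.isMetric (.of_forall fun y => (hs a).at y)
      (.of_forall fun y => hsI a y) w z).abs
  set G : X → ℝ := fun y => ∑ l, C * ∑ k, C * g (w k) (w l) y
  have hG : ContinuousAt G x := tendsto_finsetSum _ fun l _ => continuousAt_const.mul <|
    tendsto_finsetSum _ fun k _ => continuousAt_const.mul (hg _ _)
  -- Half of a sum of sixteen squares is at most 8 times the largest one, and 8 ≤ 3².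
  refine ⟨3 * (G x + 1), ((hG.eventually_lt continuousAt_const (lt_add_one _)).and
    (hw.and ho)).mono ?_⟩
  rintro y ⟨h1, h2, h3⟩
  choose c hcC hc using h2
  have htr : ∀ w z, ‖LinearMap.trace ℂ _ (curvatureEnd B y (coordField x w y) (coordField x z y))‖ ≤
      g w z y := fun w z => by
    obtain ⟨t, ht⟩ := exists_orthonormalBasis h3
    rw [LinearMap.trace_eq_sum_inner _ t]
    refine norm_sum_le_of_le _ fun a _ => ?_
    rw [ht, curvatureEnd_apply hB hB1, norm_inner_symm]
    refine (Complex.norm_le_abs_re_add_abs_im _).trans (add_le_add le_rfl (le_of_eq ?_))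
    change _ = |(inner ℂ _ (Complex.I • s a y) : ℂ).re|
    rw [inner_smul_right, Complex.I_mul_re, abs_neg]
  have hb : ∀ i j, ‖detCurvature B y (frame y i) (frame y j)‖ ≤ G x + 1 := fun i j => by
    rw [detCurvature_frame, hc i, hc j]
    refine (norm_bilin_sum_le ((curvatureEndMap hB hB1 y).compr₂
      ((LinearMap.trace ℂ (V.fiber y)).restrictScalars ℝ)) hC (hcC i) (hcC j)).trans
      (le_trans (Finset.sum_le_sum fun l _ => mul_le_mul_of_nonneg_left (Finset.sum_le_sum fun k _ =>
        mul_le_mul_of_nonneg_left (htr (w k) (w l)) hC) hC) h1.le)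
  have h0 : 0 ≤ G x + 1 := (norm_nonneg _).trans (hb 0 0)
  refine (pow_le_pow_iff_left₀ (formNorm_nonneg _ _) (by positivity) two_ne_zero).1 ?_
  have h4 := Finset.sum_le_sum fun i (_ : i ∈ Finset.univ) => Finset.sum_le_sum
    fun j (_ : j ∈ Finset.univ) => pow_le_pow_left₀ (norm_nonneg _) (hb i j) 2
  rw [Finset.sum_const, Finset.sum_const, Finset.card_univ, Fintype.card_fin, smul_smul,
    nsmul_eq_mul] at h4
  rw [formNorm_sq]
  push_cast at h4
  nlinarith [sq_nonneg (G x + 1)]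

end CurvatureFiniteness

/-! ### The a priori estimates -/

section MonopoleEstimates

set_option linter.unusedSectionVars false

lemma eq_zero_or_le_of_quartic {s φ t : ℝ} (h : s / 4 * φ ^ 2 + 1 / 8 * φ ^ 4 ≤ t * φ ^ 2) :
    φ ^ 2 = 0 ∨ s / 4 + 1 / 8 * φ ^ 2 ≤ t := by
  refine (sq_nonneg φ).eq_or_lt.imp Eq.symm fun h0 => le_of_mul_le_mul_right ?_ h0
  linarith [show φ ^ 4 = φ ^ 2 * φ ^ 2 by ring]

variable {X : Type*} [TopologicalSpace X] [ChartedSpace R4 X] [IsManifold (𝓡 4) ∞ X] [T2Space X]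
  [Bundle.RiemannianBundle (fun x : X => TangentSpace (𝓡 4) x)]
  [IsContMDiffRiemannianBundle (𝓡 4) ∞ R4 (fun x : X => TangentSpace (𝓡 4) x)]
  {o : ManifoldOrientation X} {D : TangentConnection X} {E : HermitianPlaneBundle X} {x : X}

lemma IsConnectionOfClass.hasC1Symbols_one {V : HermitianPlaneBundle X} {B : Connection V}
    (h : IsConnectionOfClass 1 B) : HasC1Symbols B :=
  hasC1Symbols_of_class h le_rfl (by rw [one_add_one_eq_two]; exact two_le_infty)

lemma IsConnectionOfClass.hasC1Symbols_infty {V : HermitianPlaneBundle X} {B : Connection V}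
    (h : IsConnectionOfClass ∞ B) : HasC1Symbols B :=
  hasC1Symbols_of_class h one_le_infty le_rfl

lemma norm_detPlus_le_selfDualPart {V : HermitianPlaneBundle X} (B : Connection V) (a : Fin 3) :
    ‖detPlus o B x a‖ ≤ 2 * formNorm (fun z : ℂ => ‖z‖) (selfDualPart o (detCurvature B x)) :=
  le_two_mul_formNorm (ν := fun z : ℂ => ‖z‖) norm_nonneg _ 0 a.succ

variable (S : SpincStructure o D)

include S in
-- The self-dual component is an average, up to sign, of two components of the full curvature, each
-- bounded by twice the norm.
lemma norm_detPlus_le {V : HermitianPlaneBundle X} {B : Connection V} (hB : IsUnitary B)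
    (hB1 : HasC1Symbols B) (a : Fin 3) :
    ‖detPlus o B x a‖ ≤ 2 * formNorm (fun z : ℂ => ‖z‖) (detCurvature B x) := by
  have h1 := fun i j => le_two_mul_formNorm (ν := fun z : ℂ => ‖z‖) norm_nonneg
    (detCurvature B x) i j
  have h2 : ‖(frameSign o x : ℂ)‖ = 1 := by
    rw [Complex.norm_real, Real.norm_eq_abs, abs_frameSign S]
  have h3 : ‖(1 / 2 : ℂ)‖ = 1 / 2 := by norm_num
  rw [detPlus_eq x hB hB1, ← detCurvature_frame, ← detCurvature_frame, norm_mul, h3]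
  have h4 := norm_add_le (detCurvature B x (frame x 0) (frame x a.succ))
    (frameSign o x * detCurvature B x (frame x (compl₁ a)) (frame x (compl₂ a)))
  rw [norm_mul, h2, one_mul] at h4
  linarith [h1 0 a.succ, h1 (compl₁ a) (compl₂ a)]

variable (P : Perturbation S E) {A : Connection E} {Φ : ∀ x, Tensor S.Wplus E x}
  (hD : IsLeviCivita D) (hA : IsUnitary A) (hA1 : HasC1Symbols A) (hP : P.IsAdmissible A)
  (hM : IsMonopole S P A Φ) (hΦ : ∀ x, TensorAt S.Wplus E 1 Φ x)
include hD hA hA1 hP hM hΦ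

/-- The inequality at a maximum of `|Φ|²` from which all estimates follow. -/
theorem curvature_inequality_at_local_max (hmax : IsLocalMax (fun y => ‖Φ y‖ ^ 2) x) :
    scalarCurvature D x / 4 * ‖Φ x‖ ^ 2 + 1 / 8 * ‖Φ x‖ ^ 4 ≤
      (32 * (P.theta0Norm + P.thetaNorm A).toReal +
        ∑ a, (‖detPlus o S.nablaPlus x a‖ + ‖detPlus o A x a‖)) * ‖Φ x‖ ^ 2 := by
  have h1 := weitzenbock_le_at_local_max S hD hA P hA1 hP hM hΦ hmax
  rw [weitzenbock_term_eq S x hA hA1 hD] at h1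
  have h2 := re_inner_rhoForm_adCurvature_ge S P hA hA1 hP hM x
  have h3 : ∀ a, (inner ℂ ((detPlus o S.nablaPlus x a + detPlus o A x a) •
      LinearMap.rTensor (E.fiber x) (quat S x a) (Φ x)) (Φ x) : ℂ).re ≤
      (‖detPlus o S.nablaPlus x a‖ + ‖detPlus o A x a‖) * ‖Φ x‖ ^ 2 := fun a => by
    refine (Complex.re_le_norm _).trans ((tensor_norm_inner_le _ _).trans ?_)
    rw [tensor_norm_smul, norm_rTensor_quat, mul_assoc, ← pow_two]
    gcongr
    exact norm_add_le _ _
  have h4 := Finset.sum_le_sum fun a (_ : a ∈ Finset.univ) => h3 a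
  rw [← Finset.sum_mul] at h4
  rw [add_mul]
  linarith

/-- Division of the quartic inequality by |Φ|²: 8 inverts the quartic coefficient, 32 is the cost of
the Dirac perturbation with θ ≤ 1, and each 6 is three self-dual components bounded by twice the
norm. -/
lemma sq_norm_le_at_local_max (hmax : IsLocalMax (fun y => ‖Φ y‖ ^ 2) x) : ‖Φ x‖ ^ 2 ≤
    8 * (32 + 6 * formNorm (fun z : ℂ => ‖z‖) (detCurvature A x) +
      6 * formNorm (fun z : ℂ => ‖z‖) (detCurvature S.nablaPlus x) + |scalarCurvature D x|) := by
  have h1 := curvature_inequality_at_local_max S P hD hA hA1 hP hM hΦ hmax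
  have hθ : (P.theta0Norm + P.thetaNorm A).toReal ≤ 1 := by
    simpa using ENNReal.toReal_mono ENNReal.one_ne_top hP.theta_le
  have hd := Finset.sum_le_sum fun a (_ : a ∈ Finset.univ) =>
    add_le_add (norm_detPlus_le S (x := x) S.nablaPlus_unitary
      S.nablaPlus_smooth.hasC1Symbols_infty a) (norm_detPlus_le S (x := x) hA hA1 a)
  rw [Finset.sum_const, Finset.card_univ, Fintype.card_fin, nsmul_eq_mul] at hd
  push_cast at hd
  have hs := neg_abs_le (scalarCurvature D x)
  have hs0 := abs_nonneg (scalarCurvature D x)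
  have f0 := formNorm_nonneg (fun z : ℂ => ‖z‖) (detCurvature A x)
  have f1 := formNorm_nonneg (fun z : ℂ => ‖z‖) (detCurvature S.nablaPlus x)
  rcases eq_zero_or_le_of_quartic h1 with h0 | h0
  · rw [h0]; linarith
  · linarith

/-- A quarter of 128 is 32, which covers the coefficient 32 of the perturbation and the 6 of each
determinant curvature. Nothing is then left to balance |Φ|²/8. -/
lemma norm_eq_zero_at_local_max (hmax : IsLocalMax (fun y => ‖Φ y‖ ^ 2) x)
    (hs : 128 * ((P.theta0Norm + P.thetaNorm A).toReal +
      formNorm (fun z : ℂ => ‖z‖) (selfDualPart o (detCurvature A x)) +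
      formNorm (fun z : ℂ => ‖z‖) (selfDualPart o (detCurvature S.nablaPlus x))) ≤
      scalarCurvature D x) : ‖Φ x‖ ^ 2 = 0 := by
  have h1 := curvature_inequality_at_local_max S P hD hA hA1 hP hM hΦ hmax
  have hd := Finset.sum_le_sum fun a (_ : a ∈ Finset.univ) =>
    add_le_add (norm_detPlus_le_selfDualPart (o := o) (x := x) S.nablaPlus a)
      (norm_detPlus_le_selfDualPart (o := o) (x := x) A a)
  rw [Finset.sum_const, Finset.card_univ, Fintype.card_fin, nsmul_eq_mul] at hd
  push_cast at hd
  have f0 := formNorm_nonneg (fun z : ℂ => ‖z‖) (selfDualPart o (detCurvature A x))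
  have f1 := formNorm_nonneg (fun z : ℂ => ‖z‖) (selfDualPart o (detCurvature S.nablaPlus x))
  rcases eq_zero_or_le_of_quartic h1 with h0 | h0
  · exact h0
  · exact le_antisymm (by linarith) (sq_nonneg _)

omit hD hA hA1 hΦ in
/-- The self-dual curvature of a monopole vanishes where its spinor does. -/
lemma adCurvaturePlus_eq_zero (h : Φ x = 0) : adCurvaturePlus o A x = 0 := by
  have h1 := formNorm_adCurvaturePlus_le S P hP hM x
  rw [h, norm_zero] at h1
  have h2 : formNorm endNorm (adCurvaturePlus o A x) = 0 :=
    le_antisymm (by simpa using h1) (formNorm_nonneg _ _)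
  obtain ⟨q, -, hc⟩ := hM.curvature_eq x
  refine (frame x).toBasis.ext fun i => (frame x).toBasis.ext fun j => LinearMap.ext fun v => ?_
  simp only [OrthonormalBasis.coe_toBasis, LinearMap.zero_apply]
  have h3 := le_two_mul_formNorm (ν := endNorm) endNorm_nonneg (adCurvaturePlus o A x) i j
  rw [h2, mul_zero] at h3
  have h4 : adCurvaturePlus o A x (frame x i) (frame x j) ∈ su (E.fiber x) := by
    rw [hc]; exact toForm_mem _ _ _
  have h5 := su_mul_self (finrank_fiber E x) h4
  rw [le_antisymm h3 (endNorm_nonneg _)] at h5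
  -- A skew endomorphism whose square vanishes is zero, since |Mv|² = -⟨v, M²v⟩.
  rw [← inner_self_eq_zero (𝕜 := ℂ), h4.1, ← Module.End.mul_apply, h5]
  simp

variable [CompactSpace X]

theorem sq_norm_le {R F₀ F₁ : ℝ} (hR : ∀ x, |scalarCurvature D x| ≤ R)
    (hF₀ : ∀ x, formNorm (fun z : ℂ => ‖z‖) (detCurvature A x) ≤ F₀)
    (hF₁ : ∀ x, formNorm (fun z : ℂ => ‖z‖) (detCurvature S.nablaPlus x) ≤ F₁) (x : X) :
    ‖Φ x‖ ^ 2 ≤ 8 * (32 + 6 * F₀ + 6 * F₁ + R) := by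
  obtain ⟨x₀, -, h⟩ := isCompact_univ.exists_isMaxOn ⟨x, Set.mem_univ x⟩
    (continuous_norm_sq_of_tensorAt hΦ).continuousOn
  have h1 := sq_norm_le_at_local_max S P hD hA hA1 hP hM hΦ (h.isLocalMax Filter.univ_mem)
  have h2 : ‖Φ x‖ ^ 2 ≤ ‖Φ x₀‖ ^ 2 := h (Set.mem_univ x)
  linarith [hR x₀, hF₀ x₀, hF₁ x₀]

theorem eq_zero_of_le_scalarCurvature
    (hs : ∀ x, 128 * ((P.theta0Norm + P.thetaNorm A).toReal +
      formNorm (fun z : ℂ => ‖z‖) (selfDualPart o (detCurvature A x)) +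
      formNorm (fun z : ℂ => ‖z‖) (selfDualPart o (detCurvature S.nablaPlus x))) ≤
      scalarCurvature D x) (x : X) : Φ x = 0 := by
  obtain ⟨x₀, -, h⟩ := isCompact_univ.exists_isMaxOn ⟨x, Set.mem_univ x⟩
    (continuous_norm_sq_of_tensorAt hΦ).continuousOn
  have h1 := norm_eq_zero_at_local_max S P hD hA hA1 hP hM hΦ (h.isLocalMax Filter.univ_mem) (hs x₀)
  have h2 : ‖Φ x‖ ^ 2 ≤ ‖Φ x₀‖ ^ 2 := h (Set.mem_univ x)
  rw [h1] at h2
  exact norm_eq_zero.1 (pow_eq_zero_iff two_ne_zero |>.1 (le_antisymm h2 (sq_nonneg _)))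

end MonopoleEstimates

/-! ### From pointwise bounds to extended `C⁰` norms -/

section MonopoleConstants

lemma le_toReal_C0norm {X : Type*} {f : X → ℝ} (h : C0norm f ≠ ⊤) (x : X) :
    f x ≤ (C0norm f).toReal :=
  ofReal_le_toReal (le_iSup (fun x => ENNReal.ofReal (f x)) x) h

lemma C0norm_le {X : Type*} {f : X → ℝ} {K : ℝ≥0} (h : ∀ x, f x ≤ K) : C0norm f ≤ K :=
  iSup_le fun x => ENNReal.ofReal_le_of_le_toReal (h x)

lemma C0norm_sq_le {X : Type*} {f : X → ℝ} {K : ℝ≥0} (h : ∀ x, f x ^ 2 ≤ K) :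
    C0norm f ^ 2 ≤ K := by
  have h1 : C0norm f ≤ NNReal.sqrt K := C0norm_le fun x => by
    rw [Real.coe_sqrt]
    exact Real.le_sqrt_of_sq_le (h x)
  refine (pow_le_pow_left₀ bot_le h1 2).trans (le_of_eq ?_)
  rw [← ENNReal.coe_pow, NNReal.sq_sqrt]

/-- The bound for `|Φ|²` and `|F_A⁺|` in terms of the `C⁰` norms of the scalar curvature and of the
curvatures of the two determinant connections. -/
def monopoleBound (R F₀ F₁ : ℝ≥0∞) : ℝ≥0 :=
  64 * (32 + 6 * F₀.toNNReal + 6 * F₁.toNNReal + R.toNNReal)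

end MonopoleConstants

end PU2Monopole

end

theorem mainTheorem10 :
    ∃ (K : ℝ≥0∞ → ℝ≥0∞ → ℝ≥0∞ → ℝ≥0) (c : ℝ≥0),
      ∀ (X : Type u) [TopologicalSpace X] [T2Space X] [CompactSpace X]
        [ChartedSpace PU2Monopole.R4 X] [IsManifold (𝓡 4) ∞ X]
        [Bundle.RiemannianBundle (fun x : X => TangentSpace (𝓡 4) x)]
        [IsContMDiffRiemannianBundle (𝓡 4) ∞ PU2Monopole.R4
          (fun x : X => TangentSpace (𝓡 4) x)]
        (o : PU2Monopole.ManifoldOrientation X)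
        (D : PU2Monopole.TangentConnection X) (_ : PU2Monopole.IsLeviCivita D)
        (S : PU2Monopole.SpincStructure.{v, u} o D)
        (E : PU2Monopole.HermitianPlaneBundle.{u, w} X)
        -- a smooth unitary connection on `E`, inducing the fixed connection on `det E`
        (A₀ : PU2Monopole.Connection E) (_ : PU2Monopole.IsUnitary A₀)
        (_ : PU2Monopole.IsConnectionOfClass ∞ A₀)
        -- a `C¹` pair `(A, Φ)` with the fixed determinant connection
        (A : PU2Monopole.Connection E) (_ : PU2Monopole.IsUnitary A)
        (_ : PU2Monopole.IsConnectionOfClass 1 A) (_ : PU2Monopole.SameDeterminant A A₀)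
        (Φ : ∀ x, PU2Monopole.Tensor S.Wplus E x)
        (_ : PU2Monopole.IsTensorSection S.Wplus E 1 Φ)
        (P : PU2Monopole.Perturbation S E) (_ : P.IsAdmissible A)
        (_ : PU2Monopole.IsMonopole S P A Φ),
        let K₃ : ℝ≥0 := K
          (PU2Monopole.C0norm fun x : X => |PU2Monopole.scalarCurvature D x|)
          (PU2Monopole.C0norm fun x => PU2Monopole.formNorm (fun z : ℂ => ‖z‖)
            (PU2Monopole.detCurvature A₀ x))
          (PU2Monopole.C0norm fun x => PU2Monopole.formNorm (fun z : ℂ => ‖z‖)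
            (PU2Monopole.detCurvature S.nablaPlus x))
        PU2Monopole.C0norm (fun x => ‖Φ x‖) ^ 2 ≤ K₃ ∧
        PU2Monopole.C0norm (fun x => PU2Monopole.formNorm PU2Monopole.endNorm
          (PU2Monopole.adCurvaturePlus o A x)) ≤ K₃ ∧
        (K₃ ≤ 0 → ∀ x : X, Φ x = 0 ∧ PU2Monopole.adCurvaturePlus o A x = 0) ∧
        ((∀ x : X, c * ((P.theta0Norm + P.thetaNorm A).toReal
            + PU2Monopole.formNorm (fun z : ℂ => ‖z‖)
              (PU2Monopole.selfDualPart o (PU2Monopole.detCurvature A₀ x))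
            + PU2Monopole.formNorm (fun z : ℂ => ‖z‖)
              (PU2Monopole.selfDualPart o (PU2Monopole.detCurvature S.nablaPlus x)))
            ≤ PU2Monopole.scalarCurvature D x) →
          ∀ x : X, Φ x = 0 ∧ PU2Monopole.adCurvaturePlus o A x = 0) := by
  -- The constant 128 is the one required by `norm_eq_zero_at_local_max`.
  refine ⟨PU2Monopole.monopoleBound, 128, ?_⟩
  intro X _ _ _ _ _ _ _ o D hD S E A₀ hA₀ hA₀' A hA hA' hdet Φ hΦ P hP hM K₃
  have hA1 := hA'.hasC1Symbols_one
  have hA₀1 := hA₀'.hasC1Symbols_infty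
  -- The pointwise estimates involve the determinant curvature of A; this replaces it by that of the
  -- fixed connection, on which alone the constant may depend.
  have hF := fun x => hdet.detCurvature_eq hA hA1 hA₀ hA₀1 x
  have hΦ1 := fun x => PU2Monopole.IsTensorSection.at PU2Monopole.one_le_infty hΦ x
  have hsq := PU2Monopole.sq_norm_le S P hD hA hA1 hP hM hΦ1
    (PU2Monopole.le_toReal_C0norm hD.C0norm_scalarCurvature_ne_top)
    (fun x => (congrArg _ (hF x)).trans_le
      (PU2Monopole.le_toReal_C0norm (hA₀.C0norm_detCurvature_ne_top hA₀1) x))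
    (PU2Monopole.le_toReal_C0norm (S.nablaPlus_unitary.C0norm_detCurvature_ne_top
      S.nablaPlus_smooth.hasC1Symbols_infty))
  have hzero := fun x (h : Φ x = 0) => PU2Monopole.adCurvaturePlus_eq_zero S P hP hM h
  -- The constant 64 in `monopoleBound` is 8 · 8; the second 8 is reserved for the bound of F_A⁺ by
  -- 8|Φ|².
  have hK : ∀ x, 8 * ‖Φ x‖ ^ 2 ≤ K₃ := fun x => by
    have := hsq x
    simp only [K₃, PU2Monopole.monopoleBound]
    push_cast
    linarith
  refine ⟨PU2Monopole.C0norm_sq_le fun x => ?_, PU2Monopole.C0norm_le fun x =>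
    (PU2Monopole.formNorm_adCurvaturePlus_le S P hP hM x).trans (hK x), fun h0 x => ?_,
    fun hs x => ?_⟩
  · linarith [hK x, sq_nonneg ‖Φ x‖]
  -- `monopoleBound` is at least 64 · 32, so the premise K₃ ≤ 0 never holds; the implication is read
  -- off from 8|Φ|² ≤ K₃. The effective vanishing criterion is the last clause.
  · have h1 : Φ x = 0 := by
      have h2 : (K₃ : ℝ) ≤ 0 := by exact_mod_cast h0
      refine norm_eq_zero.1 (pow_eq_zero_iff two_ne_zero |>.1 (le_antisymm ?_ (sq_nonneg _)))
      linarith [hK x]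
    exact ⟨h1, hzero x h1⟩
  · have h1 := PU2Monopole.eq_zero_of_le_scalarCurvature S P hD hA hA1 hP hM hΦ1
      (fun y => by rw [hF y]; exact_mod_cast hs y) x
    exact ⟨h1, hzero x h1⟩
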